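/- Let $\mathbb k$ be a field, $Q=(Q_0,Q_1;s,t)$ a finite quiver without sinks, and $L=L(Q)$ its Leavitt path algebra over $\mathbb k$ (paths are composed from right to left; relations $\alpha\beta^*=\delta_{\alpha,\beta}e_{t(\alpha)}$ for $s(\alpha)=s(\beta)$, and $\sum_{s(\alpha)=i}\alpha^*\alpha=e_i$), graded by $|e_i|=0$, $|\alpha|=1$, $|\alpha^*|=-1$ and viewed as a dg algebra with zero differential. Put $E=\bigoplus_{i\in Q_0}\mathbb k e_i\subseteq L$ and $\overline L=L/E$; $s$ denotes a shift with $|sa|=|a|-1$. A brace $B_\infty$-algebra is a $B_\infty$-algebra $(A,m_n;\mu_{p,q})$ with $m_n=0$ for $n>2$ and $\mu_{p,q}=0$ for $p>1$; one writes $a\{b_1,\dots,b_p\}=(-1)^{p|a|+(p-1)|b_1|+\cdots+|b_{p-1}|}\mu_{1,p}(a\otimes b_1\otimes\cdots\otimes b_p)$. The opposite $A^{\rm opp}$ of a $B_\infty$-algebra $A$ has the same $m_n$ and $\mu^{\rm opp}_{p,q}(a_1\otimes\cdots\otimes a_p\otimes b_1\otimes\cdots\otimes b_q)=(-1)^{pq+(\sum|a_i|)(\sum|b_j|)}\mu_{q,p}(b_1\otimes\cdots\otimes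 b_q\otimes a_1\otimes\cdots\otimes a_p)$. A $B_\infty$-morphism is a $B_\infty$-quasi-isomorphism if its linear part is a quasi-isomorphism for $m_1$. (a) Let $\overline C_E^*(L,L)=\prod_{n\ge0}\mathrm{Hom}_{E\text{-}E}((s\overline L)^{\otimes_E n},L)$ be the normalized $E$-relative Hochschild cochain complex with its differential $\delta$, cup product $\cup$ and brace operation $\varphi\{\phi_1,\dots,\phi_k\}=\sum\varphi(\mathbf 1^{\otimes i_1}\otimes s\phi_1\otimes\mathbf 1^{\otimes i_2}\otimes\cdots\otimes s\phi_k\otimes\mathbf 1^{\otimes i_{k+1}})$. (b) Let $\widehat C^*(L,L)=\bigoplus_i e_iLe_i\oplus\bigoplus_i s^{-1}e_iLe_i$, $|s^{-1}x|=|x|+1$, with differential $x\mapsto s^{-1}x-(-1)^{|x|}\sum_{\alpha}s^{-1}\alpha^*x\alpha$, $s^{-1}x\mapsto 0$ and with the product $u\cup'v=uv$, $s^{-1}u\cup' v=s^{-1}uv$, $u\cup's^{-1}v=\sum_{\alpha}s^{-1}\alpha^*u\alpha v$, $s^{-1}u\cup's^{-1}v=0$. For $v=\beta_1^*\cdots\beta_p^*\alpha_m\cdots\alpha_1\in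 L$ and $u_1,\dots,u_k\in\bigoplus_ie_iLe_i$ let $$v\{s^{-1}u_1,\dots,s^{-1}u_k\}'=\sum(-1)^{a+\epsilon}\,\beta_1^*\cdots\beta_{l_1-1}^*u_1\beta_{l_1}^*\cdots u_b\beta_{l_b}^*\cdots\beta_p^*\,\alpha_m\cdots\alpha_{i_a}u_{b+1}\alpha_{i_a-1}\cdots\alpha_{i_1}u_k\alpha_{i_1-1}\cdots\alpha_1,$$ the sum being over $a+b=k$, $1\le l_1\le\cdots\le l_b\le p$, $1\le i_1<\cdots<i_a\le m$, with $\epsilon=\sum_{r=1}^b|u_r|(m+p-l_r+1)+\sum_{r=1}^a|u_{k-r+1}|(i_r-1)$; let $(s^{-1}\beta_0^*v)\{s^{-1}u_1,\dots,s^{-1}u_k\}'=s^{-1}\beta_0^*\,(v\{s^{-1}u_1,\dots,s^{-1}u_k\}')$ for $\beta_0\in Q_1$; and for $k\ge1$ let $x\{w_1,\dots,w_k\}'=0$ if some $w_j\in\bigoplus_ie_iLe_i$. (c) Let $D\colon L\to\bigoplus_iLe_i\otimes s\mathbb k\otimes e_iL$ be the graded $E$-derivation of degree $-1$ with $D(\alpha)=-\alpha\otimes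 s\otimes e_{s(\alpha)}$ and $D(\alpha^*)=-e_{s(\alpha)}\otimes s\otimes\alpha^*$. Define $\Phi\colon\widehat C^*(L,L)\to\overline C_E^*(L,L)$ by $\Phi(u)=u$ in tensor length $0$ and, in tensor length $1$, $\Phi(s^{-1}u)(s\overline a)=\sum(-1)^{(|x|-1)(|u|+1)}xuy$ where $D(a)=\sum x\otimes s\otimes y$; define $\Psi\colon\overline C_E^*(L,L)\to\widehat C^*(L,L)$ as the identity in tensor length $0$, by $\Psi(f)=-\sum_\alpha s^{-1}\alpha^*f(s\overline\alpha)$ in tensor length $1$, and as $0$ in tensor length $\ge2$; and define $H$ by $H(f)=0$ in tensor length $0$ and $H(f)(s\overline a_1\otimes\cdots\otimes s\overline a_n)=(-1)^{1+|f|+\sum_{i<n}(|a_i|-1)}\sum\sum_\alpha-f(s\overline a_1\otimes\cdots\otimes s\overline a_{n-1}\otimes s\overline{x\alpha^*}\otimes s\overline\alpha)\,y$ for $n\ge1$, where $D(a_n)=\sum x\otimes s\otimes y$. Put $\Phi_1=\Phi$ and $\Phi_k(x_1\otimes\cdots\otimes x_k)=(-1)^{k-1}H(\Phi_{k-1}(x_1\otimes\cdots\otimes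 x_{k-1})\cup\Phi(x_k))$ for $k\ge2$. Then the following hold. 1. The derivation $D$ exists and is unique, and the operation $-\{-,\dots,-\}'$ is well defined. With the above differentials, products and brace operations, $\overline C_E^*(L,L)$ and $\widehat C^*(L,L)$ are brace $B_\infty$-algebras. 2. $(\Phi,\Psi,H)$ is a homotopy deformation retract, i.e. $\Phi$, $\Psi$ are cochain maps, $\Psi\Phi=\mathbf 1$ and $\mathbf 1=\Phi\Psi+\delta H+H\delta$. Moreover $H(g_1\cup H(g_2))=0=\Psi(g_1\cup H(g_2))$ for all $g_1,g_2$, and the product $\cup'$ (with vanishing higher products) and the maps $\Phi_k$ are obtained from the dg algebra $(\overline C_E^*(L,L),\delta,\cup)$ by homotopy transfer along this retract: $(-1)^{(k-1)(k-2)/2}\,\Psi(\Phi_{k-1}(x_1\otimes\cdots\otimes x_{k-1})\cup\Phi(x_k))$ equals $x_1\cup'x_2$ for $k=2$ and $0$ for $k>2$. 3. $(\Phi_1,\Phi_2,\dots)$ is a $B_\infty$-quasi-isomorphism from the $B_\infty$-algebra $\widehat C^*(L,L)$ to the opposite $B_\infty$-algebra $\overline C_E^*(L,L)^{\rm opp}$.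 4. The maps $\Phi_k$ are given by the brace operation: for $k\ge1$ and homogeneous $u_1,\dots,u_k\in\bigoplus_ie_iLe_i$, the cochain $\Phi_k(s^{-1}u_1\otimes\cdots\otimes s^{-1}u_k)$ is concentrated in tensor length $1$, and for homogeneous $v\in L$ $$\Phi_k(s^{-1}u_1\otimes\cdots\otimes s^{-1}u_k)(s\overline v)=(-1)^{(|v|-1)\sum_i|u_i|+\sum_{i=1}^{k-1}(|u_i|-1)(k-i)}\;v\{s^{-1}u_1,\dots,s^{-1}u_k\}';$$ $\Phi_1(u)=u$ for $u\in\bigoplus_ie_iLe_i$; and for $k\ge2$, $\Phi_k$ vanishes as soon as one of its arguments lies in $\bigoplus_ie_iLe_i$. -/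

import Mathlib

open scoped BigOperators TensorProduct

noncomputable section

/-! ### Signs, degrees and blocks

A homogeneous element of degree `d` of a graded space is recorded as a pair `(d, x)`; a simple tensor
`x₁ ⊗ ⋯ ⊗ xₙ` of homogeneous elements is the list of the corresponding pairs. -/

/-- The sign `(-1)ⁿ`. -/
def sgn (n : ℤ) : ℤ := (Int.negOnePow n : ℤˣ)

/-- The total degree of a simple tensor of homogeneous elements. -/
def totalDeg {M : Type*} (l : List (ℤ × M)) : ℤ := (l.map Prod.fst).sum

/-- The `i`-th block of `l`, when `l` is cut into consecutive blocks of lengths `c 0, c 1, …`. -/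
def block {X : Type*} {r : ℕ} (c : Fin r → ℕ) (l : List X) (i : Fin r) : List X :=
  (l.drop (∑ j ∈ Finset.Iio i, c j)).take (c i)

/-- The Koszul sign exponent of `(f₁ ⊗ ⋯ ⊗ fᵣ)(x₁ ⊗ ⋯ ⊗ xᵣ)`, with `δ i = |fᵢ|` and `x i = |xᵢ|`. -/
def koszul {r : ℕ} (δ x : Fin r → ℤ) : ℤ := ∑ j, ∑ i ∈ Finset.Iio j, δ j * x i

/-- All sequences of `r` nonnegative integers with sum `n`. -/
def weakComps (r n : ℕ) : Finset (Fin r → ℕ) := Finset.Nat.antidiagonalTuple r n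

/-- All sequences of `r` positive integers with sum `n`. -/
def comps (r n : ℕ) : Finset (Fin r → ℕ) := (weakComps r n).filter fun c => ∀ i, 1 ≤ c i

section Homogeneous

variable {k : Type*} [Field k] {M N : Type*} [AddCommGroup M] [Module k M]
  [AddCommGroup N] [Module k N]

/-- Every entry of the list is homogeneous of its recorded degree. -/
def IsHomogeneousList (gr : ℤ → Submodule k M) (l : List (ℤ × M)) : Prop :=
  ∀ x ∈ l, x.2 ∈ gr x.1

/-- `f` is a graded map `A^{⊗ n} → B` of degree `δ`: on each `A^{d₁} × ⋯ × A^{dₙ}` it is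
`k`-multilinear, with values in degree `d₁ + ⋯ + dₙ + δ`. -/
structure IsGradedMultilinear (grA : ℤ → Submodule k M) (grB : ℤ → Submodule k N) (n : ℕ) (δ : ℤ)
    (f : List (ℤ × M) → N) : Prop where
  mem : ∀ l : List (ℤ × M), l.length = n → IsHomogeneousList grA l → f l ∈ grB (totalDeg l + δ)
  add : ∀ (l l' : List (ℤ × M)) (d : ℤ) (x y : M), l.length + 1 + l'.length = n →
    IsHomogeneousList grA l → IsHomogeneousList grA l' → x ∈ grA d → y ∈ grA d →
    f (l ++ (d, x + y) :: l') = f (l ++ (d, x) :: l') + f (l ++ (d, y) :: l')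
  smul : ∀ (l l' : List (ℤ × M)) (d : ℤ) (c : k) (x : M), l.length + 1 + l'.length = n →
    IsHomogeneousList grA l → IsHomogeneousList grA l' → x ∈ grA d →
    f (l ++ (d, c • x) :: l') = c • f (l ++ (d, x) :: l')

/-- `f` is a graded linear map `A → B` of degree `δ`; `f d` is its component on `A^d`. -/
structure IsGradedLinear (grA : ℤ → Submodule k M) (grB : ℤ → Submodule k N) (δ : ℤ)
    (f : ℤ → M → N) : Prop where
  mem : ∀ d, ∀ x ∈ grA d, f d x ∈ grB (d + δ)
  add : ∀ d, ∀ x ∈ grA d, ∀ y ∈ grA d, f d (x + y) = f d x + f d y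
  smul : ∀ d (c : k), ∀ x ∈ grA d, f d (c • x) = c • f d x

end Homogeneous

/-! ### `B_∞`-algebras -/

/-- The underlying data of a `B_∞`-algebra: a graded space `A = ⨁ A^d`, given by its components
`gr d` inside an ambient space `M`, and operations `m_n`, `μ_{p,q}` on homogeneous elements
(`n`, `p`, `q` being the lengths of the lists). -/
structure BInfinityData (k : Type*) (M : Type*) [Field k] [AddCommGroup M] [Module k M] where
  gr : ℤ → Submodule k M
  m : List (ℤ × M) → M
  mu : List (ℤ × M) → List (ℤ × M) → M

namespace BInfinityData

variable {k : Type*} [Field k] {M N : Type*} [AddCommGroup M] [Module k M]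
  [AddCommGroup N] [Module k N]

/-- `m_s` applied to `l`, as an element together with its degree. -/
def mElt (A : BInfinityData k M) (l : List (ℤ × M)) : ℤ × M :=
  (totalDeg l + 2 - l.length, A.m l)

/-- `μ_{p,q}` applied to `(a, b)`, as an element together with its degree. -/
def muElt (A : BInfinityData k M) (a b : List (ℤ × M)) : ℤ × M :=
  (totalDeg a + totalDeg b + 1 - a.length - b.length, A.mu a b)

/-- `(μ_{p₁,q₁} ⊗ ⋯ ⊗ μ_{pᵣ,qᵣ}) ∘ τ_{(p;q)}` applied to `(a, b)`, up to the sign `muTensorSign`. -/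
def muTensor (A : BInfinityData k M) (a b : List (ℤ × M)) {r : ℕ} (p q : Fin r → ℕ) :
    List (ℤ × M) :=
  List.ofFn fun i => A.muElt (block p a i) (block q b i)

/-- The Koszul sign exponent of `(μ_{p₁,q₁} ⊗ ⋯ ⊗ μ_{pᵣ,qᵣ}) ∘ τ_{(p;q)}` applied to `(a, b)`:
the first summand is the sign of the shuffle `τ`, the second one that of the tensor product of
maps. -/
def muTensorSign (a b : List (ℤ × M)) {r : ℕ} (p q : Fin r → ℕ) : ℤ :=
  koszul (fun j => totalDeg (block p a j)) (fun i => totalDeg (block q b i)) +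
    koszul (fun j => 1 - (p j : ℤ) - q j)
      (fun i => totalDeg (block p a i) + totalDeg (block q b i))

/-- `∑ (pᵢ + qᵢ - 1)(r - i) + ∑ qᵢ (p_{i+1} + ⋯ + pᵣ)`, for `1 ≤ i ≤ r`. -/
def shiftSign {r : ℕ} (p q : Fin r → ℕ) : ℤ :=
  ∑ i : Fin r, ((p i : ℤ) + q i - 1) * ((r : ℤ) - 1 - (i : ℕ)) +
    ∑ i : Fin r, (q i : ℤ) * ∑ j ∈ Finset.Ioi i, (p j : ℤ)

/-- The axioms of an `A_∞`-algebra for the operations `m_n`, `n ≥ 1`. -/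
structure IsAInfinityAlgebra (A : BInfinityData k M) : Prop where
  graded : ∀ n, 1 ≤ n → IsGradedMultilinear A.gr A.gr n (2 - n) A.m
  rel : ∀ l : List (ℤ × M), l ≠ [] → IsHomogeneousList A.gr l →
    ∑ j ∈ Finset.range l.length, ∑ s ∈ Finset.Icc 1 (l.length - j),
      sgn ((j : ℤ) + s * ((l.length : ℤ) - j - s) + (2 - s) * totalDeg (l.take j)) •
        A.m (l.take j ++ A.mElt ((l.drop j).take s) :: l.drop (j + s)) = 0

/-- The axioms of a `B_∞`-algebra. -/
structure IsBInfinityAlgebra (A : BInfinityData k M) : Prop where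
  aInfinity : A.IsAInfinityAlgebra
  graded : ∀ p q : ℕ, IsGradedMultilinear A.gr A.gr (p + q) (1 - p - q)
    (fun l => A.mu (l.take p) (l.drop p))
  unit_right : ∀ d, ∀ x ∈ A.gr d, A.mu [(d, x)] [] = x
  unit_left : ∀ d, ∀ x ∈ A.gr d, A.mu [] [(d, x)] = x
  mu_nil_right : ∀ l : List (ℤ × M), IsHomogeneousList A.gr l → l.length ≠ 1 → A.mu l [] = 0
  mu_nil_left : ∀ l : List (ℤ × M), IsHomogeneousList A.gr l → l.length ≠ 1 → A.mu [] l = 0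
  /-- Associativity of the `μ_{p,q}`. -/
  assoc : ∀ a b c : List (ℤ × M), IsHomogeneousList A.gr a → IsHomogeneousList A.gr b →
    IsHomogeneousList A.gr c →
    ∑ r ∈ Finset.range (b.length + c.length + 1),
      ∑ p ∈ weakComps r b.length, ∑ q ∈ weakComps r c.length,
        sgn (shiftSign p q + muTensorSign b c p q +
            (∑ i, (1 - (p i : ℤ) - q i)) * totalDeg a) •
          A.mu a (A.muTensor b c p q) =
    ∑ s ∈ Finset.range (a.length + b.length + 1),
      ∑ p ∈ weakComps s a.length, ∑ q ∈ weakComps s b.length,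
        sgn (shiftSign p q + (c.length : ℤ) * (∑ i, ((p i : ℤ) + q i - 1)) +
            muTensorSign a b p q) •
          A.mu (A.muTensor a b p q) c
  /-- The Leibniz rule for the `m_n` with respect to the `μ_{p,q}`. -/
  leibniz : ∀ a b : List (ℤ × M), IsHomogeneousList A.gr a → IsHomogeneousList A.gr b →
    ∑ r ∈ Finset.Icc 1 (a.length + b.length),
      ∑ p ∈ weakComps r a.length, ∑ q ∈ weakComps r b.length,
        sgn (shiftSign p q + muTensorSign a b p q) • A.m (A.muTensor a b p q) =
    ∑ r ∈ Finset.Icc 1 a.length, ∑ i ∈ Finset.range (a.length - r + 1),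
      sgn ((r : ℤ) * ((a.length : ℤ) - r - i + b.length) + i +
          (2 - r) * totalDeg (a.take i)) •
        A.mu (a.take i ++ A.mElt ((a.drop i).take r) :: a.drop (i + r)) b +
    ∑ s ∈ Finset.Icc 1 b.length, ∑ i ∈ Finset.range (b.length - s + 1),
      sgn ((s : ℤ) * ((b.length : ℤ) - i - s) + a.length + i +
          (2 - s) * (totalDeg a + totalDeg (b.take i))) •
        A.mu a (b.take i ++ A.mElt ((b.drop i).take s) :: b.drop (i + s))

/-- The opposite `B_∞`-algebra. -/
def opp (A : BInfinityData k M) : BInfinityData k M where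
  gr := A.gr
  m := A.m
  mu := fun a b => sgn ((a.length : ℤ) * b.length + totalDeg b * totalDeg a) • A.mu b a

/-- `f_i` applied to the blocks of `l`, with degrees: `(f_{c₁} ⊗ ⋯ ⊗ f_{cᵣ})(l)` up to its Koszul
sign. -/
def morTensor (f : List (ℤ × M) → N) (l : List (ℤ × M)) {r : ℕ} (c : Fin r → ℕ) :
    List (ℤ × N) :=
  List.ofFn fun i => (totalDeg (block c l i) + 1 - c i, f (block c l i))

/-- `f = (f_n)_{n ≥ 1}` is an `A_∞`-morphism from `A` to `B`. -/
structure IsAInfinityMorphism (A : BInfinityData k M) (B : BInfinityData k N)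
    (f : List (ℤ × M) → N) : Prop where
  graded : ∀ n, 1 ≤ n → IsGradedMultilinear A.gr B.gr n (1 - n) f
  rel : ∀ l : List (ℤ × M), l ≠ [] → IsHomogeneousList A.gr l →
    ∑ a ∈ Finset.range l.length, ∑ s ∈ Finset.Icc 1 (l.length - a),
      sgn ((a : ℤ) + s * ((l.length : ℤ) - a - s) + (2 - s) * totalDeg (l.take a)) •
        f (l.take a ++ A.mElt ((l.drop a).take s) :: l.drop (a + s)) =
    ∑ r ∈ Finset.Icc 1 l.length, ∑ c ∈ comps r l.length,
      sgn ((∑ i : Fin r, ((r : ℤ) - 1 - (i : ℕ)) * ((c i : ℤ) - 1)) +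
          koszul (fun j => 1 - (c j : ℤ)) (fun i => totalDeg (block c l i))) •
        B.m (morTensor f l c)

/-- `f = (f_n)_{n ≥ 1}` is a `B_∞`-morphism from `A` to `B`.  In the Koszul sign on the left-hand
side, the maps `f_{j₁}, …, f_{j_s}` also move past all of `a`. -/
structure IsBInfinityMorphism (A : BInfinityData k M) (B : BInfinityData k N)
    (f : List (ℤ × M) → N) : Prop where
  aInfinity : IsAInfinityMorphism A B f
  rel : ∀ a b : List (ℤ × M), IsHomogeneousList A.gr a → IsHomogeneousList A.gr b →
    ∑ r ∈ Finset.range (a.length + 1), ∑ s ∈ Finset.range (b.length + 1),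
      ∑ i ∈ comps r a.length, ∑ j ∈ comps s b.length,
        sgn ((∑ t : Fin r, ((i t : ℤ) - 1) * ((r : ℤ) + s - 1 - (t : ℕ))) +
            (∑ t : Fin s, ((j t : ℤ) - 1) * ((s : ℤ) - 1 - (t : ℕ))) +
            koszul (fun t => 1 - (i t : ℤ)) (fun t => totalDeg (block i a t)) +
            koszul (fun t => 1 - (j t : ℤ)) (fun t => totalDeg (block j b t)) +
            (∑ t : Fin s, (1 - (j t : ℤ))) * totalDeg a) •
          B.mu (morTensor f a i) (morTensor f b j) =
    ∑ t ∈ Finset.Icc 1 (a.length + b.length),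
      ∑ p ∈ weakComps t a.length, ∑ q ∈ weakComps t b.length,
        sgn (shiftSign p q + muTensorSign a b p q) • f (A.muTensor a b p q)

/-- The linear part `f_1` induces isomorphisms on the cohomology of `(A, m_1)` and `(B, m_1)`. -/
structure IsQuasiIso (A : BInfinityData k M) (B : BInfinityData k N)
    (f : List (ℤ × M) → N) : Prop where
  injective : ∀ d, ∀ x ∈ A.gr d, A.m [(d, x)] = 0 →
    (∃ y ∈ B.gr (d - 1), f [(d, x)] = B.m [(d - 1, y)]) →
    ∃ z ∈ A.gr (d - 1), x = A.m [(d - 1, z)]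
  surjective : ∀ d, ∀ y ∈ B.gr d, B.m [(d, y)] = 0 →
    ∃ x ∈ A.gr d, A.m [(d, x)] = 0 ∧
      ∃ z ∈ B.gr (d - 1), y = f [(d, x)] + B.m [(d - 1, z)]

/-- `f` is a `B_∞`-quasi-isomorphism between the `B_∞`-algebras `A` and `B`. -/
structure IsBInfinityQuasiIso (A : BInfinityData k M) (B : BInfinityData k N)
    (f : List (ℤ × M) → N) : Prop where
  source : A.IsBInfinityAlgebra
  target : B.IsBInfinityAlgebra
  morphism : IsBInfinityMorphism A B f
  quasiIso : IsQuasiIso A B f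

/-- `(ι, π, h)` is a homotopy deformation retract from the complex `(A, m_1)` to `(B, m_1)`. -/
structure IsHomotopyDeformationRetract (A : BInfinityData k M) (B : BInfinityData k N)
    (ι : ℤ → M → N) (π : ℤ → N → M) (h : ℤ → N → N) : Prop where
  ι_graded : IsGradedLinear A.gr B.gr 0 ι
  π_graded : IsGradedLinear B.gr A.gr 0 π
  h_graded : IsGradedLinear B.gr B.gr (-1) h
  ι_comm : ∀ d, ∀ x ∈ A.gr d, B.m [(d, ι d x)] = ι (d + 1) (A.m [(d, x)])
  π_comm : ∀ d, ∀ y ∈ B.gr d, A.m [(d, π d y)] = π (d + 1) (B.m [(d, y)])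
  π_ι : ∀ d, ∀ x ∈ A.gr d, π d (ι d x) = x
  homotopy : ∀ d, ∀ y ∈ B.gr d,
    y = ι d (π d y) + B.m [(d - 1, h d y)] + h (d + 1) (B.m [(d, y)])

/-- The `A_∞`-structure of `A` and the maps `f_n` are obtained from the product of the dg algebra
`B` by homotopy transfer along the homotopy deformation retract `(ι, π, h)`, in the situation
where `h(y·h(z)) = 0 = π(y·h(z))`: only the left combs contribute to the sum over binary trees. -/
structure IsHomotopyTransfer (A : BInfinityData k M) (B : BInfinityData k N)
    (ι : ℤ → M → N) (π : ℤ → N → M) (h : ℤ → N → N) (f : List (ℤ × M) → N) : Prop where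
  retract : IsHomotopyDeformationRetract A B ι π h
  h_mul_h : ∀ d e, ∀ y ∈ B.gr d, ∀ z ∈ B.gr e,
    h (d + e - 1) (B.m [(d, y), (e - 1, h e z)]) = 0
  π_mul_h : ∀ d e, ∀ y ∈ B.gr d, ∀ z ∈ B.gr e,
    π (d + e - 1) (B.m [(d, y), (e - 1, h e z)]) = 0
  f_one : ∀ d, ∀ x ∈ A.gr d, f [(d, x)] = ι d x
  f_succ : ∀ (l : List (ℤ × M)) (d : ℤ) (x : M), l ≠ [] → IsHomogeneousList A.gr l →
    x ∈ A.gr d →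
    f (l ++ [(d, x)]) = sgn l.length •
      h (totalDeg l + 1 - l.length + d)
        (B.m [(totalDeg l + 1 - l.length, f l), (d, ι d x)])
  m_succ : ∀ (l : List (ℤ × M)) (d : ℤ) (x : M), l ≠ [] → IsHomogeneousList A.gr l →
    x ∈ A.gr d →
    A.m (l ++ [(d, x)]) = sgn ((l.length * (l.length - 1) / 2 : ℕ) : ℤ) •
      π (totalDeg l + 1 - l.length + d)
        (B.m [(totalDeg l + 1 - l.length, f l), (d, ι d x)])

/-- The data of a brace `B_∞`-algebra with differential `dif`, product `mul` and brace operation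
`a{b₁, …, b_p} = br a [b₁, …, b_p]`: `m_1 = dif`, `m_2 = mul`, `m_n = 0` for `n > 2`,
`μ_{0,1} = 1`, `μ_{1,p}(a, b₁, …, b_p) = (-1)^{p|a| + (p-1)|b₁| + ⋯ + |b_{p-1}|} a{b₁, …, b_p}`,
and `μ_{p,q} = 0` otherwise. -/
def ofBrace (gr : ℤ → Submodule k M) (dif : ℤ × M → M) (mul : ℤ × M → ℤ × M → M)
    (br : ℤ × M → List (ℤ × M) → M) : BInfinityData k M where
  gr := gr
  m := fun l => match l with
    | [x] => dif x
    | [x, y] => mul x y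
    | _ => 0
  mu := fun a b => match a, b with
    | [x], b => sgn ((b.length : ℤ) * x.1 +
        ∑ i : Fin b.length, ((b.length : ℤ) - 1 - (i : ℕ)) * (b.get i).1) • br x b
    | [], [y] => y.2
    | _, _ => 0

end BInfinityData

/-! ### Leavitt path algebras -/

namespace Leavitt

/-- The generators: a trivial path `e_i` for each vertex, each arrow `α`, and its ghost `α^*`. -/
inductive Gen (V : Type*) [Quiver V] where
  | vertex (i : V) : Gen V
  | arrow (α : Quiver.Total V) : Gen V
  | ghost (α : Quiver.Total V) : Gen V

section

variable (k : Type*) [Field k] (V : Type*) [Quiver V] [Fintype V] [Fintype (Quiver.Total V)]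

/-- A generator as an element of the free algebra. -/
abbrev gen {V : Type*} [Quiver V] (g : Gen V) : FreeAlgebra k (Gen V) := FreeAlgebra.ι k g

open Classical in
/-- The relations of the Leavitt path algebra: those of the path algebra of the double quiver
(paths are composed from right to left, so `α = e_{t(α)} α e_{s(α)}`), and the first and second
Cuntz-Krieger relations. -/
inductive Rel : FreeAlgebra k (Gen V) → FreeAlgebra k (Gen V) → Prop
  | vertex_mul_self (i : V) : Rel (gen k (.vertex i) * gen k (.vertex i)) (gen k (.vertex i))
  | vertex_mul_vertex (i j : V) (h : i ≠ j) : Rel (gen k (.vertex i) * gen k (.vertex j)) 0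
  | sum_vertex : Rel (∑ i : V, gen k (.vertex i)) 1
  | target_mul_arrow (α : Quiver.Total V) :
      Rel (gen k (.vertex α.right) * gen k (.arrow α)) (gen k (.arrow α))
  | arrow_mul_source (α : Quiver.Total V) :
      Rel (gen k (.arrow α) * gen k (.vertex α.left)) (gen k (.arrow α))
  | source_mul_ghost (α : Quiver.Total V) :
      Rel (gen k (.vertex α.left) * gen k (.ghost α)) (gen k (.ghost α))
  | ghost_mul_target (α : Quiver.Total V) :
      Rel (gen k (.ghost α) * gen k (.vertex α.right)) (gen k (.ghost α))
  | ck1_self (α : Quiver.Total V) :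
      Rel (gen k (.arrow α) * gen k (.ghost α)) (gen k (.vertex α.right))
  | ck1 (α β : Quiver.Total V) (hs : α.left = β.left) (h : α ≠ β) :
      Rel (gen k (.arrow α) * gen k (.ghost β)) 0
  | ck2 (i : V) :
      Rel (∑ α ∈ Finset.univ.filter (fun α : Quiver.Total V => α.left = i),
        gen k (.ghost α) * gen k (.arrow α)) (gen k (.vertex i))

/-- The Leavitt path algebra `L = L(Q)`. -/
def Alg : Type _ := RingQuot (Rel k V)

instance instSemiringAlg : Semiring (Alg k V) := inferInstanceAs (Semiring (RingQuot (Rel k V)))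

instance instAlgebraAlg : Algebra k (Alg k V) := inferInstanceAs (Algebra k (RingQuot (Rel k V)))

instance instRingAlg : Ring (Alg k V) := Algebra.semiringToRing k

/-- The quotient map from the free algebra onto `L`. -/
def quot : FreeAlgebra k (Gen V) →ₐ[k] Alg k V := RingQuot.mkAlgHom k (Rel k V)

variable {V}

/-- A generator as an element of `L`. -/
def mk (g : Gen V) : Alg k V := quot k V (gen k g)

/-- The idempotent `e_i`. -/
abbrev e (i : V) : Alg k V := mk k (.vertex i)

/-- The arrow `α` in `L`. -/
abbrev arr (α : Quiver.Total V) : Alg k V := mk k (.arrow α)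

/-- The ghost arrow `α^*` in `L`. -/
abbrev gho (α : Quiver.Total V) : Alg k V := mk k (.ghost α)

/-- The degree of a generator: `|e_i| = 0`, `|α| = 1`, `|α^*| = -1`. -/
def Gen.deg : Gen V → ℤ
  | .vertex _ => 0
  | .arrow _ => 1
  | .ghost _ => -1

variable (V)

/-- The homogeneous component `L^n`, spanned by the words in the generators of degree `n`. -/
def gr (n : ℤ) : Submodule k (Alg k V) :=
  Submodule.span k {x | ∃ w : List (Gen V), (w.map Gen.deg).sum = n ∧ x = (w.map (mk k)).prod}

/-- The subspace `⨁ e_i L e_i` of `L`. -/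
def diag : Submodule k (Alg k V) where
  carrier := {x | ∑ i : V, e k i * x * e k i = x}
  add_mem' := by
    intro x y hx hy
    simp only [Set.mem_ofPred_eq] at *
    simp only [mul_add, add_mul, Finset.sum_add_distrib, hx, hy]
  zero_mem' := by simp
  smul_mem' := by
    intro c x hx
    simp only [Set.mem_ofPred_eq] at *
    simp only [mul_smul_comm, smul_mul_assoc, ← Finset.smul_sum, hx]

/-- The sign automorphism on generators. -/
def sigmaGen (g : Gen V) : Alg k V := sgn (Gen.deg g) • mk k g

theorem quot_rel {x y : FreeAlgebra k (Gen V)} (h : Rel k V x y) : quot k V x = quot k V y :=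
  RingQuot.mkAlgHom_rel k h

theorem sigma_rel : ∀ ⦃x y : FreeAlgebra k (Gen V)⦄, Rel k V x y →
    FreeAlgebra.lift k (sigmaGen k V) x = FreeAlgebra.lift k (sigmaGen k V) y := by
  intro x y h
  have key := quot_rel k V h
  cases h <;>
    simp only [gen, map_mul, map_sum, map_one, map_zero, FreeAlgebra.lift_ι_apply, sigmaGen, mk,
      sgn, Gen.deg, Int.negOnePow_zero, Int.negOnePow_one, Int.negOnePow_neg, Units.val_one,
      Units.val_neg, one_smul, neg_smul, neg_mul, mul_neg, neg_neg, neg_inj] at key ⊢ <;>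
    exact key

/-- The sign automorphism `x ↦ (-1)^{|x|} x` of `L`. -/
def sigma : Alg k V →ₐ[k] Alg k V :=
  RingQuot.liftAlgHom k ⟨FreeAlgebra.lift k (sigmaGen k V), sigma_rel k V⟩

open Classical in
/-- The map `a ↦ (-1)^{d (|a| - 1)} a` of `L`: the Koszul sign for moving an element of degree `d`
past `sa`. -/
def twist (d : ℤ) : Alg k V →ₗ[k] Alg k V :=
  if Even d then LinearMap.id else -(sigma k V).toLinearMap

end

/-! ### The normalized `E`-relative Hochschild cochain complex of `L` -/

section Hochschild

variable (k : Type*) [Field k] (V : Type*) [Quiver V] [Fintype V] [Fintype (Quiver.Total V)]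

/-- A family of maps `L^n → L`, `n ≥ 0`, recorded as one function on lists:
`φ [a₁, …, aₙ] = φ(sa₁ ⊗ ⋯ ⊗ saₙ)`. -/
abbrev Cochain : Type _ := List (Alg k V) → Alg k V

/-- The degree `d` component of `C̄_E^*(L, L) = ∏ₙ Hom_{E-E}((s L̄)^{⊗_E n}, L)`, where
`L̄ = L / E`: the families of multilinear maps that are `E`-balanced, left and right `E`-linear
(for `n = 0`: central for `E`), vanish if some argument lies in `E`, and are homogeneous of
degree `d`. -/
def cochains (d : ℤ) : Submodule k (Cochain k V) where
  carrier := {φ |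
    (∀ (l l' : List (Alg k V)) (x y : Alg k V),
      φ (l ++ (x + y) :: l') = φ (l ++ x :: l') + φ (l ++ y :: l')) ∧
    (∀ (l l' : List (Alg k V)) (c : k) (x : Alg k V),
      φ (l ++ (c • x) :: l') = c • φ (l ++ x :: l')) ∧
    (∀ i : V, e k i * φ [] = φ [] * e k i) ∧
    (∀ (i : V) (x : Alg k V) (l : List (Alg k V)), φ ((e k i * x) :: l) = e k i * φ (x :: l)) ∧
    (∀ (i : V) (x : Alg k V) (l : List (Alg k V)),
      φ (l ++ [x * e k i]) = φ (l ++ [x]) * e k i) ∧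
    (∀ (i : V) (x y : Alg k V) (l l' : List (Alg k V)),
      φ (l ++ (x * e k i) :: y :: l') = φ (l ++ x :: (e k i * y) :: l')) ∧
    (∀ (i : V) (l l' : List (Alg k V)), φ (l ++ e k i :: l') = 0) ∧
    (∀ l : List (ℤ × Alg k V), (∀ x ∈ l, x.2 ∈ gr k V x.1) →
      φ (l.map Prod.snd) ∈ gr k V (d + (l.map fun x => x.1 - 1).sum))}
  add_mem' := by
    rintro φ ψ ⟨h1, h2, h3, h4, h5, h6, h7, h8⟩ ⟨g1, g2, g3, g4, g5, g6, g7, g8⟩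
    refine ⟨?_, ?_, ?_, ?_, ?_, ?_, ?_, ?_⟩
    · intro l l' x y
      simp only [Pi.add_apply, h1, g1]
      abel
    · intro l l' c x
      simp only [Pi.add_apply, h2, g2, smul_add]
    · intro i
      simp only [Pi.add_apply, mul_add, add_mul, h3, g3]
    · intro i x l
      simp only [Pi.add_apply, mul_add, h4, g4]
    · intro i x l
      simp only [Pi.add_apply, add_mul, h5, g5]
    · intro i x y l l'
      simp only [Pi.add_apply, h6, g6]
    · intro i l l'
      simp only [Pi.add_apply, h7, g7, add_zero]
    · intro l hl
      exact Submodule.add_mem _ (h8 l hl) (g8 l hl)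
  zero_mem' := by
    refine ⟨?_, ?_, ?_, ?_, ?_, ?_, ?_, ?_⟩ <;> intros <;> simp
  smul_mem' := by
    rintro c φ ⟨h1, h2, h3, h4, h5, h6, h7, h8⟩
    refine ⟨?_, ?_, ?_, ?_, ?_, ?_, ?_, ?_⟩
    · intro l l' x y
      simp only [Pi.smul_apply, h1, smul_add]
    · intro l l' b x
      simp only [Pi.smul_apply, h2, smul_comm c b]
    · intro i
      simp only [Pi.smul_apply, mul_smul_comm, smul_mul_assoc, h3]
    · intro i x l
      simp only [Pi.smul_apply, mul_smul_comm, h4]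
    · intro i x l
      simp only [Pi.smul_apply, smul_mul_assoc, h5]
    · intro i x y l l'
      simp only [Pi.smul_apply, h6]
    · intro i l l'
      simp only [Pi.smul_apply, h7, smul_zero]
    · intro l hl
      exact Submodule.smul_mem _ c (h8 l hl)

variable {k V}

/-- The Hochschild differential (the internal part is zero, since `L` has zero differential). The
three terms are the two outer ones and the sum over the products of neighbouring arguments. -/
def hochDiff (φ : ℤ × Cochain k V) : Cochain k V := fun l =>
  match l with
  | [] => 0
  | a :: l =>
    -(twist k V φ.1 a * φ.2 l) +
      sgn φ.1 • (φ.2 (((a :: l).dropLast).map (twist k V 1)) * (a :: l).getLast (by simp)) -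
      sgn φ.1 • ∑ i ∈ Finset.range l.length,
        φ.2 (((a :: l).take i).map (twist k V 1) ++
          (twist k V 1 ((a :: l).getD i 0) * (a :: l).getD (i + 1) 0) :: (a :: l).drop (i + 2))

/-- The cup product
`(φ ∪ ψ)(sa_{1,n}) = ∑_p (-1)^{|ψ|(|a₁| + ⋯ + |a_p| - p)} φ(sa_{1,p}) ψ(sa_{p+1,n})`. -/
def hochCup (φ ψ : ℤ × Cochain k V) : Cochain k V := fun l =>
  ∑ p ∈ Finset.range (l.length + 1),
    φ.2 ((l.take p).map (twist k V ψ.1)) * ψ.2 (l.drop p)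

/-- The sum, over all choices of consecutive disjoint blocks `b₁, …, b_k` of `l`, of the terms
obtained from `φ(pre, l)` by replacing each `b_j` with `ψ_j(b_j)`.  Moving `s ∘ ψ_j` to its place
gives the Koszul sign `(-1)^{(|ψ_j| - 1)(|a| - 1)}` for each `a` of `l` on the left of `b_j`. -/
def hochInsert (φ : Cochain k V) :
    List (Alg k V) → List (ℤ × Cochain k V) → List (Alg k V) → Alg k V
  | pre, [], l => φ (pre ++ l)
  | pre, ψ :: ψs, l =>
    ∑ i ∈ Finset.range (l.length + 1), ∑ j ∈ Finset.range (l.length - i + 1),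
      hochInsert φ
        (pre ++ (l.take i).map (twist k V (ψ.1 - 1 + (totalDeg ψs - ψs.length))) ++
          [ψ.2 (((l.drop i).take j).map (twist k V (totalDeg ψs - ψs.length)))])
        ψs (l.drop (i + j))

/-- The brace operation `φ{ψ₁, …, ψ_k} = ∑ φ(1^{⊗ i₁} ⊗ sψ₁ ⊗ 1^{⊗ i₂} ⊗ ⋯ ⊗ sψ_k ⊗ 1^{⊗ i_{k+1}})`
on Hochschild cochains. -/
def hochBrace (φ : ℤ × Cochain k V) (ψs : List (ℤ × Cochain k V)) : Cochain k V := fun l =>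
  hochInsert φ.2 [] ψs l

variable (k V)

/-- The `B_∞`-algebra `C̄_E^*(L, L)`. -/
def hochschild : BInfinityData k (Cochain k V) :=
  BInfinityData.ofBrace (cochains k V) hochDiff hochCup hochBrace

end Hochschild

/-! ### The Leavitt `B_∞`-algebra -/

section Leavitt

variable (k : Type*) [Field k] (V : Type*) [Quiver V] [Fintype V] [Fintype (Quiver.Total V)]

/-- The degree `d` component of `Ĉ^*(L, L) = ⨁ e_i L e_i ⊕ ⨁ s⁻¹ e_i L e_i`; the pair `(u, y)`
stands for `u + s⁻¹y`, and `|s⁻¹y| = |y| + 1`. -/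
def leavittGr (d : ℤ) : Submodule k (Alg k V × Alg k V) :=
  (gr k V d ⊓ diag k V).prod (gr k V (d - 1) ⊓ diag k V)

variable {k V}

/-- The differential `u + s⁻¹y ↦ s⁻¹u - (-1)^{|u|} ∑_α s⁻¹ α^* u α`. -/
def leavittDiff (x : ℤ × (Alg k V × Alg k V)) : Alg k V × Alg k V :=
  (0, x.2.1 - sgn x.1 • ∑ α : Quiver.Total V, gho k α * x.2.1 * arr k α)

/-- The cup product: `s⁻¹u ∪' s⁻¹v = 0`, `u ∪' v = uv`, `s⁻¹u ∪' v = s⁻¹uv` and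
`u ∪' s⁻¹v = ∑_α s⁻¹ α^* u α v`. -/
def leavittCup (x y : ℤ × (Alg k V × Alg k V)) : Alg k V × Alg k V :=
  (x.2.1 * y.2.1,
    x.2.2 * y.2.1 + ∑ α : Quiver.Total V, gho k α * x.2.1 * arr k α * y.2.2)

/-- The monomial `β₁^* ⋯ β_p^* α_m ⋯ α₁` (with `β j = β_{j+1}` and `α j = α_{j+1}`). -/
def monomial {p m : ℕ} (β : Fin p → Quiver.Total V) (α : Fin m → Quiver.Total V) : Alg k V :=
  (List.ofFn fun t => gho k (β t)).prod * (List.ofFn fun t => arr k (α t)).reverse.prod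

open Classical in
/-- The sum of all insertions of `u₁, …, u_n` (from left to right, `us = [(|u₁|, u₁), …]`) into the
monomial `β₁^* ⋯ β_p^* α_m ⋯ α₁`: `u₁, …, u_b` are put directly before `β_{l_1}^*, …, β_{l_b}^*`,
where `l_1 ≤ ⋯ ≤ l_b`, and `u_n, u_{n-1}, …, u_{b+1}` directly after `α_{i_1}, …, α_{i_a}`, where
`i_1 < ⋯ < i_a`, with the sign `(-1)^{a + ε}` for
`ε = ∑_r |u_r| (m + p - l_r + 1) + ∑_r |u_{n-r+1}| (i_r - 1)`.
In the code all indices start from `0`. -/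
def insertionSum {p m : ℕ} (β : Fin p → Quiver.Total V) (α : Fin m → Quiver.Total V)
    (us : List (ℤ × Alg k V)) : Alg k V :=
  ∑ ab ∈ Finset.HasAntidiagonal.antidiagonal us.length,
    ∑ i ∈ Finset.univ.filter (fun i : Fin ab.1 → Fin m => StrictMono i),
      ∑ l ∈ Finset.univ.filter (fun l : Fin ab.2 → Fin p => Monotone l),
        sgn ((ab.1 : ℤ) +
            ∑ r : Fin ab.2, (us.getD r 0).1 * ((m : ℤ) + p - (l r : ℕ)) +
            ∑ r : Fin ab.1, (us.getD (us.length - 1 - r) 0).1 * ((i r : ℕ) : ℤ)) •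
          ((List.ofFn fun t : Fin p =>
              (((List.finRange ab.2).filter fun r => l r = t).map fun r =>
                (us.getD r 0).2).prod * gho k (β t)).prod *
            (List.ofFn fun t : Fin m =>
              arr k (α t) * (((List.finRange ab.1).filter fun r => i r = t).map fun r =>
                (us.getD (us.length - 1 - r) 0).2).prod).reverse.prod)

/-- `T` is the linear map `v ↦ v{s⁻¹u₁, …, s⁻¹u_n}'` on `L`, which is given by `insertionSum` on
the monomials `v = β₁^* ⋯ β_p^* α_m ⋯ α₁`. -/
def IsBrace (us : List (ℤ × Alg k V)) (T : Alg k V →ₗ[k] Alg k V) : Prop :=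
  ∀ (p m : ℕ) (β : Fin p → Quiver.Total V) (α : Fin m → Quiver.Total V),
    T (monomial β α) = insertionSum β α us

/-- `T` is the linear map `v ↦ w`, where `s⁻¹w = (s⁻¹v){s⁻¹u₁, …, s⁻¹u_n}'`; it is given on the
monomials `v = β₀^* β₁^* ⋯ β_p^* α_m ⋯ α₁` by the insertions into `β₁^* ⋯ β_p^* α_m ⋯ α₁`. -/
def IsShiftedBrace (us : List (ℤ × Alg k V)) (T : Alg k V →ₗ[k] Alg k V) : Prop :=
  ∀ (β₀ : Quiver.Total V) (p m : ℕ) (β : Fin p → Quiver.Total V) (α : Fin m → Quiver.Total V),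
    T (gho k β₀ * monomial β α) = gho k β₀ * insertionSum β α us

/-- The map `v ↦ v{s⁻¹u₁, …, s⁻¹u_n}'` on `L`. -/
def brace (us : List (ℤ × Alg k V)) : Alg k V →ₗ[k] Alg k V := Classical.epsilon (IsBrace us)

/-- The map `v ↦ w` on `L`, where `s⁻¹w = (s⁻¹v){s⁻¹u₁, …, s⁻¹u_n}'`. -/
def shiftedBrace (us : List (ℤ × Alg k V)) : Alg k V →ₗ[k] Alg k V :=
  Classical.epsilon (IsShiftedBrace us)

/-- The brace operation on `Ĉ^*(L, L)`: it vanishes if one of the inserted elements lies in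
`⨁ e_i L e_i`, hence it depends only on their components in `⨁ s⁻¹ e_i L e_i`. -/
def leavittBrace (x : ℤ × (Alg k V × Alg k V)) (ys : List (ℤ × (Alg k V × Alg k V))) :
    Alg k V × Alg k V :=
  match ys with
  | [] => x.2
  | y :: ys =>
    (brace ((y :: ys).map fun z => (z.1 - 1, z.2.2)) x.2.1,
      shiftedBrace ((y :: ys).map fun z => (z.1 - 1, z.2.2)) x.2.2)

variable (k V)

/-- The Leavitt `B_∞`-algebra `Ĉ^*(L, L)`. -/
def leavitt : BInfinityData k (Alg k V × Alg k V) :=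
  BInfinityData.ofBrace (leavittGr k V) leavittDiff leavittCup leavittBrace

end Leavitt

/-! ### The `A_∞`-morphism `(Φ_1, Φ_2, …)` -/

section Transfer

variable (k : Type*) [Field k] (V : Type*) [Quiver V] [Fintype V] [Fintype (Quiver.Total V)]

/-- `D` is the graded `E`-derivation of degree `-1` from `L` to `⨁ L e_i ⊗ sk ⊗ e_i L`, viewed in
`L ⊗ L` (the symbol `s` is omitted), with `D(α) = -α ⊗ s ⊗ e_{s(α)}` and
`D(α^*) = -e_{s(α)} ⊗ s ⊗ α^*`. -/
structure IsCanonicalDerivation (D : Alg k V →ₗ[k] Alg k V ⊗[k] Alg k V) : Prop where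
  leibniz : ∀ (d : ℤ), ∀ x ∈ gr k V d, ∀ y : Alg k V,
    D (x * y) = LinearMap.lTensor (Alg k V) (LinearMap.mulRight k y) (D x) +
      sgn d • LinearMap.rTensor (Alg k V) (LinearMap.mulLeft k x) (D y)
  vertex : ∀ i : V, D (e k i) = 0
  arrow : ∀ α : Quiver.Total V, D (arr k α) = -(arr k α ⊗ₜ[k] e k α.left)
  ghost : ∀ α : Quiver.Total V, D (gho k α) = -(e k α.left ⊗ₜ[k] gho k α)

/-- The canonical derivation. -/
def derivation : Alg k V →ₗ[k] Alg k V ⊗[k] Alg k V :=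
  Classical.epsilon (IsCanonicalDerivation k V)

variable {k V}

/-- The map `Φ = Hom(π, L)`, where `π(1 ⊗ s a ⊗ 1) = D(a)`: the element `u + s⁻¹y` of degree `d`
goes to the cochain with component `u` in tensor length `0` and component
`sa ↦ ∑ (-1)^{d(|x| - 1)} x y z` in tensor length `1`, where `D(a) = ∑ x ⊗ s ⊗ z`. -/
def phiOne (d : ℤ) (w : Alg k V × Alg k V) : Cochain k V := fun l =>
  match l with
  | [] => w.1
  | [a] => TensorProduct.lift
      ((LinearMap.mul k (Alg k V)).comp
        ((LinearMap.mulRight k w.2).comp (twist k V d))) (derivation k V a)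
  | _ => 0

/-- The map `Ψ = Hom(ι, L)`: `Ψ(x) = x` in tensor length `0`,
`Ψ(f) = -∑_α s⁻¹ α^* f(sα)` in tensor length `1`, and `Ψ = 0` in tensor length at least `2`. -/
def psi (_d : ℤ) (φ : Cochain k V) : Alg k V × Alg k V :=
  (φ [], -∑ α : Quiver.Total V, gho k α * φ [arr k α])

open Classical in
/-- A function that is linear, as a linear map. -/
def asLinear (f : Alg k V → Alg k V) : Alg k V →ₗ[k] Alg k V :=
  if h : IsLinearMap k f then h.mk' f else 0

/-- The homotopy `H = Hom(h, L)`: for `n ≥ 1` and `D(a_n) = ∑ x ⊗ s ⊗ y`,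
`H(f)(sa_{1,n}) = (-1)^{1 + |f| + ∑_{i<n} (|a_i| - 1)} ∑ ∑_α -f(sa_{1,n-1} ⊗ s(xα^*) ⊗ sα) y`,
and `H(f) = 0` in tensor length `0`. -/
def homotopy (d : ℤ) (φ : Cochain k V) : Cochain k V := fun l =>
  match l.reverse with
  | [] => 0
  | a :: r =>
    sgn (1 + d) • -(TensorProduct.lift
      ((LinearMap.mul k (Alg k V)).comp
        (asLinear fun x => ∑ α : Quiver.Total V,
          φ (r.reverse.map (twist k V 1) ++ [x * gho k α, arr k α]))) (derivation k V a))

/-- `Φ_n` on the list in reversed order: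
`Φ_n(x₁, …, xₙ) = (-1)^{n-1} H(Φ_{n-1}(x₁, …, x_{n-1}) ∪ Φ_1(xₙ))`. -/
def phiRev : List (ℤ × (Alg k V × Alg k V)) → Cochain k V
  | [] => 0
  | [x] => phiOne x.1 x.2
  | x :: y :: l =>
    sgn (l.length + 1) • homotopy (totalDeg (y :: l) - l.length + x.1)
      (hochCup (totalDeg (y :: l) - l.length, phiRev (y :: l)) (x.1, phiOne x.1 x.2))

/-- The maps `(Φ_1, Φ_2, …)`, where `Φ_n` is `phi` on lists of length `n`. -/
def phi (l : List (ℤ × (Alg k V × Alg k V))) : Cochain k V := phiRev l.reverse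

end Transfer

end Leavitt

end

/-!
The first step removes the signs. Conjugated with the shift, the operations `m_n` and `μ_{p,q}`
become maps on the bar construction, whose Koszul signs only involve the shifted degrees `sdeg`;
`shiftExp` is the exponent of the sign of this conjugation. All structures are then described by
sums over the splittings of a list (`splitSum`): `jacobiSum br b F c` inserts elements of `c` into
the elements of `b` by means of the braces, and `insertM` is the part of the bar differential
coming from a differential and a product. In these terms a dg algebra with braces is a
`B_∞`-algebra as soon as it satisfies the pre-Jacobi identity `x{b}{c} = jacobiSum br b (br x) c`
and the compatibilities of the braces with the product and the differential
(`IsBraceAlgebra.isBInfinityAlgebra`): since `μ_{p,q} = 0` for `p > 1`, the coalgebra morphism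
given by the `μ_{p,q}` is a `jacobiSum`.

*The Leavitt side.* The canonical derivation `D` exists because the generators act on `L ⊕ L ⊗ L`
by the matrices that encode the derivation rule, compatibly with the relations. Pairing `D` with
linear maps, and iterating, gives linear operators `act us` on `L`, which insert the list `us`
into their argument. On a monomial `β₁^* ⋯ β_p^* α_m ⋯ α₁` the product rule `act_mul` evaluates
them to the sum over all insertions (`act_monomial`). So this sum does not depend on the way in
which an element of `L` is written in terms of monomials, and the brace operation is well defined.
The operators `shAct us` do the same for elements `s⁻¹ β₀^* v`. As `act us` is determined by its
product rule and its values on the vertices, the arrows and the ghost arrows, the pre-Jacobi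
identity (`act_act`) and the compatibility with the product and the differential (`insertM_act`)
are proved by induction on words. Together they yield `isBraceAlgebra_leavitt`.

*The Hochschild side.* The differential and the cup product of the non-relative cochains are
induced, by means of the braces, by the cochain `mulCochain` given by the multiplication of `L`,
for which `m{m} = 0`. Hence all compatibilities follow formally from the pre-Jacobi identity
(`InducedByMul.isBraceAlgebra`). Relative normalized cochains are the normalized cochains whose
differential is normalized as well (`mem_cochains_iff`), so they form a subalgebra
(`isBraceAlgebra_hochschild`).

*The morphism.* The homotopy `H` is a pairing with `D`, just as the recursion for `act`. Hence
`Φ_n` is, up to sign, the cochain of tensor length `1` that inserts its arguments (`phi_eq`); this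
is the description by braces. The compatibility of the operators `act` with the product and the
differential of `Ĉ^*(L, L)` then says that `(Φ_1, Φ_2, …)` is a twisting morphism, i.e. an
`A_∞`-morphism (`insertM_shiftedPhi`), and the pre-Jacobi identity of the Leavitt braces says that
`Φ` exchanges the braces, up to passage to the opposite algebra (`hochBrace_insCochain`): in
`C̄_E^*(L, L)` the cochain `Φ(a)` is inserted into the cochain `Φ(b)`, and in `Ĉ^*(L, L)` elements
of `b` are inserted into the elements of `a`. So the two brace structures match because of one
identity, `act_act`.

*The retract.* In tensor length at least `2` the terms of `δH + Hδ` cancel, except for those which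
measure the failure of a cochain to be right linear in its last argument. Pairing this failure
with `D` recovers the cochain (`dpair_rightDefect`), because normalized cochains vanish if the
last argument is `1`. In tensor length `1` the same happens, with `ΦΨ` as the one further term.
This is `homotopy_identity`. Since `Ψ` and `H` only involve the values of a cochain with an arrow
as its last argument, where `H(g)` vanishes, the side conditions and the transfer formulas follow.
A homotopy deformation retract is a quasi-isomorphism, so the `B_∞`-morphism is one too.
-/

noncomputable section

/-! ### Signs -/

theorem sgn_zero : sgn 0 = 1 := by simp [sgn]

theorem sgn_one : sgn 1 = -1 := by simp [sgn]

theorem sgn_add (a b : ℤ) : sgn (a + b) = sgn a * sgn b := by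
  simp [sgn, Int.negOnePow_add]

/-- Signs only depend on the exponent modulo `2`; in `ZMod 2` sign identities are identities of
polynomials. -/
theorem sgn_congr {a b : ℤ} (h : (a : ZMod 2) = b) : sgn a = sgn b := by
  unfold sgn
  rw [(Int.negOnePow_eq_iff a b).2]
  rw [← ZMod.intCast_eq_zero_iff_even]
  simp [h]

theorem sgn_of_even {a : ℤ} (h : Even a) : sgn a = 1 := by
  simp [sgn, Int.negOnePow_even a h]

theorem sgn_of_not_even {a : ℤ} (h : ¬ Even a) : sgn a = -1 := by
  simp [sgn, Int.negOnePow_odd a (Int.not_even_iff_odd.1 h)]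

theorem sgn_mul_self (a : ℤ) : sgn a * sgn a = 1 := by
  rw [← sgn_add]
  exact sgn_of_even ⟨a, rfl⟩

theorem sgn_eq_or (a : ℤ) : sgn a = 1 ∨ sgn a = -1 := by
  by_cases h : Even a
  · exact Or.inl (sgn_of_even h)
  · exact Or.inr (sgn_of_not_even h)

theorem sgn_smul_sgn_smul {N : Type*} [AddCommGroup N] (a b : ℤ) (x : N) :
    sgn a • sgn b • x = sgn (a + b) • x := by
  rw [smul_smul, sgn_add]

theorem sgn_smul_smul_self {N : Type*} [AddCommGroup N] (a : ℤ) (x : N) :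
    sgn a • sgn a • x = x := by
  rw [smul_smul, sgn_mul_self, one_smul]

theorem neg_sgn (a : ℤ) : -sgn a = sgn (a + 1) := by
  rw [sgn_add, sgn_one, mul_neg_one]

theorem neg_sgn_smul {N : Type*} [AddCommGroup N] (a : ℤ) (x : N) :
    -(sgn a • x) = sgn (a + 1) • x := by
  rw [← neg_sgn, neg_smul]

/-! ### Sums over the splittings of a list -/

section Split

variable {X Y N N' : Type*} [AddCommGroup N] [AddCommGroup N']

/-- The sum of `f l₁ l₂` over all ways to write a list as `l₁ ++ l₂`. -/
def splitSum (f : List X → List X → N) : List X → N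
  | [] => f [] []
  | a :: l => f [] (a :: l) + splitSum (fun x y => f (a :: x) y) l

@[simp] theorem splitSum_nil (f : List X → List X → N) : splitSum f [] = f [] [] := rfl

theorem splitSum_cons (f : List X → List X → N) (a : X) (l : List X) :
    splitSum f (a :: l) = f [] (a :: l) + splitSum (fun x y => f (a :: x) y) l := rfl

theorem splitSum_eq_sum (f : List X → List X → N) (l : List X) :
    splitSum f l = ∑ i ∈ Finset.range (l.length + 1), f (l.take i) (l.drop i) := by
  induction l generalizing f with
  | nil => simp
  | cons a l ih =>
    rw [splitSum_cons, ih, List.length_cons, Finset.sum_range_succ' _ (l.length + 1)]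
    simp [add_comm]

theorem splitSum_congr {f g : List X → List X → N} {l : List X}
    (h : ∀ x y, x ++ y = l → f x y = g x y) : splitSum f l = splitSum g l := by
  induction l generalizing f g with
  | nil => exact h [] [] rfl
  | cons a l ih =>
    rw [splitSum_cons, splitSum_cons, h [] _ rfl, ih fun x y hxy => h _ _ (by simp [hxy])]

theorem splitSum_eq_zero {f : List X → List X → N} {l : List X}
    (h : ∀ x y, x ++ y = l → f x y = 0) : splitSum f l = 0 := by
  induction l generalizing f with
  | nil => exact h [] [] rfl
  | cons a l ih =>
    rw [splitSum_cons, h [] _ rfl, ih fun x y hxy => h _ _ (by simp [hxy]), add_zero]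

theorem splitSum_add (f g : List X → List X → N) (l : List X) :
    splitSum (fun x y => f x y + g x y) l = splitSum f l + splitSum g l := by
  induction l generalizing f g with
  | nil => rfl
  | cons a l ih => simp only [splitSum_cons, ih]; abel

theorem map_splitSum {F : Type*} [FunLike F N N'] [AddMonoidHomClass F N N'] (φ : F)
    (f : List X → List X → N) (l : List X) :
    φ (splitSum f l) = splitSum (fun x y => φ (f x y)) l := by
  induction l generalizing f with
  | nil => rfl
  | cons a l ih => simp only [splitSum_cons, map_add, ih]

theorem splitSum_sub (f g : List X → List X → N) (l : List X) :
    splitSum (fun x y => f x y - g x y) l = splitSum f l - splitSum g l := by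
  induction l generalizing f g with
  | nil => rfl
  | cons a l ih => simp only [splitSum_cons, ih]; abel

theorem splitSum_neg (f : List X → List X → N) (l : List X) :
    splitSum (fun x y => -f x y) l = -splitSum f l :=
  (map_splitSum (negAddMonoidHom : N →+ N) f l).symm

theorem smul_splitSum {R : Type*} [Monoid R] [DistribMulAction R N] (c : R)
    (f : List X → List X → N) (l : List X) :
    c • splitSum f l = splitSum (fun x y => c • f x y) l :=
  map_splitSum (DistribSMul.toAddMonoidHom N c) f l

theorem mul_splitSum {R : Type*} [Ring R] (c : R) (f : List X → List X → R) (l : List X) :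
    c * splitSum f l = splitSum (fun x y => c * f x y) l :=
  map_splitSum (AddMonoidHom.mulLeft c) f l

theorem splitSum_mul {R : Type*} [Ring R] (c : R) (f : List X → List X → R) (l : List X) :
    splitSum f l * c = splitSum (fun x y => f x y * c) l :=
  map_splitSum (AddMonoidHom.mulRight c) f l

theorem splitSum_sum {ι : Type*} (s : Finset ι) (f : ι → List X → List X → N) (l : List X) :
    splitSum (fun x y => ∑ i ∈ s, f i x y) l = ∑ i ∈ s, splitSum (f i) l := by
  induction l generalizing f with
  | nil => rfl
  | cons a l ih => simp only [splitSum_cons, ih, Finset.sum_add_distrib]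

theorem splitSum_comm (f : List X → List X → List Y → List Y → N) (l : List X) (m : List Y) :
    splitSum (fun x y => splitSum (f x y) m) l =
      splitSum (fun z w => splitSum (fun x y => f x y z w) l) m := by
  induction l generalizing f with
  | nil => rfl
  | cons a l ih => simp only [splitSum_cons, ih, splitSum_add]

/-- Cutting a list into three parts, in the two possible orders. -/
theorem splitSum_assoc (f : List X → List X → List X → N) (l : List X) :
    splitSum (fun x y => splitSum (fun x₁ x₂ => f x₁ x₂ y) x) l =
      splitSum (fun x y => splitSum (fun y₁ y₂ => f x y₁ y₂) y) l := by
  induction l generalizing f with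
  | nil => rfl
  | cons a l ih =>
    simp only [splitSum_cons, splitSum_add, ih, splitSum_nil]
    abel

theorem splitSum_append_singleton (f : List X → List X → N) (l : List X) (a : X) :
    splitSum f (l ++ [a]) = splitSum (fun x y => f x (y ++ [a])) l + f (l ++ [a]) [] := by
  induction l generalizing f with
  | nil => rfl
  | cons b l ih => simp only [List.cons_append, splitSum_cons, ih]; abel

theorem splitSum_map (f : List Y → List Y → N) (g : X → Y) (l : List X) :
    splitSum f (l.map g) = splitSum (fun x y => f (x.map g) (y.map g)) l := by
  induction l generalizing f with
  | nil => rfl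
  | cons b l ih => simp only [List.map_cons, splitSum_cons, ih]; rfl

/-- Only the trivial splitting with empty first part contributes. -/
theorem splitSum_eq_left {f : List X → List X → N} {l : List X}
    (h : ∀ a x y, (a :: x) ++ y = l → f (a :: x) y = 0) : splitSum f l = f [] l := by
  cases l with
  | nil => rfl
  | cons a l =>
    rw [splitSum_cons, splitSum_eq_zero fun x y hxy => h a x y (by simp [hxy]), add_zero]

theorem splitSum_eq_right {f : List X → List X → N} {l : List X}
    (h : ∀ a x y, x ++ (a :: y) = l → f x (a :: y) = 0) : splitSum f l = f l [] := by
  induction l generalizing f with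
  | nil => rfl
  | cons a l ih =>
    rw [splitSum_cons, h a [] l rfl, zero_add]
    exact ih fun b x y hxy => h b _ _ (by simp [hxy])

end Split

/-! ### Degrees of lists -/

section Degrees

variable {M : Type*}

@[simp] theorem totalDeg_nil : totalDeg ([] : List (ℤ × M)) = 0 := rfl

@[simp] theorem totalDeg_cons (x : ℤ × M) (l : List (ℤ × M)) :
    totalDeg (x :: l) = x.1 + totalDeg l := by simp [totalDeg]

@[simp] theorem totalDeg_append (l l' : List (ℤ × M)) :
    totalDeg (l ++ l') = totalDeg l + totalDeg l' := by simp [totalDeg]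

/-- The degree of `sx₁ ⊗ ⋯ ⊗ sxₙ`. -/
def sdeg (l : List (ℤ × M)) : ℤ := totalDeg l - l.length

@[simp] theorem sdeg_nil : sdeg ([] : List (ℤ × M)) = 0 := rfl

@[simp] theorem sdeg_cons (x : ℤ × M) (l : List (ℤ × M)) :
    sdeg (x :: l) = x.1 - 1 + sdeg l := by simp [sdeg]; ring

@[simp] theorem sdeg_append (l l' : List (ℤ × M)) :
    sdeg (l ++ l') = sdeg l + sdeg l' := by simp [sdeg]; ring

/-- The exponent `∑ (n - i)|xᵢ|` of the sign of `x₁ ⊗ ⋯ ⊗ xₙ ↦ sx₁ ⊗ ⋯ ⊗ sxₙ`. -/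
def shiftExp : List (ℤ × M) → ℤ
  | [] => 0
  | x :: l => l.length * x.1 + shiftExp l

@[simp] theorem shiftExp_nil : shiftExp ([] : List (ℤ × M)) = 0 := rfl

@[simp] theorem shiftExp_cons (x : ℤ × M) (l : List (ℤ × M)) :
    shiftExp (x :: l) = l.length * x.1 + shiftExp l := rfl

@[simp] theorem shiftExp_append (l l' : List (ℤ × M)) :
    shiftExp (l ++ l') = shiftExp l + l'.length * totalDeg l + shiftExp l' := by
  induction l with
  | nil => simp
  | cons x l ih => simp [ih]; ring

end Degrees

/-! ### Sums over compositions as iterated sums -/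

section Compositions

variable {N : Type*} [AddCommGroup N]

theorem sum_weakComps_zero (n : ℕ) (f : (Fin 0 → ℕ) → N) :
    ∑ c ∈ weakComps 0 n, f c = if n = 0 then f ![] else 0 := by
  cases n with
  | zero => simp [weakComps]
  | succ n => simp [weakComps]

theorem sum_weakComps_succ (r n : ℕ) (f : (Fin (r + 1) → ℕ) → N) :
    ∑ c ∈ weakComps (r + 1) n, f c =
      ∑ i ∈ Finset.range (n + 1), ∑ c ∈ weakComps r (n - i), f (Fin.cons i c) := by
  rw [Finset.sum_sigma']
  refine Finset.sum_bij' (fun c _ => ⟨c 0, Fin.tail c⟩) (fun c _ => Fin.cons c.1 c.2) ?_ ?_ ?_ ?_ ?_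
  · intro c hc
    simp only [weakComps, Finset.Nat.mem_antidiagonalTuple, Fin.sum_univ_succ] at hc
    simp only [weakComps, Finset.mem_sigma, Finset.mem_range, Finset.Nat.mem_antidiagonalTuple,
      Fin.tail]
    omega
  · intro c hc
    simp only [weakComps, Finset.mem_sigma, Finset.mem_range,
      Finset.Nat.mem_antidiagonalTuple] at hc
    simp only [weakComps, Finset.Nat.mem_antidiagonalTuple, Fin.sum_univ_succ, Fin.cons_zero,
      Fin.cons_succ]
    omega
  · intro c _; exact Fin.cons_self_tail c
  · intro c _; simp
  · intro c _; simp

theorem sum_of_mem_weakComps {r n : ℕ} {c : Fin r → ℕ} (h : c ∈ weakComps r n) :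
    ∑ i, c i = n := Finset.Nat.mem_antidiagonalTuple.1 h

end Compositions

section Blocks

variable {X : Type*}

theorem sum_Iio_zero {N : Type*} [AddCommMonoid N] {r : ℕ} (f : Fin (r + 1) → N) :
    ∑ j ∈ Finset.Iio 0, f j = 0 :=
  Finset.sum_eq_zero fun j hj => absurd (Finset.mem_Iio.1 hj) (Fin.not_lt_zero j)

theorem sum_Iio_succ {N : Type*} [AddCommMonoid N] {r : ℕ} (f : Fin (r + 1) → N) (t : Fin r) :
    ∑ j ∈ Finset.Iio t.succ, f j = f 0 + ∑ j ∈ Finset.Iio t, f j.succ := by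
  have h : Finset.Iio t.succ = insert 0 ((Finset.Iio t).image Fin.succ) := by
    ext j
    refine Fin.cases ?_ (fun j => ?_) j
    · simp
    · simp
  rw [h, Finset.sum_insert (by simp),
    Finset.sum_image fun _ _ _ _ h => Fin.succ_injective _ h]

theorem sum_Ioi_zero {N : Type*} [AddCommMonoid N] {r : ℕ} (f : Fin (r + 1) → N) :
    ∑ j ∈ Finset.Ioi 0, f j = ∑ j, f (Fin.succ j) := by
  have h : Finset.Ioi (0 : Fin (r + 1)) = Finset.univ.image Fin.succ := by
    ext j
    refine Fin.cases ?_ (fun j => ?_) j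
    · simp
    · simp
  rw [h, Finset.sum_image fun _ _ _ _ h => Fin.succ_injective _ h]

theorem sum_Ioi_succ {N : Type*} [AddCommMonoid N] {r : ℕ} (f : Fin (r + 1) → N) (t : Fin r) :
    ∑ j ∈ Finset.Ioi t.succ, f j = ∑ j ∈ Finset.Ioi t, f j.succ := by
  have h : Finset.Ioi t.succ = (Finset.Ioi t).image Fin.succ := by
    ext j
    refine Fin.cases ?_ (fun j => ?_) j
    · simp
    · simp
  rw [h, Finset.sum_image fun _ _ _ _ h => Fin.succ_injective _ h]

theorem block_cons_zero {r : ℕ} (i : ℕ) (c : Fin r → ℕ) (l : List X) :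
    block (Fin.cons i c : Fin (r + 1) → ℕ) l 0 = l.take i := by
  simp [block, sum_Iio_zero]

theorem block_cons_succ {r : ℕ} (i : ℕ) (c : Fin r → ℕ) (l : List X) (t : Fin r) :
    block (Fin.cons i c : Fin (r + 1) → ℕ) l t.succ = block c (l.drop i) t := by
  simp [block, sum_Iio_succ, List.drop_drop]

theorem koszul_succ {r : ℕ} (δ x : Fin (r + 1) → ℤ) :
    koszul δ x =
      koszul (fun i => δ i.succ) (fun i => x i.succ) + (∑ i : Fin r, δ i.succ) * x 0 := by
  unfold koszul
  rw [Fin.sum_univ_succ]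
  simp only [sum_Iio_succ, sum_Iio_zero, Finset.sum_add_distrib, Finset.sum_mul]
  ring

theorem shiftSign_cons {r : ℕ} (i j : ℕ) (p q : Fin r → ℕ) :
    BInfinityData.shiftSign (Fin.cons i p : Fin (r + 1) → ℕ) (Fin.cons j q) =
      BInfinityData.shiftSign p q + ((i : ℤ) + j - 1) * r + j * ∑ t, (p t : ℤ) := by
  unfold BInfinityData.shiftSign
  simp only [Fin.sum_univ_succ, Fin.cons_zero, Fin.cons_succ, sum_Ioi_zero, sum_Ioi_succ]
  push_cast
  have h : ∀ t : Fin r, ((r : ℤ) + 1 - 1 - ((t : ℤ) + 1)) = (r : ℤ) - 1 - t := fun t => by ring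
  simp only [Fin.val_succ, Fin.val_zero]
  push_cast
  simp only [h]
  ring

theorem sum_totalDeg_block {M : Type*} {r : ℕ} (c : Fin r → ℕ) (l : List (ℤ × M))
    (h : ∑ i, c i = l.length) : ∑ t, totalDeg (block c l t) = totalDeg l := by
  induction r generalizing l with
  | zero => simp at h; simp [List.length_eq_zero_iff.1 h.symm]
  | succ r ih =>
    obtain ⟨i, c, rfl⟩ : ∃ i c', c = Fin.cons i c' := ⟨c 0, Fin.tail c, (Fin.cons_self_tail c).symm⟩
    simp only [Fin.sum_univ_succ, Fin.cons_zero, Fin.cons_succ] at h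
    rw [Fin.sum_univ_succ]
    simp only [block_cons_zero, block_cons_succ]
    rw [ih _ _ (by simp; omega), ← totalDeg_append, List.take_append_drop]

end Blocks

namespace BInfinityData

variable {k : Type*} {M N : Type*} [Field k] [AddCommGroup M] [Module k M] [AddCommGroup N]

theorem muTensor_cons (A : BInfinityData k M) (a b : List (ℤ × M)) {r : ℕ} (i j : ℕ)
    (p q : Fin r → ℕ) :
    A.muTensor a b (Fin.cons i p : Fin (r + 1) → ℕ) (Fin.cons j q) =
      A.muElt (a.take i) (b.take j) :: A.muTensor (a.drop i) (b.drop j) p q := by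
  simp only [muTensor, List.ofFn_succ, block_cons_zero, block_cons_succ]

theorem muTensorSign_cons {P : Type*} (a b : List (ℤ × P)) {r : ℕ} (i j : ℕ)
    (p q : Fin r → ℕ) (hp : ∑ t, p t = (a.drop i).length) (hq : ∑ t, q t = (b.drop j).length) :
    muTensorSign a b (Fin.cons i p : Fin (r + 1) → ℕ) (Fin.cons j q) =
      muTensorSign (a.drop i) (b.drop j) p q + totalDeg (a.drop i) * totalDeg (b.take j) +
      ((r : ℤ) - (a.drop i).length - (b.drop j).length) *
        (totalDeg (a.take i) + totalDeg (b.take j)) := by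
  unfold muTensorSign
  rw [koszul_succ, koszul_succ]
  simp only [block_cons_zero, block_cons_succ, Fin.cons_succ]
  rw [sum_totalDeg_block p _ hp, Finset.sum_sub_distrib, Finset.sum_sub_distrib, ← hp, ← hq]
  push_cast
  simp
  ring

/-- The sum of `F ∘ (μ ⊗ ⋯ ⊗ μ) ∘ τ` (with `r` factors) over all block decompositions, with the
Koszul signs of the shifted operations, which are all of degree zero. -/
def tensorSum (A : BInfinityData k M) :
    ℕ → (List (ℤ × M) → N) → List (ℤ × M) → List (ℤ × M) → N
  | 0, F, a, b => if a.length = 0 then if b.length = 0 then F [] else 0 else 0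
  | r + 1, F, a, b => splitSum (fun a₁ a₂ => splitSum (fun b₁ b₂ =>
      sgn (sdeg b₁ * sdeg a₂ + shiftExp (a₁ ++ b₁)) •
        tensorSum A r (fun l => F (A.muElt a₁ b₁ :: l)) a₂ b₂) b) a

@[simp] theorem sdeg_muElt_cons (A : BInfinityData k M) (a b l : List (ℤ × M)) :
    sdeg (A.muElt a b :: l) = sdeg a + sdeg b + sdeg l := by
  simp [muElt, sdeg]
  ring

/-- All lists to which `F` is applied in `tensorSum` have the same length and the same degree. -/
theorem tensorSum_congr (A : BInfinityData k M) {r : ℕ} {F G : List (ℤ × M) → N}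
    (a b : List (ℤ × M)) (h : ∀ l, l.length = r → sdeg l = sdeg a + sdeg b → F l = G l) :
    A.tensorSum r F a b = A.tensorSum r G a b := by
  induction r generalizing F G a b with
  | zero =>
    simp only [tensorSum]
    split_ifs with h1 h2
    · rw [h [] rfl]
      simp [List.length_eq_zero_iff.1 h1, List.length_eq_zero_iff.1 h2]
    · rfl
    · rfl
  | succ r ih =>
    simp only [tensorSum]
    refine splitSum_congr fun a₁ a₂ ha => splitSum_congr fun b₁ b₂ hb => ?_
    rw [ih _ _ fun l hl hs => h _ (by simp [hl]) ?_]
    rw [sdeg_muElt_cons, hs, ← ha, ← hb, sdeg_append, sdeg_append]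
    ring

theorem tensorSum_zsmul (A : BInfinityData k M) (r : ℕ) (c : ℤ) (F : List (ℤ × M) → N)
    (a b : List (ℤ × M)) :
    A.tensorSum r (fun l => c • F l) a b = c • A.tensorSum r F a b := by
  induction r generalizing F a b with
  | zero => simp only [tensorSum]; split_ifs <;> simp
  | succ r ih => simp only [tensorSum, ih, smul_splitSum, smul_comm c]

theorem sum_muTensor_cons (A : BInfinityData k M) (r : ℕ) (F : List (ℤ × M) → N)
    (a₁ a₂ b₁ b₂ : List (ℤ × M))
    (ih : ∀ F : List (ℤ × M) → N, ∑ p ∈ weakComps r a₂.length, ∑ q ∈ weakComps r b₂.length,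
      sgn (shiftSign p q + muTensorSign a₂ b₂ p q) • F (A.muTensor a₂ b₂ p q) =
      sgn (shiftExp (a₂ ++ b₂)) • A.tensorSum r (fun l => sgn (shiftExp l) • F l) a₂ b₂) :
    ∑ p ∈ weakComps r a₂.length, ∑ q ∈ weakComps r b₂.length,
      sgn (shiftSign (Fin.cons a₁.length p : Fin (r + 1) → ℕ) (Fin.cons b₁.length q) +
        muTensorSign (a₁ ++ a₂) (b₁ ++ b₂) (Fin.cons a₁.length p : Fin (r + 1) → ℕ)
          (Fin.cons b₁.length q)) •
        F (A.muTensor (a₁ ++ a₂) (b₁ ++ b₂) (Fin.cons a₁.length p : Fin (r + 1) → ℕ)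
          (Fin.cons b₁.length q)) =
    sgn (shiftExp ((a₁ ++ a₂) ++ (b₁ ++ b₂))) •
      sgn (sdeg b₁ * sdeg a₂ + shiftExp (a₁ ++ b₁)) •
        A.tensorSum r (fun l => sgn (shiftExp (A.muElt a₁ b₁ :: l)) • F (A.muElt a₁ b₁ :: l))
          a₂ b₂ := by
  have h1 : A.tensorSum r (fun l => sgn (shiftExp (A.muElt a₁ b₁ :: l)) • F (A.muElt a₁ b₁ :: l))
      a₂ b₂ = sgn (r * (A.muElt a₁ b₁).1) •
        A.tensorSum r (fun l => sgn (shiftExp l) • F (A.muElt a₁ b₁ :: l)) a₂ b₂ := by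
    rw [← tensorSum_zsmul]
    refine tensorSum_congr _ _ _ fun l hl _ => ?_
    rw [sgn_smul_sgn_smul, shiftExp_cons, hl]
  have h2 := congrArg (fun z => sgn (shiftExp ((a₁ ++ a₂) ++ (b₁ ++ b₂)) +
      (sdeg b₁ * sdeg a₂ + shiftExp (a₁ ++ b₁)) + r * (A.muElt a₁ b₁).1 +
      shiftExp (a₂ ++ b₂)) • z) (ih fun l => F (A.muElt a₁ b₁ :: l))
  simp only [sgn_smul_sgn_smul, Finset.smul_sum] at h2
  rw [h1, sgn_smul_sgn_smul, sgn_smul_sgn_smul]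
  convert h2 using 1
  · refine Finset.sum_congr rfl fun p hp => Finset.sum_congr rfl fun q hq => ?_
    rw [muTensorSign_cons _ _ _ _ _ _ (by simpa using sum_of_mem_weakComps hp)
      (by simpa using sum_of_mem_weakComps hq), shiftSign_cons, muTensor_cons]
    have hp' : ∑ t, (p t : ℤ) = a₂.length := by exact_mod_cast sum_of_mem_weakComps hp
    simp only [List.take_left, List.drop_left, hp', sdeg, shiftExp_append, muElt, totalDeg_append,
      List.length_append]
    congr 1
    apply sgn_congr
    clear h1 h2 ih
    push_cast
    grind
  · congr 1
    apply sgn_congr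
    clear h1 h2 ih
    push_cast
    grind

theorem sum_muTensor (A : BInfinityData k M) (r : ℕ) (F : List (ℤ × M) → N)
    (a b : List (ℤ × M)) :
    ∑ p ∈ weakComps r a.length, ∑ q ∈ weakComps r b.length,
      sgn (shiftSign p q + muTensorSign a b p q) • F (A.muTensor a b p q) =
    sgn (shiftExp (a ++ b)) • A.tensorSum r (fun l => sgn (shiftExp l) • F l) a b := by
  induction r generalizing F a b with
  | zero =>
    simp only [sum_weakComps_zero, tensorSum]
    split_ifs with h1 h2
    · simp [List.length_eq_zero_iff.1 h1, List.length_eq_zero_iff.1 h2, shiftSign, muTensorSign,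
        koszul, muTensor, sgn_zero]
    · simp
    · simp
  | succ r ih =>
    simp only [sum_weakComps_succ, tensorSum, splitSum_eq_sum, Finset.smul_sum]
    refine Finset.sum_congr rfl fun i hi => ?_
    rw [Finset.sum_comm]
    refine Finset.sum_congr rfl fun j hj => ?_
    rw [Finset.mem_range] at hi hj
    have key := sum_muTensor_cons A r F (a.take i) (a.drop i) (b.take j) (b.drop j)
      (fun F => ih F _ _)
    rw [List.take_append_drop, List.take_append_drop, List.length_take, List.length_take,
      List.length_drop, List.length_drop, min_eq_left (by omega), min_eq_left (by omega)] at key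
    exact key

theorem sum_assoc_left (A : BInfinityData k M) (a b c : List (ℤ × M)) (r : ℕ) :
    ∑ p ∈ weakComps r b.length, ∑ q ∈ weakComps r c.length,
      sgn (shiftSign p q + muTensorSign b c p q +
          (∑ i, (1 - (p i : ℤ) - q i)) * totalDeg a) • A.mu a (A.muTensor b c p q) =
    sgn (shiftExp (a ++ b ++ c)) •
      A.tensorSum r (fun l => sgn (shiftExp (a ++ l)) • A.mu a l) b c := by
  have h1 : A.tensorSum r (fun l => sgn (shiftExp (a ++ l)) • A.mu a l) b c =
      sgn (shiftExp a + r * totalDeg a) •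
        A.tensorSum r (fun l => sgn (shiftExp l) • A.mu a l) b c := by
    rw [← tensorSum_zsmul]
    refine tensorSum_congr _ _ _ fun l hl _ => ?_
    rw [sgn_smul_sgn_smul, shiftExp_append, hl]
  have h2 := congrArg (fun z => sgn (((r : ℤ) - b.length - c.length) * totalDeg a) • z)
    (A.sum_muTensor r (A.mu a) b c)
  simp only [sgn_smul_sgn_smul, Finset.smul_sum] at h2
  rw [h1, sgn_smul_sgn_smul]
  convert h2 using 1
  · refine Finset.sum_congr rfl fun p hp => Finset.sum_congr rfl fun q hq => ?_
    have hp' : ∑ t, (p t : ℤ) = b.length := by exact_mod_cast sum_of_mem_weakComps hp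
    have hq' : ∑ t, (q t : ℤ) = c.length := by exact_mod_cast sum_of_mem_weakComps hq
    rw [Finset.sum_sub_distrib, Finset.sum_sub_distrib, hp', hq']
    congr 2
    simp
    ring
  · congr 1
    apply sgn_congr
    clear h1 h2
    simp only [shiftExp_append, totalDeg_append]
    push_cast
    grind

theorem sum_assoc_right (A : BInfinityData k M) (a b c : List (ℤ × M)) (r : ℕ) :
    ∑ p ∈ weakComps r a.length, ∑ q ∈ weakComps r b.length,
      sgn (shiftSign p q + (c.length : ℤ) * (∑ i, ((p i : ℤ) + q i - 1)) +
          muTensorSign a b p q) • A.mu (A.muTensor a b p q) c =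
    sgn (shiftExp (a ++ b ++ c)) •
      A.tensorSum r (fun l => sgn (shiftExp (l ++ c)) • A.mu l c) a b := by
  have h1 : A.tensorSum r (fun l => sgn (shiftExp (l ++ c)) • A.mu l c) a b =
      sgn (c.length * (sdeg a + sdeg b + r) + shiftExp c) •
        A.tensorSum r (fun l => sgn (shiftExp l) • A.mu l c) a b := by
    rw [← tensorSum_zsmul]
    refine tensorSum_congr _ _ _ fun l hl hs => ?_
    rw [sgn_smul_sgn_smul, shiftExp_append, ← hs, sdeg, hl]
    congr 2
    ring
  have h2 := congrArg (fun z => sgn ((c.length : ℤ) * ((a.length : ℤ) + b.length - r)) • z)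
    (A.sum_muTensor r (fun l => A.mu l c) a b)
  simp only [sgn_smul_sgn_smul, Finset.smul_sum] at h2
  rw [h1, sgn_smul_sgn_smul]
  convert h2 using 1
  · refine Finset.sum_congr rfl fun p hp => Finset.sum_congr rfl fun q hq => ?_
    have hp' : ∑ t, (p t : ℤ) = a.length := by exact_mod_cast sum_of_mem_weakComps hp
    have hq' : ∑ t, (q t : ℤ) = b.length := by exact_mod_cast sum_of_mem_weakComps hq
    rw [Finset.sum_sub_distrib, Finset.sum_add_distrib, hp', hq']
    congr 2
    simp
    ring
  · congr 1
    apply sgn_congr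
    clear h1 h2
    simp only [shiftExp_append, totalDeg_append, sdeg]
    push_cast
    grind

/-- The associativity axiom, with the Koszul signs of the shifted operations. -/
theorem assoc_iff (A : BInfinityData k M) (a b c : List (ℤ × M)) :
    (∑ r ∈ Finset.range (b.length + c.length + 1),
      ∑ p ∈ weakComps r b.length, ∑ q ∈ weakComps r c.length,
        sgn (shiftSign p q + muTensorSign b c p q +
            (∑ i, (1 - (p i : ℤ) - q i)) * totalDeg a) •
          A.mu a (A.muTensor b c p q) =
    ∑ s ∈ Finset.range (a.length + b.length + 1),
      ∑ p ∈ weakComps s a.length, ∑ q ∈ weakComps s b.length,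
        sgn (shiftSign p q + (c.length : ℤ) * (∑ i, ((p i : ℤ) + q i - 1)) +
            muTensorSign a b p q) •
          A.mu (A.muTensor a b p q) c) ↔
    ∑ r ∈ Finset.range (b.length + c.length + 1),
      A.tensorSum r (fun l => sgn (shiftExp (a ++ l)) • A.mu a l) b c =
    ∑ s ∈ Finset.range (a.length + b.length + 1),
      A.tensorSum s (fun l => sgn (shiftExp (l ++ c)) • A.mu l c) a b := by
  simp only [sum_assoc_left, sum_assoc_right, ← Finset.smul_sum]
  constructor
  · intro h
    have := congrArg (fun z => sgn (shiftExp (a ++ b ++ c)) • z) h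
    simpa only [sgn_smul_smul_self] using this
  · intro h
    rw [h]

/-- The left hand side of the Leibniz rule. -/
theorem sum_leibniz_left (A : BInfinityData k M) (a b : List (ℤ × M)) :
    ∑ r ∈ Finset.Icc 1 (a.length + b.length),
      ∑ p ∈ weakComps r a.length, ∑ q ∈ weakComps r b.length,
        sgn (shiftSign p q + muTensorSign a b p q) • A.m (A.muTensor a b p q) =
    sgn (shiftExp (a ++ b)) • ∑ r ∈ Finset.Icc 1 (a.length + b.length),
      A.tensorSum r (fun l => sgn (shiftExp l) • A.m l) a b := by
  simp only [sum_muTensor, Finset.smul_sum]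

theorem sgn_leibniz_first (A : BInfinityData k M) (a₁ a₂ a₃ b : List (ℤ × M)) (x : M) :
    sgn (a₂.length * ((a₁ ++ a₂ ++ a₃).length - a₂.length - a₁.length + b.length) + a₁.length +
      (2 - a₂.length) * totalDeg a₁) • x =
    sgn (shiftExp (a₁ ++ a₂ ++ a₃ ++ b)) • sgn (sdeg a₁ + shiftExp a₂ +
      shiftExp (a₁ ++ A.mElt a₂ :: a₃ ++ b)) • x := by
  rw [sgn_smul_sgn_smul]
  congr 1
  apply sgn_congr
  simp only [shiftExp_append, shiftExp_cons, totalDeg_append, totalDeg_cons, sdeg, mElt,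
    List.length_append, List.length_cons]
  push_cast
  grind

theorem sgn_leibniz_second (A : BInfinityData k M) (a b₁ b₂ b₃ : List (ℤ × M)) (x : M) :
    sgn (b₂.length * ((b₁ ++ b₂ ++ b₃).length - b₁.length - b₂.length) + a.length + b₁.length +
      (2 - b₂.length) * (totalDeg a + totalDeg b₁)) • x =
    sgn (shiftExp (a ++ (b₁ ++ b₂ ++ b₃))) • sgn (sdeg a + sdeg b₁ + shiftExp b₂ +
      shiftExp (a ++ (b₁ ++ A.mElt b₂ :: b₃))) • x := by
  rw [sgn_smul_sgn_smul]
  congr 1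
  apply sgn_congr
  simp only [shiftExp_append, shiftExp_cons, totalDeg_append, sdeg, mElt,
    List.length_append, List.length_cons]
  push_cast
  grind

end BInfinityData

namespace BInfinityData

variable {k : Type*} {M N : Type*} [Field k] [AddCommGroup M] [Module k M] [AddCommGroup N]

/-- The sum of `f l₁ l₂ l₃` over all decompositions `l = l₁ ++ l₂ ++ l₃` with `l₂ ≠ []`. -/
def blockSum {X : Type*} (f : List X → List X → List X → N) (l : List X) : N :=
  ∑ s ∈ Finset.Icc 1 l.length, ∑ i ∈ Finset.range (l.length - s + 1),
    f (l.take i) ((l.drop i).take s) (l.drop (i + s))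

theorem blockSum_congr {X : Type*} {f g : List X → List X → List X → N} {l : List X}
    (h : ∀ x y z, x ++ y ++ z = l → f x y z = g x y z) : blockSum f l = blockSum g l := by
  refine Finset.sum_congr rfl fun s _ => Finset.sum_congr rfl fun i _ => h _ _ _ ?_
  rw [List.append_assoc, ← List.drop_drop, List.take_append_drop, List.take_append_drop]

theorem zsmul_blockSum {X : Type*} (c : ℤ) (f : List X → List X → List X → N) (l : List X) :
    c • blockSum f l = blockSum (fun x y z => c • f x y z) l := by
  simp only [blockSum, Finset.smul_sum]

theorem blockSum_eq_sum {X : Type*} (f : List X → List X → List X → N) (l : List X) :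
    ∑ i ∈ Finset.range l.length, ∑ s ∈ Finset.Icc 1 (l.length - i),
      f (l.take i) ((l.drop i).take s) (l.drop (i + s)) = blockSum f l := by
  rw [blockSum, Finset.sum_comm' (t' := Finset.Icc 1 l.length)
    (s' := fun s => Finset.range (l.length - s + 1))]
  intro i s
  simp only [Finset.mem_range, Finset.mem_Icc]
  omega

/-- The Leibniz rule, with the Koszul signs of the shifted operations. -/
theorem leibniz_iff (A : BInfinityData k M) (a b : List (ℤ × M)) :
    (∑ r ∈ Finset.Icc 1 (a.length + b.length),
      ∑ p ∈ weakComps r a.length, ∑ q ∈ weakComps r b.length,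
        sgn (shiftSign p q + muTensorSign a b p q) • A.m (A.muTensor a b p q) =
    ∑ r ∈ Finset.Icc 1 a.length, ∑ i ∈ Finset.range (a.length - r + 1),
      sgn ((r : ℤ) * ((a.length : ℤ) - r - i + b.length) + i +
          (2 - r) * totalDeg (a.take i)) •
        A.mu (a.take i ++ A.mElt ((a.drop i).take r) :: a.drop (i + r)) b +
    ∑ s ∈ Finset.Icc 1 b.length, ∑ i ∈ Finset.range (b.length - s + 1),
      sgn ((s : ℤ) * ((b.length : ℤ) - i - s) + a.length + i +
          (2 - s) * (totalDeg a + totalDeg (b.take i))) •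
        A.mu a (b.take i ++ A.mElt ((b.drop i).take s) :: b.drop (i + s))) ↔
    ∑ r ∈ Finset.Icc 1 (a.length + b.length),
      A.tensorSum r (fun l => sgn (shiftExp l) • A.m l) a b =
    blockSum (fun a₁ a₂ a₃ => sgn (sdeg a₁ + shiftExp a₂ + shiftExp (a₁ ++ A.mElt a₂ :: a₃ ++ b)) •
      A.mu (a₁ ++ A.mElt a₂ :: a₃) b) a +
    blockSum (fun b₁ b₂ b₃ => sgn (sdeg a + sdeg b₁ + shiftExp b₂ +
      shiftExp (a ++ (b₁ ++ A.mElt b₂ :: b₃))) • A.mu a (b₁ ++ A.mElt b₂ :: b₃)) b := by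
  rw [sum_leibniz_left]
  have h1 : ∑ r ∈ Finset.Icc 1 a.length, ∑ i ∈ Finset.range (a.length - r + 1),
      sgn ((r : ℤ) * ((a.length : ℤ) - r - i + b.length) + i +
          (2 - r) * totalDeg (a.take i)) •
        A.mu (a.take i ++ A.mElt ((a.drop i).take r) :: a.drop (i + r)) b =
      sgn (shiftExp (a ++ b)) • blockSum (fun a₁ a₂ a₃ => sgn (sdeg a₁ + shiftExp a₂ +
        shiftExp (a₁ ++ A.mElt a₂ :: a₃ ++ b)) • A.mu (a₁ ++ A.mElt a₂ :: a₃) b) a := by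
    rw [blockSum, Finset.smul_sum]
    refine Finset.sum_congr rfl fun s hs => ?_
    rw [Finset.smul_sum]
    refine Finset.sum_congr rfl fun i hi => ?_
    have hl : a.take i ++ (a.drop i).take s ++ a.drop (i + s) = a := by
      rw [List.append_assoc, ← List.drop_drop, List.take_append_drop, List.take_append_drop]
    have := A.sgn_leibniz_first (a.take i) ((a.drop i).take s) (a.drop (i + s)) b
      (A.mu (a.take i ++ A.mElt ((a.drop i).take s) :: a.drop (i + s)) b)
    rw [Finset.mem_Icc] at hs
    rw [Finset.mem_range] at hi
    rwa [hl, List.length_take, List.length_take, List.length_drop, min_eq_left (by omega),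
      min_eq_left (by omega)] at this
  have h2 : ∑ s ∈ Finset.Icc 1 b.length, ∑ i ∈ Finset.range (b.length - s + 1),
      sgn ((s : ℤ) * ((b.length : ℤ) - i - s) + a.length + i +
          (2 - s) * (totalDeg a + totalDeg (b.take i))) •
        A.mu a (b.take i ++ A.mElt ((b.drop i).take s) :: b.drop (i + s)) =
      sgn (shiftExp (a ++ b)) • blockSum (fun b₁ b₂ b₃ => sgn (sdeg a + sdeg b₁ + shiftExp b₂ +
        shiftExp (a ++ (b₁ ++ A.mElt b₂ :: b₃))) • A.mu a (b₁ ++ A.mElt b₂ :: b₃)) b := by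
    rw [blockSum, Finset.smul_sum]
    refine Finset.sum_congr rfl fun s hs => ?_
    rw [Finset.smul_sum]
    refine Finset.sum_congr rfl fun i hi => ?_
    have hl : b.take i ++ (b.drop i).take s ++ b.drop (i + s) = b := by
      rw [List.append_assoc, ← List.drop_drop, List.take_append_drop, List.take_append_drop]
    have := A.sgn_leibniz_second a (b.take i) ((b.drop i).take s) (b.drop (i + s))
      (A.mu a (b.take i ++ A.mElt ((b.drop i).take s) :: b.drop (i + s)))
    rw [Finset.mem_Icc] at hs
    rw [Finset.mem_range] at hi
    rwa [hl, List.length_take, List.length_take, List.length_drop, min_eq_left (by omega),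
      min_eq_left (by omega)] at this
  rw [h1, h2, ← smul_add]
  constructor
  · intro h
    have := congrArg (fun z => sgn (shiftExp (a ++ b)) • z) h
    simpa only [sgn_smul_smul_self] using this
  · intro h
    rw [h]

/-! ### Multilinearity and the opposite algebra -/

@[simp] theorem isHomogeneousList_nil (gr : ℤ → Submodule k M) : IsHomogeneousList gr [] := by
  simp [IsHomogeneousList]

@[simp] theorem isHomogeneousList_cons (gr : ℤ → Submodule k M) (x : ℤ × M) (l : List (ℤ × M)) :
    IsHomogeneousList gr (x :: l) ↔ x.2 ∈ gr x.1 ∧ IsHomogeneousList gr l := by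
  simp [IsHomogeneousList]

@[simp] theorem isHomogeneousList_append (gr : ℤ → Submodule k M) (l l' : List (ℤ × M)) :
    IsHomogeneousList gr (l ++ l') ↔ IsHomogeneousList gr l ∧ IsHomogeneousList gr l' := by
  simp only [IsHomogeneousList, List.mem_append]
  constructor
  · exact fun h => ⟨fun x hx => h x (Or.inl hx), fun x hx => h x (Or.inr hx)⟩
  · rintro ⟨h1, h2⟩ x (hx | hx)
    exacts [h1 x hx, h2 x hx]

/-- The multilinearity of the operations `μ_{p,q}`, in each of the two lists of arguments. -/
structure MuGraded (A : BInfinityData k M) : Prop where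
  mem : ∀ a b, IsHomogeneousList A.gr a → IsHomogeneousList A.gr b →
    A.mu a b ∈ A.gr (sdeg a + sdeg b + 1)
  add_left : ∀ l l' b d x y, IsHomogeneousList A.gr l → IsHomogeneousList A.gr l' →
    IsHomogeneousList A.gr b → x ∈ A.gr d → y ∈ A.gr d →
    A.mu (l ++ (d, x + y) :: l') b = A.mu (l ++ (d, x) :: l') b + A.mu (l ++ (d, y) :: l') b
  smul_left : ∀ l l' b d (c : k) x, IsHomogeneousList A.gr l → IsHomogeneousList A.gr l' →
    IsHomogeneousList A.gr b → x ∈ A.gr d →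
    A.mu (l ++ (d, c • x) :: l') b = c • A.mu (l ++ (d, x) :: l') b
  add_right : ∀ a l l' d x y, IsHomogeneousList A.gr a → IsHomogeneousList A.gr l →
    IsHomogeneousList A.gr l' → x ∈ A.gr d → y ∈ A.gr d →
    A.mu a (l ++ (d, x + y) :: l') = A.mu a (l ++ (d, x) :: l') + A.mu a (l ++ (d, y) :: l')
  smul_right : ∀ a l l' d (c : k) x, IsHomogeneousList A.gr a → IsHomogeneousList A.gr l →
    IsHomogeneousList A.gr l' → x ∈ A.gr d →
    A.mu a (l ++ (d, c • x) :: l') = c • A.mu a (l ++ (d, x) :: l')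

theorem muGraded_iff (A : BInfinityData k M) :
    (∀ p q : ℕ, IsGradedMultilinear A.gr A.gr (p + q) (1 - p - q)
      (fun l => A.mu (l.take p) (l.drop p))) ↔ A.MuGraded := by
  constructor
  · intro h
    refine ⟨?_, ?_, ?_, ?_, ?_⟩
    · intro a b ha hb
      have := (h a.length b.length).mem (a ++ b) (by simp) (by simp [ha, hb])
      simp only [List.take_left, List.drop_left] at this
      convert this using 2
      simp [sdeg]
      ring
    · intro l l' b d x y hl hl' hb hx hy
      have := (h (l.length + 1 + l'.length) b.length).add l (l' ++ b) d x y (by simp; ring) hl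
        (by simp [hl', hb]) hx hy
      have e : ∀ z, l ++ (d, z) :: (l' ++ b) = (l ++ (d, z) :: l') ++ b := by simp
      have f : ∀ z : M, l.length + 1 + l'.length = (l ++ (d, z) :: l').length := by
        intro z; simp; ring
      simp only [e] at this
      simpa only [List.take_left' (f (x + y)).symm,
        List.drop_left' (f (x + y)).symm, List.take_left' (f y).symm,
        List.drop_left' (f y).symm, List.take_left' (f x).symm,
        List.drop_left' (f x).symm] using this
    · intro l l' b d c x hl hl' hb hx
      have := (h (l.length + 1 + l'.length) b.length).smul l (l' ++ b) d c x (by simp; ring) hl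
        (by simp [hl', hb]) hx
      have e : ∀ z, l ++ (d, z) :: (l' ++ b) = (l ++ (d, z) :: l') ++ b := by simp
      have f : ∀ z : M, l.length + 1 + l'.length = (l ++ (d, z) :: l').length := by
        intro z; simp; ring
      simp only [e] at this
      simpa only [List.take_left' (f (c • x)).symm,
        List.drop_left' (f (c • x)).symm, List.take_left' (f x).symm,
        List.drop_left' (f x).symm] using this
    · intro a l l' d x y ha hl hl' hx hy
      have := (h a.length (l.length + 1 + l'.length)).add (a ++ l) l' d x y (by simp; ring)
        (by simp [ha, hl]) hl' hx hy
      simpa only [List.append_assoc, List.take_left, List.drop_left] using this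
    · intro a l l' d c x ha hl hl' hx
      have := (h a.length (l.length + 1 + l'.length)).smul (a ++ l) l' d c x (by simp; ring)
        (by simp [ha, hl]) hl' hx
      simpa only [List.append_assoc, List.take_left, List.drop_left] using this
  · intro h p q
    have key : ∀ (l l' : List (ℤ × M)), l.length + 1 + l'.length = p + q →
        (∃ u, l' = u ++ l'.drop u.length ∧ l.length + 1 + u.length = p) ∨
        (∃ u, l = l.take p ++ u ∧ (l.take p).length = p) := by
      intro l l' hl
      by_cases hp : l.length < p
      · refine Or.inl ⟨l'.take (p - l.length - 1), ?_, ?_⟩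
        · have : (l'.take (p - l.length - 1)).length = p - l.length - 1 := by simp; omega
          rw [this, List.take_append_drop]
        · simp; omega
      · exact Or.inr ⟨l.drop p, (List.take_append_drop _ _).symm, by simp; omega⟩
    have tk : ∀ (l u v : List (ℤ × M)) (z : ℤ × M), l.length + 1 + u.length = p →
        (l ++ z :: (u ++ v)).take p = l ++ z :: u ∧ (l ++ z :: (u ++ v)).drop p = v := by
      intro l u v z hp
      have e : l ++ z :: (u ++ v) = (l ++ z :: u) ++ v := by simp
      have f : p = (l ++ z :: u).length := by simp; omega
      rw [e, List.take_left' f.symm, List.drop_left' f.symm]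
      exact ⟨rfl, rfl⟩
    have tk' : ∀ (w u v : List (ℤ × M)) (z : ℤ × M), w.length = p →
        (w ++ u ++ z :: v).take p = w ∧ (w ++ u ++ z :: v).drop p = u ++ z :: v := by
      intro w u v z hp
      rw [List.append_assoc, List.take_left' hp, List.drop_left' hp]
      exact ⟨rfl, rfl⟩
    refine ⟨?_, ?_, ?_⟩
    · intro l hl hh
      have e := List.take_append_drop p l
      rw [← e, isHomogeneousList_append] at hh
      have := h.mem _ _ hh.1 hh.2
      convert this using 2
      rw [← sdeg_append, e, sdeg, hl]
      push_cast
      ring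
    · intro l l' d x y hn hl hl' hx hy
      rcases key l l' hn with ⟨u, hu, hp⟩ | ⟨u, hu, hp⟩
      · rw [hu] at hl' ⊢
        rw [isHomogeneousList_append] at hl'
        simp only [(tk _ _ _ _ hp).1, (tk _ _ _ _ hp).2]
        exact h.add_left _ _ _ _ _ _ hl hl'.1 hl'.2 hx hy
      · rw [hu] at hl ⊢
        rw [isHomogeneousList_append] at hl
        simp only [(tk' _ _ _ _ hp).1, (tk' _ _ _ _ hp).2]
        exact h.add_right _ _ _ _ _ _ hl.1 hl.2 hl' hx hy
    · intro l l' d c x hn hl hl' hx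
      rcases key l l' hn with ⟨u, hu, hp⟩ | ⟨u, hu, hp⟩
      · rw [hu] at hl' ⊢
        rw [isHomogeneousList_append] at hl'
        simp only [(tk _ _ _ _ hp).1, (tk _ _ _ _ hp).2]
        exact h.smul_left _ _ _ _ _ _ hl hl'.1 hl'.2 hx
      · rw [hu] at hl ⊢
        rw [isHomogeneousList_append] at hl
        simp only [(tk' _ _ _ _ hp).1, (tk' _ _ _ _ hp).2]
        exact h.smul_right _ _ _ _ _ _ hl.1 hl.2 hl' hx

/-- `F` is additive in each argument, on homogeneous elements. -/
def IsMultiadditive (gr : ℤ → Submodule k M) (F : List (ℤ × M) → N) : Prop :=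
  ∀ l l' d x y, IsHomogeneousList gr l → IsHomogeneousList gr l' → x ∈ gr d → y ∈ gr d →
    F (l ++ (d, x + y) :: l') = F (l ++ (d, x) :: l') + F (l ++ (d, y) :: l')

namespace IsMultiadditive

variable {gr : ℤ → Submodule k M} {F : List (ℤ × M) → N}

theorem apply_zero (h : IsMultiadditive gr F) {l l' : List (ℤ × M)} (d : ℤ)
    (hl : IsHomogeneousList gr l) (hl' : IsHomogeneousList gr l') : F (l ++ (d, 0) :: l') = 0 := by
  have := h l l' d 0 0 hl hl' (Submodule.zero_mem _) (Submodule.zero_mem _)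
  rw [add_zero] at this
  exact left_eq_add.1 this

theorem apply_sgn_smul (h : IsMultiadditive gr F) {l l' : List (ℤ × M)} {d : ℤ} {x : M} (e : ℤ)
    (hl : IsHomogeneousList gr l) (hl' : IsHomogeneousList gr l') (hx : x ∈ gr d) :
    F (l ++ (d, sgn e • x) :: l') = sgn e • F (l ++ (d, x) :: l') := by
  rcases sgn_eq_or e with he | he
  · simp [he]
  · have := h l l' d x (-x) hl hl' hx (Submodule.neg_mem _ hx)
    rw [add_neg_cancel, h.apply_zero d hl hl'] at this
    rw [he, neg_one_smul, neg_one_smul]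
    exact (neg_eq_of_add_eq_zero_right this.symm).symm

theorem cons (h : IsMultiadditive gr F) {x : ℤ × M} (hx : x.2 ∈ gr x.1) :
    IsMultiadditive gr (fun l => F (x :: l)) := by
  intro l l' d y z hl hl' hy hz
  exact h (x :: l) l' d y z (by simp [hx, hl]) hl' hy hz

theorem shiftExp_smul (h : IsMultiadditive gr F) (a b : List (ℤ × M)) :
    IsMultiadditive gr (fun l => sgn (shiftExp (a ++ l ++ b)) • F l) := by
  intro l l' d x y hl hl' hx hy
  simp only [h l l' d x y hl hl' hx hy, smul_add, shiftExp_append, shiftExp_cons, totalDeg_append,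
    totalDeg_cons, List.length_append, List.length_cons]

end IsMultiadditive

theorem muElt_mem {A : BInfinityData k M} (h : A.MuGraded) {a b : List (ℤ × M)}
    (ha : IsHomogeneousList A.gr a) (hb : IsHomogeneousList A.gr b) :
    (A.muElt a b).2 ∈ A.gr (A.muElt a b).1 := by
  have e : (A.muElt a b).1 = sdeg a + sdeg b + 1 := by simp only [muElt, sdeg]; ring
  rw [e]
  exact h.mem a b ha hb

theorem muGraded_opp {A : BInfinityData k M} (h : A.MuGraded) : A.opp.MuGraded := by
  refine ⟨?_, ?_, ?_, ?_, ?_⟩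
  · intro a b ha hb
    rw [add_comm (sdeg a)]
    exact (A.gr _).smul_of_tower_mem _ (h.mem b a hb ha)
  · intro l l' b d x y hl hl' hb hx hy
    simp [opp, h.add_right _ _ _ _ _ _ hb hl hl' hx hy]
  · intro l l' b d c x hl hl' hb hx
    simp only [opp, h.smul_right _ _ _ _ _ _ hb hl hl' hx, List.length_append, List.length_cons,
      totalDeg_append, totalDeg_cons]
    rw [smul_comm]
  · intro b l l' d x y hb hl hl' hx hy
    simp [opp, h.add_left _ _ _ _ _ _ hl hl' hb hx hy]
  · intro b l l' d c x hb hl hl' hx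
    simp only [opp, h.smul_left _ _ _ _ _ _ hl hl' hb hx, List.length_append, List.length_cons,
      totalDeg_append, totalDeg_cons]
    rw [smul_comm]

theorem tensorSum_congr_of_homogeneous {A : BInfinityData k M} (h : A.MuGraded) {r : ℕ}
    {F G : List (ℤ × M) → N} {a b : List (ℤ × M)} (ha : IsHomogeneousList A.gr a)
    (hb : IsHomogeneousList A.gr b)
    (hFG : ∀ l, IsHomogeneousList A.gr l → l.length = r → sdeg l = sdeg a + sdeg b → F l = G l) :
    A.tensorSum r F a b = A.tensorSum r G a b := by
  induction r generalizing F G a b with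
  | zero =>
    simp only [tensorSum]
    split_ifs with h1 h2
    · rw [hFG [] (by simp) rfl]
      simp [List.length_eq_zero_iff.1 h1, List.length_eq_zero_iff.1 h2]
    · rfl
    · rfl
  | succ r ih =>
    simp only [tensorSum]
    refine splitSum_congr fun a₁ a₂ ha' => splitSum_congr fun b₁ b₂ hb' => ?_
    subst ha' hb'
    rw [isHomogeneousList_append] at ha hb
    rw [ih ha.2 hb.2 fun l h0 hl hs => hFG _ ?_ (by simp [hl]) ?_]
    · rw [isHomogeneousList_cons]
      exact ⟨muElt_mem h ha.1 hb.1, h0⟩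
    · rw [sdeg_muElt_cons, hs, sdeg_append, sdeg_append]
      ring

theorem tensorSum_opp {A : BInfinityData k M} (h : A.MuGraded) (r : ℕ) {F : List (ℤ × M) → N}
    (hF : IsMultiadditive A.gr F) {a b : List (ℤ × M)} (ha : IsHomogeneousList A.gr a)
    (hb : IsHomogeneousList A.gr b) :
    A.opp.tensorSum r F a b = sgn (sdeg a * sdeg b) • A.tensorSum r F b a := by
  induction r generalizing F a b with
  | zero =>
    simp only [tensorSum]
    split_ifs with h1 h2
    · simp [List.length_eq_zero_iff.1 h1, List.length_eq_zero_iff.1 h2, sgn_zero]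
    all_goals simp
  | succ r ih =>
    simp only [tensorSum, smul_splitSum]
    rw [splitSum_comm]
    refine splitSum_congr fun b₁ b₂ hb' => splitSum_congr fun a₁ a₂ ha' => ?_
    subst ha' hb'
    rw [isHomogeneousList_append] at ha hb
    have hm := muElt_mem h hb.1 ha.1
    have hm' := muElt_mem (muGraded_opp h) ha.1 hb.1
    have e : A.opp.muElt a₁ b₁ = ((A.muElt b₁ a₁).1,
        sgn ((a₁.length : ℤ) * b₁.length + totalDeg b₁ * totalDeg a₁) • (A.muElt b₁ a₁).2) := by
      simp only [muElt, opp, Prod.mk.injEq, and_true]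
      ring
    rw [ih (hF.cons hm') ha.2 hb.2, tensorSum_congr_of_homogeneous h hb.2 ha.2
      (G := fun l => sgn ((a₁.length : ℤ) * b₁.length + totalDeg b₁ * totalDeg a₁) •
        F (A.muElt b₁ a₁ :: l)), tensorSum_zsmul, sgn_smul_sgn_smul, sgn_smul_sgn_smul,
        sgn_smul_sgn_smul]
    · congr 1
      apply sgn_congr
      clear hm hm' e hF ih ha hb
      simp only [shiftExp_append, sdeg, totalDeg_append, List.length_append]
      push_cast
      grind
    · intro l hl _ _
      rw [e]
      exact hF.apply_sgn_smul (l := []) _ (by simp) hl hm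

theorem IsAInfinityAlgebra.multiadditive {A : BInfinityData k M} (h : A.IsAInfinityAlgebra) :
    IsMultiadditive A.gr A.m := by
  intro l l' d x y hl hl' hx hy
  exact (h.graded (l.length + 1 + l'.length) (by omega)).add l l' d x y rfl hl hl' hx hy

/-- The opposite of a `B_∞`-algebra is a `B_∞`-algebra. -/
theorem IsBInfinityAlgebra.opp {A : BInfinityData k M} (h : A.IsBInfinityAlgebra) :
    A.opp.IsBInfinityAlgebra := by
  have hg := A.muGraded_iff.1 h.graded
  refine ⟨⟨h.aInfinity.graded, h.aInfinity.rel⟩, A.opp.muGraded_iff.2 (muGraded_opp hg), ?_, ?_,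
    ?_, ?_, ?_, ?_⟩
  · intro d x hx
    simpa [BInfinityData.opp, sgn_zero] using h.unit_left d x hx
  · intro d x hx
    simpa [BInfinityData.opp, sgn_zero] using h.unit_right d x hx
  · intro l hl hl'
    simp [BInfinityData.opp, h.mu_nil_left l hl hl']
  · intro l hl hl'
    simp [BInfinityData.opp, h.mu_nil_right l hl hl']
  · intro a b c ha hb hc
    rw [assoc_iff]
    have key := (A.assoc_iff c b a).1 (h.assoc c b a hc hb ha)
    have h1 : ∀ r, A.opp.tensorSum r (fun l => sgn (shiftExp (a ++ l)) • A.opp.mu a l) b c =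
        sgn (sdeg b * sdeg c + sdeg a * (sdeg b + sdeg c)) •
          A.tensorSum r (fun l => sgn (shiftExp (l ++ a)) • A.mu l a) c b := by
      intro r
      have hF : IsMultiadditive A.gr (fun l => sgn (shiftExp (a ++ l)) • A.opp.mu a l) := by
        have : IsMultiadditive A.gr (A.opp.mu a) := fun l l' d x y hl hl' hx hy =>
          (muGraded_opp hg).add_right a l l' d x y ha hl hl' hx hy
        simpa using this.shiftExp_smul a []
      rw [tensorSum_opp hg r hF hb hc, ← sgn_smul_sgn_smul]
      congr 1
      rw [← tensorSum_zsmul]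
      refine tensorSum_congr _ _ _ fun l hl hs => ?_
      rw [add_comm (sdeg b), ← hs]
      simp only [BInfinityData.opp, sgn_smul_sgn_smul]
      congr 1
      apply sgn_congr
      clear key
      simp only [shiftExp_append, sdeg]
      push_cast
      grind
    have h2 : ∀ r, A.opp.tensorSum r (fun l => sgn (shiftExp (l ++ c)) • A.opp.mu l c) a b =
        sgn (sdeg b * sdeg c + sdeg a * (sdeg b + sdeg c)) •
          A.tensorSum r (fun l => sgn (shiftExp (c ++ l)) • A.mu c l) b a := by
      intro r
      have hF : IsMultiadditive A.gr (fun l => sgn (shiftExp (l ++ c)) • A.opp.mu l c) := by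
        have : IsMultiadditive A.gr (fun l => A.opp.mu l c) := fun l l' d x y hl hl' hx hy =>
          (muGraded_opp hg).add_left l l' c d x y hl hl' hc hx hy
        simpa using this.shiftExp_smul [] c
      have e : sgn (sdeg b * sdeg c + sdeg a * (sdeg b + sdeg c)) =
          sgn (sdeg a * sdeg b + sdeg c * (sdeg b + sdeg a)) := by congr 1; ring
      rw [tensorSum_opp hg r hF ha hb, e, ← sgn_smul_sgn_smul]
      congr 1
      rw [← tensorSum_zsmul]
      refine tensorSum_congr _ _ _ fun l hl hs => ?_
      rw [← hs]
      simp only [BInfinityData.opp, sgn_smul_sgn_smul]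
      congr 1
      apply sgn_congr
      clear key
      simp only [shiftExp_append, sdeg]
      push_cast
      grind
    simp only [h1, h2, ← Finset.smul_sum]
    rw [add_comm b.length, add_comm a.length, key]
  · intro a b ha hb
    rw [leibniz_iff]
    have key := (A.leibniz_iff b a).1 (h.leibniz b a hb ha)
    have h1 : ∀ r, A.opp.tensorSum r (fun l => sgn (shiftExp l) • A.opp.m l) a b =
        sgn (sdeg a * sdeg b) • A.tensorSum r (fun l => sgn (shiftExp l) • A.m l) b a := by
      intro r
      refine tensorSum_opp hg r ?_ ha hb
      simpa [BInfinityData.opp] using h.aInfinity.multiadditive.shiftExp_smul [] []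
    simp only [h1, ← Finset.smul_sum]
    rw [add_comm a.length, key, smul_add, add_comm, zsmul_blockSum, zsmul_blockSum]
    congr 1
    · refine blockSum_congr fun a₁ a₂ a₃ e => ?_
      simp only [BInfinityData.opp, sgn_smul_sgn_smul, ← e]
      congr 1
      apply sgn_congr
      clear key h1
      simp only [shiftExp_append, shiftExp_cons, sdeg, mElt, totalDeg_append, totalDeg_cons,
        List.length_append, List.length_cons]
      push_cast
      grind
    · refine blockSum_congr fun a₁ a₂ a₃ e => ?_
      simp only [BInfinityData.opp, sgn_smul_sgn_smul, ← e]
      congr 1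
      apply sgn_congr
      clear key h1
      simp only [shiftExp_append, shiftExp_cons, sdeg, mElt, totalDeg_append, totalDeg_cons,
        List.length_append, List.length_cons]
      push_cast
      grind

end BInfinityData

namespace BInfinityData

variable {k : Type*} {M N : Type*} [Field k] [AddCommGroup M] [Module k M] [AddCommGroup N]

/-! ### Brace algebras -/

/-- `x{c₁, …, c_p}`, together with its degree. -/
def brElt {M' : Type*} (br : ℤ × M' → List (ℤ × M) → M) (x : ℤ × M') (c : List (ℤ × M)) : ℤ × M :=
  (x.1 + sdeg c, br x c)

/-- The sum of `F(c₀, b₁{c₁}, c₂, b₂{c₃}, …)` over all ways to cut `c` into consecutive blocks, with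
the Koszul signs for moving the `c`'s past the `b`'s.  For `F = x{-}` this is the right-hand side of
the pre-Jacobi identity for `x{b}{c}`. -/
def jacobiSum {M' : Type*} (br : ℤ × M' → List (ℤ × M) → M) :
    List (ℤ × M') → (List (ℤ × M) → N) → List (ℤ × M) → N
  | [], F, c => F c
  | x :: b, F, c => splitSum (fun c₀ c' => sgn (sdeg c₀ * sdeg (x :: b)) •
      splitSum (fun c₁ c₂ => sgn (sdeg c₁ * sdeg b) •
        jacobiSum br b (fun l => F (c₀ ++ brElt br x c₁ :: l)) c₂) c') c

section Star

variable {M M' : Type*} {br : ℤ × M' → List (ℤ × M) → M}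

@[simp] theorem jacobiSum_nil (F : List (ℤ × M) → N) (c : List (ℤ × M)) :
    jacobiSum br [] F c = F c := rfl

theorem jacobiSum_cons_nil (x : ℤ × M') (b : List (ℤ × M')) (F : List (ℤ × M) → N) :
    jacobiSum br (x :: b) F [] = jacobiSum br b (fun l => F (brElt br x [] :: l)) [] := by
  simp [jacobiSum, sgn_zero]

theorem jacobiSum_add (b : List (ℤ × M')) (F G : List (ℤ × M) → N) (c : List (ℤ × M)) :
    jacobiSum br b (fun l => F l + G l) c = jacobiSum br b F c + jacobiSum br b G c := by
  induction b generalizing F G c with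
  | nil => rfl
  | cons x b ih => simp only [jacobiSum, ih, smul_add, splitSum_add]

theorem jacobiSum_zsmul (b : List (ℤ × M')) (a : ℤ) (F : List (ℤ × M) → N) (c : List (ℤ × M)) :
    jacobiSum br b (fun l => a • F l) c = a • jacobiSum br b F c := by
  induction b generalizing F c with
  | nil => rfl
  | cons x b ih => simp only [jacobiSum, ih, smul_splitSum, smul_comm a]

theorem jacobiSum_cons_cons (x : ℤ × M') (y : ℤ × M) (b : List (ℤ × M')) (c : List (ℤ × M))
    (F : List (ℤ × M) → N) :
    jacobiSum br (x :: b) F (y :: c) =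
      sgn ((y.1 - 1) * sdeg (x :: b)) • jacobiSum br (x :: b) (fun l => F (y :: l)) c +
      splitSum (fun c₁ c₂ => sgn (sdeg c₁ * sdeg b) •
        jacobiSum br b (fun l => F (brElt br x c₁ :: l)) c₂) (y :: c) := by
  conv_lhs => rw [jacobiSum, splitSum_cons]
  rw [add_comm]
  congr 1
  · rw [jacobiSum, smul_splitSum]
    refine splitSum_congr fun c₀ c' _ => ?_
    rw [sgn_smul_sgn_smul, sdeg_cons, add_mul]
    rfl
  · simp [sgn_zero]

/-- The lists to which `F` is applied in `jacobiSum` are homogeneous of fixed degree, and at least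
as long as the first list. -/
theorem jacobiSum_congr [AddCommGroup M] [Module k M] [AddCommGroup M'] [Module k M']
    {gr' : ℤ → Submodule k M'} {gr : ℤ → Submodule k M}
    (hbr : ∀ x c, x.2 ∈ gr' x.1 → IsHomogeneousList gr c →
    br x c ∈ gr (x.1 + sdeg c)) {F G : List (ℤ × M) → N} {b : List (ℤ × M')}
    {c : List (ℤ × M)} (hb : IsHomogeneousList gr' b) (hc : IsHomogeneousList gr c)
    (h : ∀ l, IsHomogeneousList gr l → b.length ≤ l.length → sdeg l = sdeg b + sdeg c →
      F l = G l) : jacobiSum br b F c = jacobiSum br b G c := by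
  induction b generalizing F G c with
  | nil => exact h c hc (by simp) (by simp)
  | cons x b ih =>
    simp only [jacobiSum]
    refine splitSum_congr fun c₀ c' e => ?_
    congr 1
    refine splitSum_congr fun c₁ c₂ e' => ?_
    subst e'
    subst e
    simp only [isHomogeneousList_append, isHomogeneousList_cons] at hb hc
    rw [ih hb.2 hc.2.2 fun l hl hl' hs => h _ ?_ ?_ ?_]
    · simp only [isHomogeneousList_append, isHomogeneousList_cons]
      exact ⟨hc.1, hbr _ _ hb.1 hc.2.1, hl⟩
    · simp; omega
    · simp [brElt, hs]; ring

theorem jacobiSum_eq_zero {F : List (ℤ × M) → N} {b : List (ℤ × M')} {c : List (ℤ × M)}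
    (h : ∀ l, b.length ≤ l.length → F l = 0) : jacobiSum br b F c = 0 := by
  induction b generalizing F c with
  | nil => exact h c (by simp)
  | cons x b ih =>
    simp only [jacobiSum]
    refine splitSum_eq_zero fun c₀ c' e => ?_
    rw [splitSum_eq_zero, smul_zero]
    intro c₁ c₂ e'
    rw [ih, smul_zero]
    intro l hl
    exact h _ (by simp; omega)

/-- If `F` vanishes on lists with at least two entries, only `x{c}` contributes. -/
theorem jacobiSum_singleton_of_length {F : List (ℤ × M) → N} (h : ∀ l, 2 ≤ l.length → F l = 0)
    (x : ℤ × M') (c : List (ℤ × M)) : jacobiSum br [x] F c = F [brElt br x c] := by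
  simp only [jacobiSum]
  rw [splitSum_eq_left, splitSum_eq_right]
  · simp [sgn_zero]
  · intro a u v _
    rw [h _ (by simp), smul_zero]
  · intro a u v _
    rw [splitSum_eq_zero, smul_zero]
    intro u' v' _
    rw [h _ (by simp; omega), smul_zero]

end Star

section OfBrace

variable {gr : ℤ → Submodule k M} {dif : ℤ × M → M} {mul : ℤ × M → ℤ × M → M}
  {br : ℤ × M → List (ℤ × M) → M}

/-- The operations `m_1` and `m_2` of a dg algebra on the shifted elements. -/
def shiftedM (dif : ℤ × M → M) (mul : ℤ × M → ℤ × M → M) : List (ℤ × M) → M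
  | [x] => dif x
  | [x, y] => sgn x.1 • mul x y
  | _ => 0

/-- The coderivation of the bar construction of a dg algebra: the sum of
`(-1)^{|sb₁| + ⋯ + |sb_i|} G(b₁, …, b_i, m(b_{i+1}, …), …)`. -/
def insertM (dif : ℤ × M → M) (mul : ℤ × M → ℤ × M → M) :
    (List (ℤ × M) → N) → List (ℤ × M) → N
  | _, [] => 0
  | G, [y] => G [(y.1 + 1, dif y)]
  | G, y :: z :: b => G ((y.1 + 1, dif y) :: z :: b) +
      sgn y.1 • G ((y.1 + z.1, mul y z) :: b) +
      sgn (y.1 - 1) • insertM dif mul (fun l => G (y :: l)) (z :: b)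

/-- The axioms of a brace `B_∞`-algebra. -/
structure IsBraceAlgebra (gr : ℤ → Submodule k M) (dif : ℤ × M → M) (mul : ℤ × M → ℤ × M → M)
    (br : ℤ × M → List (ℤ × M) → M) : Prop where
  dif_mem : ∀ d, ∀ x ∈ gr d, dif (d, x) ∈ gr (d + 1)
  dif_add : ∀ d, ∀ x ∈ gr d, ∀ y ∈ gr d, dif (d, x + y) = dif (d, x) + dif (d, y)
  dif_smul : ∀ d (c : k), ∀ x ∈ gr d, dif (d, c • x) = c • dif (d, x)
  mul_mem : ∀ d e, ∀ x ∈ gr d, ∀ y ∈ gr e, mul (d, x) (e, y) ∈ gr (d + e)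
  add_mul : ∀ d e, ∀ x ∈ gr d, ∀ x' ∈ gr d, ∀ y ∈ gr e,
    mul (d, x + x') (e, y) = mul (d, x) (e, y) + mul (d, x') (e, y)
  mul_add : ∀ d e, ∀ x ∈ gr d, ∀ y ∈ gr e, ∀ y' ∈ gr e,
    mul (d, x) (e, y + y') = mul (d, x) (e, y) + mul (d, x) (e, y')
  smul_mul : ∀ d e (c : k), ∀ x ∈ gr d, ∀ y ∈ gr e, mul (d, c • x) (e, y) = c • mul (d, x) (e, y)
  mul_smul : ∀ d e (c : k), ∀ x ∈ gr d, ∀ y ∈ gr e, mul (d, x) (e, c • y) = c • mul (d, x) (e, y)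
  br_mem : ∀ x c, x.2 ∈ gr x.1 → IsHomogeneousList gr c → br x c ∈ gr (x.1 + sdeg c)
  br_add_left : ∀ d c, ∀ x ∈ gr d, ∀ y ∈ gr d, IsHomogeneousList gr c →
    br (d, x + y) c = br (d, x) c + br (d, y) c
  br_smul_left : ∀ d c (a : k), ∀ x ∈ gr d, IsHomogeneousList gr c →
    br (d, a • x) c = a • br (d, x) c
  br_add_right : ∀ x l l' d y z, x.2 ∈ gr x.1 → IsHomogeneousList gr l →
    IsHomogeneousList gr l' → y ∈ gr d → z ∈ gr d →
    br x (l ++ (d, y + z) :: l') = br x (l ++ (d, y) :: l') + br x (l ++ (d, z) :: l')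
  br_smul_right : ∀ x l l' d (a : k) y, x.2 ∈ gr x.1 → IsHomogeneousList gr l →
    IsHomogeneousList gr l' → y ∈ gr d → br x (l ++ (d, a • y) :: l') = a • br x (l ++ (d, y) :: l')
  br_nil : ∀ x, x.2 ∈ gr x.1 → br x [] = x.2
  dif_dif : ∀ d, ∀ x ∈ gr d, dif (d + 1, dif (d, x)) = 0
  dif_mul : ∀ d e, ∀ x ∈ gr d, ∀ y ∈ gr e, dif (d + e, mul (d, x) (e, y)) =
    mul (d + 1, dif (d, x)) (e, y) + sgn d • mul (d, x) (e + 1, dif (e, y))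
  mul_assoc : ∀ d e f, ∀ x ∈ gr d, ∀ y ∈ gr e, ∀ z ∈ gr f,
    mul (d + e, mul (d, x) (e, y)) (f, z) = mul (d, x) (e + f, mul (e, y) (f, z))
  /-- The (higher) pre-Jacobi identities. -/
  br_br : ∀ x b c, x.2 ∈ gr x.1 → IsHomogeneousList gr b → IsHomogeneousList gr c →
    br (brElt br x b) c = jacobiSum br b (br x) c
  /-- Compatibility of the braces with the differential. -/
  br_dif : ∀ x c, x.2 ∈ gr x.1 → IsHomogeneousList gr c →
    jacobiSum br [x] (shiftedM dif mul) c =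
      br (x.1 + 1, dif x) c + sgn (x.1 - 1) • insertM dif mul (br x) c
  /-- Compatibility of the braces with the product. -/
  br_mul : ∀ x y c, x.2 ∈ gr x.1 → y.2 ∈ gr y.1 → IsHomogeneousList gr c →
    jacobiSum br [x, y] (shiftedM dif mul) c = sgn x.1 • br (x.1 + y.1, mul x y) c

variable (gr dif mul br) in
theorem ofBrace_mu_singleton (x : ℤ × M) (b : List (ℤ × M)) :
    (ofBrace gr dif mul br).mu [x] b = sgn (shiftExp (x :: b)) • br x b := by
  have h : ∀ b : List (ℤ × M), ∑ i : Fin b.length, ((b.length : ℤ) - 1 - (i : ℕ)) * (b.get i).1 =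
      shiftExp b := by
    intro b
    induction b with
    | nil => rfl
    | cons y b ih =>
      rw [shiftExp_cons, ← ih]
      simp only [List.length_cons, Fin.sum_univ_succ]
      congr 1
      · simp
      · refine Finset.sum_congr rfl fun i _ => ?_
        have e : (y :: b).get i.succ = b.get i := rfl
        rw [e]
        push_cast [Fin.val_succ]
        ring
  simp only [ofBrace, h, shiftExp_cons]

theorem ofBrace_mu_cons_cons (x y : ℤ × M) (a b : List (ℤ × M)) :
    (ofBrace gr dif mul br).mu (x :: y :: a) b = 0 := by
  simp [ofBrace]

theorem ofBrace_mu_nil_singleton (y : ℤ × M) : (ofBrace gr dif mul br).mu [] [y] = y.2 := by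
  simp [ofBrace]

theorem ofBrace_mu_nil_nil : (ofBrace gr dif mul br).mu [] [] = 0 := by
  simp [ofBrace]

theorem ofBrace_mu_nil_cons_cons (x y : ℤ × M) (b : List (ℤ × M)) :
    (ofBrace gr dif mul br).mu [] (x :: y :: b) = 0 := by
  simp [ofBrace]

theorem IsBraceAlgebra.muGraded (h : IsBraceAlgebra gr dif mul br) :
    (ofBrace gr dif mul br).MuGraded := by
  refine ⟨?_, ?_, ?_, ?_, ?_⟩
  · rintro (_ | ⟨x, _ | ⟨y, a⟩⟩) b ha hb
    · rcases b with _ | ⟨y, _ | ⟨z, b⟩⟩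
      · rw [ofBrace_mu_nil_nil]; exact Submodule.zero_mem _
      · rw [ofBrace_mu_nil_singleton]
        have := hb y (by simp)
        simpa using this
      · rw [ofBrace_mu_nil_cons_cons]; exact Submodule.zero_mem _
    · rw [ofBrace_mu_singleton]
      refine Submodule.smul_of_tower_mem _ _ ?_
      have := h.br_mem x b (ha x (by simp)) hb
      have e : sdeg [x] + sdeg b + 1 = x.1 + sdeg b := by simp; ring
      rw [e]
      exact this
    · rw [ofBrace_mu_cons_cons]; exact Submodule.zero_mem _
  · intro l l' b d x y hl hl' hb hx hy
    rcases l with _ | ⟨z, _ | ⟨w, l⟩⟩ <;> rcases l' with _ | ⟨z', l'⟩ <;>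
      simp only [List.nil_append, List.cons_append, ofBrace_mu_cons_cons, add_zero,
        ofBrace_mu_singleton]
    rw [h.br_add_left d b x hx y hy hb, smul_add]
    rfl
  · intro l l' b d c x hl hl' hb hx
    rcases l with _ | ⟨z, _ | ⟨w, l⟩⟩ <;> rcases l' with _ | ⟨z', l'⟩ <;>
      simp only [List.nil_append, List.cons_append, ofBrace_mu_cons_cons, smul_zero,
        ofBrace_mu_singleton]
    rw [h.br_smul_left d b c x hx hb, smul_comm]
    rfl
  · intro a l l' d x y ha hl hl' hx hy
    rcases a with _ | ⟨z, _ | ⟨w, a⟩⟩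
    · rcases l with _ | ⟨z, _ | ⟨w, l⟩⟩ <;> rcases l' with _ | ⟨z', l'⟩ <;>
        simp only [List.nil_append, List.cons_append, ofBrace_mu_nil_cons_cons, add_zero,
          ofBrace_mu_nil_singleton]
    · simp only [ofBrace_mu_singleton, h.br_add_right z l l' d x y (ha z (by simp)) hl hl' hx hy,
        smul_add, shiftExp_cons, shiftExp_append, List.length_append, List.length_cons]
    · simp [ofBrace_mu_cons_cons]
  · intro a l l' d c x ha hl hl' hx
    rcases a with _ | ⟨z, _ | ⟨w, a⟩⟩
    · rcases l with _ | ⟨z, _ | ⟨w, l⟩⟩ <;> rcases l' with _ | ⟨z', l'⟩ <;>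
        simp only [List.nil_append, List.cons_append, ofBrace_mu_nil_cons_cons, smul_zero,
          ofBrace_mu_nil_singleton]
    · simp only [ofBrace_mu_singleton, h.br_smul_right z l l' d c x (ha z (by simp)) hl hl' hx,
        shiftExp_cons, shiftExp_append, List.length_append, List.length_cons]
      rw [smul_comm]
    · simp [ofBrace_mu_cons_cons]

theorem tensorSum_zero_fun (A : BInfinityData k M) (r : ℕ) (a b : List (ℤ × M)) :
    A.tensorSum r (fun _ => (0 : N)) a b = 0 := by
  have := A.tensorSum_zsmul r 0 (fun _ => (0 : N)) a b
  simpa using this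

/-- For a brace algebra only the blocks `μ_{0,1}` and `μ_{1,q}` contribute. -/
theorem tensorSum_succ_ofBrace (h : IsBraceAlgebra gr dif mul br) (r : ℕ) {F : List (ℤ × M) → N}
    (hF : IsMultiadditive gr F) {a b : List (ℤ × M)} (ha : IsHomogeneousList gr a)
    (hb : IsHomogeneousList gr b) :
    (ofBrace gr dif mul br).tensorSum (r + 1) F a b =
      (match b with
        | [] => 0
        | y :: b => sgn ((y.1 - 1) * sdeg a) •
            (ofBrace gr dif mul br).tensorSum r (fun l => F (y :: l)) a b) +
      (match a with
        | [] => 0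
        | x :: a => splitSum (fun b₁ b₂ => sgn (sdeg b₁ * sdeg a) •
            (ofBrace gr dif mul br).tensorSum r (fun l => F (brElt br x b₁ :: l)) a b₂) b) := by
  set A := ofBrace gr dif mul br with hA
  have hg : A.MuGraded := h.muGraded
  have hz : ∀ (a₁ a₂ b₁ b₂ : List (ℤ × M)), IsHomogeneousList gr (a₁ ++ a₂) →
      IsHomogeneousList gr (b₁ ++ b₂) → A.mu a₁ b₁ = 0 →
      A.tensorSum r (fun l => F (A.muElt a₁ b₁ :: l)) a₂ b₂ = 0 := by
    intro a₁ a₂ b₁ b₂ h1 h2 h3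
    rw [isHomogeneousList_append] at h1 h2
    rw [tensorSum_congr_of_homogeneous hg h1.2 h2.2 (G := fun _ => 0), tensorSum_zero_fun]
    intro l hl _ _
    have := hF.apply_zero (l := []) (A.muElt a₁ b₁).1 (by simp) hl
    rw [muElt, h3]
    exact this
  -- the blocks which do not involve `a`
  have h1 : splitSum (fun b₁ b₂ => sgn (sdeg b₁ * sdeg a + shiftExp ([] ++ b₁)) •
      A.tensorSum r (fun l => F (A.muElt [] b₁ :: l)) a b₂) b =
      (match b with
        | [] => 0
        | y :: b => sgn ((y.1 - 1) * sdeg a) • A.tensorSum r (fun l => F (y :: l)) a b) := by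
    rcases b with _ | ⟨y, b⟩
    · simp only [splitSum_nil]
      rw [hz [] a [] [] ha (by simp) ofBrace_mu_nil_nil, smul_zero]
    · rw [splitSum_cons, hz [] a [] (y :: b) ha hb ofBrace_mu_nil_nil, smul_zero, zero_add,
        splitSum_eq_left]
      · have e : A.muElt [] [y] = y := by
          simp [muElt, hA, ofBrace_mu_nil_singleton]
        rw [e]
        simp
      · rintro z u v rfl
        rw [hz [] a (y :: z :: u) v ha (by simpa using hb) (ofBrace_mu_nil_cons_cons y z u),
          smul_zero]
  rw [tensorSum]
  rcases a with _ | ⟨x, a⟩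
  · rw [splitSum_nil, h1, add_zero]
  · rw [splitSum_cons, h1]
    congr 1
    rw [splitSum_eq_left]
    · refine splitSum_congr fun b₁ b₂ hb' => ?_
      subst hb'
      rw [isHomogeneousList_append] at hb
      rw [isHomogeneousList_cons] at ha
      have e : A.muElt [x] b₁ =
          ((brElt br x b₁).1, sgn (shiftExp (x :: b₁)) • (brElt br x b₁).2) := by
        rw [muElt, hA, ofBrace_mu_singleton]
        simp [brElt, sdeg]
        ring
      rw [e, tensorSum_congr_of_homogeneous hg ha.2 hb.2
        (G := fun l => sgn (shiftExp (x :: b₁)) • F (brElt br x b₁ :: l)), tensorSum_zsmul,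
        sgn_smul_sgn_smul]
      · congr 1
        apply sgn_congr
        clear h1 hz
        simp only [List.cons_append, List.nil_append]
        push_cast
        grind
      · intro l hl _ _
        exact hF.apply_sgn_smul (l := []) _ (by simp) hl (h.br_mem x b₁ ha.1 hb.1)
    · rintro z u v rfl
      refine splitSum_eq_zero fun b₁ b₂ hb' => ?_
      subst hb'
      rw [hz (x :: z :: u) v b₁ b₂ (by simpa using ha) hb (ofBrace_mu_cons_cons x z u b₁),
        smul_zero]

theorem sum_tensorSum_ofBrace (h : IsBraceAlgebra gr dif mul br) (n : ℕ) {F : List (ℤ × M) → N}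
    (hF : IsMultiadditive gr F) {a b : List (ℤ × M)} (ha : IsHomogeneousList gr a)
    (hb : IsHomogeneousList gr b) (hn : a.length + b.length ≤ n) :
    ∑ r ∈ Finset.range (n + 1), (ofBrace gr dif mul br).tensorSum r F a b = jacobiSum br a F b := by
  induction n generalizing F a b with
  | zero =>
    obtain rfl := List.length_eq_zero_iff.1 (show a.length = 0 by omega)
    obtain rfl := List.length_eq_zero_iff.1 (show b.length = 0 by omega)
    simp [tensorSum]
  | succ n ih =>
    rw [Finset.sum_range_succ']
    simp only [tensorSum_succ_ofBrace h _ hF ha hb, Finset.sum_add_distrib]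
    rcases a with _ | ⟨x, a⟩ <;> rcases b with _ | ⟨y, b⟩
    · simp [tensorSum]
    · rw [isHomogeneousList_cons] at hb
      simp only [sdeg_nil, mul_zero, sgn_zero, one_smul, Finset.sum_const_zero, add_zero]
      rw [ih (hF.cons hb.1) ha hb.2 (by simpa using hn)]
      simp [tensorSum]
    · rw [isHomogeneousList_cons] at ha
      simp only [splitSum_nil, sdeg_nil, zero_mul, sgn_zero, one_smul, Finset.sum_const_zero,
        zero_add]
      rw [ih (hF.cons (h.br_mem x [] ha.1 hb)) ha.2 hb (by simpa using hn), jacobiSum_cons_nil]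
      simp [tensorSum]
    · have ha' := ha
      have hb' := hb
      rw [isHomogeneousList_cons] at ha' hb'
      rw [jacobiSum_cons_cons, ← Finset.smul_sum,
        ih (hF.cons hb'.1) ha hb'.2 (by simp at hn ⊢; omega), ← splitSum_sum]
      simp only [tensorSum, List.length_cons, Nat.add_eq_zero_iff, one_ne_zero, and_false, if_false,
        add_zero]
      congr 1
      refine splitSum_congr fun b₁ b₂ e => ?_
      have hl := congrArg List.length e
      rw [← e, isHomogeneousList_append] at hb
      rw [← Finset.smul_sum, ih (hF.cons (h.br_mem x b₁ ha'.1 hb.1)) ha'.2 hb.2]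
      simp at hn hl
      omega

theorem blockSum_cons {X : Type*} (f : List X → List X → List X → N) (y : X) (l : List X) :
    blockSum f (y :: l) =
      splitSum (fun u v => f [] (y :: u) v) l + blockSum (fun a b c => f (y :: a) b c) l := by
  rw [← blockSum_eq_sum, ← blockSum_eq_sum, splitSum_eq_sum, List.length_cons,
    Finset.sum_range_succ', add_comm]
  congr 1
  · have e : Finset.Icc 1 (l.length + 1 - 0) = Finset.Ico 1 (l.length + 2) := by
      ext i; simp; omega
    rw [e, Finset.sum_Ico_eq_sum_range]
    refine Finset.sum_congr rfl fun i _ => ?_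
    simp [add_comm 1 i]
  · refine Finset.sum_congr rfl fun i _ => ?_
    rw [show l.length + 1 - (i + 1) = l.length - i by omega]
    refine Finset.sum_congr rfl fun s _ => ?_
    simp [show i + 1 + s = (i + s) + 1 by omega]

theorem blockSum_nil {X : Type*} (f : List X → List X → List X → N) : blockSum f [] = 0 := by
  simp [blockSum]

theorem ofBrace_mElt_singleton (y : ℤ × M) :
    (ofBrace gr dif mul br).mElt [y] = (y.1 + 1, dif y) := by
  simp [mElt, ofBrace]
  ring

theorem ofBrace_mElt_pair (y z : ℤ × M) :
    (ofBrace gr dif mul br).mElt [y, z] = (y.1 + z.1, mul y z) := by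
  simp [mElt, ofBrace]

theorem ofBrace_m_cons_cons_cons (x y z : ℤ × M) (l : List (ℤ × M)) :
    (ofBrace gr dif mul br).m (x :: y :: z :: l) = 0 := by
  simp [ofBrace]

theorem blockSum_ofBrace {G : List (ℤ × M) → N} (hG : IsMultiadditive gr G) {b : List (ℤ × M)}
    (hb : IsHomogeneousList gr b) :
    blockSum (fun b₁ b₂ b₃ => sgn (sdeg b₁ + shiftExp b₂) •
      G (b₁ ++ (ofBrace gr dif mul br).mElt b₂ :: b₃)) b = insertM dif mul G b := by
  induction b generalizing G with
  | nil => rw [blockSum_nil, insertM]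
  | cons y b ih =>
    rw [blockSum_cons]
    rw [isHomogeneousList_cons] at hb
    have e : blockSum (fun b₁ b₂ b₃ => sgn (sdeg (y :: b₁) + shiftExp b₂) •
        G (y :: b₁ ++ (ofBrace gr dif mul br).mElt b₂ :: b₃)) b =
        sgn (y.1 - 1) • insertM dif mul (fun l => G (y :: l)) b := by
      rw [← ih (hG.cons hb.1) hb.2, zsmul_blockSum]
      refine blockSum_congr fun b₁ b₂ b₃ _ => ?_
      rw [sgn_smul_sgn_smul, sdeg_cons, add_assoc]
      rfl
    rw [e]
    rcases b with _ | ⟨z, b⟩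
    · simp [ofBrace_mElt_singleton, insertM, sgn_zero]
    · rw [splitSum_cons, splitSum_eq_left, insertM]
      · simp [ofBrace_mElt_singleton, ofBrace_mElt_pair, sgn_zero]
      · rintro w u v rfl
        have h0 := hG.apply_zero (l := []) (l' := v)
          (totalDeg (y :: z :: w :: u) + 2 - (y :: z :: w :: u).length) (by simp)
          (by simp at hb; exact hb.2.2.2.2)
        rw [mElt, ofBrace_m_cons_cons_cons, h0, smul_zero]

omit [AddCommGroup M] in
theorem insertM_eq_zero {G : List (ℤ × M) → N} {b : List (ℤ × M)}
    (h : ∀ l, b.length ≤ l.length + 1 → G l = 0) : insertM dif mul G b = 0 := by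
  fun_induction insertM dif mul G b with
  | case1 => rfl
  | case2 G y => exact h _ (by simp)
  | case3 G y z b ih =>
    rw [h _ (by simp), h _ (by simp), ih, smul_zero, smul_zero, add_zero, add_zero]
    intro l hl
    exact h _ (by simpa using hl)

theorem sum_insert_eq (F : List (ℤ × M) → N) (hF : IsMultiadditive gr F) {l : List (ℤ × M)}
    (hl : IsHomogeneousList gr l) :
    ∑ j ∈ Finset.range l.length, ∑ s ∈ Finset.Icc 1 (l.length - j),
      sgn ((j : ℤ) + s * ((l.length : ℤ) - j - s) + (2 - s) * totalDeg (l.take j)) •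
        F (l.take j ++ (ofBrace gr dif mul br).mElt ((l.drop j).take s) :: l.drop (j + s)) =
    sgn (shiftExp l) • insertM dif mul (fun l => sgn (shiftExp l) • F l) l := by
  have hG : IsMultiadditive gr (fun l => sgn (shiftExp l) • F l) := by
    simpa using hF.shiftExp_smul [] []
  rw [← blockSum_ofBrace (br := br) hG hl, ← blockSum_eq_sum, Finset.smul_sum]
  refine Finset.sum_congr rfl fun i hi => ?_
  rw [Finset.smul_sum]
  refine Finset.sum_congr rfl fun s hs => ?_
  have e : l.take i ++ (l.drop i).take s ++ l.drop (i + s) = l := by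
    rw [List.append_assoc, ← List.drop_drop, List.take_append_drop, List.take_append_drop]
  rw [Finset.mem_Icc] at hs
  rw [Finset.mem_range] at hi
  have e1 : (l.take i).length = i := by simp; omega
  have e2 : ((l.drop i).take s).length = s := by simp; omega
  generalize l.take i = l₁ at *
  generalize (l.drop i).take s = l₂ at *
  generalize l.drop (i + s) = l₃ at *
  subst e e1 e2
  rw [sgn_smul_sgn_smul, sgn_smul_sgn_smul]
  congr 1
  apply sgn_congr
  clear hG hF hl
  simp only [shiftExp_append, shiftExp_cons, totalDeg_append, sdeg, mElt,
    List.length_append, List.length_cons]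
  push_cast
  grind

theorem shiftExp_smul_ofBrace_m (l : List (ℤ × M)) :
    sgn (shiftExp l) • (ofBrace gr dif mul br).m l = shiftedM dif mul l := by
  rcases l with _ | ⟨x, _ | ⟨y, _ | ⟨z, l⟩⟩⟩ <;> simp [ofBrace, shiftedM, sgn_zero]

theorem IsBraceAlgebra.isAInfinityAlgebra (h : IsBraceAlgebra gr dif mul br) :
    (ofBrace gr dif mul br).IsAInfinityAlgebra := by
  have dif_zero : ∀ d, dif (d, 0) = 0 := fun d => by
    simpa using h.dif_smul d 0 0 (Submodule.zero_mem _)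
  have zero_mul : ∀ d e, ∀ y ∈ gr e, mul (d, 0) (e, y) = 0 := fun d e y hy => by
    simpa using h.smul_mul d e 0 0 (Submodule.zero_mem _) y hy
  have mul_zero : ∀ d e, ∀ y ∈ gr e, mul (e, y) (d, 0) = 0 := fun d e y hy => by
    simpa using h.mul_smul e d 0 y hy 0 (Submodule.zero_mem _)
  have hgr : ∀ n : ℕ, 1 ≤ n → IsGradedMultilinear gr gr n (2 - n) (ofBrace gr dif mul br).m := by
    intro n hn
    refine ⟨?_, ?_, ?_⟩
    · intro l hl hh
      rcases l with _ | ⟨x, _ | ⟨y, _ | ⟨z, l⟩⟩⟩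
      · simp at hl; omega
      · have := h.dif_mem x.1 x.2 (hh x (by simp))
        simp at hl
        subst hl
        simpa [ofBrace] using this
      · have := h.mul_mem x.1 y.1 x.2 (hh x (by simp)) y.2 (hh y (by simp))
        simp at hl
        subst hl
        simpa [ofBrace] using this
      · rw [ofBrace_m_cons_cons_cons]; exact Submodule.zero_mem _
    · intro l l' d x y hn hl hl' hx hy
      rcases l with _ | ⟨u, _ | ⟨v, l⟩⟩ <;> rcases l' with _ | ⟨u', _ | ⟨v', l'⟩⟩ <;>
        simp only [ofBrace, List.nil_append, List.cons_append, add_zero]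
      · exact h.dif_add d x hx y hy
      · exact h.add_mul d u'.1 x hx y hy u'.2 (hl' u' (by simp))
      · exact h.mul_add u.1 d u.2 (hl u (by simp)) x hx y hy
      all_goals rcases l with _ | ⟨w, l⟩ <;> simp
    · intro l l' d c x hn hl hl' hx
      rcases l with _ | ⟨u, _ | ⟨v, l⟩⟩ <;> rcases l' with _ | ⟨u', _ | ⟨v', l'⟩⟩ <;>
        simp only [ofBrace, List.nil_append, List.cons_append, smul_zero]
      · exact h.dif_smul d c x hx
      · exact h.smul_mul d u'.1 c x hx u'.2 (hl' u' (by simp))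
      · exact h.mul_smul u.1 d c u.2 (hl u (by simp)) x hx
      all_goals rcases l with _ | ⟨w, l⟩ <;> simp
  · refine ⟨hgr, fun l h0 hl => ?_⟩
    have hm : IsMultiadditive gr (ofBrace gr dif mul br).m := by
      intro l l' d x y hl hl' hx hy
      exact (hgr (l.length + 1 + l'.length) (by omega)).add l l' d x y rfl hl hl' hx hy
    rw [sum_insert_eq (ofBrace gr dif mul br).m hm hl]
    simp only [shiftExp_smul_ofBrace_m]
    rcases l with _ | ⟨x, _ | ⟨y, _ | ⟨z, _ | ⟨w, l⟩⟩⟩⟩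
    · exact absurd rfl h0
    · simp [insertM, shiftedM, h.dif_dif x.1 x.2 (hl x (by simp))]
    · simp only [insertM, shiftedM]
      rw [h.dif_mul x.1 y.1 x.2 (hl x (by simp)) y.2 (hl y (by simp)), sub_eq_add_neg, sgn_add,
        sgn_add]
      simp [sgn, smul_smul]
    · simp only [insertM, shiftedM]
      have := h.mul_assoc x.1 y.1 z.1 x.2 (hl x (by simp)) y.2 (hl y (by simp)) z.2
        (hl z (by simp))
      simp only [zero_add, smul_zero, add_zero, Prod.mk.eta] at this ⊢
      have hs : sgn (x.1 - 1 + y.1) * sgn x.1 = -sgn (x.1 + (x.1 + y.1)) := by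
        rw [← sgn_add, neg_sgn]
        apply sgn_congr
        push_cast
        grind
      have hs' : sgn (x.1 - 1) * (sgn y.1 * sgn x.1) = -(sgn x.1 * sgn (x.1 + y.1)) := by
        rw [← _root_.mul_assoc, ← sgn_add, hs, ← sgn_add]
      simp only [this, smul_smul, hs', neg_smul, add_neg_cancel, smul_zero]
    · rw [insertM_eq_zero, smul_zero]
      rintro (_ | ⟨x, _ | ⟨y, _ | ⟨z, l⟩⟩⟩) hl <;> simp [shiftedM] at hl ⊢
      omega

/-- A brace algebra is a `B_∞`-algebra. -/
theorem IsBraceAlgebra.isBInfinityAlgebra (h : IsBraceAlgebra gr dif mul br) :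
    (ofBrace gr dif mul br).IsBInfinityAlgebra := by
  have hg := h.muGraded
  refine ⟨h.isAInfinityAlgebra, (muGraded_iff _).2 hg, ?_, ?_, ?_, ?_, ?_, ?_⟩
  · intro d x hx
    rw [ofBrace_mu_singleton, h.br_nil (d, x) hx]
    simp [sgn_zero]
  · intro d x hx
    rw [ofBrace_mu_nil_singleton]
  · rintro (_ | ⟨x, _ | ⟨y, l⟩⟩) hl hl'
    · exact ofBrace_mu_nil_nil
    · simp at hl'
    · exact ofBrace_mu_cons_cons x y l []
  · rintro (_ | ⟨x, _ | ⟨y, l⟩⟩) hl hl'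
    · exact ofBrace_mu_nil_nil
    · simp at hl'
    · exact ofBrace_mu_nil_cons_cons x y l
  · intro a b c ha hb hc
    rw [assoc_iff]
    have hF : IsMultiadditive gr (fun l => sgn (shiftExp (a ++ l)) •
        (ofBrace gr dif mul br).mu a l) := by
      have : IsMultiadditive gr ((ofBrace gr dif mul br).mu a) := fun l l' d x y hl hl' hx hy =>
        hg.add_right a l l' d x y ha hl hl' hx hy
      simpa using this.shiftExp_smul a []
    have hF' : IsMultiadditive gr (fun l => sgn (shiftExp (l ++ c)) •
        (ofBrace gr dif mul br).mu l c) := by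
      have : IsMultiadditive gr (fun l => (ofBrace gr dif mul br).mu l c) :=
        fun l l' d x y hl hl' hx hy => hg.add_left l l' c d x y hl hl' hc hx hy
      simpa using this.shiftExp_smul [] c
    rw [sum_tensorSum_ofBrace h _ hF hb hc le_rfl, sum_tensorSum_ofBrace h _ hF' ha hb le_rfl]
    have e1 : ∀ l : List (ℤ × M), 2 ≤ l.length →
        sgn (shiftExp (l ++ c)) • (ofBrace gr dif mul br).mu l c = 0 := by
      rintro (_ | ⟨x, _ | ⟨y, l⟩⟩) hl
      · simp at hl
      · simp at hl
      · rw [ofBrace_mu_cons_cons, smul_zero]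
    have e2 : ∀ (x : ℤ × M) (l : List (ℤ × M)),
        sgn (shiftExp ([x] ++ l)) • (ofBrace gr dif mul br).mu [x] l = br x l := by
      intro x l
      rw [ofBrace_mu_singleton]
      exact sgn_smul_smul_self _ _
    rcases a with _ | ⟨x, _ | ⟨y, a⟩⟩
    · have e3 : ∀ l : List (ℤ × M), 2 ≤ l.length →
          sgn (shiftExp ([] ++ l)) • (ofBrace gr dif mul br).mu [] l = 0 := by
        rintro (_ | ⟨x, _ | ⟨y, l⟩⟩) hl
        · simp at hl
        · simp at hl
        · rw [ofBrace_mu_nil_cons_cons, smul_zero]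
      rw [jacobiSum_nil]
      rcases b with _ | ⟨x, _ | ⟨y, b⟩⟩
      · rfl
      · rw [jacobiSum_singleton_of_length e3, ofBrace_mu_nil_singleton, e2]
        simp [sgn_zero, brElt]
      · rw [jacobiSum_eq_zero, e1 _ (by simp)]
        intro l hl
        exact e3 l (by simp at hl; omega)
    · simp only [e2]
      rw [jacobiSum_singleton_of_length e1, e2,
        h.br_br x b c (ha x (by simp)) hb hc]
    · rw [jacobiSum_eq_zero, jacobiSum_eq_zero]
      · intro l hl
        exact e1 l (by simp at hl; omega)
      · intro l _
        rw [ofBrace_mu_cons_cons, smul_zero]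
  · intro a b ha hb
    rw [leibniz_iff]
    have hm : IsMultiadditive gr (fun l => sgn (shiftExp l) • (ofBrace gr dif mul br).m l) := by
      have : IsMultiadditive gr ((ofBrace gr dif mul br).m) := h.isAInfinityAlgebra.multiadditive
      simpa using this.shiftExp_smul [] []
    have e0 : ∑ r ∈ Finset.Icc 1 (a.length + b.length), (ofBrace gr dif mul br).tensorSum r
        (fun l => sgn (shiftExp l) • (ofBrace gr dif mul br).m l) a b =
        jacobiSum br a (shiftedM dif mul) b := by
      have := sum_tensorSum_ofBrace h (a.length + b.length) hm ha hb le_rfl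
      simp only [shiftExp_smul_ofBrace_m] at this ⊢
      rw [← this, Finset.sum_range_succ']
      have e : Finset.Icc 1 (a.length + b.length) = Finset.Ico 1 (a.length + b.length + 1) := by
        ext i; simp
      rw [e, Finset.sum_Ico_eq_sum_range]
      simp [tensorSum, shiftedM, add_comm 1]
    have hF : IsMultiadditive gr (fun l => sgn (shiftExp (a ++ l)) •
        (ofBrace gr dif mul br).mu a l) := by
      have : IsMultiadditive gr ((ofBrace gr dif mul br).mu a) := fun l l' d x y hl hl' hx hy =>
        hg.add_right a l l' d x y ha hl hl' hx hy
      simpa using this.shiftExp_smul a []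
    have hF' : IsMultiadditive gr (fun l => sgn (shiftExp (l ++ b)) •
        (ofBrace gr dif mul br).mu l b) := by
      have : IsMultiadditive gr (fun l => (ofBrace gr dif mul br).mu l b) :=
        fun l l' d x y hl hl' hx hy => hg.add_left l l' b d x y hl hl' hb hx hy
      simpa using this.shiftExp_smul [] b
    have e1 := blockSum_ofBrace (dif := dif) (mul := mul) (br := br) hF' ha
    have e2 := congrArg (fun z => sgn (sdeg a) • z)
      (blockSum_ofBrace (dif := dif) (mul := mul) (br := br) hF hb)
    simp only [zsmul_blockSum, sgn_smul_sgn_smul, ← add_assoc] at e1 e2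
    rw [e0, e1, e2]
    have e3 : ∀ (x : ℤ × M) (l : List (ℤ × M)),
        sgn (shiftExp ([x] ++ l)) • (ofBrace gr dif mul br).mu [x] l = br x l := by
      intro x l
      rw [ofBrace_mu_singleton]
      exact sgn_smul_smul_self _ _
    have e4 : ∀ (x y : ℤ × M) (a l : List (ℤ × M)),
        sgn (shiftExp (x :: y :: a ++ l)) • (ofBrace gr dif mul br).mu (x :: y :: a) l = 0 := by
      intro x y a l
      rw [ofBrace_mu_cons_cons, smul_zero]
    have e4' : ∀ (a : List (ℤ × M)), 2 ≤ a.length → ∀ l : List (ℤ × M),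
        sgn (shiftExp (a ++ l)) • (ofBrace gr dif mul br).mu a l = 0 := by
      rintro (_ | ⟨x, _ | ⟨y, a⟩⟩) h' l
      · simp at h'
      · simp at h'
      · exact e4 x y a l
    rcases a with _ | ⟨x, _ | ⟨y, _ | ⟨z, a⟩⟩⟩
    · have e5 : ∀ y : ℤ × M,
          sgn (shiftExp ([] ++ [y])) • (ofBrace gr dif mul br).mu [] [y] = y.2 := by
        intro y
        simp [ofBrace_mu_nil_singleton, sgn_zero]
      have e6 : ∀ l : List (ℤ × M), 2 ≤ l.length →
          sgn (shiftExp ([] ++ l)) • (ofBrace gr dif mul br).mu [] l = 0 := by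
        rintro (_ | ⟨x, _ | ⟨y, l⟩⟩) hl
        · simp at hl
        · simp at hl
        · rw [ofBrace_mu_nil_cons_cons, smul_zero]
      rw [jacobiSum_nil, insertM, zero_add, sdeg_nil, sgn_zero, one_smul]
      rcases b with _ | ⟨x, _ | ⟨y, _ | ⟨z, b⟩⟩⟩
      · rfl
      · rw [insertM, e5, shiftedM]
      · rw [insertM, insertM, e5, e6 _ (by simp), e6 _ (by simp), smul_zero, zero_add, add_zero,
          shiftedM]
      · rw [insertM_eq_zero, shiftedM]
        · simp
        · simp
        · intro l hl
          exact e6 l (by simp at hl; omega)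
    · simp only [e3, insertM]
      rw [h.br_dif x b (ha x (by simp)) hb]
      simp
    · have e5 : insertM dif mul (fun l => sgn (shiftExp ([x, y] ++ l)) •
          (ofBrace gr dif mul br).mu [x, y] l) b = 0 :=
        insertM_eq_zero fun l _ => e4 x y [] l
      simp only [e5, smul_zero, add_zero, insertM]
      rw [h.br_mul x y b (ha x (by simp)) (ha y (by simp)) hb, e3, e4, e4]
      simp
    · rw [insertM_eq_zero, insertM_eq_zero, jacobiSum_eq_zero]
      · simp
      · rintro (_ | ⟨x, _ | ⟨y, _ | ⟨z, l⟩⟩⟩) hl <;> simp [shiftedM] at hl ⊢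
      · exact fun l _ => e4 x y _ l
      · exact fun l hl => e4' l (by simp at hl; omega) b

end OfBrace

end BInfinityData

namespace Leavitt

variable {k : Type*} [Field k] {V : Type*} [Quiver V] [Fintype V] [Fintype (Quiver.Total V)]

/-! ### The Leavitt path algebra -/

section Relations

theorem sum_e : ∑ i : V, e k i = (1 : Alg k V) := by
  simpa [mk, gen] using quot_rel k V (Rel.sum_vertex)

theorem e_mul_self (i : V) : e k i * e k i = (e k i : Alg k V) := by
  simpa [mk, gen] using quot_rel k V (Rel.vertex_mul_self i)

theorem e_mul_ne {i j : V} (h : i ≠ j) : e k i * e k j = (0 : Alg k V) := by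
  simpa [mk, gen] using quot_rel k V (Rel.vertex_mul_vertex i j h)

theorem e_mul_arr_self (α : Quiver.Total V) : e k α.right * arr k α = arr k α := by
  simpa [mk, gen] using quot_rel k V (Rel.target_mul_arrow α)

theorem arr_mul_e_self (α : Quiver.Total V) : arr k α * e k α.left = arr k α := by
  simpa [mk, gen] using quot_rel k V (Rel.arrow_mul_source α)

theorem e_mul_gho_self (α : Quiver.Total V) : e k α.left * gho k α = gho k α := by
  simpa [mk, gen] using quot_rel k V (Rel.source_mul_ghost α)

theorem gho_mul_e_self (α : Quiver.Total V) : gho k α * e k α.right = gho k α := by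
  simpa [mk, gen] using quot_rel k V (Rel.ghost_mul_target α)

theorem arr_mul_gho_self (α : Quiver.Total V) : arr k α * gho k α = e k α.right := by
  simpa [mk, gen] using quot_rel k V (Rel.ck1_self α)

theorem arr_mul_gho_ne {α β : Quiver.Total V} (h : α ≠ β) : arr k α * gho k β = 0 := by
  by_cases hs : α.left = β.left
  · simpa [mk, gen] using quot_rel k V (Rel.ck1 α β hs h)
  · rw [← arr_mul_e_self, ← e_mul_gho_self, mul_assoc, ← mul_assoc (e k α.left), e_mul_ne hs,
      zero_mul, mul_zero]

open Classical in
theorem sum_filter_gho_mul_arr (i : V) :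
    ∑ α ∈ Finset.univ.filter (fun α : Quiver.Total V => α.left = i), gho k α * arr k α = e k i := by
  simpa [mk, gen] using quot_rel k V (Rel.ck2 i)

theorem sum_gho_mul_arr : ∑ α : Quiver.Total V, gho k α * arr k α = (1 : Alg k V) := by
  classical
  rw [← sum_e, ← Finset.sum_fiberwise_of_maps_to (g := fun α : Quiver.Total V => α.left)
    (t := Finset.univ) (by simp)]
  exact Finset.sum_congr rfl fun i _ => sum_filter_gho_mul_arr i

open Classical in
theorem e_mul_gho (i : V) (α : Quiver.Total V) :
    e k i * gho k α = if α.left = i then gho k α else 0 := by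
  split_ifs with h
  · rw [← h, e_mul_gho_self]
  · rw [← e_mul_gho_self, ← mul_assoc, e_mul_ne (Ne.symm h), zero_mul]

open Classical in
theorem arr_mul_e (i : V) (α : Quiver.Total V) :
    arr k α * e k i = if α.left = i then arr k α else 0 := by
  split_ifs with h
  · rw [← h, arr_mul_e_self]
  · rw [← arr_mul_e_self, mul_assoc, e_mul_ne h, mul_zero]

open Classical in
theorem arr_mul_gho (α β : Quiver.Total V) :
    arr k α * gho k β = if α = β then e k α.right else 0 := by
  split_ifs with h
  · rw [← h, arr_mul_gho_self]
  · exact arr_mul_gho_ne h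

end Relations

section Induction

theorem induction_gen {P : Alg k V → Prop} (one : P 1) (gen : ∀ g z, P z → P (mk k g * z))
    (add : ∀ y z, P y → P z → P (y + z)) (smul : ∀ (c : k) z, P z → P (c • z)) (z : Alg k V) :
    P z := by
  have key : ∀ a : FreeAlgebra k (Gen V), ∀ z, P z → P (quot k V a * z) := by
    intro a
    induction a with
    | grade0 r =>
      intro z hz
      rw [AlgHom.commutes, ← Algebra.smul_def]
      exact smul r z hz
    | grade1 g => exact gen g
    | mul a b ha hb =>
      intro z hz
      rw [map_mul, mul_assoc]
      exact ha _ (hb _ hz)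
    | add a b ha hb =>
      intro z hz
      rw [map_add, add_mul]
      exact add _ _ (ha _ hz) (hb _ hz)
  obtain ⟨a, rfl⟩ := RingQuot.mkAlgHom_surjective k (Rel k V) z
  have := key a 1 one
  rwa [mul_one] at this

/-- The vertices are not needed as generators, since `e_i = ∑ α^* α`. -/
theorem induction_arr_gho {P : Alg k V → Prop} (one : P 1)
    (arr : ∀ α z, P z → P (arr k α * z)) (gho : ∀ α z, P z → P (gho k α * z))
    (add : ∀ y z, P y → P z → P (y + z)) (smul : ∀ (c : k) z, P z → P (c • z)) (z : Alg k V) :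
    P z := by
  classical
  refine induction_gen one ?_ add smul z
  rintro (i | α | α) z hz
  · change P (e k i * z)
    rw [← sum_filter_gho_mul_arr, Finset.sum_mul]
    refine Finset.sum_induction _ P add (by simpa using smul 0 1 one) fun α _ => ?_
    rw [mul_assoc]
    exact gho α _ (arr α _ hz)
  · exact arr α z hz
  · exact gho α z hz

theorem ext_arr_gho {W : Type*} [AddCommGroup W] [Module k W] {F G : Alg k V →ₗ[k] W}
    (one : F 1 = G 1)
    (arr : ∀ α z, F z = G z → F (arr k α * z) = G (arr k α * z))
    (gho : ∀ α z, F z = G z → F (gho k α * z) = G (gho k α * z)) : F = G := by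
  ext z
  refine induction_arr_gho (P := fun z => F z = G z) one arr gho ?_ ?_ z
  · intro y z hy hz
    rw [map_add, map_add, hy, hz]
  · intro c z hz
    rw [map_smul, map_smul, hz]

end Induction

section Grading

variable (k) in
theorem mk_mem_gr (g : Gen V) : mk k g ∈ gr k V g.deg :=
  Submodule.subset_span ⟨[g], by simp⟩

theorem e_mem_gr (i : V) : e k i ∈ gr k V 0 := mk_mem_gr k (.vertex i)

theorem arr_mem_gr (α : Quiver.Total V) : arr k α ∈ gr k V 1 := mk_mem_gr k (.arrow α)

theorem gho_mem_gr (α : Quiver.Total V) : gho k α ∈ gr k V (-1) := mk_mem_gr k (.ghost α)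

theorem one_mem_gr : (1 : Alg k V) ∈ gr k V 0 :=
  Submodule.subset_span ⟨[], by simp⟩

theorem mul_mem_gr {m n : ℤ} {x y : Alg k V} (hx : x ∈ gr k V m) (hy : y ∈ gr k V n) :
    x * y ∈ gr k V (m + n) := by
  rw [gr] at hx
  induction hx using Submodule.span_induction with
  | mem x hx =>
    obtain ⟨v, rfl, rfl⟩ := hx
    rw [gr] at hy
    induction hy using Submodule.span_induction with
    | mem y hy =>
      obtain ⟨w, rfl, rfl⟩ := hy
      exact Submodule.subset_span ⟨v ++ w, by simp⟩
    | zero => simp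
    | add y y' _ _ h h' => rw [mul_add]; exact add_mem h h'
    | smul c y _ h => rw [mul_smul_comm]; exact Submodule.smul_mem _ c h
  | zero => simp
  | add y y' _ _ h h' => rw [add_mul]; exact add_mem h h'
  | smul c y _ h => rw [smul_mul_assoc]; exact Submodule.smul_mem _ c h

theorem mem_gr_congr {m n : ℤ} {x : Alg k V} (hx : x ∈ gr k V m) (h : m = n) : x ∈ gr k V n :=
  h ▸ hx

theorem zsmul_mem_gr {m : ℤ} {x : Alg k V} (n : ℤ) (hx : x ∈ gr k V m) : n • x ∈ gr k V m :=
  zsmul_mem hx n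

theorem iSup_gr : ⨆ n, gr k V n = ⊤ := by
  rw [eq_top_iff]
  rintro z -
  refine induction_gen (P := fun z => z ∈ ⨆ n, gr k V n)
    (Submodule.mem_iSup_of_mem 0 one_mem_gr) ?_ (fun _ _ => add_mem)
    (fun c _ => Submodule.smul_mem _ c) z
  intro g z hz
  induction hz using Submodule.iSup_induction' with
  | mem n x hx => exact Submodule.mem_iSup_of_mem _ (mul_mem_gr (mk_mem_gr k g) hx)
  | zero => simp
  | add x y _ _ hx hy => rw [mul_add]; exact add_mem hx hy

/-- Additive identities in `L` can be checked on homogeneous elements. -/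
theorem induction_homogeneous {P : Alg k V → Prop} (hom : ∀ n, ∀ z ∈ gr k V n, P z)
    (add : ∀ y z, P y → P z → P (y + z)) (z : Alg k V) : P z := by
  have hz : z ∈ ⨆ n, gr k V n := iSup_gr (k := k) (V := V) ▸ Submodule.mem_top
  induction hz using Submodule.iSup_induction' with
  | mem n x hx => exact hom n x hx
  | zero => exact hom 0 0 (Submodule.zero_mem _)
  | add x y _ _ hx hy => exact add _ _ hx hy

theorem sigma_mk (g : Gen V) : sigma k V (mk k g) = sgn g.deg • mk k g := by
  exact (RingQuot.liftAlgHom_mkAlgHom_apply k (FreeAlgebra.lift k (sigmaGen k V)) (sigma_rel k V)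
    (gen k g)).trans (FreeAlgebra.lift_ι_apply _ _)

@[simp] theorem sigma_e (i : V) : sigma k V (e k i) = e k i := by
  simpa [Gen.deg, sgn_zero] using sigma_mk (k := k) (.vertex i)

@[simp] theorem sigma_arr (α : Quiver.Total V) : sigma k V (arr k α) = -arr k α := by
  simpa [Gen.deg, sgn_one] using sigma_mk (k := k) (.arrow α)

@[simp] theorem sigma_gho (α : Quiver.Total V) : sigma k V (gho k α) = -gho k α := by
  simpa [Gen.deg, sgn] using sigma_mk (k := k) (.ghost α)

theorem sigma_of_mem {n : ℤ} {x : Alg k V} (hx : x ∈ gr k V n) : sigma k V x = sgn n • x := by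
  rw [gr] at hx
  induction hx using Submodule.span_induction with
  | mem x hx =>
    obtain ⟨w, rfl, rfl⟩ := hx
    induction w with
    | nil => simp [sgn_zero]
    | cons g w ih =>
      simp only [List.map_cons, List.prod_cons, List.sum_cons, map_mul, sigma_mk, ih, sgn_add,
        mul_smul, smul_mul_assoc, mul_smul_comm]
      exact smul_comm _ _ _
  | zero => simp
  | add y y' _ _ h h' => rw [map_add, h, h', smul_add]
  | smul c y _ h => rw [map_smul, h, smul_comm]

@[simp] theorem sigma_sigma (x : Alg k V) : sigma k V (sigma k V x) = x := by
  refine induction_homogeneous (P := fun x => sigma k V (sigma k V x) = x) ?_ ?_ x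
  · intro n z hz
    rw [sigma_of_mem hz, map_zsmul, sigma_of_mem hz, sgn_smul_smul_self]
  · intro y z hy hz
    rw [map_add, map_add, hy, hz]

variable (k V) in
/-- The power `σ^n` of the sign automorphism `σ`, which acts as `(-1)^{n d}` in degree `d`. -/
def sg (n : ℤ) : Alg k V →ₐ[k] Alg k V :=
  open Classical in if Even n then AlgHom.id k _ else sigma k V

theorem sg_of_mem (n : ℤ) {d : ℤ} {x : Alg k V} (hx : x ∈ gr k V d) :
    sg k V n x = sgn (n * d) • x := by
  rw [sg]
  split_ifs with h
  · rw [sgn_of_even (h.mul_right d), one_smul, AlgHom.id_apply]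
  · rw [sigma_of_mem hx]
    congr 1
    apply sgn_congr
    have := Int.not_even_iff_odd.1 h
    have : (n : ZMod 2) = 1 := (ZMod.intCast_eq_one_iff_odd).2 this
    push_cast
    rw [this, one_mul]

theorem sg_congr {m n : ℤ} (h : (m : ZMod 2) = n) (x : Alg k V) : sg k V m x = sg k V n x := by
  refine induction_homogeneous (P := fun x => sg k V m x = sg k V n x) ?_ ?_ x
  · intro d z hz
    rw [sg_of_mem _ hz, sg_of_mem _ hz]
    congr 1
    apply sgn_congr
    push_cast
    rw [h]
  · intro y z hy hz
    rw [map_add, map_add, hy, hz]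

@[simp] theorem sg_zero (x : Alg k V) : sg k V 0 x = x := by simp [sg]

@[simp] theorem sg_one (x : Alg k V) : sg k V 1 x = sigma k V x := by simp [sg]

@[simp] theorem sg_e (n : ℤ) (i : V) : sg k V n (e k i) = e k i := by
  rw [sg_of_mem n (e_mem_gr i), mul_zero, sgn_zero, one_smul]

@[simp] theorem sg_arr (n : ℤ) (α : Quiver.Total V) : sg k V n (arr k α) = sgn n • arr k α := by
  rw [sg_of_mem n (arr_mem_gr α), mul_one]

@[simp] theorem sg_gho (n : ℤ) (α : Quiver.Total V) : sg k V n (gho k α) = sgn n • gho k α := by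
  rw [sg_of_mem n (gho_mem_gr α)]
  congr 1
  apply sgn_congr
  push_cast
  grind

theorem sg_mem (n : ℤ) {d : ℤ} {x : Alg k V} (hx : x ∈ gr k V d) : sg k V n x ∈ gr k V d := by
  rw [sg_of_mem n hx]
  exact zsmul_mem hx _

theorem sg_add (m n : ℤ) (x : Alg k V) : sg k V (m + n) x = sg k V m (sg k V n x) := by
  refine induction_homogeneous (P := fun x => sg k V (m + n) x = sg k V m (sg k V n x)) ?_ ?_ x
  · intro d z hz
    rw [sg_of_mem _ hz, sg_of_mem _ hz, map_zsmul, sg_of_mem _ hz, smul_smul, ← sgn_add]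
    congr 1
    apply sgn_congr
    push_cast
    ring
  · intro y z hy hz
    simp only [map_add, hy, hz]

theorem twist_eq (d : ℤ) (x : Alg k V) : twist k V d x = sgn d • sg k V d x := by
  rw [twist, sg]
  split_ifs with h
  · rw [sgn_of_even h]; simp
  · rw [sgn_of_not_even h]; simp

theorem twist_of_mem (n : ℤ) {d : ℤ} {x : Alg k V} (hx : x ∈ gr k V d) :
    twist k V n x = sgn (n * (d - 1)) • x := by
  rw [twist_eq, sg_of_mem n hx, smul_smul, ← sgn_add]
  congr 1
  apply sgn_congr
  push_cast
  grind

theorem twist_mem (n : ℤ) {d : ℤ} {x : Alg k V} (hx : x ∈ gr k V d) :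
    twist k V n x ∈ gr k V d := by
  rw [twist_of_mem n hx]
  exact zsmul_mem hx _

theorem twist_congr {m n : ℤ} (h : (m : ZMod 2) = n) (x : Alg k V) :
    twist k V m x = twist k V n x := by
  rw [twist_eq, twist_eq, sg_congr h, sgn_congr h]

@[simp] theorem twist_zero (x : Alg k V) : twist k V 0 x = x := by simp [twist_eq, sgn_zero]

theorem twist_add (m n : ℤ) (x : Alg k V) :
    twist k V (m + n) x = twist k V m (twist k V n x) := by
  rw [twist_eq, twist_eq m, twist_eq n, map_zsmul, sg_add, sgn_add, mul_smul]

end Grading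

section Diagonal

theorem mem_diag {u : Alg k V} : u ∈ diag k V ↔ ∀ i, e k i * u = u * e k i := by
  classical
  constructor
  · intro (h : ∑ i : V, e k i * u * e k i = u) i
    have key : ∀ j, e k j * u = e k j * u * e k j ∧ u * e k j = e k j * u * e k j := by
      intro j
      constructor
      · conv_lhs => rw [← h, Finset.mul_sum]
        rw [Finset.sum_eq_single j]
        · rw [← mul_assoc, ← mul_assoc, e_mul_self]
        · intro l _ hl
          rw [← mul_assoc, ← mul_assoc, e_mul_ne hl.symm, zero_mul, zero_mul]
        · simp
      · conv_lhs => rw [← h, Finset.sum_mul]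
        rw [Finset.sum_eq_single j]
        · rw [mul_assoc, e_mul_self]
        · intro l _ hl
          rw [mul_assoc, e_mul_ne hl, mul_zero]
        · simp
    rw [(key i).1, ← (key i).2]
  · intro h
    change ∑ i : V, e k i * u * e k i = u
    simp only [h, mul_assoc, e_mul_self]
    rw [← Finset.mul_sum, sum_e, mul_one]

theorem mul_mem_diag {u v : Alg k V} (hu : u ∈ diag k V) (hv : v ∈ diag k V) :
    u * v ∈ diag k V := by
  rw [mem_diag] at *
  intro i
  rw [← mul_assoc, hu, mul_assoc, hv, mul_assoc]

theorem sg_mem_diag (n : ℤ) {u : Alg k V} (hu : u ∈ diag k V) : sg k V n u ∈ diag k V := by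
  rw [mem_diag] at *
  intro i
  have := congrArg (sg k V n) (hu i)
  simpa using this

variable (k V) in
/-- The map `u ↦ ∑_α α^* u α`. -/
def shiftMap : Alg k V →ₗ[k] Alg k V :=
  ∑ α : Quiver.Total V, (LinearMap.mulLeft k (gho k α)).comp (LinearMap.mulRight k (arr k α))

theorem shiftMap_apply (u : Alg k V) :
    shiftMap k V u = ∑ α : Quiver.Total V, gho k α * u * arr k α := by
  simp [shiftMap, mul_assoc]

theorem shiftMap_mem_gr {d : ℤ} {u : Alg k V} (hu : u ∈ gr k V d) : shiftMap k V u ∈ gr k V d := by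
  rw [shiftMap_apply]
  exact Submodule.sum_mem _ fun α _ =>
    mem_gr_congr (mul_mem_gr (mul_mem_gr (gho_mem_gr α) hu) (arr_mem_gr α)) (by ring)

theorem shiftMap_mem_diag (u : Alg k V) : shiftMap k V u ∈ diag k V := by
  classical
  rw [mem_diag]
  intro i
  rw [shiftMap_apply, Finset.mul_sum, Finset.sum_mul]
  refine Finset.sum_congr rfl fun α _ => ?_
  rw [← mul_assoc, ← mul_assoc, e_mul_gho, mul_assoc (gho k α * u), arr_mul_e]
  split_ifs <;> simp

theorem shiftMap_mul_gho {u : Alg k V} (hu : u ∈ diag k V) (β : Quiver.Total V) :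
    shiftMap k V u * gho k β = gho k β * u := by
  classical
  rw [shiftMap_apply, Finset.sum_mul, Finset.sum_eq_single β]
  · rw [mul_assoc, arr_mul_gho_self, mul_assoc, ← mem_diag.1 hu, ← mul_assoc, gho_mul_e_self]
  · intro α _ h
    rw [mul_assoc, arr_mul_gho_ne h, mul_zero]
  · simp

theorem arr_mul_shiftMap {u : Alg k V} (hu : u ∈ diag k V) (α : Quiver.Total V) :
    arr k α * shiftMap k V u = u * arr k α := by
  classical
  rw [shiftMap_apply, Finset.mul_sum, Finset.sum_eq_single α]
  · rw [← mul_assoc, ← mul_assoc, arr_mul_gho_self, mem_diag.1 hu, mul_assoc, e_mul_arr_self]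
  · intro β _ h
    rw [← mul_assoc, ← mul_assoc, arr_mul_gho_ne h.symm, zero_mul, zero_mul]
  · simp

theorem shiftMap_mul {u : Alg k V} (hu : u ∈ diag k V) (v : Alg k V) :
    shiftMap k V (u * v) = shiftMap k V u * shiftMap k V v := by
  rw [shiftMap_apply v, Finset.mul_sum, shiftMap_apply]
  refine Finset.sum_congr rfl fun α _ => ?_
  simp only [← mul_assoc, shiftMap_mul_gho hu]

/-- Every element of `L` is a sum `∑ α^* (α z)`. -/
theorem sum_gho_mul_arr_mul (z : Alg k V) :
    ∑ α : Quiver.Total V, gho k α * (arr k α * z) = z := by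
  simp only [← mul_assoc]
  rw [← Finset.sum_mul, sum_gho_mul_arr, one_mul]

end Diagonal

end Leavitt

namespace Leavitt

variable {k : Type*} [Field k] {V : Type*} [Quiver V] [Fintype V] [Fintype (Quiver.Total V)]

/-! ### The canonical derivation -/

section Derivation

/-- The action of `L` on the left factor of `L ⊗ L`. -/
abbrev leftAct (x : Alg k V) : Alg k V ⊗[k] Alg k V →ₗ[k] Alg k V ⊗[k] Alg k V :=
  LinearMap.rTensor (Alg k V) (LinearMap.mulLeft k x)

/-- The action of `L` on the right factor of `L ⊗ L`. -/
abbrev rightAct (y : Alg k V) : Alg k V ⊗[k] Alg k V →ₗ[k] Alg k V ⊗[k] Alg k V :=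
  LinearMap.lTensor (Alg k V) (LinearMap.mulRight k y)

theorem leftAct_mul (x y : Alg k V) (m : Alg k V ⊗[k] Alg k V) :
    leftAct (x * y) m = leftAct x (leftAct y m) := by
  rw [leftAct, LinearMap.mulLeft_mul, LinearMap.rTensor_comp]
  rfl

theorem rightAct_mul (x y : Alg k V) (m : Alg k V ⊗[k] Alg k V) :
    rightAct (x * y) m = rightAct y (rightAct x m) := by
  rw [rightAct, LinearMap.mulRight_mul, LinearMap.lTensor_comp]
  rfl

theorem rightAct_leftAct (x y : Alg k V) (m : Alg k V ⊗[k] Alg k V) :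
    rightAct y (leftAct x m) = leftAct x (rightAct y m) := by
  induction m using TensorProduct.induction_on with
  | zero => simp
  | tmul a b => simp
  | add a b ha hb => simp only [map_add, ha, hb]

theorem leftAct_one (m : Alg k V ⊗[k] Alg k V) : leftAct 1 m = m := by
  simp [leftAct]

theorem rightAct_one (m : Alg k V ⊗[k] Alg k V) : rightAct 1 m = m := by
  simp [rightAct]

theorem leftAct_add (x y : Alg k V) (m : Alg k V ⊗[k] Alg k V) :
    leftAct (x + y) m = leftAct x m + leftAct y m := by
  rw [leftAct, show LinearMap.mulLeft k (x + y) = LinearMap.mulLeft k x + LinearMap.mulLeft k y by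
    ext; simp [add_mul], LinearMap.rTensor_add, LinearMap.add_apply]

theorem leftAct_smul (c : k) (x : Alg k V) (m : Alg k V ⊗[k] Alg k V) :
    leftAct (c • x) m = c • leftAct x m := by
  rw [leftAct, show LinearMap.mulLeft k (c • x) = c • LinearMap.mulLeft k x by
    ext; simp, LinearMap.rTensor_smul, LinearMap.smul_apply]

theorem leftAct_zsmul (c : ℤ) (x : Alg k V) (m : Alg k V ⊗[k] Alg k V) :
    leftAct (c • x) m = c • leftAct x m := by
  rw [← Int.cast_smul_eq_zsmul k, ← Int.cast_smul_eq_zsmul k, leftAct_smul]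

theorem leftAct_sum {ι : Type*} (s : Finset ι) (x : ι → Alg k V) (m : Alg k V ⊗[k] Alg k V) :
    leftAct (∑ i ∈ s, x i) m = ∑ i ∈ s, leftAct (x i) m := by
  classical
  induction s using Finset.induction_on with
  | empty => simp [leftAct]
  | insert a s ha ih => rw [Finset.sum_insert ha, Finset.sum_insert ha, leftAct_add, ih]

variable (k V) in
/-- The right action of `L` on `L ⊗ L`, as a bilinear map. -/
def rightActHom : Alg k V ⊗[k] Alg k V →ₗ[k] Alg k V →ₗ[k] Alg k V ⊗[k] Alg k V :=
  ((LinearMap.lTensorHom (R := k) (Alg k V)).comp (LinearMap.mul k (Alg k V)).flip).flip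

/-- The values of the canonical derivation on the generators. -/
def derivationGen : Gen V → Alg k V ⊗[k] Alg k V
  | .vertex _ => 0
  | .arrow α => -(arr k α ⊗ₜ[k] e k α.left)
  | .ghost α => -(e k α.left ⊗ₜ[k] gho k α)

variable (k) in
/-- The action `(y, m) ↦ (g y, D(g) y + σ(g) m)` of a generator `g` on `L × (L ⊗ L)`. -/
def derivationAct (g : Gen V) : Module.End k (Alg k V × Alg k V ⊗[k] Alg k V) :=
  ((LinearMap.mulLeft k (mk k g)).comp (LinearMap.fst k _ _)).prod
    ((rightActHom k V (derivationGen g)).comp (LinearMap.fst k _ _) +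
      (leftAct (sigma k V (mk k g))).comp (LinearMap.snd k _ _))

theorem derivationAct_apply (g : Gen V) (y : Alg k V) (m : Alg k V ⊗[k] Alg k V) :
    derivationAct k g (y, m) =
      (mk k g * y, rightAct y (derivationGen g) + leftAct (sigma k V (mk k g)) m) := rfl

theorem rightAct_tmul (a b y : Alg k V) : rightAct y (a ⊗ₜ[k] b) = a ⊗ₜ[k] (b * y) := rfl

theorem leftAct_tmul (a b x : Alg k V) : leftAct x (a ⊗ₜ[k] b) = (x * a) ⊗ₜ[k] b := rfl

theorem derivationAct_rel ⦃x y : FreeAlgebra k (Gen V)⦄ (h : Rel k V x y) :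
    FreeAlgebra.lift k (derivationAct k) x = FreeAlgebra.lift k (derivationAct k) y := by
  classical
  refine LinearMap.ext fun ⟨y, m⟩ => ?_
  cases h with
  | vertex_mul_self i =>
    simp only [gen, map_mul, FreeAlgebra.lift_ι_apply, Module.End.mul_apply, derivationAct_apply,
      derivationGen, map_zero, zero_add, sigma_e, ← leftAct_mul, ← mul_assoc, e_mul_self]
  | vertex_mul_vertex i j h =>
    simp only [gen, map_mul, FreeAlgebra.lift_ι_apply, Module.End.mul_apply, derivationAct_apply,
      derivationGen, map_zero, zero_add, sigma_e, ← leftAct_mul, ← mul_assoc, e_mul_ne h]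
    simp [leftAct]
  | sum_vertex =>
    simp only [gen, map_sum, map_one, FreeAlgebra.lift_ι_apply, LinearMap.sum_apply,
      derivationAct_apply, derivationGen, map_zero, zero_add, sigma_e, Module.End.one_apply]
    rw [Prod.ext_iff]
    simp only [Prod.fst_sum, Prod.snd_sum, ← leftAct_sum, ← Finset.sum_mul, sum_e, one_mul,
      leftAct_one, and_self]
  | target_mul_arrow α =>
    simp only [gen, map_mul, FreeAlgebra.lift_ι_apply, Module.End.mul_apply, derivationAct_apply,
      derivationGen, map_zero, zero_add, sigma_e, sigma_arr, ← leftAct_mul, ← mul_assoc,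
      e_mul_arr_self, map_add, map_neg, rightAct_tmul, leftAct_tmul, mul_neg]
  | arrow_mul_source α =>
    simp only [gen, map_mul, FreeAlgebra.lift_ι_apply, Module.End.mul_apply, derivationAct_apply,
      derivationGen, map_zero, zero_add, sigma_e, sigma_arr, ← leftAct_mul, ← mul_assoc,
      arr_mul_e_self, map_neg, rightAct_tmul, neg_mul, e_mul_self]
  | source_mul_ghost α =>
    simp only [gen, map_mul, FreeAlgebra.lift_ι_apply, Module.End.mul_apply, derivationAct_apply,
      derivationGen, map_zero, zero_add, sigma_e, sigma_gho, ← leftAct_mul, ← mul_assoc,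
      e_mul_gho_self, map_add, map_neg, rightAct_tmul, leftAct_tmul, mul_neg, e_mul_self]
  | ghost_mul_target α =>
    simp only [gen, map_mul, FreeAlgebra.lift_ι_apply, Module.End.mul_apply, derivationAct_apply,
      derivationGen, map_zero, zero_add, sigma_e, sigma_gho, ← leftAct_mul, ← mul_assoc,
      gho_mul_e_self, map_neg, rightAct_tmul, neg_mul]
  | ck1_self α =>
    simp only [gen, map_mul, FreeAlgebra.lift_ι_apply, Module.End.mul_apply, derivationAct_apply,
      derivationGen, map_zero, zero_add, sigma_e, sigma_gho, sigma_arr, ← leftAct_mul, ← mul_assoc,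
      map_add, map_neg, rightAct_tmul, leftAct_tmul, mul_neg, neg_mul, neg_neg, arr_mul_gho_self,
      e_mul_gho_self, arr_mul_e_self, TensorProduct.neg_tmul, neg_add_cancel_left]
  | ck1 α β hs h =>
    simp only [gen, map_mul, FreeAlgebra.lift_ι_apply, Module.End.mul_apply, derivationAct_apply,
      derivationGen, map_zero, sigma_gho, sigma_arr, ← leftAct_mul, ← mul_assoc,
      map_add, map_neg, rightAct_tmul, leftAct_tmul, mul_neg, neg_mul, neg_neg, arr_mul_gho_ne h,
      hs, e_mul_gho_self, TensorProduct.neg_tmul]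
    rw [← hs, arr_mul_e_self]
    simp [leftAct]
  | ck2 i =>
    simp only [gen, map_mul, map_sum, FreeAlgebra.lift_ι_apply, Module.End.mul_apply,
      LinearMap.sum_apply, derivationAct_apply, derivationGen, map_zero, zero_add, sigma_e,
      sigma_gho, sigma_arr, ← leftAct_mul, ← mul_assoc, map_add, map_neg, rightAct_tmul,
      leftAct_tmul, mul_neg, neg_mul, neg_neg, TensorProduct.neg_tmul]
    rw [Prod.ext_iff]
    simp only [Prod.fst_sum, Prod.snd_sum, ← leftAct_sum, ← Finset.sum_mul, Finset.sum_add_distrib,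
      sum_filter_gho_mul_arr, true_and]
    rw [← add_assoc, add_eq_right, Finset.sum_neg_distrib, neg_add_eq_zero]
    have h1 : ∀ α ∈ Finset.univ.filter (fun α : Quiver.Total V => α.left = i),
        e k α.left ⊗ₜ[k] (gho k α * arr k α * y) = e k i ⊗ₜ[k] (gho k α * arr k α * y) := by
      intro α hα
      rw [(Finset.mem_filter.1 hα).2]
    have h2 : ∀ α ∈ Finset.univ.filter (fun α : Quiver.Total V => α.left = i),
        (gho k α * arr k α) ⊗ₜ[k] (e k α.left * y) = (gho k α * arr k α) ⊗ₜ[k] (e k i * y) := by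
      intro α hα
      rw [(Finset.mem_filter.1 hα).2]
    rw [Finset.sum_congr rfl h1, Finset.sum_congr rfl h2, ← TensorProduct.tmul_sum,
      ← TensorProduct.sum_tmul, ← Finset.sum_mul, sum_filter_gho_mul_arr]

variable (k V) in
/-- The representation of `L` on `L × (L ⊗ L)` extending `derivationAct`. -/
def derivationRep : Alg k V →ₐ[k] Module.End k (Alg k V × Alg k V ⊗[k] Alg k V) :=
  RingQuot.liftAlgHom k ⟨FreeAlgebra.lift k (derivationAct k), derivationAct_rel⟩

theorem derivationRep_mk (g : Gen V) : derivationRep k V (mk k g) = derivationAct k g :=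
  (RingQuot.liftAlgHom_mkAlgHom_apply k (FreeAlgebra.lift k (derivationAct k)) derivationAct_rel
    (gen k g)).trans (FreeAlgebra.lift_ι_apply _ _)

theorem derivationRep_apply (x y : Alg k V) (m : Alg k V ⊗[k] Alg k V) :
    derivationRep k V x (y, m) =
      (x * y, rightAct y (derivationRep k V x (1, 0)).2 + leftAct (sigma k V x) m) := by
  refine induction_gen (P := fun x => ∀ y m, derivationRep k V x (y, m) =
      (x * y, rightAct y (derivationRep k V x (1, 0)).2 + leftAct (sigma k V x) m))
      ?_ ?_ ?_ ?_ x y m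
  · intro y m
    simp [leftAct_one]
  · intro g z hz y m
    rw [map_mul, Module.End.mul_apply, Module.End.mul_apply, hz, hz 1 0, derivationRep_mk,
      derivationAct_apply, derivationAct_apply, map_mul, leftAct_mul]
    simp only [mul_one, mul_assoc, map_add, map_zero, add_zero, ← rightAct_mul, rightAct_leftAct,
      rightAct_one, add_assoc]
  · intro x z hx hz y m
    rw [map_add, LinearMap.add_apply, LinearMap.add_apply, hx, hz]
    simp [add_mul, leftAct_add]
    abel
  · intro c z hz y m
    rw [map_smul, LinearMap.smul_apply, LinearMap.smul_apply, hz]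
    simp [leftAct_smul]

/-- The matrices `(g, 0; D(g), σ(g))` satisfy the relations of `L`, so they define a representation,
and `D(a)` is obtained by applying it to `(1, 0)`. -/
theorem exists_isCanonicalDerivation : ∃ D, IsCanonicalDerivation k V D := by
  refine ⟨(LinearMap.snd k _ _).comp
    ((LinearMap.applyₗ (1, 0)).comp (derivationRep k V).toLinearMap), ?_, ?_, ?_, ?_⟩
  · intro d x hx y
    simp only [LinearMap.comp_apply, AlgHom.toLinearMap_apply, LinearMap.applyₗ_apply_apply,
      LinearMap.snd_apply, map_mul, Module.End.mul_apply]
    rw [derivationRep_apply y, derivationRep_apply x, sigma_of_mem hx, leftAct_zsmul]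
    simp [rightAct_one]
  all_goals
    intro i
    simp only [LinearMap.comp_apply, AlgHom.toLinearMap_apply, LinearMap.applyₗ_apply_apply,
      LinearMap.snd_apply, derivationRep_mk, derivationAct_apply, map_zero, add_zero, rightAct_one]
    rfl

theorem IsCanonicalDerivation.one {D : Alg k V →ₗ[k] Alg k V ⊗[k] Alg k V}
    (h : IsCanonicalDerivation k V D) : D 1 = 0 := by
  rw [← sum_e, map_sum]
  exact Finset.sum_eq_zero fun i _ => h.vertex i

theorem IsCanonicalDerivation.unique {D D' : Alg k V →ₗ[k] Alg k V ⊗[k] Alg k V}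
    (h : IsCanonicalDerivation k V D) (h' : IsCanonicalDerivation k V D') : D = D' := by
  refine ext_arr_gho ?_ ?_ ?_
  · rw [h.one, h'.one]
  · intro α z hz
    rw [h.leibniz 1 _ (arr_mem_gr α), h'.leibniz 1 _ (arr_mem_gr α), hz, h.arrow, h'.arrow]
  · intro α z hz
    rw [h.leibniz (-1) _ (gho_mem_gr α), h'.leibniz (-1) _ (gho_mem_gr α), hz, h.ghost, h'.ghost]

theorem existsUnique_isCanonicalDerivation : ∃! D, IsCanonicalDerivation k V D := by
  obtain ⟨D, hD⟩ := exists_isCanonicalDerivation (k := k) (V := V)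
  exact ⟨D, hD, fun D' hD' => hD'.unique hD⟩

theorem isCanonicalDerivation_derivation : IsCanonicalDerivation k V (derivation k V) :=
  Classical.epsilon_spec exists_isCanonicalDerivation

/-- The map `a ↦ ∑ g(x) y`, where `D(a) = ∑ x ⊗ s ⊗ y`. -/
def dpair (g : Alg k V →ₗ[k] Alg k V) : Alg k V →ₗ[k] Alg k V :=
  (TensorProduct.lift ((LinearMap.mul k (Alg k V)).comp g)).comp (derivation k V)

theorem dpair_add (g h : Alg k V →ₗ[k] Alg k V) (a : Alg k V) :
    dpair (g + h) a = dpair g a + dpair h a := by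
  simp only [dpair, LinearMap.comp_apply]
  generalize derivation k V a = m
  induction m using TensorProduct.induction_on with
  | zero => simp
  | tmul x y => simp
  | add x y hx hy =>
    simp only [map_add, hx, hy]
    abel

theorem dpair_smul (c : k) (g : Alg k V →ₗ[k] Alg k V) (a : Alg k V) :
    dpair (c • g) a = c • dpair g a := by
  simp only [dpair, LinearMap.comp_apply]
  generalize derivation k V a = m
  induction m using TensorProduct.induction_on with
  | zero => simp
  | tmul x y => simp
  | add x y hx hy => simp only [map_add, hx, hy, smul_add]

theorem dpair_zsmul (c : ℤ) (g : Alg k V →ₗ[k] Alg k V) (a : Alg k V) :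
    dpair (c • g) a = c • dpair g a := by
  rw [← Int.cast_smul_eq_zsmul k, ← Int.cast_smul_eq_zsmul k, dpair_smul]

theorem dpair_neg (g : Alg k V →ₗ[k] Alg k V) (a : Alg k V) : dpair (-g) a = -dpair g a := by
  rw [← neg_one_smul k g, dpair_smul, neg_one_smul]

@[simp] theorem dpair_zero (a : Alg k V) : dpair (0 : Alg k V →ₗ[k] Alg k V) a = 0 := by
  have := dpair_smul 0 (0 : Alg k V →ₗ[k] Alg k V) a
  simpa using this

@[simp] theorem dpair_one (g : Alg k V →ₗ[k] Alg k V) : dpair g 1 = 0 := by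
  rw [dpair, LinearMap.comp_apply, isCanonicalDerivation_derivation.one, map_zero]

@[simp] theorem dpair_e (g : Alg k V →ₗ[k] Alg k V) (i : V) : dpair g (e k i) = 0 := by
  rw [dpair, LinearMap.comp_apply, isCanonicalDerivation_derivation.vertex, map_zero]

theorem dpair_arr (g : Alg k V →ₗ[k] Alg k V) (α : Quiver.Total V) :
    dpair g (arr k α) = -(g (arr k α) * e k α.left) := by
  rw [dpair, LinearMap.comp_apply, isCanonicalDerivation_derivation.arrow]
  simp

theorem dpair_gho (g : Alg k V →ₗ[k] Alg k V) (α : Quiver.Total V) :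
    dpair g (gho k α) = -(g (e k α.left) * gho k α) := by
  rw [dpair, LinearMap.comp_apply, isCanonicalDerivation_derivation.ghost]
  simp

/-- The Leibniz rule for `D`. -/
theorem dpair_mul (g : Alg k V →ₗ[k] Alg k V) (a b : Alg k V) :
    dpair g (a * b) = dpair g a * b + dpair (g.comp (LinearMap.mulLeft k (sigma k V a))) b := by
  refine induction_homogeneous (P := fun a => dpair g (a * b) = dpair g a * b +
    dpair (g.comp (LinearMap.mulLeft k (sigma k V a))) b) ?_ ?_ a
  · intro d a ha
    rw [dpair, LinearMap.comp_apply, isCanonicalDerivation_derivation.leibniz d a ha, map_add,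
      map_zsmul, sigma_of_mem ha]
    congr 1
    · rw [LinearMap.comp_apply]
      generalize derivation k V a = m
      induction m using TensorProduct.induction_on with
      | zero => simp
      | tmul x y => simp [mul_assoc]
      | add x y hx hy => simp only [map_add, hx, hy, add_mul]
    · rw [show g.comp (LinearMap.mulLeft k (sgn d • a)) =
        sgn d • g.comp (LinearMap.mulLeft k a) by
          ext; simp only [LinearMap.comp_apply, LinearMap.mulLeft_apply, smul_mul_assoc,
            map_zsmul, LinearMap.smul_apply], dpair_zsmul]
      congr 1
      rw [dpair, LinearMap.comp_apply]
      generalize derivation k V b = m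
      induction m using TensorProduct.induction_on with
      | zero => simp
      | tmul x y => simp
      | add x y hx hy => simp only [map_add, hx, hy]
  · intro y z hy hz
    rw [add_mul, map_add, map_add, add_mul, hy, hz, map_add,
      show g.comp (LinearMap.mulLeft k (sigma k V y + sigma k V z)) =
        g.comp (LinearMap.mulLeft k (sigma k V y)) + g.comp (LinearMap.mulLeft k (sigma k V z)) by
        ext; simp [add_mul], dpair_add]
    abel

theorem dpair_mulLeft_comp (x : Alg k V) (g : Alg k V →ₗ[k] Alg k V) (a : Alg k V) :
    dpair ((LinearMap.mulLeft k x).comp g) a = x * dpair g a := by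
  simp only [dpair, LinearMap.comp_apply]
  generalize derivation k V a = m
  induction m using TensorProduct.induction_on with
  | zero => simp
  | tmul x y => simp [mul_assoc]
  | add x y hx hy => simp only [map_add, hx, hy, mul_add]

end Derivation

end Leavitt

namespace Leavitt

variable {k : Type*} [Field k] {V : Type*} [Quiver V] [Fintype V] [Fintype (Quiver.Total V)]

/-! ### The insertion operators -/

section Insertion

variable (k V) in
/-- The homogeneous component of degree `d` of `⨁ e_i L e_i`. -/
abbrev diagGr (d : ℤ) : Submodule k (Alg k V) := gr k V d ⊓ diag k V

/-- The map `x ↦ ∑_α A(σ^{d+1}(x) α^*) α u`. -/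
def lamInner (d : ℤ) (u : Alg k V) (A : Alg k V →ₗ[k] Alg k V) : Alg k V →ₗ[k] Alg k V :=
  ∑ α : Quiver.Total V, (LinearMap.mulRight k (arr k α * u)).comp
    (A.comp ((LinearMap.mulRight k (gho k α)).comp (sg k V (d + 1)).toLinearMap))

theorem lamInner_apply (d : ℤ) (u : Alg k V) (A : Alg k V →ₗ[k] Alg k V) (x : Alg k V) :
    lamInner d u A x = ∑ α : Quiver.Total V, A (sg k V (d + 1) x * gho k α) * (arr k α * u) := by
  simp [lamInner, mul_assoc]

/-- The insertion operators up to the sign `(-1)^{|us| |v|}`, on lists in reversed order.  The last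
element is inserted by means of the canonical derivation. -/
def lamRev : List (ℤ × Alg k V) → Alg k V →ₗ[k] Alg k V
  | [] => LinearMap.id
  | x :: us => -dpair (lamInner x.1 x.2 (lamRev us))

/-- The insertion operators up to the sign `(-1)^{|us| |v|}`. -/
def lam (us : List (ℤ × Alg k V)) : Alg k V →ₗ[k] Alg k V := lamRev us.reverse

@[simp] theorem lam_nil : lam ([] : List (ℤ × Alg k V)) = LinearMap.id := rfl

theorem lam_append_singleton (us : List (ℤ × Alg k V)) (x : ℤ × Alg k V) :
    lam (us ++ [x]) = -dpair (lamInner x.1 x.2 (lam us)) := by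
  simp [lam, lamRev]

theorem lam_append_singleton_apply (us : List (ℤ × Alg k V)) (x : ℤ × Alg k V) (v : Alg k V) :
    lam (us ++ [x]) v = -dpair (lamInner x.1 x.2 (lam us)) v := by
  rw [lam_append_singleton, LinearMap.neg_apply]

theorem lam_one {us : List (ℤ × Alg k V)} (h : us ≠ []) : lam us 1 = 0 := by
  induction us using List.reverseRecOn with
  | nil => exact absurd rfl h
  | append_singleton us x ih => simp [lam_append_singleton]

theorem lam_e {us : List (ℤ × Alg k V)} (h : us ≠ []) (i : V) : lam us (e k i) = 0 := by
  induction us using List.reverseRecOn with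
  | nil => exact absurd rfl h
  | append_singleton us x ih => simp [lam_append_singleton]

/-- The product rule. -/
theorem lam_mul (us : List (ℤ × Alg k V)) (v w : Alg k V) :
    lam us (v * w) =
      splitSum (fun us₁ us₂ => lam us₁ (sg k V (totalDeg us₂) v) * lam us₂ w) us := by
  induction us using List.reverseRecOn generalizing v w with
  | nil => simp
  | append_singleton us x ih =>
    have key : (lamInner x.1 x.2 (lam us)).comp (LinearMap.mulLeft k (sigma k V v)) =
        splitSum (fun us₁ us₂ => (LinearMap.mulLeft k
          (lam us₁ (sg k V (totalDeg us₂ + x.1) v))).comp (lamInner x.1 x.2 (lam us₂))) us := by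
      ext y
      rw [show ∀ f : List (ℤ × Alg k V) → List (ℤ × Alg k V) → Alg k V →ₗ[k] Alg k V,
        (splitSum f us) y = splitSum (fun a b => f a b y) us from
          fun f => map_splitSum (LinearMap.applyₗ (R := k) y) f us]
      simp only [LinearMap.comp_apply, LinearMap.mulLeft_apply, lamInner_apply, map_mul, mul_assoc,
        ih, splitSum_mul, Finset.mul_sum, splitSum_sum]
      refine Finset.sum_congr rfl fun α _ => splitSum_congr fun us₁ us₂ _ => ?_
      rw [← sg_one v, ← sg_add, ← sg_add]
      congr 2
      apply sg_congr
      push_cast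
      grind
    rw [splitSum_append_singleton, lam_append_singleton_apply, dpair_mul, key,
      show ∀ f : List (ℤ × Alg k V) → List (ℤ × Alg k V) → Alg k V →ₗ[k] Alg k V,
        dpair (splitSum f us) w = splitSum (fun a b => dpair (f a b) w) us from fun f => ?_]
    · simp only [dpair_mulLeft_comp, lam_nil, LinearMap.id_apply, totalDeg_nil, sg_zero,
        lam_append_singleton_apply, totalDeg_append, totalDeg_cons, add_zero, mul_neg, splitSum_neg]
      rw [neg_add, neg_mul, add_comm]
    · exact map_splitSum (AddMonoidHom.mk' (fun g => dpair g w) fun g h => dpair_add g h w) f us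

theorem lam_arr_singleton {d : ℤ} {u : Alg k V} (hu : u ∈ diag k V) (α : Quiver.Total V) :
    lam [(d, u)] (arr k α) = sgn (d + 1) • (arr k α * u) := by
  classical
  rw [← List.nil_append [(d, u)], lam_append_singleton_apply, dpair_arr, lamInner_apply,
    Finset.sum_eq_single α]
  · simp only [lam_nil, LinearMap.id_apply, sg_arr, smul_mul_assoc, neg_neg]
    rw [← mul_assoc, arr_mul_gho_self, e_mul_arr_self, mul_assoc, ← mem_diag.1 hu, ← mul_assoc,
      arr_mul_e_self]
  · intro β _ h
    rw [lam_nil, LinearMap.id_apply, sg_arr, smul_mul_assoc, arr_mul_gho_ne h.symm, smul_zero,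
      zero_mul]
  · simp

theorem lam_arr_cons_cons (us : List (ℤ × Alg k V)) (x y : ℤ × Alg k V) (α : Quiver.Total V) :
    lam (x :: y :: us) (arr k α) = 0 := by
  classical
  obtain ⟨z, vs, h⟩ : ∃ z vs, y :: us = vs ++ [z] :=
    ⟨_, _, (List.dropLast_append_getLast (List.cons_ne_nil y us)).symm⟩
  rw [h, ← List.cons_append, lam_append_singleton_apply, dpair_arr, lamInner_apply,
    Finset.sum_eq_single α]
  · rw [sg_arr, smul_mul_assoc, map_zsmul, arr_mul_gho_self, lam_e (List.cons_ne_nil _ _)]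
    simp
  · intro β _ h
    rw [sg_arr, smul_mul_assoc, arr_mul_gho_ne h.symm, smul_zero, map_zero, zero_mul]
  · simp

theorem lam_gho {us : List (ℤ × Alg k V)} (hus : ∀ x ∈ us, x.2 ∈ diag k V) (α : Quiver.Total V) :
    lam us (gho k α) = (us.map Prod.snd).prod * gho k α := by
  classical
  induction us using List.reverseRecOn generalizing α with
  | nil => simp
  | append_singleton us x ih =>
    have hx : x.2 ∈ diag k V := hus x (by simp)
    rw [lam_append_singleton_apply, dpair_gho, lamInner_apply, neg_neg]
    simp only [sg_e, e_mul_gho, apply_ite (lam us), map_zero, ite_mul, zero_mul]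
    rw [← Finset.sum_filter, Finset.sum_congr rfl fun β _ => by
      rw [ih (fun y hy => hus y (by simp [hy])), mul_assoc, ← mul_assoc (gho k β)],
      ← Finset.mul_sum, ← Finset.sum_mul, sum_filter_gho_mul_arr]
    simp only [List.map_append, List.prod_append, List.map_cons, List.map_nil, List.prod_cons,
      List.prod_nil, mul_one]
    rw [mem_diag.1 hx, mul_assoc, mul_assoc x.2, e_mul_gho_self, mul_assoc]

theorem lamInner_add_left (d : ℤ) (u u' : Alg k V) (A : Alg k V →ₗ[k] Alg k V) :
    lamInner d (u + u') A = lamInner d u A + lamInner d u' A := by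
  ext x
  simp only [lamInner_apply, LinearMap.add_apply, mul_add, Finset.sum_add_distrib]

theorem lamInner_add_right (d : ℤ) (u : Alg k V) (A B : Alg k V →ₗ[k] Alg k V) :
    lamInner d u (A + B) = lamInner d u A + lamInner d u B := by
  ext x
  simp only [lamInner_apply, LinearMap.add_apply, add_mul, Finset.sum_add_distrib]

theorem lamInner_smul_left (d : ℤ) (c : k) (u : Alg k V) (A : Alg k V →ₗ[k] Alg k V) :
    lamInner d (c • u) A = c • lamInner d u A := by
  ext x
  simp only [lamInner_apply, LinearMap.smul_apply, mul_smul_comm, Finset.smul_sum]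

theorem lamInner_smul_right (d : ℤ) (c : k) (u : Alg k V) (A : Alg k V →ₗ[k] Alg k V) :
    lamInner d u (c • A) = c • lamInner d u A := by
  ext x
  simp only [lamInner_apply, LinearMap.smul_apply, smul_mul_assoc, Finset.smul_sum]

theorem lam_add (l l' : List (ℤ × Alg k V)) (d : ℤ) (u u' : Alg k V) :
    lam (l ++ (d, u + u') :: l') = lam (l ++ (d, u) :: l') + lam (l ++ (d, u') :: l') := by
  induction l' using List.reverseRecOn with
  | nil =>
    ext v
    simp only [lam_append_singleton, lamInner_add_left, LinearMap.neg_apply, LinearMap.add_apply,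
      dpair_add, neg_add]
  | append_singleton l' x ih =>
    simp only [← List.cons_append, ← List.append_assoc] at ih ⊢
    ext v
    simp only [lam_append_singleton, ih, lamInner_add_right, LinearMap.neg_apply,
      LinearMap.add_apply, dpair_add, neg_add]

theorem lam_smul (l l' : List (ℤ × Alg k V)) (d : ℤ) (c : k) (u : Alg k V) :
    lam (l ++ (d, c • u) :: l') = c • lam (l ++ (d, u) :: l') := by
  induction l' using List.reverseRecOn with
  | nil =>
    ext v
    simp only [lam_append_singleton, lamInner_smul_left, LinearMap.neg_apply, LinearMap.smul_apply,
      dpair_smul, smul_neg]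
  | append_singleton l' x ih =>
    simp only [← List.cons_append, ← List.append_assoc] at ih ⊢
    ext v
    simp only [lam_append_singleton, ih, lamInner_smul_right, LinearMap.neg_apply,
      LinearMap.smul_apply, dpair_smul, smul_neg]

theorem dpair_mem_gr {g : Alg k V →ₗ[k] Alg k V} {δ : ℤ}
    (hg : ∀ c, ∀ x ∈ gr k V c, g x ∈ gr k V (c + δ)) {c : ℤ} {a : Alg k V} (ha : a ∈ gr k V c) :
    dpair g a ∈ gr k V (c + δ) := by
  rw [gr] at ha
  induction ha using Submodule.span_induction with
  | mem x hx =>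
    obtain ⟨w, rfl, rfl⟩ := hx
    induction w generalizing g δ with
    | nil => simp
    | cons g' w ih =>
      rw [List.map_cons, List.map_cons, List.prod_cons, dpair_mul, List.sum_cons]
      refine add_mem ?_ ?_
      · have hw : (w.map (mk k)).prod ∈ gr k V (w.map Gen.deg).sum :=
          Submodule.subset_span ⟨w, rfl, rfl⟩
        have h1 : dpair g (mk k g') ∈ gr k V (g'.deg + δ) := by
          rcases g' with i | α | α
          · change dpair g (e k i) ∈ _
            simp
          · change dpair g (arr k α) ∈ _
            rw [dpair_arr]
            exact neg_mem (mem_gr_congr (mul_mem_gr (hg _ _ (arr_mem_gr α)) (e_mem_gr _))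
              (by simp [Gen.deg]))
          · change dpair g (gho k α) ∈ _
            rw [dpair_gho]
            exact neg_mem (mem_gr_congr (mul_mem_gr (hg _ _ (e_mem_gr _)) (gho_mem_gr α))
              (by simp [Gen.deg]; ring))
        exact mem_gr_congr (mul_mem_gr h1 hw) (by ring)
      · refine mem_gr_congr (ih (δ := g'.deg + δ) fun c x hx => ?_) (by ring)
        rw [LinearMap.comp_apply, LinearMap.mulLeft_apply, sigma_mk, smul_mul_assoc, map_zsmul]
        exact zsmul_mem_gr _
          (mem_gr_congr (hg _ _ (mul_mem_gr (mk_mem_gr k g') hx)) (by ring))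
  | zero => simp
  | add y y' _ _ h h' => rw [map_add]; exact add_mem h h'
  | smul c y _ h => rw [map_smul]; exact Submodule.smul_mem _ c h

theorem lam_mem_gr {us : List (ℤ × Alg k V)} (hus : ∀ x ∈ us, x.2 ∈ gr k V x.1) {c : ℤ}
    {v : Alg k V} (hv : v ∈ gr k V c) : lam us v ∈ gr k V (c + totalDeg us) := by
  induction us using List.reverseRecOn generalizing c v with
  | nil => simpa using hv
  | append_singleton us x ih =>
    rw [lam_append_singleton_apply]
    refine neg_mem (dpair_mem_gr (fun c y hy => ?_) hv)
    rw [lamInner_apply]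
    refine Submodule.sum_mem _ fun α _ => ?_
    refine mem_gr_congr (mul_mem_gr (ih (fun y hy => hus y (by simp [hy]))
      (mul_mem_gr (sg_mem _ hy) (gho_mem_gr α))) (mul_mem_gr (arr_mem_gr α) (hus x (by simp)))) ?_
    simp
    ring

/-- The insertion operator `v ↦ v{s⁻¹u₁, …, s⁻¹u_n}'` on `L`. -/
def act (us : List (ℤ × Alg k V)) : Alg k V →ₗ[k] Alg k V :=
  (lam us).comp (sg k V (totalDeg us)).toLinearMap

theorem act_apply (us : List (ℤ × Alg k V)) (v : Alg k V) :
    act us v = lam us (sg k V (totalDeg us) v) := rfl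

@[simp] theorem act_nil_apply (v : Alg k V) : act [] v = v := by simp [act_apply]

/-- The product rule. -/
theorem act_mul (us : List (ℤ × Alg k V)) (v w : Alg k V) : act us (v * w) =
    splitSum (fun us₁ us₂ => act us₁ v * act us₂ (sg k V (totalDeg us₁) w)) us := by
  rw [act_apply, map_mul, lam_mul]
  refine splitSum_congr fun us₁ us₂ h => ?_
  subst h
  rw [act_apply, act_apply, ← sg_add, ← sg_add, totalDeg_append]
  congr 2
  · apply sg_congr; push_cast; grind
  · apply sg_congr; push_cast; grind

theorem act_one {us : List (ℤ × Alg k V)} (h : us ≠ []) : act us 1 = 0 := by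
  rw [act_apply, map_one, lam_one h]

theorem act_e {us : List (ℤ × Alg k V)} (h : us ≠ []) (i : V) : act us (e k i) = 0 := by
  rw [act_apply, sg_e, lam_e h]

theorem act_arr_singleton {x : ℤ × Alg k V} (hu : x.2 ∈ diag k V) (α : Quiver.Total V) :
    act [x] (arr k α) = -(arr k α * x.2) := by
  rw [act_apply, sg_arr, map_zsmul, lam_arr_singleton hu, sgn_smul_sgn_smul, ← neg_one_zsmul,
    ← sgn_one]
  congr 1
  apply sgn_congr
  simp only [totalDeg_cons, totalDeg_nil]
  push_cast
  grind

theorem act_arr_cons_cons (us : List (ℤ × Alg k V)) (x y : ℤ × Alg k V) (α : Quiver.Total V) :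
    act (x :: y :: us) (arr k α) = 0 := by
  rw [act_apply, sg_arr, map_zsmul, lam_arr_cons_cons, smul_zero]

theorem act_gho {us : List (ℤ × Alg k V)} (hus : ∀ x ∈ us, x.2 ∈ diag k V) (α : Quiver.Total V) :
    act us (gho k α) = sgn (totalDeg us) • ((us.map Prod.snd).prod * gho k α) := by
  rw [act_apply, sg_gho, map_zsmul, lam_gho hus]

theorem act_add (l l' : List (ℤ × Alg k V)) (d : ℤ) (u u' : Alg k V) :
    act (l ++ (d, u + u') :: l') = act (l ++ (d, u) :: l') + act (l ++ (d, u') :: l') := by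
  ext v
  simp only [act_apply, lam_add, LinearMap.add_apply, totalDeg_append, totalDeg_cons]

theorem act_smul (l l' : List (ℤ × Alg k V)) (d : ℤ) (c : k) (u : Alg k V) :
    act (l ++ (d, c • u) :: l') = c • act (l ++ (d, u) :: l') := by
  ext v
  simp only [act_apply, lam_smul, LinearMap.smul_apply, totalDeg_append, totalDeg_cons]

theorem act_mem_gr {us : List (ℤ × Alg k V)} (hus : ∀ x ∈ us, x.2 ∈ gr k V x.1) {c : ℤ}
    {v : Alg k V} (hv : v ∈ gr k V c) : act us v ∈ gr k V (c + totalDeg us) :=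
  lam_mem_gr hus (sg_mem _ hv)

theorem act_e_mul (us : List (ℤ × Alg k V)) (i : V) (v : Alg k V) :
    act us (e k i * v) = e k i * act us v := by
  rw [act_mul, splitSum_eq_left]
  · simp
  · intro x us₁ us₂ _
    rw [act_e (List.cons_ne_nil _ _), zero_mul]

theorem act_mul_e (us : List (ℤ × Alg k V)) (i : V) (v : Alg k V) :
    act us (v * e k i) = act us v * e k i := by
  rw [act_mul, splitSum_eq_right]
  · simp
  · intro x us₁ us₂ _
    rw [sg_e, act_e (List.cons_ne_nil _ _), mul_zero]

theorem act_mem_diag (us : List (ℤ × Alg k V)) {v : Alg k V} (hv : v ∈ diag k V) :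
    act us v ∈ diag k V := by
  rw [mem_diag] at *
  intro i
  rw [← act_e_mul, hv, act_mul_e]

theorem sg_act {us : List (ℤ × Alg k V)} (hus : ∀ x ∈ us, x.2 ∈ gr k V x.1) (n : ℤ) (v : Alg k V) :
    sg k V n (act us v) = sgn (n * totalDeg us) • act us (sg k V n v) := by
  refine induction_homogeneous (P := fun v => sg k V n (act us v) =
    sgn (n * totalDeg us) • act us (sg k V n v)) ?_ ?_ v
  · intro d z hz
    rw [sg_of_mem _ hz, sg_of_mem _ (act_mem_gr hus hz), map_zsmul, sgn_smul_sgn_smul, mul_add,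
      add_comm]
  · intro y z hy hz
    simp only [map_add, hy, hz, smul_add]

/-- The insertion operator `v ↦ w`, where `s⁻¹w = (s⁻¹v){s⁻¹u₁, …, s⁻¹u_n}'`: compared to `act`,
nothing is inserted before the first letter. -/
def shAct : List (ℤ × Alg k V) → Alg k V →ₗ[k] Alg k V
  | [] => LinearMap.id
  | x :: us => act (x :: us) -
      (LinearMap.mulLeft k x.2).comp ((act us).comp (sg k V x.1).toLinearMap)

@[simp] theorem shAct_nil_apply (v : Alg k V) : shAct [] v = v := rfl

theorem shAct_cons_apply (x : ℤ × Alg k V) (us : List (ℤ × Alg k V)) (v : Alg k V) :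
    shAct (x :: us) v = act (x :: us) v - x.2 * act us (sg k V x.1 v) := rfl

theorem act_arr_mul {us : List (ℤ × Alg k V)} (hus : ∀ x ∈ us, x.2 ∈ diag k V)
    (α : Quiver.Total V) (z : Alg k V) : act us (arr k α * z) = arr k α * shAct us z := by
  rcases us with _ | ⟨x, us⟩
  · simp
  · rw [act_mul, splitSum_cons]
    have : splitSum (fun us₁ us₂ => act (x :: us₁) (arr k α) *
        act us₂ (sg k V (totalDeg (x :: us₁)) z)) us =
      -(arr k α * x.2) * act us (sg k V x.1 z) := by
      rw [splitSum_eq_left]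
      · rw [act_arr_singleton (hus x (by simp))]
        simp
      · intro y us₁ us₂ _
        rw [act_arr_cons_cons, zero_mul]
    rw [this, shAct_cons_apply]
    simp only [act_nil_apply, totalDeg_nil, sg_zero]
    rw [mul_sub, neg_mul, mul_assoc, sub_eq_add_neg]

theorem shAct_mul (us : List (ℤ × Alg k V)) (v w : Alg k V) : shAct us (v * w) =
    splitSum (fun us₁ us₂ => shAct us₁ v * act us₂ (sg k V (totalDeg us₁) w)) us := by
  rcases us with _ | ⟨x, us⟩
  · simp
  · rw [splitSum_cons, shAct_cons_apply, act_mul, splitSum_cons, map_mul, act_mul, mul_splitSum,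
      add_sub_assoc, ← splitSum_sub]
    simp only [act_nil_apply, shAct_nil_apply]
    congr 1
    refine splitSum_congr fun us₁ us₂ _ => ?_
    rw [shAct_cons_apply, sub_mul, ← sg_add, totalDeg_cons, mul_assoc, add_comm x.1]

theorem shAct_gho_mul {us : List (ℤ × Alg k V)} (hus : ∀ x ∈ us, x.2 ∈ diag k V)
    (β : Quiver.Total V) (w : Alg k V) : shAct us (gho k β * w) = gho k β * act us w := by
  rw [shAct_mul, splitSum_eq_left]
  · simp
  · intro x us₁ us₂ h
    have h' : ∀ y ∈ us₁, y.2 ∈ diag k V := fun y hy => hus y (by simp [← h, hy])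
    have hx : ∀ y ∈ x :: us₁, y.2 ∈ diag k V := fun y hy => hus y (by
      rw [← h]; exact List.mem_append_left _ hy)
    rw [shAct_cons_apply, act_gho hx, sg_gho, map_zsmul, act_gho h', sgn_smul_sgn_smul,
      mul_smul_comm, ← mul_assoc, List.map_cons, List.prod_cons, totalDeg_cons, sub_self, zero_mul]

theorem shAct_one_singleton (x : ℤ × Alg k V) : shAct [x] 1 = -x.2 := by
  rw [shAct_cons_apply, act_one (List.cons_ne_nil _ _)]
  simp

theorem shAct_one_cons_cons (x y : ℤ × Alg k V) (us : List (ℤ × Alg k V)) :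
    shAct (x :: y :: us) 1 = 0 := by
  rw [shAct_cons_apply, act_one (List.cons_ne_nil _ _), map_one, act_one (List.cons_ne_nil _ _)]
  simp

theorem shAct_add (l l' : List (ℤ × Alg k V)) (d : ℤ) (u u' : Alg k V) :
    shAct (l ++ (d, u + u') :: l') = shAct (l ++ (d, u) :: l') + shAct (l ++ (d, u') :: l') := by
  ext v
  rcases l with _ | ⟨x, l⟩
  · simp only [List.nil_append, shAct_cons_apply, LinearMap.add_apply]
    rw [show act ((d, u + u') :: l') v = act ((d, u) :: l') v + act ((d, u') :: l') v from
      congrArg (fun f => f v) (act_add [] l' d u u'), add_mul]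
    abel
  · simp only [List.cons_append, shAct_cons_apply, LinearMap.add_apply]
    rw [show act (x :: (l ++ (d, u + u') :: l')) v = act (x :: (l ++ (d, u) :: l')) v +
      act (x :: (l ++ (d, u') :: l')) v from
      congrArg (fun f => f v) (act_add (x :: l) l' d u u'), act_add, LinearMap.add_apply, mul_add]
    abel

theorem shAct_smul (l l' : List (ℤ × Alg k V)) (d : ℤ) (c : k) (u : Alg k V) :
    shAct (l ++ (d, c • u) :: l') = c • shAct (l ++ (d, u) :: l') := by
  ext v
  rcases l with _ | ⟨x, l⟩
  · simp only [List.nil_append, shAct_cons_apply, LinearMap.smul_apply]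
    rw [show act ((d, c • u) :: l') v = c • act ((d, u) :: l') v from
      congrArg (fun f => f v) (act_smul [] l' d c u), smul_mul_assoc, smul_sub]
  · simp only [List.cons_append, shAct_cons_apply, LinearMap.smul_apply]
    rw [show act (x :: (l ++ (d, c • u) :: l')) v = c • act (x :: (l ++ (d, u) :: l')) v from
      congrArg (fun f => f v) (act_smul (x :: l) l' d c u), act_smul, LinearMap.smul_apply,
      mul_smul_comm, smul_sub]

theorem shAct_mem_gr {us : List (ℤ × Alg k V)} (hus : ∀ x ∈ us, x.2 ∈ gr k V x.1) {c : ℤ}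
    {v : Alg k V} (hv : v ∈ gr k V c) : shAct us v ∈ gr k V (c + totalDeg us) := by
  rcases us with _ | ⟨x, us⟩
  · simpa using hv
  · rw [shAct_cons_apply]
    refine sub_mem (act_mem_gr hus hv) ?_
    refine mem_gr_congr (mul_mem_gr (hus x (by simp))
      (act_mem_gr (fun y hy => hus y (by simp [hy])) (sg_mem _ hv))) ?_
    simp
    ring

theorem shAct_mem_diag {us : List (ℤ × Alg k V)} (hus : ∀ x ∈ us, x.2 ∈ diag k V)
    {v : Alg k V} (hv : v ∈ diag k V) : shAct us v ∈ diag k V := by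
  rcases us with _ | ⟨x, us⟩
  · simpa using hv
  · rw [shAct_cons_apply]
    exact sub_mem (act_mem_diag _ hv)
      (mul_mem_diag (hus x (by simp)) (act_mem_diag _ (sg_mem_diag _ hv)))

/-- The compatibility of the insertion operators with `s⁻¹z ↦ v ∪' s⁻¹z`. -/
theorem shAct_shiftMap_mul {us : List (ℤ × Alg k V)}
    (hus : IsHomogeneousList (diagGr k V) us) {v : Alg k V} (hv : v ∈ diag k V) (z : Alg k V) :
    shAct us (shiftMap k V v * z) = splitSum (fun us₁ us₂ => sgn (totalDeg us₁) •
      (shiftMap k V (act us₁ v) * shAct us₂ (sg k V (totalDeg us₁) z))) us := by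
  have hd : ∀ x ∈ us, x.2 ∈ diag k V := fun x hx => (hus x hx).2
  conv_lhs => rw [← sum_gho_mul_arr_mul z]
  conv_rhs => rw [← sum_gho_mul_arr_mul z]
  simp only [Finset.mul_sum, map_sum, Finset.smul_sum, splitSum_sum]
  refine Finset.sum_congr rfl fun β _ => ?_
  rw [← mul_assoc, shiftMap_mul_gho hv, mul_assoc, shAct_gho_mul hd, act_mul, mul_splitSum]
  refine splitSum_congr fun us₁ us₂ h => ?_
  rw [map_mul _ (gho k β), sg_gho, smul_mul_assoc, map_zsmul, shAct_gho_mul, mul_smul_comm,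
    sgn_smul_smul_self, ← mul_assoc, ← mul_assoc, shiftMap_mul_gho (act_mem_diag _ hv)]
  exact fun x hx => hd x (by simp [← h, hx])

end Insertion

end Leavitt

/-! ### Sums over the last entry of a list -/

section LastTerm

variable {X N N' : Type*} [AddCommGroup N] [AddCommGroup N']

/-- `lastTerm f [x₁, …, xₙ] = f [x₁, …, x_{n-1}] xₙ`, and `0` for the empty list. -/
def lastTerm (f : List X → X → N) : List X → N
  | [] => 0
  | [y] => f [] y
  | y :: z :: c => lastTerm (fun l => f (y :: l)) (z :: c)

theorem lastTerm_cons_cons (f : List X → X → N) (y z : X) (c : List X) :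
    lastTerm f (y :: z :: c) = lastTerm (fun l => f (y :: l)) (z :: c) := rfl

@[simp] theorem lastTerm_singleton (f : List X → X → N) (y : X) : lastTerm f [y] = f [] y := rfl

theorem lastTerm_append_singleton (f : List X → X → N) (l : List X) (z : X) :
    lastTerm f (l ++ [z]) = f l z := by
  induction l generalizing f with
  | nil => rfl
  | cons y l ih =>
    obtain ⟨w, l', h⟩ : ∃ w l', l ++ [z] = w :: l' := List.exists_cons_of_ne_nil (by simp)
    rw [List.cons_append, h, lastTerm_cons_cons, ← h, ih]

/-- If only the splittings with at most one entry in the second part contribute to a sum over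
splittings, then it has two terms. -/
theorem splitSum_of_length {f : List X → List X → N} (h : ∀ a b, 2 ≤ b.length → f a b = 0)
    (c : List X) : splitSum f c = f c [] + lastTerm (fun a z => f a [z]) c := by
  induction c generalizing f with
  | nil => simp [lastTerm]
  | cons y c ih =>
    rw [splitSum_cons, ih fun a b hb => h _ b hb]
    rcases c with _ | ⟨z, c⟩
    · simp [lastTerm, add_comm]
    · rw [h [] (y :: z :: c) (by simp), zero_add]
      rfl

theorem exists_append_singleton {c : List X} (h : c ≠ []) : ∃ l z, c = l ++ [z] :=
  ⟨_, _, (List.dropLast_append_getLast h).symm⟩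

end LastTerm

namespace BInfinityData

section Star

variable {M M' N N' : Type*} [AddCommGroup M] [AddCommGroup N] [AddCommGroup N']
  {br : ℤ × M → List (ℤ × M) → M} {dif : ℤ × M → M} {mul : ℤ × M → ℤ × M → M}

omit [AddCommGroup M] in
theorem map_jacobiSum {Φ : Type*} [FunLike Φ N N'] [AddMonoidHomClass Φ N N']
    {br : ℤ × M' → List (ℤ × M) → M} (φ : Φ)
    (b : List (ℤ × M')) (F : List (ℤ × M) → N) (c : List (ℤ × M)) :
    φ (jacobiSum br b F c) = jacobiSum br b (fun l => φ (F l)) c := by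
  induction b generalizing F c with
  | nil => rfl
  | cons x b ih => simp only [jacobiSum, map_splitSum, map_zsmul, ih]

omit [AddCommGroup M] in
theorem mul_jacobiSum {R : Type*} [Ring R]
    {br : ℤ × M' → List (ℤ × M) → M} (r : R) (b : List (ℤ × M')) (F : List (ℤ × M) → R)
    (c : List (ℤ × M)) : r * jacobiSum br b F c = jacobiSum br b (fun l => r * F l) c :=
  map_jacobiSum (AddMonoidHom.mulLeft r) b F c

omit [AddCommGroup M] in
theorem jacobiSum_sub {br : ℤ × M' → List (ℤ × M) → M} (b : List (ℤ × M'))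
    (F G : List (ℤ × M) → N) (c : List (ℤ × M)) :
    jacobiSum br b (fun l => F l - G l) c = jacobiSum br b F c - jacobiSum br b G c := by
  simp only [sub_eq_add_neg, jacobiSum_add]
  congr 1
  exact (map_jacobiSum (negAddMonoidHom : N →+ N) b G c).symm

omit [AddCommGroup M] in
theorem jacobiSum_nil_right (hbr : ∀ x, br x [] = x.2) (b : List (ℤ × M)) (F : List (ℤ × M) → N) :
    jacobiSum br b F [] = F b := by
  induction b generalizing F with
  | nil => rfl
  | cons x b ih => rw [jacobiSum_cons_nil, ih, brElt, hbr, sdeg_nil, add_zero]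

omit [AddCommGroup M] in
theorem map_insertM {Φ : Type*} [FunLike Φ N N'] [AddMonoidHomClass Φ N N'] (φ : Φ)
    (G : List (ℤ × M) → N) (b : List (ℤ × M)) :
    φ (insertM dif mul G b) = insertM dif mul (fun l => φ (G l)) b := by
  fun_induction insertM dif mul G b with
  | case1 => simp [insertM]
  | case2 G y => simp [insertM]
  | case3 G y z b ih => simp only [map_add, map_zsmul, ih, insertM]

omit [AddCommGroup M] in
theorem insertM_sub (F G : List (ℤ × M) → N) (b : List (ℤ × M)) :
    insertM dif mul (fun l => F l - G l) b = insertM dif mul F b - insertM dif mul G b := by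
  fun_induction insertM dif mul F b generalizing G with
  | case1 => simp [insertM]
  | case2 F y => simp [insertM]
  | case3 F y z b ih =>
    simp only [insertM, ih, smul_sub]
    abel

theorem insertM_congr {k : Type*} [Field k] [Module k M] {gr : ℤ → Submodule k M}
    (hd : ∀ x, x.2 ∈ gr x.1 → dif x ∈ gr (x.1 + 1))
    (hm : ∀ x y, x.2 ∈ gr x.1 → y.2 ∈ gr y.1 → mul x y ∈ gr (x.1 + y.1))
    {F G : List (ℤ × M) → N} {b : List (ℤ × M)} (hb : IsHomogeneousList gr b)
    (h : ∀ l, l ≠ [] → IsHomogeneousList gr l → F l = G l) :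
    insertM dif mul F b = insertM dif mul G b := by
  fun_induction insertM dif mul F b generalizing G with
  | case1 => rfl
  | case2 F y =>
    rw [insertM, h _ (by simp)]
    simp only [isHomogeneousList_cons, isHomogeneousList_nil, and_true] at hb ⊢
    exact hd y hb
  | case3 F y z b ih =>
    simp only [isHomogeneousList_cons] at hb
    rw [insertM, h _ (by simp), h _ (by simp), ih (G := fun l => G (y :: l))]
    · simp only [isHomogeneousList_cons]
      exact hb.2
    · intro l _ hl
      refine h _ (by simp) ?_
      simp only [isHomogeneousList_cons]
      exact ⟨hb.1, hl⟩
    · simp only [isHomogeneousList_cons]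
      exact ⟨hm y z hb.1 hb.2.1, hb.2.2⟩
    · simp only [isHomogeneousList_cons]
      exact ⟨hd y hb.1, hb.2⟩

theorem jacobiSum_congr_br {k : Type*} [Field k] [Module k M] {gr : ℤ → Submodule k M}
    {br' : ℤ × M → List (ℤ × M) → M} {b c : List (ℤ × M)}
    (hb : IsHomogeneousList gr b) (hc : IsHomogeneousList gr c)
    (h : ∀ x c, x.2 ∈ gr x.1 → IsHomogeneousList gr c → br x c = br' x c)
    (F : List (ℤ × M) → N) : jacobiSum br b F c = jacobiSum br' b F c := by
  induction b generalizing F c with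
  | nil => rfl
  | cons x b ih =>
    simp only [jacobiSum]
    refine splitSum_congr fun c₀ c' e => ?_
    congr 1
    refine splitSum_congr fun c₁ c₂ e' => ?_
    subst e'
    subst e
    simp only [isHomogeneousList_append, isHomogeneousList_cons] at hb hc
    rw [ih hb.2 hc.2.2, brElt, brElt, h x c₁ hb.1 hc.2.1]

end Star

end BInfinityData

namespace Leavitt

open BInfinityData

variable {k : Type*} [Field k] {V : Type*} [Quiver V] [Fintype V] [Fintype (Quiver.Total V)]

/-! ### The brace algebra structure of the Leavitt complex -/

section LeavittBrace

theorem leavittDiff_apply (x : ℤ × (Alg k V × Alg k V)) :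
    leavittDiff x = (0, x.2.1 - sgn x.1 • shiftMap k V x.2.1) := by
  rw [leavittDiff, shiftMap_apply]

theorem leavittCup_apply (x y : ℤ × (Alg k V × Alg k V)) :
    leavittCup x y = (x.2.1 * y.2.1, x.2.2 * y.2.1 + shiftMap k V x.2.1 * y.2.2) := by
  rw [leavittCup, shiftMap_apply, Finset.sum_mul]

theorem mem_leavittGr {d : ℤ} {w : Alg k V × Alg k V} :
    w ∈ leavittGr k V d ↔ w.1 ∈ diagGr k V d ∧ w.2 ∈ diagGr k V (d - 1) := Iff.rfl

theorem mul_mem_diagGr {d d' : ℤ} {u v : Alg k V} (hu : u ∈ diagGr k V d)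
    (hv : v ∈ diagGr k V d') : u * v ∈ diagGr k V (d + d') :=
  ⟨mul_mem_gr hu.1 hv.1, mul_mem_diag hu.2 hv.2⟩

theorem shiftMap_mem_diagGr {d : ℤ} {u : Alg k V} (hu : u ∈ diagGr k V d) :
    shiftMap k V u ∈ diagGr k V d :=
  ⟨shiftMap_mem_gr hu.1, shiftMap_mem_diag u⟩

theorem leavittDiff_mem (x : ℤ × (Alg k V × Alg k V)) (hx : x.2 ∈ leavittGr k V x.1) :
    leavittDiff x ∈ leavittGr k V (x.1 + 1) := by
  rw [leavittDiff_apply, mem_leavittGr, add_sub_cancel_right]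
  exact ⟨zero_mem _, sub_mem hx.1 (zsmul_mem (shiftMap_mem_diagGr hx.1) _)⟩

theorem leavittCup_mem (x y : ℤ × (Alg k V × Alg k V)) (hx : x.2 ∈ leavittGr k V x.1)
    (hy : y.2 ∈ leavittGr k V y.1) : leavittCup x y ∈ leavittGr k V (x.1 + y.1) := by
  rw [leavittCup_apply, mem_leavittGr]
  refine ⟨mul_mem_diagGr hx.1 hy.1, add_mem ?_ ?_⟩
  · rw [add_sub_right_comm]
    exact mul_mem_diagGr hx.2 hy.1
  · rw [add_sub_assoc]
    exact mul_mem_diagGr (shiftMap_mem_diagGr hx.1) hy.2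

/-- The components in `⨁ s⁻¹ e_i L e_i`, as elements of `⨁ e_i L e_i`. -/
def shiftPart (c : List (ℤ × (Alg k V × Alg k V))) : List (ℤ × Alg k V) :=
  c.map fun z => (z.1 - 1, z.2.2)

@[simp] theorem shiftPart_nil : shiftPart ([] : List (ℤ × (Alg k V × Alg k V))) = [] := rfl

@[simp] theorem shiftPart_cons (x : ℤ × (Alg k V × Alg k V)) (c) :
    shiftPart (x :: c) = (x.1 - 1, x.2.2) :: shiftPart c := rfl

@[simp] theorem shiftPart_append (b c : List (ℤ × (Alg k V × Alg k V))) :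
    shiftPart (b ++ c) = shiftPart b ++ shiftPart c := List.map_append ..

@[simp] theorem totalDeg_shiftPart (c : List (ℤ × (Alg k V × Alg k V))) :
    totalDeg (shiftPart c) = sdeg c := by
  induction c with
  | nil => rfl
  | cons x c ih => simp [ih]

theorem isHomogeneousList_shiftPart {c : List (ℤ × (Alg k V × Alg k V))}
    (hc : IsHomogeneousList (leavittGr k V) c) :
    IsHomogeneousList (diagGr k V) (shiftPart c) := by
  induction c with
  | nil => simp
  | cons x c ih =>
    simp only [isHomogeneousList_cons, shiftPart_cons] at hc ⊢
    exact ⟨hc.1.2, ih hc.2⟩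

theorem splitSum_shiftPart {N : Type*} [AddCommGroup N]
    (f : List (ℤ × Alg k V) → List (ℤ × Alg k V) → N) (c : List (ℤ × (Alg k V × Alg k V))) :
    splitSum f (shiftPart c) = splitSum (fun a b => f (shiftPart a) (shiftPart b)) c :=
  splitSum_map _ _ _

/-- The brace operation of the Leavitt complex, in terms of the insertion operators. -/
def insBrace (x : ℤ × (Alg k V × Alg k V)) (c : List (ℤ × (Alg k V × Alg k V))) :
    Alg k V × Alg k V :=
  (act (shiftPart c) x.2.1, shAct (shiftPart c) x.2.2)

theorem insBrace_nil (x : ℤ × (Alg k V × Alg k V)) : insBrace x [] = x.2 := by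
  simp [insBrace]

theorem insBrace_mem (x : ℤ × (Alg k V × Alg k V)) (c : List (ℤ × (Alg k V × Alg k V)))
    (hx : x.2 ∈ leavittGr k V x.1) (hc : IsHomogeneousList (leavittGr k V) c) :
    insBrace x c ∈ leavittGr k V (x.1 + sdeg c) := by
  have hc' := isHomogeneousList_shiftPart hc
  rw [mem_leavittGr, ← totalDeg_shiftPart]
  refine ⟨⟨act_mem_gr (fun y hy => (hc' y hy).1) hx.1.1, act_mem_diag _ hx.1.2⟩,
    ⟨?_, shAct_mem_diag (fun y hy => (hc' y hy).2) hx.2.2⟩⟩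
  rw [add_sub_right_comm]
  exact shAct_mem_gr (fun y hy => (hc' y hy).1) hx.2.1

theorem shAct_sub_act (x : ℤ × (Alg k V × Alg k V)) (c : List (ℤ × (Alg k V × Alg k V)))
    (v : Alg k V) : shAct (shiftPart (x :: c)) v =
      act (shiftPart (x :: c)) v - x.2.2 * act (shiftPart c) (sg k V (x.1 - 1) v) := rfl

/-- The term by which the operators `act` and `shAct` differ. -/
def headTerm (v : Alg k V) : List (ℤ × (Alg k V × Alg k V)) → Alg k V
  | [] => 0
  | x :: c => x.2.2 * act (shiftPart c) (sg k V (x.1 - 1) v)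

theorem shAct_shiftPart (c : List (ℤ × (Alg k V × Alg k V))) (v : Alg k V) :
    shAct (shiftPart c) v = act (shiftPart c) v - headTerm v c := by
  rcases c with _ | ⟨x, c⟩
  · simp [headTerm]
  · rfl

/-- The pre-Jacobi identities for `act` and those for `shAct` imply each other, given those for
shorter lists. -/
theorem shAct_shAct_sub_jacobiSum {x y : ℤ × (Alg k V × Alg k V)}
    {b c : List (ℤ × (Alg k V × Alg k V))} (hb : IsHomogeneousList (leavittGr k V) (x :: b))
    (w : Alg k V)
    (h1 : ∀ n, act (shiftPart c) (act (shiftPart (x :: b)) (sg k V n w)) =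
      jacobiSum insBrace (x :: b) (fun l => act (shiftPart l) (sg k V n w)) c)
    (h2 : ∀ n c₁ c₂, c₁ ++ c₂ = y :: c → act (shiftPart c₂) (act (shiftPart b) (sg k V n w)) =
      jacobiSum insBrace b (fun l => act (shiftPart l) (sg k V n w)) c₂) :
    shAct (shiftPart (y :: c)) (shAct (shiftPart (x :: b)) w) -
        jacobiSum insBrace (x :: b) (fun l => shAct (shiftPart l) w) (y :: c) =
      act (shiftPart (y :: c)) (act (shiftPart (x :: b)) w) -
        jacobiSum insBrace (x :: b) (fun l => act (shiftPart l) w) (y :: c) := by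
  have hb' := isHomogeneousList_shiftPart hb
  have hbb : ∀ z ∈ shiftPart b, z.2 ∈ gr k V z.1 := fun z hz => (hb' z (by simp [hz])).1
  simp only [shAct_shiftPart (v := w), jacobiSum_sub, map_sub]
  have e1 : shAct (shiftPart (y :: c)) (act (shiftPart (x :: b)) w) =
      act (shiftPart (y :: c)) (act (shiftPart (x :: b)) w) - sgn ((y.1 - 1) * sdeg (x :: b)) •
        (y.2.2 * jacobiSum insBrace (x :: b) (fun l => act (shiftPart l) (sg k V (y.1 - 1) w)) c) := by
    rw [shAct_sub_act, sg_act (fun z hz => (hb' z hz).1), map_zsmul, h1, mul_smul_comm,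
      totalDeg_shiftPart]
  have e2 : shAct (shiftPart (y :: c)) (headTerm w (x :: b)) =
      splitSum (fun c₁ c₂ => sgn (sdeg c₁ * sdeg b) • (shAct (shiftPart c₁) x.2.2 *
        jacobiSum insBrace b (fun l => act (shiftPart l) (sg k V (x.1 + sdeg c₁ - 1) w)) c₂))
        (y :: c) := by
    rw [headTerm, shAct_mul, splitSum_shiftPart]
    refine splitSum_congr fun c₁ c₂ h => ?_
    rw [sg_act hbb, map_zsmul, mul_smul_comm, totalDeg_shiftPart, totalDeg_shiftPart, ← sg_add,
      h2 _ c₁ c₂ h]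
    congr 3
    rw [show sdeg c₁ + (x.1 - 1) = x.1 + sdeg c₁ - 1 by ring]
  have e3 : jacobiSum insBrace (x :: b) (fun l => headTerm w l) (y :: c) =
      sgn ((y.1 - 1) * sdeg (x :: b)) •
        (y.2.2 * jacobiSum insBrace (x :: b) (fun l => act (shiftPart l) (sg k V (y.1 - 1) w)) c) +
      splitSum (fun c₁ c₂ => sgn (sdeg c₁ * sdeg b) • (shAct (shiftPart c₁) x.2.2 *
        jacobiSum insBrace b (fun l => act (shiftPart l) (sg k V (x.1 + sdeg c₁ - 1) w)) c₂))
        (y :: c) := by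
    rw [jacobiSum_cons_cons]
    simp only [headTerm]
    congr 1
    · rw [mul_jacobiSum]
    · refine splitSum_congr fun c₁ c₂ _ => ?_
      rw [mul_jacobiSum]
      rfl
  rw [e1, e2, e3]
  abel

theorem act_act_nil_right (b : List (ℤ × (Alg k V × Alg k V))) (v : Alg k V) :
    act (shiftPart []) (act (shiftPart b) v) =
      jacobiSum insBrace b (fun l => act (shiftPart l) v) [] := by
  rw [jacobiSum_nil_right insBrace_nil]
  simp

theorem shAct_shAct_of_act_act {z : Alg k V}
    (h : ∀ n b c, IsHomogeneousList (leavittGr k V) b → IsHomogeneousList (leavittGr k V) c →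
      act (shiftPart c) (act (shiftPart b) (sg k V n z)) =
        jacobiSum insBrace b (fun l => act (shiftPart l) (sg k V n z)) c)
    (b c : List (ℤ × (Alg k V × Alg k V))) (hb : IsHomogeneousList (leavittGr k V) b)
    (hc : IsHomogeneousList (leavittGr k V) c) :
    shAct (shiftPart c) (shAct (shiftPart b) z) =
      jacobiSum insBrace b (fun l => shAct (shiftPart l) z) c := by
  rcases b with _ | ⟨x, b⟩
  · simp
  rcases c with _ | ⟨y, c⟩
  · rw [jacobiSum_nil_right insBrace_nil]
    simp
  · have hb' := (isHomogeneousList_cons _ _ _).1 hb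
    have hc' := (isHomogeneousList_cons _ _ _).1 hc
    have := shAct_shAct_sub_jacobiSum (y := y) (c := c) hb z (fun n => h n _ _ hb hc'.2)
      fun n c₁ c₂ e =>
      h n _ _ hb'.2 (by rw [← e, isHomogeneousList_append] at hc; exact hc.2)
    have h0 := h 0 _ _ hb hc
    simp only [sg_zero] at h0
    rw [h0, sub_self] at this
    exact sub_eq_zero.1 this

theorem act_act_of_shAct_shAct {z : Alg k V}
    (h : ∀ n b c, IsHomogeneousList (leavittGr k V) b → IsHomogeneousList (leavittGr k V) c →
      shAct (shiftPart c) (shAct (shiftPart b) (sg k V n z)) =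
        jacobiSum insBrace b (fun l => shAct (shiftPart l) (sg k V n z)) c)
    (n : ℤ) (b c : List (ℤ × (Alg k V × Alg k V))) (hb : IsHomogeneousList (leavittGr k V) b)
    (hc : IsHomogeneousList (leavittGr k V) c) :
    act (shiftPart c) (act (shiftPart b) (sg k V n z)) =
      jacobiSum insBrace b (fun l => act (shiftPart l) (sg k V n z)) c := by
  obtain ⟨N, hN⟩ : ∃ N, b.length + c.length ≤ N := ⟨_, le_rfl⟩
  induction N generalizing n b c with
  | zero =>
    obtain rfl : c = [] := List.length_eq_zero_iff.1 (by omega)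
    exact act_act_nil_right _ _
  | succ N ih =>
    rcases b with _ | ⟨x, b⟩
    · simp
    rcases c with _ | ⟨y, c⟩
    · exact act_act_nil_right _ _
    · have hb' := (isHomogeneousList_cons _ _ _).1 hb
      have hc' := (isHomogeneousList_cons _ _ _).1 hc
      simp only [List.length_cons] at hN
      have := shAct_shAct_sub_jacobiSum (y := y) (c := c) hb (sg k V n z) (fun m => ?_)
        fun m c₁ c₂ e => ?_
      · rw [h n _ _ hb hc, sub_self] at this
        exact sub_eq_zero.1 this.symm
      · rw [← sg_add]
        exact ih _ _ _ hb hc'.2 (by simp; omega)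
      · rw [← sg_add]
        have := congrArg List.length e
        simp only [List.length_append, List.length_cons] at this
        exact ih _ _ _ hb'.2 (by rw [← e, isHomogeneousList_append] at hc; exact hc.2) (by omega)

/-- The pre-Jacobi identities for the insertion operators, by induction on words. -/
theorem act_act_sg (z : Alg k V) (n : ℤ) (b c : List (ℤ × (Alg k V × Alg k V)))
    (hb : IsHomogeneousList (leavittGr k V) b) (hc : IsHomogeneousList (leavittGr k V) c) :
    act (shiftPart c) (act (shiftPart b) (sg k V n z)) =
      jacobiSum insBrace b (fun l => act (shiftPart l) (sg k V n z)) c := by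
  refine induction_arr_gho (P := fun z => ∀ n b c, IsHomogeneousList (leavittGr k V) b →
    IsHomogeneousList (leavittGr k V) c → act (shiftPart c) (act (shiftPart b) (sg k V n z)) =
      jacobiSum insBrace b (fun l => act (shiftPart l) (sg k V n z)) c) ?_ ?_ ?_ ?_ ?_ z n b c hb hc
  · intro n b c _ _
    rcases b with _ | ⟨x, b⟩
    · simp
    · rw [map_one, act_one (by simp), map_zero, jacobiSum_eq_zero]
      intro l hl
      rw [act_one]
      rintro h
      simp only [shiftPart, List.map_eq_nil_iff] at h
      simp [h] at hl
  -- in `α z` nothing is inserted before `α`, so that `act` on `α z` reduces to `shAct` on `z`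
  · intro α z ih n b c hb hc
    have hR := shAct_shAct_of_act_act (z := sg k V n z)
      (fun m b c hb hc => by rw [← sg_add]; exact ih _ _ _ hb hc) b c hb hc
    have hd : ∀ {l : List (ℤ × (Alg k V × Alg k V))}, IsHomogeneousList (leavittGr k V) l →
        ∀ x ∈ shiftPart l, x.2 ∈ diag k V := fun hl x hx =>
      (isHomogeneousList_shiftPart hl x hx).2
    rw [jacobiSum_congr (gr := leavittGr k V) insBrace_mem hb hc
      (G := fun l => sgn n • (arr k α * shAct (shiftPart l) (sg k V n z))) fun l hl _ _ => by
        rw [map_mul, sg_arr, smul_mul_assoc, map_zsmul, act_arr_mul (hd hl)]]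
    rw [jacobiSum_zsmul, map_mul, sg_arr, smul_mul_assoc, map_zsmul, act_arr_mul (hd hb), map_zsmul,
      act_arr_mul (hd hc), hR, mul_jacobiSum]
  -- for `β^* w` it is `shAct` that is simple: it reduces to `act` on `w`
  · intro β w ih n b c hb hc
    have hd : ∀ {l : List (ℤ × (Alg k V × Alg k V))}, IsHomogeneousList (leavittGr k V) l →
        ∀ x ∈ shiftPart l, x.2 ∈ diag k V := fun hl x hx =>
      (isHomogeneousList_shiftPart hl x hx).2
    refine act_act_of_shAct_shAct (fun n b c hb hc => ?_) n b c hb hc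
    rw [jacobiSum_congr (gr := leavittGr k V) insBrace_mem hb hc
      (G := fun l => sgn n • (gho k β * act (shiftPart l) (sg k V n w))) fun l hl _ _ => by
        rw [map_mul, sg_gho, smul_mul_assoc, map_zsmul, shAct_gho_mul (hd hl)]]
    rw [jacobiSum_zsmul, map_mul, sg_gho, smul_mul_assoc, map_zsmul, shAct_gho_mul (hd hb),
      map_zsmul,
      shAct_gho_mul (hd hc), ih n b c hb hc, mul_jacobiSum]
  · intro y z hy hz n b c hb hc
    simp only [map_add, hy n b c hb hc, hz n b c hb hc, jacobiSum_add]
  · intro a z hz n b c hb hc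
    simp only [map_smul, hz n b c hb hc]
    exact map_jacobiSum (DistribSMul.toAddMonoidHom (Alg k V) a) b _ c

theorem act_act (v : Alg k V) (b c : List (ℤ × (Alg k V × Alg k V)))
    (hb : IsHomogeneousList (leavittGr k V) b) (hc : IsHomogeneousList (leavittGr k V) c) :
    act (shiftPart c) (act (shiftPart b) v) =
      jacobiSum insBrace b (fun l => act (shiftPart l) v) c := by
  simpa using act_act_sg v 0 b c hb hc

theorem shAct_shAct (v : Alg k V) (b c : List (ℤ × (Alg k V × Alg k V)))
    (hb : IsHomogeneousList (leavittGr k V) b) (hc : IsHomogeneousList (leavittGr k V) c) :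
    shAct (shiftPart c) (shAct (shiftPart b) v) =
      jacobiSum insBrace b (fun l => shAct (shiftPart l) v) c :=
  shAct_shAct_of_act_act (fun _ b c hb hc => act_act _ b c hb hc) b c hb hc

theorem insBrace_insBrace (x : ℤ × (Alg k V × Alg k V)) (b c : List (ℤ × (Alg k V × Alg k V)))
    (hb : IsHomogeneousList (leavittGr k V) b) (hc : IsHomogeneousList (leavittGr k V) c) :
    insBrace (brElt insBrace x b) c = jacobiSum insBrace b (insBrace x) c := by
  refine Prod.ext ?_ ?_
  · rw [show (jacobiSum insBrace b (insBrace x) c).1 = AddMonoidHom.fst _ _ (jacobiSum insBrace b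
      (insBrace x) c) from rfl, map_jacobiSum]
    exact act_act _ b c hb hc
  · rw [show (jacobiSum insBrace b (insBrace x) c).2 = AddMonoidHom.snd _ _ (jacobiSum insBrace b
      (insBrace x) c) from rfl, map_jacobiSum]
    exact shAct_shAct _ b c hb hc

end LeavittBrace

end Leavitt

namespace BInfinityData

variable {M N : Type*} [AddCommGroup M] [AddCommGroup N] {br : ℤ × M → List (ℤ × M) → M}

omit [AddCommGroup M] in
theorem jacobiSum_pair_of_length {F : List (ℤ × M) → N} (h : ∀ l, 3 ≤ l.length → F l = 0)
    (x y : ℤ × M) (c : List (ℤ × M)) : jacobiSum br [x, y] F c =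
      splitSum (fun c₁ c₂ => sgn (sdeg c₁ * (y.1 - 1)) • F [brElt br x c₁, brElt br y c₂]) c := by
  rw [jacobiSum, splitSum_eq_left]
  · simp only [sdeg_nil, zero_mul, sgn_zero, one_smul, List.nil_append]
    refine splitSum_congr fun c₁ c₂ _ => ?_
    rw [jacobiSum_singleton_of_length fun l hl => h _ (by simp; omega)]
    simp
  · intro a u v _
    rw [splitSum_eq_zero, smul_zero]
    intro u' v' _
    rw [jacobiSum_eq_zero, smul_zero]
    intro l hl
    exact h _ (by simp at hl ⊢; omega)

omit [AddCommGroup M] in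
/-- The terms `x{c}`, `(y, x{c'})` and `(x{c''}, z)`, where `c = y c' = c'' z`. -/
theorem jacobiSum_singleton_cons_of_length {F : List (ℤ × M) → N}
    (h : ∀ l, 3 ≤ l.length → F l = 0) (x y : ℤ × M) (c : List (ℤ × M)) :
    jacobiSum br [x] F (y :: c) = sgn ((y.1 - 1) * (x.1 - 1)) • F [y, brElt br x c] +
      (F [brElt br x (y :: c)] + lastTerm (fun c' z => F [brElt br x c', z]) (y :: c)) := by
  rw [jacobiSum_cons_cons, jacobiSum_singleton_of_length fun l hl => h _ (by simp; omega)]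
  simp only [sdeg_nil, mul_zero, sgn_zero, one_smul, jacobiSum_nil, sdeg_cons, add_zero]
  rw [splitSum_of_length fun a b hb => h _ (by simp; omega)]

end BInfinityData

section LastTerm

variable {X N N' : Type*} [AddCommGroup N] [AddCommGroup N']

theorem lastTerm_congr {f g : List X → X → N} {c : List X}
    (h : ∀ l z, l ++ [z] = c → f l z = g l z) : lastTerm f c = lastTerm g c := by
  rcases eq_or_ne c [] with rfl | hc
  · rfl
  · obtain ⟨l, z, rfl⟩ := exists_append_singleton hc
    rw [lastTerm_append_singleton, lastTerm_append_singleton, h l z rfl]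

theorem map_lastTerm {Φ : Type*} [FunLike Φ N N'] [AddMonoidHomClass Φ N N'] (φ : Φ)
    (f : List X → X → N) (c : List X) : φ (lastTerm f c) = lastTerm (fun l z => φ (f l z)) c := by
  rcases eq_or_ne c [] with rfl | hc
  · exact map_zero φ
  · obtain ⟨l, z, rfl⟩ := exists_append_singleton hc
    rw [lastTerm_append_singleton, lastTerm_append_singleton]

end LastTerm

namespace Leavitt

open BInfinityData

variable {k : Type*} [Field k] {V : Type*} [Quiver V] [Fintype V] [Fintype (Quiver.Total V)]

section LeavittBrace

theorem leavittDiff_leavittDiff (x : ℤ × (Alg k V × Alg k V)) (d : ℤ) :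
    leavittDiff (d, leavittDiff x) = 0 := by
  simp [leavittDiff_apply]

theorem leavittCup_assoc {x y : ℤ × (Alg k V × Alg k V)} (hx : x.2.1 ∈ diag k V)
    (z : ℤ × (Alg k V × Alg k V)) (d e : ℤ) :
    leavittCup (d, leavittCup x y) z = leavittCup x (e, leavittCup y z) := by
  simp only [leavittCup_apply, shiftMap_mul hx, mul_assoc, add_mul, mul_add, add_assoc]

theorem leavittDiff_leavittCup {x y : ℤ × (Alg k V × Alg k V)}
    (hx : x.2.1 ∈ diagGr k V x.1) :
    leavittDiff (x.1 + y.1, leavittCup x y) = leavittCup (x.1 + 1, leavittDiff x) y +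
      sgn x.1 • leavittCup x (y.1 + 1, leavittDiff y) := by
  simp only [leavittDiff_apply, leavittCup_apply, shiftMap_mul hx.2]
  refine Prod.ext ?_ ?_
  · simp
  · simp only [sub_mul, mul_sub, mul_zero, map_zero, zero_mul, add_zero, zero_add, smul_mul_assoc,
      mul_smul_comm, sgn_add, smul_sub, Prod.snd_add, Prod.smul_snd, mul_smul]
    abel

theorem sgn_smul_act_mul {v w : Alg k V} {d : ℤ} (hw : w ∈ gr k V d)
    (c : List (ℤ × (Alg k V × Alg k V))) : act (shiftPart c) (v * w) =
      splitSum (fun c₁ c₂ => sgn (sdeg c₁ * d) • (act (shiftPart c₁) v * act (shiftPart c₂) w))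
        c := by
  rw [act_mul, splitSum_shiftPart]
  refine splitSum_congr fun c₁ c₂ _ => ?_
  rw [sg_of_mem _ hw, map_zsmul, mul_smul_comm, totalDeg_shiftPart]

theorem sgn_smul_shAct_mul {v w : Alg k V} {d : ℤ} (hw : w ∈ gr k V d)
    (c : List (ℤ × (Alg k V × Alg k V))) : shAct (shiftPart c) (v * w) =
      splitSum (fun c₁ c₂ => sgn (sdeg c₁ * d) • (shAct (shiftPart c₁) v * act (shiftPart c₂) w))
        c := by
  rw [shAct_mul, splitSum_shiftPart]
  refine splitSum_congr fun c₁ c₂ _ => ?_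
  rw [sg_of_mem _ hw, map_zsmul, mul_smul_comm, totalDeg_shiftPart]

theorem insBrace_leavittCup {x y : ℤ × (Alg k V × Alg k V)} (hx : x.2 ∈ leavittGr k V x.1)
    (hy : y.2 ∈ leavittGr k V y.1) {c : List (ℤ × (Alg k V × Alg k V))}
    (hc : IsHomogeneousList (leavittGr k V) c) :
    jacobiSum insBrace [x, y] (shiftedM leavittDiff leavittCup) c =
      sgn x.1 • insBrace (x.1 + y.1, leavittCup x y) c := by
  rw [jacobiSum_pair_of_length]
  swap
  · rintro (_ | ⟨x, _ | ⟨y, _ | ⟨z, l⟩⟩⟩) hl <;> simp [shiftedM] at hl ⊢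
  have e : splitSum (fun c₁ c₂ => sgn (sdeg c₁ * (y.1 - 1)) •
      shiftedM leavittDiff leavittCup [brElt insBrace x c₁, brElt insBrace y c₂]) c =
      sgn x.1 • splitSum (fun c₁ c₂ => sgn (sdeg c₁ * y.1) •
        leavittCup (brElt insBrace x c₁) (brElt insBrace y c₂)) c := by
    rw [smul_splitSum]
    refine splitSum_congr fun c₁ c₂ _ => ?_
    rw [shiftedM, sgn_smul_sgn_smul, sgn_smul_sgn_smul]
    congr 1
    apply sgn_congr
    simp only [brElt]
    push_cast
    grind
  rw [e]
  congr 1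
  simp only [leavittCup_apply, insBrace, brElt]
  refine Prod.ext ?_ ?_
  · rw [show ∀ z : Alg k V × Alg k V, z.1 = AddMonoidHom.fst _ _ z from fun _ => rfl, map_splitSum,
      sgn_smul_act_mul hy.1.1]
    rfl
  · rw [show ∀ z : Alg k V × Alg k V, z.2 = AddMonoidHom.snd _ _ z from fun _ => rfl, map_splitSum]
    simp only [map_zsmul, AddMonoidHom.coe_snd, smul_add, splitSum_add, map_add]
    rw [sgn_smul_shAct_mul hy.1.1, shAct_shiftMap_mul (isHomogeneousList_shiftPart hc) hx.1.2,
      splitSum_shiftPart]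
    congr 1
    refine splitSum_congr fun c₁ c₂ _ => ?_
    rw [sg_of_mem _ hy.2.1, map_zsmul, mul_smul_comm, sgn_smul_sgn_smul, totalDeg_shiftPart]
    congr 1
    apply sgn_congr
    push_cast
    grind

/-- The two forms of the compatibility of the insertion operators with the differential imply each
other, given the first form for shorter lists. -/
theorem insertM_shAct_sub_insertM_act (y : ℤ × (Alg k V × Alg k V))
    (c : List (ℤ × (Alg k V × Alg k V))) (v : Alg k V)
    (h : ∀ n z c', c = z :: c' →
      insertM leavittDiff leavittCup (fun l => act (shiftPart l) (sg k V n v)) c =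
        z.2.1 * act (shiftPart c') (sg k V z.1 (sg k V n v)) -
          lastTerm (fun l t => sgn (sdeg l) • (act (shiftPart l) (sg k V n v) * t.2.1)) c) :
    insertM leavittDiff leavittCup (fun l => shAct (shiftPart l) v) (y :: c) -
        (sgn y.1 • (shiftMap k V y.2.1 * shAct (shiftPart c) (sg k V y.1 v)) -
          lastTerm (fun l t => sgn (sdeg l) • (shAct (shiftPart l) v * t.2.1)) (y :: c)) =
      insertM leavittDiff leavittCup (fun l => act (shiftPart l) v) (y :: c) -
        (y.2.1 * act (shiftPart c) (sg k V y.1 v) -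
          lastTerm (fun l t => sgn (sdeg l) • (act (shiftPart l) v * t.2.1)) (y :: c)) := by
  rcases c with _ | ⟨z, c⟩
  · simp only [insertM, shiftPart_cons, shiftPart_nil, shAct_cons_apply, leavittDiff_apply,
      lastTerm_singleton, sdeg_nil, sgn_zero, one_smul, shAct_nil_apply, act_nil_apply, sub_mul,
      smul_mul_assoc, add_sub_cancel_right]
    abel
  · have e1 : insertM leavittDiff leavittCup (fun l => shAct (shiftPart (y :: l)) v) (z :: c) =
        insertM leavittDiff leavittCup (fun l => act (shiftPart (y :: l)) v) (z :: c) -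
          y.2.2 * (z.2.1 * act (shiftPart c) (sg k V z.1 (sg k V (y.1 - 1) v)) -
          lastTerm (fun l t => sgn (sdeg l) • (act (shiftPart l) (sg k V (y.1 - 1) v) * t.2.1))
            (z :: c)) := by
      simp only [shAct_sub_act, insertM_sub]
      rw [← h (y.1 - 1) z c rfl, ← AddMonoidHom.coe_mulLeft, map_insertM]
    have e2 : lastTerm (fun l t => sgn (sdeg l) • (shAct (shiftPart l) v * t.2.1)) (y :: z :: c) =
        lastTerm (fun l t => sgn (sdeg l) • (act (shiftPart l) v * t.2.1)) (y :: z :: c) -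
        sgn (y.1 - 1) • (y.2.2 * lastTerm (fun l t => sgn (sdeg l) •
          (act (shiftPart l) (sg k V (y.1 - 1) v) * t.2.1)) (z :: c)) := by
      rw [lastTerm_cons_cons, lastTerm_cons_cons]
      obtain ⟨l, t, e⟩ := exists_append_singleton (List.cons_ne_nil z c)
      rw [e, lastTerm_append_singleton, lastTerm_append_singleton, lastTerm_append_singleton,
        shAct_sub_act, sub_mul, smul_sub, mul_smul_comm, sgn_smul_sgn_smul, sdeg_cons, mul_assoc]
    rw [insertM, insertM, e1, e2]
    simp only [shiftPart_cons, shAct_cons_apply, leavittDiff_apply, leavittCup_apply]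
    rw [← sg_add z.1, sg_congr (show ((z.1 + (y.1 - 1) : ℤ) : ZMod 2) = ((y.1 + z.1 - 1 : ℤ)) by
      push_cast; ring), ← sg_add (z.1 - 1),
      sg_congr (show ((z.1 - 1 + y.1 : ℤ) : ZMod 2) = ((y.1 + z.1 - 1 : ℤ)) by push_cast; ring),
      show sgn (y.1 - 1) = -sgn y.1 by rw [neg_sgn]; exact sgn_congr (by push_cast; grind)]
    simp only [add_sub_cancel_right, sub_mul, mul_sub, add_mul, smul_mul_assoc, smul_sub, smul_add,
      neg_smul, mul_assoc]
    abel

theorem insertM_shAct_of_act {z : Alg k V}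
    (h : ∀ n y c, IsHomogeneousList (leavittGr k V) (y :: c) →
      insertM leavittDiff leavittCup (fun l => act (shiftPart l) (sg k V n z)) (y :: c) =
        y.2.1 * act (shiftPart c) (sg k V y.1 (sg k V n z)) -
          lastTerm (fun l t => sgn (sdeg l) • (act (shiftPart l) (sg k V n z) * t.2.1)) (y :: c))
    (y : ℤ × (Alg k V × Alg k V)) (c : List (ℤ × (Alg k V × Alg k V)))
    (hc : IsHomogeneousList (leavittGr k V) (y :: c)) :
    insertM leavittDiff leavittCup (fun l => shAct (shiftPart l) z) (y :: c) =
        sgn y.1 • (shiftMap k V y.2.1 * shAct (shiftPart c) (sg k V y.1 z)) -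
          lastTerm (fun l t => sgn (sdeg l) • (shAct (shiftPart l) z * t.2.1)) (y :: c) := by
  have := insertM_shAct_sub_insertM_act y c z fun n w c' e => by
    subst e
    exact h n w c' ((isHomogeneousList_cons _ _ _).1 hc).2
  have h0 := h 0 y c hc
  simp only [sg_zero] at h0
  rw [h0, sub_self] at this
  exact sub_eq_zero.1 this

theorem insertM_act_of_shAct {z : Alg k V}
    (h : ∀ n y c, IsHomogeneousList (leavittGr k V) (y :: c) →
      insertM leavittDiff leavittCup (fun l => shAct (shiftPart l) (sg k V n z)) (y :: c) =
        sgn y.1 • (shiftMap k V y.2.1 * shAct (shiftPart c) (sg k V y.1 (sg k V n z))) -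
          lastTerm (fun l t => sgn (sdeg l) • (shAct (shiftPart l) (sg k V n z) * t.2.1)) (y :: c))
    (n : ℤ) (y : ℤ × (Alg k V × Alg k V)) (c : List (ℤ × (Alg k V × Alg k V)))
    (hc : IsHomogeneousList (leavittGr k V) (y :: c)) :
    insertM leavittDiff leavittCup (fun l => act (shiftPart l) (sg k V n z)) (y :: c) =
        y.2.1 * act (shiftPart c) (sg k V y.1 (sg k V n z)) -
          lastTerm (fun l t => sgn (sdeg l) • (act (shiftPart l) (sg k V n z) * t.2.1))
            (y :: c) := by
  induction c generalizing n y with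
  | nil =>
    have := insertM_shAct_sub_insertM_act y [] (sg k V n z) fun n w c' e => by simp at e
    rw [h n y [] hc, sub_self] at this
    exact sub_eq_zero.1 this.symm
  | cons w c ih =>
    have := insertM_shAct_sub_insertM_act y (w :: c) (sg k V n z) fun m w c' e => by
      rw [List.cons.injEq] at e
      obtain ⟨rfl, rfl⟩ := e
      rw [← sg_add]
      exact ih _ _ ((isHomogeneousList_cons _ _ _).1 hc).2
    rw [h n y _ hc, sub_self] at this
    exact sub_eq_zero.1 this.symm

theorem insertM_apply (F : List (ℤ × (Alg k V × Alg k V)) → Alg k V →ₗ[k] Alg k V) (v : Alg k V)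
    (c : List (ℤ × (Alg k V × Alg k V))) : insertM leavittDiff leavittCup (fun l => F l v) c =
      insertM leavittDiff leavittCup F c v :=
  (map_insertM (LinearMap.applyₗ (R := k) v) F c).symm

theorem lastTerm_act (v : Alg k V) (c : List (ℤ × (Alg k V × Alg k V))) :
    lastTerm (fun l t => sgn (sdeg l) • (act (shiftPart l) v * t.2.1)) c =
      lastTerm (fun l t => sgn (sdeg l) • (LinearMap.mulRight k t.2.1).comp (act (shiftPart l)))
        c v :=
  (map_lastTerm (LinearMap.applyₗ (R := k) v) (fun l t => sgn (sdeg l) •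
    (LinearMap.mulRight k t.2.1).comp (act (shiftPart l))) c).symm

/-- The compatibility of the insertion operators with the differential, by induction on words. -/
theorem insertM_act_sg (z : Alg k V) (n : ℤ) (y : ℤ × (Alg k V × Alg k V))
    (c : List (ℤ × (Alg k V × Alg k V))) (hc : IsHomogeneousList (leavittGr k V) (y :: c)) :
    insertM leavittDiff leavittCup (fun l => act (shiftPart l) (sg k V n z)) (y :: c) =
        y.2.1 * act (shiftPart c) (sg k V y.1 (sg k V n z)) -
          lastTerm (fun l t => sgn (sdeg l) • (act (shiftPart l) (sg k V n z) * t.2.1))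
            (y :: c) := by
  have hd : ∀ {l : List (ℤ × (Alg k V × Alg k V))}, IsHomogeneousList (leavittGr k V) l →
      ∀ x ∈ shiftPart l, x.2 ∈ diag k V := fun hl x hx =>
    (isHomogeneousList_shiftPart hl x hx).2
  have hpre : ∀ {y : ℤ × (Alg k V × Alg k V)} {c l : List (ℤ × (Alg k V × Alg k V))}
      {t : ℤ × (Alg k V × Alg k V)}, IsHomogeneousList (leavittGr k V) (y :: c) →
      l ++ [t] = y :: c → IsHomogeneousList (leavittGr k V) l := fun h e => by
    rw [← e, isHomogeneousList_append] at h
    exact h.1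
  refine induction_arr_gho (P := fun z => ∀ n y c, IsHomogeneousList (leavittGr k V) (y :: c) →
    insertM leavittDiff leavittCup (fun l => act (shiftPart l) (sg k V n z)) (y :: c) =
        y.2.1 * act (shiftPart c) (sg k V y.1 (sg k V n z)) -
          lastTerm (fun l t => sgn (sdeg l) • (act (shiftPart l) (sg k V n z) * t.2.1))
            (y :: c)) ?_ ?_ ?_ ?_ ?_ z n y c hc
  · intro n y c hc
    rw [insertM_congr (gr := leavittGr k V) leavittDiff_mem leavittCup_mem hc (G := fun _ => 0)
      fun l hl _ => by rw [map_one, act_one (by simpa [shiftPart] using hl)]]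
    rw [show insertM leavittDiff leavittCup (fun _ => (0 : Alg k V)) (y :: c) = 0 from
      (map_insertM (0 : Alg k V →+ Alg k V) (fun _ => 0) (y :: c)).symm]
    simp only [map_one]
    rcases c with _ | ⟨w, c⟩
    · simp [sgn_zero]
    · rw [act_one (by simp), lastTerm_cons_cons]
      rw [lastTerm_congr (g := fun _ _ => 0) fun l t _ => by
        rw [act_one (by simp), zero_mul, smul_zero]]
      obtain ⟨l, t, e⟩ := exists_append_singleton (List.cons_ne_nil w c)
      rw [e, lastTerm_append_singleton]
      simp
  · intro α z ih n y c hc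
    have hR := insertM_shAct_of_act (z := sg k V n z)
      (fun m y c hc => by rw [← sg_add]; exact ih _ _ _ hc) y c hc
    have e1 : ∀ l, IsHomogeneousList (leavittGr k V) l → act (shiftPart l) (sg k V n (arr k α * z)) =
        sgn n • (arr k α * shAct (shiftPart l) (sg k V n z)) := fun l hl => by
      rw [map_mul, sg_arr, smul_mul_assoc, map_zsmul, act_arr_mul (hd hl)]
    have hy := (isHomogeneousList_cons _ _ _).1 hc
    rw [insertM_congr (gr := leavittGr k V) leavittDiff_mem leavittCup_mem hc
      fun l _ hl => e1 l hl, lastTerm_congr (g := fun l t => sgn n • (arr k α * (sgn (sdeg l) •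
        (shAct (shiftPart l) (sg k V n z) * t.2.1)))) fun l t e => by
        rw [e1 l (hpre hc e), smul_mul_assoc, mul_assoc, mul_smul_comm, smul_comm]]
    have e2 := congrArg ((DistribSMul.toAddMonoidHom (Alg k V) (sgn n)).comp
      (AddMonoidHom.mulLeft (arr k α))) hR
    rw [map_sub, map_insertM, map_lastTerm] at e2
    refine e2.trans (congrArg (· - _) ?_)
    change sgn n • (arr k α * _) = _
    rw [map_mul, sg_arr, smul_mul_assoc, map_zsmul, map_mul, sg_arr, smul_mul_assoc, map_zsmul,
      map_zsmul, act_arr_mul (hd hy.2), mul_smul_comm, mul_smul_comm, mul_smul_comm, ← mul_assoc,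
      ← mul_assoc, arr_mul_shiftMap hy.1.1.2]
  · intro β w ih n y c hc
    refine insertM_act_of_shAct (fun n y c hc => ?_) n y c hc
    have e1 : ∀ l, IsHomogeneousList (leavittGr k V) l →
        shAct (shiftPart l) (sg k V n (gho k β * w)) =
        sgn n • (gho k β * act (shiftPart l) (sg k V n w)) := fun l hl => by
      rw [map_mul, sg_gho, smul_mul_assoc, map_zsmul, shAct_gho_mul (hd hl)]
    have hy := (isHomogeneousList_cons _ _ _).1 hc
    rw [insertM_congr (gr := leavittGr k V) leavittDiff_mem leavittCup_mem hc
      fun l _ hl => e1 l hl, lastTerm_congr (g := fun l t => sgn n • (gho k β * (sgn (sdeg l) •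
        (act (shiftPart l) (sg k V n w) * t.2.1)))) fun l t e => by
        rw [e1 l (hpre hc e), smul_mul_assoc, mul_assoc, mul_smul_comm, smul_comm]]
    have e2 := congrArg ((DistribSMul.toAddMonoidHom (Alg k V) (sgn n)).comp
      (AddMonoidHom.mulLeft (gho k β))) (ih n y c hc)
    rw [map_sub, map_insertM, map_lastTerm] at e2
    refine e2.trans (congrArg (· - _) ?_)
    change sgn n • (gho k β * _) = _
    rw [map_mul, sg_gho, smul_mul_assoc, map_zsmul, map_mul, sg_gho, smul_mul_assoc, map_zsmul,
      map_zsmul, shAct_gho_mul (hd hy.2), mul_smul_comm, mul_smul_comm, ← mul_assoc, ← mul_assoc,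
      shiftMap_mul_gho hy.1.1.2, smul_comm (sgn n), sgn_smul_smul_self]
  · intro z z' hz hz' n y c hc
    have h1 := hz n y c hc
    have h2 := hz' n y c hc
    rw [insertM_apply (fun l => act (shiftPart l)), lastTerm_act] at h1 h2 ⊢
    simp only [map_add, mul_add, h1, h2]
    abel
  · intro a z hz n y c hc
    have h1 := hz n y c hc
    rw [insertM_apply (fun l => act (shiftPart l)), lastTerm_act] at h1 ⊢
    simp only [map_smul, mul_smul_comm, h1, smul_sub]

theorem insertM_act (v : Alg k V) (y : ℤ × (Alg k V × Alg k V))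
    (c : List (ℤ × (Alg k V × Alg k V))) (hc : IsHomogeneousList (leavittGr k V) (y :: c)) :
    insertM leavittDiff leavittCup (fun l => act (shiftPart l) v) (y :: c) =
        y.2.1 * act (shiftPart c) (sg k V y.1 v) -
          lastTerm (fun l t => sgn (sdeg l) • (act (shiftPart l) v * t.2.1)) (y :: c) := by
  simpa using insertM_act_sg v 0 y c hc

theorem insertM_shAct (v : Alg k V) (y : ℤ × (Alg k V × Alg k V))
    (c : List (ℤ × (Alg k V × Alg k V))) (hc : IsHomogeneousList (leavittGr k V) (y :: c)) :
    insertM leavittDiff leavittCup (fun l => shAct (shiftPart l) v) (y :: c) =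
        sgn y.1 • (shiftMap k V y.2.1 * shAct (shiftPart c) (sg k V y.1 v)) -
          lastTerm (fun l t => sgn (sdeg l) • (shAct (shiftPart l) v * t.2.1)) (y :: c) :=
  insertM_shAct_of_act (fun _ _ _ hc => insertM_act _ _ _ hc) y c hc

theorem shAct_shiftMap_append_singleton {y t : ℤ × (Alg k V × Alg k V)}
    (c l : List (ℤ × (Alg k V × Alg k V))) (e : y :: c = l ++ [t])
    (hc : IsHomogeneousList (leavittGr k V) (y :: c)) {v : Alg k V} (hv : v ∈ diag k V) :
    shAct (shiftPart (y :: c)) (shiftMap k V v) =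
      sgn (sdeg (y :: c)) • shiftMap k V (act (shiftPart (y :: c)) v) -
        sgn (sdeg l) • (shiftMap k V (act (shiftPart l) v) * t.2.2) := by
  have := shAct_shiftMap_mul (isHomogeneousList_shiftPart hc) hv 1
  rw [mul_one, splitSum_shiftPart, splitSum_of_length, e, lastTerm_append_singleton] at this
  · rw [e, this]
    simp [shAct_one_singleton, sub_eq_add_neg]
  · rintro a (_ | ⟨p, _ | ⟨q, b⟩⟩) hb
    · simp at hb
    · simp at hb
    · rw [shiftPart_cons, shiftPart_cons, map_one, shAct_one_cons_cons, mul_zero, smul_zero]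

theorem insBrace_leavittDiff {x : ℤ × (Alg k V × Alg k V)} (hx : x.2 ∈ leavittGr k V x.1)
    {c : List (ℤ × (Alg k V × Alg k V))} (hc : IsHomogeneousList (leavittGr k V) c) :
    jacobiSum insBrace [x] (shiftedM leavittDiff leavittCup) c =
      insBrace (x.1 + 1, leavittDiff x) c +
        sgn (x.1 - 1) • insertM leavittDiff leavittCup (insBrace x) c := by
  rcases c with _ | ⟨y, c⟩
  · rw [jacobiSum_nil_right insBrace_nil, insBrace_nil]
    simp [insertM, shiftedM]
  rw [jacobiSum_singleton_cons_of_length]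
  swap
  · rintro (_ | ⟨x, _ | ⟨y, _ | ⟨z, l⟩⟩⟩) hl <;> simp [shiftedM] at hl ⊢
  have hy := (isHomogeneousList_cons _ _ _).1 hc
  obtain ⟨l, t, e⟩ := exists_append_singleton (List.cons_ne_nil y c)
  have G1 := insertM_act x.2.1 y c hc
  have G2 := insertM_shAct x.2.2 y c hc
  have h1 : (insertM leavittDiff leavittCup (insBrace x) (y :: c)).1 =
      insertM leavittDiff leavittCup (fun l => act (shiftPart l) x.2.1) (y :: c) :=
    map_insertM (AddMonoidHom.fst (Alg k V) (Alg k V)) _ _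
  have h2 : (insertM leavittDiff leavittCup (insBrace x) (y :: c)).2 =
      insertM leavittDiff leavittCup (fun l => shAct (shiftPart l) x.2.2) (y :: c) :=
    map_insertM (AddMonoidHom.snd (Alg k V) (Alg k V)) _ _
  rw [e, lastTerm_append_singleton] at G1 G2 ⊢
  rw [← e] at G1 G2 ⊢
  simp only [shiftedM]
  refine Prod.ext ?_ ?_
  · simp only [Prod.fst_add, Prod.smul_fst, h1, G1, leavittDiff_apply, leavittCup_apply, insBrace,
      brElt, map_zero, zero_add]
    rw [sg_of_mem _ hx.1.1, map_zsmul, mul_smul_comm, smul_sub, sgn_smul_sgn_smul,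
      sgn_smul_sgn_smul, sgn_smul_sgn_smul, sub_eq_add_neg _ (sgn _ • _), neg_sgn_smul]
    congr 1
    · congr 1
      apply sgn_congr
      push_cast
      grind
    · congr 1
      apply sgn_congr
      push_cast
      grind
  · simp only [Prod.snd_add, Prod.smul_snd, h2, G2, leavittDiff_apply, leavittCup_apply, insBrace,
      brElt, map_sub, map_zsmul]
    rw [shAct_shiftMap_append_singleton _ _ e hc hx.1.2, shAct_sub_act, sg_of_mem _ hx.1.1,
      sg_of_mem _ hx.2.1]
    simp only [map_zsmul, mul_smul_comm, smul_sub, smul_add, sgn_smul_sgn_smul]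
    have s2 : sgn ((y.1 - 1) * (x.1 - 1) + y.1) = -sgn ((y.1 - 1) * x.1) := by
      rw [neg_sgn]; exact sgn_congr (by push_cast; grind)
    have s3 : sgn (x.1 - 1 + (y.1 + y.1 * (x.1 - 1))) = -sgn ((y.1 - 1) * x.1) := by
      rw [neg_sgn]; exact sgn_congr (by push_cast; grind)
    have s4 : sgn (x.1 - 1 + sdeg l) = -sgn (x.1 + sdeg l) := by
      rw [neg_sgn]; exact sgn_congr (by push_cast; grind)
    rw [s2, s3, s4]
    simp only [neg_smul]
    abel

end LeavittBrace

end Leavitt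

namespace Leavitt

open BInfinityData

variable {k : Type*} [Field k] {V : Type*} [Quiver V] [Fintype V] [Fintype (Quiver.Total V)]

/-! ### The sums over all insertions into a monomial -/

section Monotone

variable {N : Type*} [AddCommMonoid N]

open Classical in
/-- A monotone map out of `Fin (b + 1)` either takes the value `0` at `0`, or avoids `0`. -/
theorem sum_monotone_succ (b p : ℕ) (f : (Fin (b + 1) → Fin (p + 1)) → N) :
    ∑ l ∈ Finset.univ.filter (fun l : Fin (b + 1) → Fin (p + 1) => Monotone l), f l =
      ∑ l ∈ Finset.univ.filter (fun l : Fin (b + 1) → Fin p => Monotone l),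
        f (fun r => (l r).succ) +
      ∑ l ∈ Finset.univ.filter (fun l : Fin b → Fin (p + 1) => Monotone l),
        f (Fin.cons 0 l) := by
  rw [← Finset.sum_filter_add_sum_filter_not _ (fun l => l 0 ≠ 0)]
  congr 1
  · refine (Finset.sum_nbij (fun l r => (l r).succ) ?_ ?_ ?_ ?_).symm
    · intro l hl
      simp only [Finset.mem_filter, Finset.mem_univ, true_and] at hl ⊢
      exact ⟨fun r s h => Fin.succ_le_succ_iff.2 (hl h), Fin.succ_ne_zero _⟩
    · intro l _ l' _ h
      funext r
      exact Fin.succ_injective _ (congrFun h r)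
    · intro l hl
      simp only [Finset.coe_filter, Finset.mem_filter, Finset.mem_univ, true_and,
        Set.mem_ofPred_eq] at hl
      have h0 : ∀ r, l r ≠ 0 := fun r h => hl.2 (Fin.le_zero_iff.1 (h ▸ hl.1 (Fin.zero_le r)))
      refine ⟨fun r => (l r).pred (h0 r), ?_, ?_⟩
      · simp only [Finset.coe_filter, Finset.mem_univ, true_and, Set.mem_ofPred_eq]
        exact fun r s h => Fin.pred_le_pred_iff.2 (hl.1 h)
      · funext r
        simp
    · intro l _
      rfl
  · refine (Finset.sum_nbij (fun l => (Fin.cons 0 l : Fin (b + 1) → Fin (p + 1))) ?_ ?_ ?_ ?_).symm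
    · intro l hl
      simp only [Finset.mem_filter, Finset.mem_univ, true_and] at hl ⊢
      refine ⟨fun r s h => ?_, by simp⟩
      induction r using Fin.cases with
      | zero => simp
      | succ r =>
        induction s using Fin.cases with
        | zero => exact absurd h (by simp)
        | succ s => simpa using hl (Fin.succ_le_succ_iff.1 h)
    · intro l _ l' _ h
      exact Fin.cons_right_injective (α := fun _ => Fin (p + 1)) 0 h
    · intro l hl
      simp only [Finset.coe_filter, Finset.mem_filter, Finset.mem_univ, true_and,
        Set.mem_ofPred_eq, not_not] at hl
      refine ⟨Fin.tail l, ?_, ?_⟩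
      · simp only [Finset.coe_filter, Finset.mem_univ, true_and, Set.mem_ofPred_eq]
        exact fun r s h => hl.1 (Fin.succ_le_succ_iff.2 h)
      · conv_rhs => rw [← Fin.cons_self_tail l, hl.2]
    · intro l _
      rfl

open Classical in
/-- A strictly monotone map out of `Fin (a + 1)` either avoids `0`, or takes the value `0` exactly
at `0`. -/
theorem sum_strictMono_succ (a m : ℕ) (f : (Fin (a + 1) → Fin (m + 1)) → N) :
    ∑ i ∈ Finset.univ.filter (fun i : Fin (a + 1) → Fin (m + 1) => StrictMono i), f i =
      ∑ i ∈ Finset.univ.filter (fun i : Fin (a + 1) → Fin m => StrictMono i),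
        f (fun r => (i r).succ) +
      ∑ i ∈ Finset.univ.filter (fun i : Fin a → Fin m => StrictMono i),
        f (Fin.cons 0 fun r => (i r).succ) := by
  rw [← Finset.sum_filter_add_sum_filter_not _ (fun l => l 0 ≠ 0)]
  congr 1
  · refine (Finset.sum_nbij (fun l r => (l r).succ) ?_ ?_ ?_ ?_).symm
    · intro l hl
      simp only [Finset.mem_filter, Finset.mem_univ, true_and] at hl ⊢
      exact ⟨fun r s h => Fin.succ_lt_succ_iff.2 (hl h), Fin.succ_ne_zero _⟩
    · intro l _ l' _ h
      funext r
      exact Fin.succ_injective _ (congrFun h r)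
    · intro l hl
      simp only [Finset.coe_filter, Finset.mem_filter, Finset.mem_univ, true_and,
        Set.mem_ofPred_eq] at hl
      have h0 : ∀ r, l r ≠ 0 := fun r h =>
        hl.2 (Fin.le_zero_iff.1 (h ▸ hl.1.monotone (Fin.zero_le r)))
      refine ⟨fun r => (l r).pred (h0 r), ?_, ?_⟩
      · simp only [Finset.coe_filter, Finset.mem_univ, true_and, Set.mem_ofPred_eq]
        exact fun r s h => Fin.pred_lt_pred_iff.2 (hl.1 h)
      · funext r
        simp
    · intro l _
      rfl
  · refine (Finset.sum_nbij
      (fun l => (Fin.cons 0 fun r => (l r).succ : Fin (a + 1) → Fin (m + 1))) ?_ ?_ ?_ ?_).symm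
    · intro l hl
      simp only [Finset.mem_filter, Finset.mem_univ, true_and] at hl ⊢
      refine ⟨fun r s h => ?_, by simp⟩
      induction s using Fin.cases with
      | zero => exact absurd h (by simp)
      | succ s =>
        induction r using Fin.cases with
        | zero => simp
        | succ r => simpa using hl (Fin.succ_lt_succ_iff.1 h)
    · intro l _ l' _ h
      funext r
      exact Fin.succ_injective _
        (congrFun (Fin.cons_right_injective (α := fun _ => Fin (m + 1)) 0 h) r)
    · intro l hl
      simp only [Finset.coe_filter, Finset.mem_filter, Finset.mem_univ, true_and,
        Set.mem_ofPred_eq, not_not] at hl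
      have h0 : ∀ r : Fin a, l r.succ ≠ 0 := fun r h => by
        have := hl.1 (Fin.succ_pos r)
        rw [h] at this
        simp at this
      refine ⟨fun r => (l r.succ).pred (h0 r), ?_, ?_⟩
      · simp only [Finset.coe_filter, Finset.mem_univ, true_and, Set.mem_ofPred_eq]
        exact fun r s h => Fin.pred_lt_pred_iff.2 (hl.1 (Fin.succ_lt_succ_iff.2 h))
      · funext r
        induction r using Fin.cases with
        | zero => simp [hl.2]
        | succ r => simp
    · intro l _
      rfl

end Monotone

section InsertionSum

open Classical in
/-- The sum of all insertions of `w₀, w₁, …` into `β₀^* β₁^* ⋯`. -/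
def ghoInsertion {p b : ℕ} (β : Fin p → Quiver.Total V) (w : Fin b → ℤ × Alg k V) : Alg k V :=
  ∑ l ∈ Finset.univ.filter (fun l : Fin b → Fin p => Monotone l),
    sgn (∑ r, (w r).1 * ((p : ℤ) - (l r : ℕ))) •
      (List.ofFn fun t : Fin p => (((List.finRange b).filter fun r => l r = t).map fun r =>
        (w r).2).prod * gho k (β t)).prod

open Classical in
/-- The sum of all insertions of `…, w₁, w₀` into `⋯ α₁ α₀`. -/
def arrInsertion {m a : ℕ} (α : Fin m → Quiver.Total V) (w : Fin a → ℤ × Alg k V) : Alg k V :=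
  ∑ i ∈ Finset.univ.filter (fun i : Fin a → Fin m => StrictMono i),
    sgn ((a : ℤ) + ∑ r, (w r).1 * ((i r : ℕ) : ℤ)) •
      (List.ofFn fun t : Fin m => arr k (α t) * (((List.finRange a).filter fun r => i r = t).map
        fun r => (w r).2).prod).reverse.prod

theorem ghoInsertion_zero {p : ℕ} (β : Fin p → Quiver.Total V) (w : Fin 0 → ℤ × Alg k V) :
    ghoInsertion β w = (List.ofFn fun t => gho k (β t)).prod := by
  classical
  rw [ghoInsertion, Finset.filter_true_of_mem fun l _ => Subsingleton.monotone l]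
  simp [sgn_zero]

theorem arrInsertion_zero {m : ℕ} (α : Fin m → Quiver.Total V) (w : Fin 0 → ℤ × Alg k V) :
    arrInsertion α w = (List.ofFn fun t => arr k (α t)).reverse.prod := by
  classical
  rw [arrInsertion, Finset.filter_true_of_mem fun l _ => Subsingleton.strictMono l]
  simp [sgn_zero]

theorem ghoInsertion_succ {p b : ℕ} (β : Fin (p + 1) → Quiver.Total V)
    (w : Fin (b + 1) → ℤ × Alg k V) : ghoInsertion β w =
      gho k (β 0) * ghoInsertion (fun t => β t.succ) w +
      sgn ((w 0).1 * (p + 1)) • ((w 0).2 * ghoInsertion β (fun r => w r.succ)) := by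
  classical
  rw [ghoInsertion, sum_monotone_succ, ghoInsertion, ghoInsertion, Finset.mul_sum, Finset.mul_sum,
    Finset.smul_sum]
  congr 1
  · refine Finset.sum_congr rfl fun l _ => ?_
    rw [mul_smul_comm]
    congr 1
    · apply sgn_congr
      push_cast
      refine Finset.sum_congr rfl fun r _ => ?_
      simp
    · rw [List.ofFn_succ, List.prod_cons]
      simp
  · refine Finset.sum_congr rfl fun l _ => ?_
    rw [mul_smul_comm, sgn_smul_sgn_smul]
    congr 1
    · apply sgn_congr
      rw [Fin.sum_univ_succ]
      simp
    · rw [List.ofFn_succ, List.prod_cons, List.ofFn_succ, List.prod_cons, ← mul_assoc, ← mul_assoc]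
      simp [List.finRange_succ, List.filter_map, List.map_map, Function.comp_def, mul_assoc,
        (Fin.succ_ne_zero _).symm]

theorem arrInsertion_succ {m a : ℕ} (α : Fin (m + 1) → Quiver.Total V)
    (w : Fin (a + 1) → ℤ × Alg k V) : arrInsertion α w =
      sgn (∑ r, (w r).1) • (arrInsertion (fun t => α t.succ) w * arr k (α 0)) -
      sgn (∑ r : Fin a, (w r.succ).1) •
        (arrInsertion (fun t => α t.succ) (fun r => w r.succ) * (arr k (α 0) * (w 0).2)) := by
  classical
  rw [arrInsertion, sum_strictMono_succ, arrInsertion, arrInsertion, Finset.sum_mul, Finset.sum_mul,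
    Finset.smul_sum, Finset.smul_sum, sub_eq_add_neg, ← Finset.sum_neg_distrib]
  congr 1
  · refine Finset.sum_congr rfl fun l _ => ?_
    rw [smul_mul_assoc, sgn_smul_sgn_smul]
    congr 1
    · apply sgn_congr
      simp only [Fin.val_succ]
      push_cast
      simp only [mul_add, Finset.sum_add_distrib]
      ring_nf
    · rw [List.ofFn_succ, List.reverse_cons, List.prod_append, List.prod_singleton]
      simp
  · refine Finset.sum_congr rfl fun l _ => ?_
    rw [smul_mul_assoc, sgn_smul_sgn_smul, neg_sgn_smul]
    congr 1
    · apply sgn_congr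
      rw [Fin.sum_univ_succ]
      simp only [Fin.cons_zero, Fin.cons_succ, Fin.val_succ]
      push_cast
      simp only [mul_add, Finset.sum_add_distrib, Fin.val_zero]
      push_cast
      ring_nf
    · rw [List.ofFn_succ, List.reverse_cons, List.prod_append, List.prod_singleton]
      simp [List.finRange_succ, List.filter_map, List.map_map, Function.comp_def,
        Fin.succ_ne_zero, (Fin.succ_ne_zero _).symm]

theorem act_prod_gho {p b : ℕ} (β : Fin p → Quiver.Total V) (w : Fin b → ℤ × Alg k V)
    (hw : ∀ r, (w r).2 ∈ diagGr k V (w r).1) :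
    act (List.ofFn w) (List.ofFn fun t => gho k (β t)).prod = ghoInsertion β w := by
  classical
  induction p generalizing b with
  | zero =>
    rcases b with _ | b
    · simp [ghoInsertion_zero]
    · simp only [List.ofFn_zero, List.prod_nil]
      rw [act_one (by simp), ghoInsertion, Finset.univ_eq_empty]
      simp
  | succ p ih =>
    induction b with
    | zero => simp [ghoInsertion_zero]
    | succ b ih' =>
      have hd : ∀ x ∈ List.ofFn w, x.2 ∈ diag k V := fun x hx => by
        obtain ⟨r, rfl⟩ := (List.mem_ofFn' _ _).1 hx
        exact (hw r).2
      have hm : (List.ofFn fun t => gho k (β t)).prod ∈ gr k V (-(p + 1 : ℕ)) := by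
        have : ∀ (q : ℕ) (β : Fin q → Quiver.Total V),
            (List.ofFn fun t => gho k (β t)).prod ∈ gr k V (-(q : ℤ)) := by
          intro q
          induction q with
          | zero => intro β; simpa using one_mem_gr
          | succ q ih =>
            intro β
            rw [List.ofFn_succ, List.prod_cons]
            exact mem_gr_congr (mul_mem_gr (gho_mem_gr _) (ih _)) (by push_cast; ring)
        exact this _ β
      rw [ghoInsertion_succ, ← ih _ w hw, ← ih' _ fun r => hw r.succ]
      have key := shAct_gho_mul hd (β 0) (List.ofFn fun t : Fin p => gho k (β t.succ)).prod
      rw [← List.prod_cons, ← List.ofFn_succ (f := fun t => gho k (β t)), List.ofFn_succ (f := w),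
        shAct_cons_apply, sub_eq_iff_eq_add, sg_of_mem _ hm, map_zsmul, mul_smul_comm] at key
      rw [List.ofFn_succ (f := w), key]
      congr 2
      apply sgn_congr
      push_cast
      grind

theorem prod_arr_mem_gr {m : ℕ} (α : Fin m → Quiver.Total V) :
    (List.ofFn fun t => arr k (α t)).reverse.prod ∈ gr k V m := by
  induction m with
  | zero => simpa using one_mem_gr
  | succ m ih =>
    rw [List.ofFn_succ, List.reverse_cons, List.prod_append, List.prod_singleton]
    exact mem_gr_congr (mul_mem_gr (ih _) (arr_mem_gr _)) (by push_cast; ring)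

theorem totalDeg_ofFn_reverse {b : ℕ} (w : Fin b → ℤ × Alg k V) :
    totalDeg (List.ofFn w).reverse = ∑ r, (w r).1 := by
  rw [totalDeg, List.map_reverse, List.sum_reverse, List.map_ofFn, List.sum_ofFn]
  rfl

theorem act_prod_arr {m a : ℕ} (α : Fin m → Quiver.Total V) (w : Fin a → ℤ × Alg k V)
    (hw : ∀ r, (w r).2 ∈ diagGr k V (w r).1) :
    act (List.ofFn w).reverse (List.ofFn fun t => arr k (α t)).reverse.prod =
      arrInsertion α w := by
  classical
  induction m generalizing a with
  | zero =>
    rcases a with _ | a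
    · simp [arrInsertion_zero]
    · simp only [List.ofFn_zero, List.reverse_nil, List.prod_nil]
      rw [act_one (by simp), arrInsertion, Finset.univ_eq_empty]
      simp
  | succ m ih =>
    rcases a with _ | a
    · simp [arrInsertion_zero]
    · rw [arrInsertion_succ, ← ih _ w hw, ← ih _ (fun r => w r.succ) fun r => hw r.succ,
        List.ofFn_succ (f := fun t => arr k (α t)), List.reverse_cons, List.prod_append,
        List.prod_singleton, act_mul, splitSum_of_length]
      · conv_lhs => rw [List.ofFn_succ, List.reverse_cons, lastTerm_append_singleton, sg_arr,
          sg_arr, map_zsmul, map_zsmul, act_arr_singleton (hw 0).2, ← List.reverse_cons,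
          ← List.ofFn_succ]
        rw [act_nil_apply, totalDeg_ofFn_reverse, totalDeg_ofFn_reverse]
        simp only [mul_smul_comm, mul_neg, smul_neg, sub_eq_add_neg]
      · rintro x (_ | ⟨y, _ | ⟨z, l⟩⟩) hl
        · simp at hl
        · simp at hl
        · rw [sg_arr, map_zsmul, act_arr_cons_cons, smul_zero, mul_zero]

theorem list_coe_eq_map {n : ℕ} (l : List (Fin n)) :
    (do let a ← l; pure (a : ℕ)) = l.map Fin.val := by
  induction l with
  | nil => rfl
  | cons a l ih => simp_all

theorem insertionSum_eq {p m : ℕ} (β : Fin p → Quiver.Total V) (α : Fin m → Quiver.Total V)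
    (us : List (ℤ × Alg k V)) : insertionSum β α us =
      ∑ ab ∈ Finset.HasAntidiagonal.antidiagonal us.length,
        sgn (m * ∑ r : Fin ab.2, (us.getD r 0).1) •
          (ghoInsertion β (fun r : Fin ab.2 => us.getD r 0) *
            arrInsertion α (fun r : Fin ab.1 => us.getD (us.length - 1 - r) 0)) := by
  classical
  rw [insertionSum]
  refine Finset.sum_congr rfl fun ab _ => ?_
  rw [ghoInsertion, arrInsertion, Finset.sum_mul_sum, Finset.smul_sum, Finset.sum_comm]
  refine Finset.sum_congr rfl fun l _ => ?_
  rw [Finset.smul_sum]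
  refine Finset.sum_congr rfl fun i _ => ?_
  rw [smul_mul_smul_comm, ← sgn_add, sgn_smul_sgn_smul]
  simp only [list_coe_eq_map, List.map_map, Function.comp_def]
  congr 1
  apply sgn_congr
  push_cast
  rw [Finset.mul_sum, ← add_assoc, ← add_assoc]
  congr 1
  rw [add_comm (ab.1 : ZMod 2), ← Finset.sum_add_distrib]
  congr 1
  refine Finset.sum_congr rfl fun r _ => ?_
  ring

/-- On monomials the insertion operators are given by the explicit sums: by the product rule, the
elements are distributed over the ghost part and the real part, and each part is computed letter by
letter. -/
theorem act_monomial {us : List (ℤ × Alg k V)} (hus : IsHomogeneousList (diagGr k V) us)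
    {p m : ℕ} (β : Fin p → Quiver.Total V) (α : Fin m → Quiver.Total V) :
    act us (monomial β α) = insertionSum β α us := by
  rw [insertionSum_eq, monomial, act_mul, splitSum_eq_sum,
    ← Finset.Nat.sum_antidiagonal_swap, Finset.Nat.sum_antidiagonal_eq_sum_range_succ_mk]
  refine Finset.sum_congr rfl fun b hb => ?_
  have hb : b ≤ us.length := Nat.lt_succ_iff.1 (Finset.mem_range.1 hb)
  simp only [Prod.swap]
  have e1 : List.ofFn (fun r : Fin b => us.getD r 0) = us.take b := by
    refine List.ext_getElem (by simp [hb]) fun i h1 h2 => ?_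
    simp at h1
    simp [List.getD_eq_getElem?_getD, List.getElem?_eq_getElem (show i < us.length by omega)]
  have e2 : (List.ofFn (fun r : Fin (us.length - b) => us.getD (us.length - 1 - r) 0)).reverse =
      us.drop b := by
    refine List.ext_getElem (by simp) fun i h1 h2 => ?_
    simp at h1
    rw [List.getElem_reverse, List.getElem_ofFn, List.getElem_drop]
    simp only [List.length_ofFn]
    rw [List.getD_eq_getElem _ _ (by omega)]
    congr 1
    omega
  have hm : ∀ n, n < us.length → (us.getD n 0).2 ∈ diagGr k V (us.getD n 0).1 := fun n hn => by
    rw [List.getD_eq_getElem _ _ hn]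
    exact hus _ (List.getElem_mem hn)
  rw [← act_prod_gho _ _ fun r => hm _ (by omega), ← act_prod_arr _ _ fun r => hm _ (by omega), e1,
    e2, sg_of_mem _ (prod_arr_mem_gr α), map_zsmul, mul_smul_comm]
  congr 2
  rw [← e1, totalDeg, List.map_ofFn, List.sum_ofFn, mul_comm]
  rfl

/-- The monomials `β₁^* ⋯ β_p^* α_m ⋯ α₁` span `L`. -/
theorem span_monomial : Submodule.span k {x : Alg k V | ∃ (p m : ℕ) (β : Fin p → Quiver.Total V)
    (α : Fin m → Quiver.Total V), x = monomial β α} = ⊤ := by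
  classical
  have hmem : ∀ bs as : List (Quiver.Total V), (bs.map (gho k)).prod * (as.map (arr k)).prod ∈
      Submodule.span k {x : Alg k V | ∃ (p m : ℕ) (β : Fin p → Quiver.Total V)
        (α : Fin m → Quiver.Total V), x = monomial β α} := by
    intro bs as
    refine Submodule.subset_span ⟨_, _, bs.get, as.reverse.get, ?_⟩
    have e : ∀ (f : Quiver.Total V → Alg k V) (l : List (Quiver.Total V)),
        List.ofFn (fun t => f (l.get t)) = l.map f := fun f l => by
      refine List.ext_getElem (by simp) fun i h1 h2 => by simp
    rw [monomial, e, e, List.map_reverse, List.reverse_reverse]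
  have hspan : ∀ x : Alg k V, x ∈ Submodule.span k {x : Alg k V | ∃ bs as : List (Quiver.Total V),
      x = (bs.map (gho k)).prod * (as.map (arr k)).prod} := by
    have he : ∀ (i : V) (bs as : List (Quiver.Total V)),
        e k i * ((bs.map (gho k)).prod * (as.map (arr k)).prod) ∈
        Submodule.span k {x : Alg k V | ∃ bs as : List (Quiver.Total V),
          x = (bs.map (gho k)).prod * (as.map (arr k)).prod} := by
      intro i bs as
      rcases bs with _ | ⟨β, bs⟩
      · rcases as with _ | ⟨α, as⟩
        · simp only [List.map_nil, List.prod_nil, mul_one]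
          rw [← sum_filter_gho_mul_arr]
          exact Submodule.sum_mem _ fun α _ => Submodule.subset_span ⟨[α], [α], by simp⟩
        · simp only [List.map_nil, List.prod_nil, one_mul, List.map_cons, List.prod_cons]
          rw [← e_mul_arr_self, ← mul_assoc, ← mul_assoc]
          by_cases h : i = α.right
          · rw [h, e_mul_self, e_mul_arr_self]
            exact Submodule.subset_span ⟨[], α :: as, by simp⟩
          · rw [e_mul_ne h]
            simp
      · rw [List.map_cons, List.prod_cons, ← mul_assoc, ← mul_assoc, e_mul_gho]
        split_ifs
        · exact Submodule.subset_span ⟨β :: bs, as, by simp⟩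
        · simp
    intro x
    refine induction_arr_gho (P := fun x => x ∈ Submodule.span k {x : Alg k V |
      ∃ bs as : List (Quiver.Total V), x = (bs.map (gho k)).prod * (as.map (arr k)).prod})
      (Submodule.subset_span ⟨[], [], by simp⟩) ?_ ?_ (fun _ _ => add_mem)
      (fun c _ => Submodule.smul_mem _ c) x
    · intro α z hz
      induction hz using Submodule.span_induction with
      | mem z hz =>
        obtain ⟨bs, as, rfl⟩ := hz
        rcases bs with _ | ⟨β, bs⟩
        · exact Submodule.subset_span ⟨[], α :: as, by simp⟩
        · rw [List.map_cons, List.prod_cons, ← mul_assoc, ← mul_assoc, arr_mul_gho]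
          split_ifs
          · rw [mul_assoc]
            exact he _ _ _
          · simp
      | zero => simp
      | add y z _ _ hy hz => rw [mul_add]; exact add_mem hy hz
      | smul c z _ hz => rw [mul_smul_comm]; exact Submodule.smul_mem _ c hz
    · intro β z hz
      induction hz using Submodule.span_induction with
      | mem z hz =>
        obtain ⟨bs, as, rfl⟩ := hz
        exact Submodule.subset_span ⟨β :: bs, as, by simp [mul_assoc]⟩
      | zero => simp
      | add y z _ _ hy hz => rw [mul_add]; exact add_mem hy hz
      | smul c z _ hz => rw [mul_smul_comm]; exact Submodule.smul_mem _ c hz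
  rw [eq_top_iff]
  rintro x -
  refine Submodule.span_le.2 ?_ (hspan x)
  rintro _ ⟨bs, as, rfl⟩
  exact hmem bs as

theorem isBrace_act {us : List (ℤ × Alg k V)} (hus : IsHomogeneousList (diagGr k V) us) :
    IsBrace us (act us) := fun _ _ β α => act_monomial hus β α

theorem isShiftedBrace_shAct {us : List (ℤ × Alg k V)}
    (hus : IsHomogeneousList (diagGr k V) us) : IsShiftedBrace us (shAct us) :=
  fun β₀ _ _ β α => by
    rw [shAct_gho_mul fun x hx => (hus x hx).2, act_monomial hus]

theorem IsBrace.unique {us : List (ℤ × Alg k V)} {S T : Alg k V →ₗ[k] Alg k V} (hS : IsBrace us S)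
    (hT : IsBrace us T) : S = T := by
  refine LinearMap.ext_on span_monomial ?_
  rintro _ ⟨p, m, β, α, rfl⟩
  rw [hS, hT]

theorem IsShiftedBrace.unique {us : List (ℤ × Alg k V)} {S T : Alg k V →ₗ[k] Alg k V}
    (hS : IsShiftedBrace us S) (hT : IsShiftedBrace us T) : S = T := by
  have h : ∀ β₀, S.comp (LinearMap.mulLeft k (gho k β₀)) =
      T.comp (LinearMap.mulLeft k (gho k β₀)) := fun β₀ => by
    refine LinearMap.ext_on span_monomial ?_
    rintro _ ⟨p, m, β, α, rfl⟩
    exact (hS β₀ p m β α).trans (hT β₀ p m β α).symm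
  ext z
  rw [← sum_gho_mul_arr_mul z, map_sum, map_sum]
  exact Finset.sum_congr rfl fun β _ => congrArg (fun f => f (arr k β * z)) (h β)

theorem brace_eq_act {us : List (ℤ × Alg k V)} (hus : IsHomogeneousList (diagGr k V) us) :
    brace us = act us :=
  (Classical.epsilon_spec ⟨_, isBrace_act hus⟩ : IsBrace us (brace us)).unique (isBrace_act hus)

theorem shiftedBrace_eq_shAct {us : List (ℤ × Alg k V)}
    (hus : IsHomogeneousList (diagGr k V) us) : shiftedBrace us = shAct us :=
  (Classical.epsilon_spec ⟨_, isShiftedBrace_shAct hus⟩ :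
    IsShiftedBrace us (shiftedBrace us)).unique (isShiftedBrace_shAct hus)

theorem leavittBrace_eq (x : ℤ × (Alg k V × Alg k V)) {c : List (ℤ × (Alg k V × Alg k V))}
    (hc : IsHomogeneousList (leavittGr k V) c) : leavittBrace x c = insBrace x c := by
  have hc' := isHomogeneousList_shiftPart hc
  rcases c with _ | ⟨y, c⟩
  · rw [insBrace_nil]
    rfl
  · change (brace (shiftPart (y :: c)) x.2.1, shiftedBrace (shiftPart (y :: c)) x.2.2) = _
    rw [brace_eq_act hc', shiftedBrace_eq_shAct hc']
    rfl

end InsertionSum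

end Leavitt

namespace Leavitt

open BInfinityData

variable {k : Type*} [Field k] {V : Type*} [Quiver V] [Fintype V] [Fintype (Quiver.Total V)]

section LeavittAlgebra

theorem insBrace_add_right (x : ℤ × (Alg k V × Alg k V)) (l l' : List (ℤ × (Alg k V × Alg k V)))
    (d : ℤ) (y z : Alg k V × Alg k V) : insBrace x (l ++ (d, y + z) :: l') =
      insBrace x (l ++ (d, y) :: l') + insBrace x (l ++ (d, z) :: l') := by
  simp only [insBrace, shiftPart_append, shiftPart_cons, Prod.snd_add, act_add, shAct_add,
    LinearMap.add_apply, Prod.mk_add_mk]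

theorem insBrace_smul_right (x : ℤ × (Alg k V × Alg k V)) (l l' : List (ℤ × (Alg k V × Alg k V)))
    (d : ℤ) (a : k) (y : Alg k V × Alg k V) :
    insBrace x (l ++ (d, a • y) :: l') = a • insBrace x (l ++ (d, y) :: l') := by
  simp only [insBrace, shiftPart_append, shiftPart_cons, Prod.smul_snd, act_smul, shAct_smul,
    LinearMap.smul_apply, Prod.smul_mk]

variable (k V) in
/-- The Leavitt complex is a brace algebra. -/
theorem isBraceAlgebra_leavitt :
    IsBraceAlgebra (leavittGr k V) leavittDiff leavittCup leavittBrace where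
  dif_mem d x hx := leavittDiff_mem (d, x) hx
  dif_add d x _ y _ := by
    simp only [leavittDiff_apply, Prod.fst_add, map_add, smul_add, Prod.mk_add_mk, add_zero]
    rw [add_sub_add_comm]
  dif_smul d c x _ := by
    simp only [leavittDiff_apply, Prod.smul_fst, map_smul, Prod.smul_mk, smul_zero, smul_sub]
    rw [smul_comm c]
  mul_mem d e x hx y hy := leavittCup_mem (d, x) (e, y) hx hy
  add_mul d e x _ x' _ y _ := by
    simp only [leavittCup_apply, Prod.fst_add, Prod.snd_add, map_add, add_mul, Prod.mk_add_mk,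
      add_add_add_comm]
  mul_add d e x _ y _ y' _ := by
    simp only [leavittCup_apply, Prod.fst_add, Prod.snd_add, mul_add, Prod.mk_add_mk,
      add_add_add_comm]
  smul_mul d e c x _ y _ := by
    simp only [leavittCup_apply, Prod.smul_fst, Prod.smul_snd, map_smul, smul_mul_assoc,
      Prod.smul_mk, smul_add]
  mul_smul d e c x _ y _ := by
    simp only [leavittCup_apply, Prod.smul_fst, Prod.smul_snd, mul_smul_comm,
      Prod.smul_mk, smul_add]
  br_mem x c hx hc := by
    rw [leavittBrace_eq x hc]
    exact insBrace_mem x c hx hc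
  br_add_left d c x _ y _ hc := by
    simp only [leavittBrace_eq _ hc, insBrace, Prod.fst_add, Prod.snd_add, map_add, Prod.mk_add_mk]
  br_smul_left d c a x _ hc := by
    simp only [leavittBrace_eq _ hc, insBrace, Prod.smul_fst, Prod.smul_snd, map_smul,
      Prod.smul_mk]
  br_add_right x l l' d y z _ hl hl' hy hz := by
    rw [leavittBrace_eq, leavittBrace_eq, leavittBrace_eq, insBrace_add_right] <;>
      simp only [isHomogeneousList_append, isHomogeneousList_cons]
    · exact ⟨hl, hz, hl'⟩
    · exact ⟨hl, hy, hl'⟩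
    · exact ⟨hl, add_mem hy hz, hl'⟩
  br_smul_right x l l' d a y _ hl hl' hy := by
    rw [leavittBrace_eq, leavittBrace_eq, insBrace_smul_right] <;>
      simp only [isHomogeneousList_append, isHomogeneousList_cons]
    · exact ⟨hl, hy, hl'⟩
    · exact ⟨hl, Submodule.smul_mem _ a hy, hl'⟩
  br_nil x _ := rfl
  dif_dif d x _ := leavittDiff_leavittDiff (d, x) (d + 1)
  dif_mul d e x hx y _ := leavittDiff_leavittCup (x := (d, x)) (y := (e, y)) hx.1
  mul_assoc d e f x hx y _ z _ := leavittCup_assoc (x := (d, x)) (y := (e, y)) hx.1.2 (f, z) _ _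
  br_br x b c _ hb hc := by
    rw [jacobiSum_congr_br hb hc fun x c _ hc => leavittBrace_eq x hc, leavittBrace_eq _ hc,
      brElt, leavittBrace_eq x hb, jacobiSum_congr (gr := leavittGr k V) insBrace_mem hb hc
      fun l hl _ _ => leavittBrace_eq x hl]
    exact insBrace_insBrace x b c hb hc
  br_dif x c hx hc := by
    rw [jacobiSum_congr_br (by simpa using hx) hc fun x c _ hc => leavittBrace_eq x hc,
      leavittBrace_eq _ hc, insertM_congr (gr := leavittGr k V) leavittDiff_mem leavittCup_mem hc
      fun l _ hl => leavittBrace_eq x hl]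
    exact insBrace_leavittDiff hx hc
  br_mul x y c hx hy hc := by
    rw [jacobiSum_congr_br (gr := leavittGr k V) (by simpa using ⟨hx, hy⟩) hc
      fun x c _ hc => leavittBrace_eq x hc, leavittBrace_eq _ hc]
    exact insBrace_leavittCup hx hy hc

end LeavittAlgebra

end Leavitt

/-! ### Iterated insertions -/

section SplitMore

variable {X N : Type*} [AddCommGroup N]

/-- The splittings of `p ++ a :: l` are those which cut `p` and those which cut `l`. -/
theorem splitSum_append_cons (f : List X → List X → N) (p : List X) (a : X) (l : List X) :
    splitSum f (p ++ a :: l) = splitSum (fun x y => f x (y ++ a :: l)) p +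
      splitSum (fun x y => f (p ++ a :: x) y) l := by
  induction p generalizing f with
  | nil => rfl
  | cons b p ih => simp only [List.cons_append, splitSum_cons, ih, add_assoc]

theorem splitSum_assoc' (f : List X → List X → List X → List X → N) (l : List X) :
    splitSum (fun x y => splitSum (fun x₁ x₂ => f x x₁ x₂ y) x) l =
      splitSum (fun x y => splitSum (fun y₁ y₂ => f (x ++ y₁) x y₁ y₂) y) l := by
  rw [← splitSum_assoc fun x₁ x₂ y => f (x₁ ++ x₂) x₁ x₂ y]
  refine splitSum_congr fun x y _ => splitSum_congr fun x₁ x₂ h => ?_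
  rw [h]

end SplitMore

namespace BInfinityData

variable {M M' N : Type*} [AddCommGroup M] [AddCommGroup N]
  {ev : ℤ × M' → List (ℤ × M) → M}

omit [AddCommGroup M] in
/-- A linear combination of functions can be taken out of `jacobiSum`. -/
theorem jacobiSum_splitSum_fun {X : Type*} (c : List (ℤ × M'))
    (f : List X → List X → List (ℤ × M) → N) (m : List X) (l : List (ℤ × M)) :
    jacobiSum ev c (fun l' => splitSum (fun u w => f u w l') m) l =
      splitSum (fun u w => jacobiSum ev c (f u w) l) m := by
  induction m generalizing f with
  | nil => rfl
  | cons a m ih => simp only [splitSum_cons, jacobiSum_add, ih]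

omit [AddCommGroup M] in
/-- Cutting the result of an insertion into two parts: the insertion is cut accordingly. -/
theorem jacobiSum_splitSum (c : List (ℤ × M')) (f : List (ℤ × M) → List (ℤ × M) → N)
    (l : List (ℤ × M)) :
    jacobiSum ev c (splitSum f) l = splitSum (fun c₁ c₂ => splitSum (fun l₁ l₂ =>
      sgn (sdeg l₁ * sdeg c₂) •
        jacobiSum ev c₁ (fun u => jacobiSum ev c₂ (f u) l₂) l₁) l) c := by
  induction c generalizing f l with
  | nil => simp [sgn_zero, jacobiSum_nil]
  | cons x c ih =>
    rw [splitSum_cons]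
    conv_lhs => rw [jacobiSum]
    simp only [splitSum_append_cons, jacobiSum_add, smul_add, splitSum_add, jacobiSum_nil]
    congr 1
    · simp only [jacobiSum_splitSum_fun, smul_splitSum]
      simp only [jacobiSum, smul_splitSum]
      refine Eq.trans ?_ (splitSum_assoc _ _)
      refine splitSum_congr fun p l' _ => ?_
      refine (splitSum_comm _ _ _).trans ?_
      refine splitSum_congr fun p₁ p₂ hp => splitSum_congr fun q r _ => ?_
      subst hp
      simp only [sgn_smul_sgn_smul]
      congr 1
      apply sgn_congr
      simp only [sdeg_append]
      push_cast
      ring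
    · refine Eq.trans ?_ (splitSum_comm (fun l₁ l₂ c₁ c₂ => sgn (sdeg l₁ * sdeg c₂) •
        jacobiSum ev (x :: c₁) (fun u => jacobiSum ev c₂ (f u) l₂) l₁) l c)
      simp only [ih, smul_splitSum]
      simp only [jacobiSum, smul_splitSum]
      refine Eq.trans ?_ (splitSum_congr fun l₁ l₂ _ => splitSum_comm _ l₁ c)
      refine Eq.trans ?_ (splitSum_assoc' _ _).symm
      refine splitSum_congr fun p l' _ => ?_
      refine Eq.trans ?_ (splitSum_congr fun y₁ y₂ _ => splitSum_comm _ _ _)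
      refine Eq.trans ?_ (splitSum_assoc' _ _).symm
      refine splitSum_congr fun q r _ => ?_
      refine (splitSum_comm _ _ _).trans ?_
      refine splitSum_congr fun r₁ r₂ _ => splitSum_congr fun c₁ c₂ hc => ?_
      subst hc
      simp only [sgn_smul_sgn_smul]
      congr 1
      apply sgn_congr
      simp only [sdeg_append, sdeg_cons]
      push_cast
      ring

omit [AddCommGroup M] in
/-- Isolating one of the inserted operations. -/
theorem jacobiSum_append_cons (c₀ : List (ℤ × M')) (y : ℤ × M') (c : List (ℤ × M'))
    (F : List (ℤ × M) → N) (l : List (ℤ × M)) :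
    jacobiSum ev (c₀ ++ y :: c) F l = splitSum (fun l₀ l' => splitSum (fun l₁ l₂ =>
      sgn (sdeg l₀ * sdeg (y :: c) + sdeg l₁ * sdeg c) • jacobiSum ev c₀ (fun u =>
        jacobiSum ev c (fun w => F (u ++ brElt ev y l₁ :: w)) l₂) l₀) l') l := by
  induction c₀ generalizing F l with
  | nil => simp only [List.nil_append, jacobiSum, smul_splitSum, sgn_smul_sgn_smul]
  | cons z c₀ ih =>
    rw [List.cons_append]
    simp only [jacobiSum, ih, smul_splitSum]
    refine Eq.trans ?_ (splitSum_congr fun l₁ l₂ _ => splitSum_comm _ _ _)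
    refine Eq.trans ?_ (splitSum_assoc' _ _).symm
    refine splitSum_congr fun p l' _ => ?_
    refine Eq.trans ?_ (splitSum_congr fun l₁ l₂ _ => splitSum_comm _ _ _)
    refine Eq.trans ?_ (splitSum_assoc' _ _).symm
    refine splitSum_congr fun q r _ => splitSum_congr fun r₀ r' _ =>
      splitSum_congr fun r₁ r₂ _ => ?_
    simp only [sgn_smul_sgn_smul, List.append_assoc, List.cons_append]
    congr 1
    apply sgn_congr
    simp only [sdeg_append, sdeg_cons]
    push_cast
    ring

omit [AddCommGroup M] in
/-- Insertions of independent operations can be interchanged. -/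
theorem jacobiSum_jacobiSum_comm {P Q : Type*} [AddCommGroup P] [AddCommGroup Q]
    {br : ℤ × Q → List (ℤ × P) → P} (c : List (ℤ × M')) (b : List (ℤ × Q))
    (f : List (ℤ × M) → List (ℤ × P) → N) (l : List (ℤ × M)) (m : List (ℤ × P)) :
    jacobiSum ev c (fun u => jacobiSum br b (f u) m) l =
      jacobiSum br b (fun w => jacobiSum ev c (fun u => f u w) l) m := by
  have h := map_jacobiSum (AddMonoidHom.mk' (fun F : List (ℤ × M) → N => jacobiSum ev c F l)
    fun F G => jacobiSum_add c F G l) (br := br) b (fun w u => f u w) m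
  refine Eq.trans ?_ h
  refine congrArg (fun F => jacobiSum ev c F l) (funext fun u => ?_)
  exact (map_jacobiSum (Pi.evalAddMonoidHom (fun _ => N) u) (br := br) b (fun w u => f u w) m).symm

/-- The pre-Jacobi identity: if `br x c` is the operation obtained by inserting the operations `c`
into `x`, then inserting first the `b`'s and then the `c`'s is the same as inserting the operations
which are obtained by inserting some of the `c`'s into the `b`'s. -/
theorem jacobiSum_jacobiSum {k : Type*} [Field k] [AddCommGroup M'] [Module k M] [Module k M']
    {gr : ℤ → Submodule k M} {gr' : ℤ → Submodule k M'} {br : ℤ × M' → List (ℤ × M') → M'}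
    (hev : ∀ x l, x.2 ∈ gr' x.1 → IsHomogeneousList gr l → ev x l ∈ gr (x.1 + sdeg l))
    (hbm : ∀ x c, x.2 ∈ gr' x.1 → IsHomogeneousList gr' c → br x c ∈ gr' (x.1 + sdeg c))
    (hbr : ∀ x c l, x.2 ∈ gr' x.1 → IsHomogeneousList gr' c → IsHomogeneousList gr l →
      ev (brElt br x c) l = jacobiSum ev c (ev x) l)
    {F : List (ℤ × M) → N}
    (hF : ∀ l l' d x y, F (l ++ (d, x + y) :: l') = F (l ++ (d, x) :: l') + F (l ++ (d, y) :: l'))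
    {b c : List (ℤ × M')} {l : List (ℤ × M)} (hb : IsHomogeneousList gr' b)
    (hc : IsHomogeneousList gr' c) (hl : IsHomogeneousList gr l) :
    jacobiSum ev c (jacobiSum ev b F) l = jacobiSum br b (fun c' => jacobiSum ev c' F l) c := by
  induction b generalizing c l F with
  | nil => rfl
  | cons x b ih =>
    have e0 : jacobiSum ev (x :: b) F = splitSum (fun p l' => splitSum (fun q r =>
        sgn (sdeg p * sdeg (x :: b)) • sgn (sdeg q * sdeg b) •
          jacobiSum ev b (fun m => F (p ++ brElt ev x q :: m)) r) l') := by
      funext l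
      simp only [jacobiSum, smul_splitSum]
    rw [e0, jacobiSum_splitSum]
    conv_rhs => rw [jacobiSum]
    refine splitSum_congr fun c₀ c' h₀ => ?_
    subst h₀
    simp only [jacobiSum_splitSum, jacobiSum_append_cons, jacobiSum_splitSum_fun, smul_splitSum]
    refine (splitSum_congr fun l₀ l' _ => (splitSum_comm _ _ _)).trans ?_
    refine Eq.trans ?_ (splitSum_comm _ _ _)
    refine splitSum_congr fun l₀ l' h₀ => ?_
    refine Eq.trans ?_ (splitSum_comm _ _ _)
    refine splitSum_congr fun l₁ l₂ h₁ => splitSum_congr fun c₁ c₂ h₂ => ?_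
    subst h₀ h₁ h₂
    simp only [isHomogeneousList_append, isHomogeneousList_cons] at hb hc hl
    -- the left-hand side: the order of the insertions is changed by the induction hypothesis
    rw [jacobiSum_congr hev hc.1 hl.1 (G := fun p => sgn (sdeg l₁ * sdeg c₂ +
        (sdeg c₀ + sdeg l₀) * sdeg (x :: b) + (sdeg c₁ + sdeg l₁) * sdeg b) •
        jacobiSum br b (fun w => jacobiSum ev w (fun m =>
          F (p ++ brElt ev (brElt br x c₁) l₁ :: m)) l₂) c₂) ?_, jacobiSum_zsmul,
      jacobiSum_jacobiSum_comm, sgn_smul_sgn_smul]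
    · -- the right-hand side
      rw [jacobiSum_congr hbm hb.2 hc.2.2 (F := fun w =>
        sgn (sdeg l₀ * sdeg (brElt br x c₁ :: w) + sdeg l₁ * sdeg w) •
          jacobiSum ev c₀ (fun u => jacobiSum ev w (fun m =>
            F (u ++ brElt ev (brElt br x c₁) l₁ :: m)) l₂) l₀) (G := fun w =>
        sgn (sdeg l₀ * (x.1 - 1 + sdeg c₁ + (sdeg b + sdeg c₂)) + sdeg l₁ * (sdeg b + sdeg c₂)) •
          jacobiSum ev c₀ (fun u => jacobiSum ev w (fun m =>
            F (u ++ brElt ev (brElt br x c₁) l₁ :: m)) l₂) l₀) ?_, jacobiSum_zsmul,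
        sgn_smul_sgn_smul, sgn_smul_sgn_smul]
      · congr 1
        apply sgn_congr
        simp only [sdeg_append, sdeg_cons]
        push_cast
        grind
      · intro w _ _ hw
        rw [sdeg_cons, hw, brElt]
        congr 3
        ring
    · intro p _ _ hp
      rw [jacobiSum_congr hev hc.2.1 hl.2.1
        (G := fun q => sgn ((sdeg c₀ + sdeg l₀) * sdeg (x :: b) +
        (sdeg c₁ + sdeg l₁) * sdeg b) • jacobiSum br b (fun w => jacobiSum ev w (fun m =>
          F (p ++ (x.1 + (sdeg c₁ + sdeg l₁), ev x q) :: m)) l₂) c₂) ?_, jacobiSum_zsmul,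
        sgn_smul_sgn_smul, add_assoc]
      · congr 1
        have h := map_jacobiSum (AddMonoidHom.mk' (fun y : M => jacobiSum br b (fun w =>
          jacobiSum ev w (fun m => F (p ++ (x.1 + (sdeg c₁ + sdeg l₁), y) :: m)) l₂) c₂)
          fun y z => by simp only [hF, jacobiSum_add]) (br := ev) c₁ (ev x) l₁
        refine h.symm.trans ?_
        simp only [AddMonoidHom.mk'_apply, ← hbr x c₁ l₁ hb.1 hc.2.1 hl.2.1]
        simp only [brElt, add_assoc]
      · intro q _ _ hq
        simp only [jacobiSum_zsmul, sgn_smul_sgn_smul, hp, hq]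
        congr 1
        rw [← ih (fun l l' d y z => ?_) hb.2 hc.2.2 hl.2.2]
        · simp only [brElt, hq]
        · have := hF (p ++ (x.1 + (sdeg c₁ + sdeg l₁), ev x q) :: l) l' d y z
          simpa using this

end BInfinityData

namespace BInfinityData

/-! ### The dg algebra structure induced by a multiplication in a brace algebra -/

section InducedByMul

variable {k : Type*} [Field k] {M N : Type*} [AddCommGroup M] [Module k M] [AddCommGroup N]
  {gr : ℤ → Submodule k M} {dif : ℤ × M → M} {mul : ℤ × M → ℤ × M → M}
  {br : ℤ × M → List (ℤ × M) → M} {m : M}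

/-- The braces satisfy the pre-Jacobi identities, `m` is a multiplication, i.e. `m{m} = 0` and
`m{c₁, …, c_p} = 0` for `p ≥ 3`, and the differential and the product are induced by it:
`d x = m{x} - (-1)^{|x| - 1} x{m}` and `x y = (-1)^{|x|} m{x, y}`. -/
structure InducedByMul (gr : ℤ → Submodule k M) (dif : ℤ × M → M) (mul : ℤ × M → ℤ × M → M)
    (br : ℤ × M → List (ℤ × M) → M) (m : M) : Prop where
  mem : m ∈ gr 2
  br_mem : ∀ x c, x.2 ∈ gr x.1 → IsHomogeneousList gr c → br x c ∈ gr (x.1 + sdeg c)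
  br_add_left : ∀ d c x y, br (d, x + y) c = br (d, x) c + br (d, y) c
  br_smul_left : ∀ d c (a : k) x, br (d, a • x) c = a • br (d, x) c
  br_multiadditive : ∀ x, x.2 ∈ gr x.1 → IsMultiadditive gr (br x)
  br_smul_right : ∀ x l l' d (a : k) y, x.2 ∈ gr x.1 →
    br x (l ++ (d, a • y) :: l') = a • br x (l ++ (d, y) :: l')
  br_nil : ∀ x, br x [] = x.2
  br_br : ∀ x b c, x.2 ∈ gr x.1 → IsHomogeneousList gr b → IsHomogeneousList gr c →
    br (brElt br x b) c = jacobiSum br b (br x) c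
  br_of_three_le : ∀ c, IsHomogeneousList gr c → 3 ≤ c.length → br (2, m) c = 0
  br_self : br (2, m) [(2, m)] = 0
  dif_eq : ∀ x, x.2 ∈ gr x.1 → dif x = br (2, m) [x] - sgn (x.1 - 1) • br x [(2, m)]
  mul_eq : ∀ x y, x.2 ∈ gr x.1 → y.2 ∈ gr y.1 → sgn x.1 • mul x y = br (2, m) [x, y]

namespace InducedByMul

variable (h : InducedByMul gr dif mul br m)
include h

theorem br_sub_left (d : ℤ) (c : List (ℤ × M)) (x y : M) :
    br (d, x - y) c = br (d, x) c - br (d, y) c :=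
  map_sub (AddMonoidHom.mk' (fun x => br (d, x) c) (h.br_add_left d c)) x y

theorem br_zsmul_left (d : ℤ) (c : List (ℤ × M)) (n : ℤ) (x : M) :
    br (d, n • x) c = n • br (d, x) c :=
  map_zsmul (AddMonoidHom.mk' (fun x => br (d, x) c) (h.br_add_left d c)) n x

theorem br_zero_left (d : ℤ) (c : List (ℤ × M)) : br (d, 0) c = 0 :=
  map_zero (AddMonoidHom.mk' (fun x => br (d, x) c) (h.br_add_left d c))

theorem dif_eq_add (x : ℤ × M) (hx : x.2 ∈ gr x.1) :
    dif x = br (2, m) [x] + sgn x.1 • br x [(2, m)] := by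
  rw [h.dif_eq x hx, sub_eq_add_neg, neg_sgn_smul, sub_add_cancel]

theorem mul_eq' (x y : ℤ × M) (hx : x.2 ∈ gr x.1) (hy : y.2 ∈ gr y.1) :
    mul x y = sgn x.1 • br (2, m) [x, y] := by
  rw [← h.mul_eq x y hx hy, sgn_smul_smul_self]

theorem br_self_mem (x : ℤ × M) (hx : x.2 ∈ gr x.1) : br x [(2, m)] ∈ gr (x.1 + 1) := by
  have := h.br_mem x [(2, m)] hx (by simpa using h.mem)
  simpa using this

theorem self_br_mem (x : ℤ × M) (hx : x.2 ∈ gr x.1) : br (2, m) [x] ∈ gr (x.1 + 1) := by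
  have := h.br_mem (2, m) [x] h.mem (by simpa using hx)
  simp only [sdeg_cons, sdeg_nil] at this
  rwa [show x.1 + 1 = 2 + (x.1 - 1 + 0) by ring]

theorem dif_mem (x : ℤ × M) (hx : x.2 ∈ gr x.1) : dif x ∈ gr (x.1 + 1) := by
  rw [h.dif_eq x hx]
  exact sub_mem (h.self_br_mem x hx) (zsmul_mem (h.br_self_mem x hx) _)

theorem mul_mem (x y : ℤ × M) (hx : x.2 ∈ gr x.1) (hy : y.2 ∈ gr y.1) :
    mul x y ∈ gr (x.1 + y.1) := by
  rw [h.mul_eq' x y hx hy]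
  refine zsmul_mem ?_ _
  have := h.br_mem (2, m) [x, y] h.mem (by simpa using ⟨hx, hy⟩)
  simp only [sdeg_cons, sdeg_nil] at this
  rwa [show x.1 + y.1 = 2 + (x.1 - 1 + (y.1 - 1 + 0)) by ring]

theorem apply_dif {F : List (ℤ × M) → N} (hF : IsMultiadditive gr F) {y : ℤ × M}
    {c : List (ℤ × M)} (hy : y.2 ∈ gr y.1) (hc : IsHomogeneousList gr c) :
    F ((y.1 + 1, dif y) :: c) =
      F (brElt br (2, m) [y] :: c) + sgn y.1 • F (brElt br y [(2, m)] :: c) := by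
  have h1 := hF [] c (y.1 + 1) _ _ (by simp) hc (h.self_br_mem y hy)
    (zsmul_mem (h.br_self_mem y hy) (sgn y.1))
  rw [List.nil_append, ← h.dif_eq_add y hy] at h1
  have h2 := hF.apply_sgn_smul (l := []) y.1 (by simp) hc (h.br_self_mem y hy)
  rw [h1]
  simp only [List.nil_append] at h2 ⊢
  rw [h2]
  simp only [brElt, sdeg_cons, sdeg_nil]
  congr 3
  ring_nf

theorem apply_mul {F : List (ℤ × M) → N} (hF : IsMultiadditive gr F) {y z : ℤ × M}
    {c : List (ℤ × M)} (hy : y.2 ∈ gr y.1) (hz : z.2 ∈ gr z.1) (hc : IsHomogeneousList gr c) :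
    sgn y.1 • F ((y.1 + z.1, mul y z) :: c) = F (brElt br (2, m) [y, z] :: c) := by
  have h2 := hF.apply_sgn_smul (l := []) y.1 (by simp) hc (h.mul_mem y z hy hz)
  simp only [List.nil_append] at h2
  rw [← h2, h.mul_eq y z hy hz, brElt]
  simp only [sdeg_cons, sdeg_nil]
  congr 3
  ring

omit h in
theorem _root_.BInfinityData.jacobiSum_cons_singleton (hnil : ∀ x, br x [] = x.2)
    (F : List (ℤ × M) → N) (y w : ℤ × M) (c : List (ℤ × M)) :
    jacobiSum br (y :: c) F [w] = jacobiSum br c (fun l => F (y :: l)) [w] +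
      sgn ((w.1 - 1) * sdeg c) • F (brElt br y [w] :: c) +
      sgn ((w.1 - 1) * sdeg (y :: c)) • F (w :: y :: c) := by
  have e : brElt br y [] = y := by simp [brElt, hnil]
  simp [jacobiSum, splitSum_cons, e, sgn_zero, jacobiSum_nil_right hnil]

/-- The coderivation induced by the multiplication is a commutator. -/
theorem insertM_eq {F : List (ℤ × M) → N} (hF : IsMultiadditive gr F) {c : List (ℤ × M)}
    (hc : IsHomogeneousList gr c) : insertM dif mul F c =
      jacobiSum br [(2, m)] F c - sgn (sdeg c) • jacobiSum br c F [(2, m)] := by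
  have hone : sdeg [((2 : ℤ), m)] = 1 := by simp
  have s1 : ∀ t : ℤ, sgn (t + (2 - 1) * t) = 1 := fun t => sgn_of_even ⟨t, by ring⟩
  have s2 : ∀ d t : ℤ, sgn (d - 1 + t + (2 - 1) * t) = -sgn d := fun d t => by
    rw [neg_sgn]
    apply sgn_congr
    push_cast
    grind
  induction c generalizing F with
  | nil => simp [insertM, jacobiSum, brElt, h.br_nil, sgn_zero]
  | cons y c ih =>
    rw [isHomogeneousList_cons] at hc
    have e0 : brElt br (2, m) [] = (2, m) := by simp [brElt, h.br_nil]
    rw [jacobiSum_cons_cons, jacobiSum_cons_singleton h.br_nil, hone, splitSum_cons]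
    rcases c with _ | ⟨z, c⟩
    · rw [insertM, h.apply_dif hF hc.1 hc.2]
      simp only [jacobiSum_nil, splitSum_nil, sdeg_nil, mul_zero, mul_one, sgn_zero, one_smul, e0,
        sdeg_cons, smul_add, sgn_smul_sgn_smul, s1, jacobiSum_cons_nil]
      rw [show y.1 - 1 + 0 = y.1 - 1 + 0 + (2 - 1) * 0 by ring, s2,
        show y.1 - 1 = y.1 - 1 + 0 + (2 - 1) * 0 by ring, s2]
      simp only [neg_smul]
      abel
    · have hc2 := (isHomogeneousList_cons _ _ _).1 hc.2
      rw [insertM, h.apply_dif hF hc.1 hc.2, h.apply_mul hF hc.1 hc2.1 hc2.2,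
        ih (hF.cons hc.1) hc.2, splitSum_cons, splitSum_eq_left]
      · simp only [jacobiSum_nil, sdeg_nil, mul_zero, mul_one, sgn_zero, one_smul, e0,
          sdeg_cons, smul_add, sgn_smul_sgn_smul, smul_sub, s1, s2, neg_smul]
        abel
      · rintro w u v rfl
        have hc3 := (isHomogeneousList_append _ _ _).1 ((isHomogeneousList_cons _ _ _).1 hc2.2).2
        have h0 := hF.apply_zero (l := []) (brElt br (2, m) (y :: z :: w :: u)).1 (by simp) hc3.2
        simp only [List.nil_append] at h0
        rw [brElt, h.br_of_three_le _ (by simp_all) (by simp)]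
        rw [jacobiSum_nil]
        exact (congrArg _ h0).trans (smul_zero _)

theorem insertM_self_br {c : List (ℤ × M)} (hc : IsHomogeneousList gr c) :
    insertM dif mul (br (2, m)) c = -(sgn (sdeg c) • br (brElt br (2, m) c) [(2, m)]) := by
  have hm : IsHomogeneousList gr [((2 : ℤ), m)] := by simpa using h.mem
  rw [h.insertM_eq (h.br_multiadditive (2, m) h.mem) hc, ← h.br_br _ _ _ h.mem hm hc,
    ← h.br_br _ _ _ h.mem hc hm, brElt, h.br_self, h.br_zero_left, zero_sub]

theorem br_mul (x y : ℤ × M) (c : List (ℤ × M)) (hx : x.2 ∈ gr x.1) (hy : y.2 ∈ gr y.1)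
    (hc : IsHomogeneousList gr c) :
    jacobiSum br [x, y] (shiftedM dif mul) c = sgn x.1 • br (x.1 + y.1, mul x y) c := by
  have hxy : IsHomogeneousList gr [x, y] := by simpa using ⟨hx, hy⟩
  rw [jacobiSum_congr h.br_mem hxy hc (G := br (2, m)), ← h.br_br _ _ _ h.mem hxy hc, brElt,
    ← h.mul_eq x y hx hy, h.br_zsmul_left]
  · congr 3
    simp
    ring
  · rintro (_ | ⟨z, _ | ⟨w, _ | ⟨v, l⟩⟩⟩) hl hl' _
    · simp at hl'
    · simp at hl'
    · simp only [isHomogeneousList_cons] at hl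
      exact h.mul_eq z w hl.1 hl.2.1
    · rw [h.br_of_three_le _ hl (by simp)]
      rfl

theorem br_dif (x : ℤ × M) (c : List (ℤ × M)) (hx : x.2 ∈ gr x.1) (hc : IsHomogeneousList gr c) :
    jacobiSum br [x] (shiftedM dif mul) c =
      br (x.1 + 1, dif x) c + sgn (x.1 - 1) • insertM dif mul (br x) c := by
  have hm : IsHomogeneousList gr [((2 : ℤ), m)] := by simpa using h.mem
  have hx' : IsHomogeneousList gr [x] := by simpa using hx
  have e1 : jacobiSum br [x] (shiftedM dif mul) c = jacobiSum br [x] (fun l => br (2, m) l -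
      (fun l => if l.length = 1 then sgn (x.1 + sdeg c - 1) •
        br (l.headD (0, 0)) [(2, m)] else 0) l) c := by
    refine jacobiSum_congr h.br_mem hx' hc ?_
    rintro (_ | ⟨z, _ | ⟨w, _ | ⟨v, l⟩⟩⟩) hl hl' hs
    · simp at hl'
    · simp only [isHomogeneousList_cons] at hl
      simp only [sdeg_cons, sdeg_nil] at hs
      simp only [shiftedM, h.dif_eq z hl.1, List.length_singleton, if_true, List.headD_cons]
      congr 3
      linarith
    · simp only [isHomogeneousList_cons] at hl
      rw [← h.mul_eq z w hl.1 hl.2.1]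
      simp [shiftedM]
    · rw [h.br_of_three_le _ hl (by simp)]
      simp [shiftedM]
  rw [e1, jacobiSum_sub, jacobiSum_singleton_of_length
      (F := fun l => if l.length = 1 then sgn (x.1 + sdeg c - 1) •
        br (l.headD (0, 0)) [(2, m)] else 0), ← h.br_br _ _ _ h.mem hx' hc,
    h.insertM_eq (h.br_multiadditive x hx) hc, ← h.br_br _ _ _ hx hm hc, ← h.br_br _ _ _ hx hc hm,
    h.dif_eq x hx, h.br_sub_left, h.br_zsmul_left]
  · simp only [List.length_singleton, if_true, List.headD_cons, brElt, smul_sub,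
      sgn_smul_sgn_smul, sdeg_cons, sdeg_nil]
    rw [show (2 : ℤ) + (x.1 - 1 + 0) = x.1 + 1 by ring, show x.1 + (2 - 1 + 0) = x.1 + 1 by ring,
      show x.1 + sdeg c - 1 = x.1 - 1 + sdeg c by ring]
    abel
  · intro l hl
    rw [if_neg (by omega)]

theorem mul_assoc (x y z : ℤ × M) (hx : x.2 ∈ gr x.1) (hy : y.2 ∈ gr y.1) (hz : z.2 ∈ gr z.1) :
    mul (x.1 + y.1, mul x y) z = mul x (y.1 + z.1, mul y z) := by
  have hxyz : IsHomogeneousList gr [x, y, z] := by simpa using ⟨hx, hy, hz⟩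
  have key := h.insertM_self_br hxyz
  have hxy := h.mul_mem x y hx hy
  have hyz := h.mul_mem y z hy hz
  rw [brElt, h.br_of_three_le _ hxyz (by simp), h.br_zero_left, smul_zero, neg_zero] at key
  simp only [insertM] at key
  rw [h.br_of_three_le [(_, dif x), y, z] (by simpa using ⟨h.dif_mem x hx, hy, hz⟩) (by simp),
    h.br_of_three_le [x, (_, dif y), z] (by simpa using ⟨hx, h.dif_mem y hy, hz⟩) (by simp),
    h.br_of_three_le [x, y, (_, dif z)] (by simpa using ⟨hx, hy, h.dif_mem z hz⟩) (by simp),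
    ← h.mul_eq _ _ hxy hz, ← h.mul_eq _ _ hx hyz] at key
  simp only [zero_add, smul_zero, add_zero, sgn_smul_sgn_smul] at key
  have e1 : sgn (x.1 + (x.1 + y.1)) = sgn y.1 := by
    apply sgn_congr
    push_cast
    grind
  have e2 : sgn (x.1 - 1 + (y.1 + x.1)) = -sgn y.1 := by
    rw [neg_sgn]
    apply sgn_congr
    push_cast
    grind
  rw [e1, e2, neg_smul, ← sub_eq_add_neg, ← smul_sub] at key
  have := congrArg (fun t => sgn y.1 • t) key
  simp only [sgn_smul_smul_self, smul_zero] at this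
  exact sub_eq_zero.1 this

theorem dif_mul (x y : ℤ × M) (hx : x.2 ∈ gr x.1) (hy : y.2 ∈ gr y.1) :
    dif (x.1 + y.1, mul x y) = mul (x.1 + 1, dif x) y + sgn x.1 • mul x (y.1 + 1, dif y) := by
  have key := h.insertM_self_br (c := [x, y]) (by simpa using ⟨hx, hy⟩)
  have hxy := h.mul_mem x y hx hy
  simp only [insertM] at key
  rw [← h.mul_eq (_, dif x) y (h.dif_mem x hx) hy, ← h.mul_eq x (_, dif y) hx (h.dif_mem y hy),
    brElt, ← h.mul_eq x y hx hy, h.br_zsmul_left] at key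
  simp only [sdeg_cons, sdeg_nil, sgn_smul_sgn_smul] at key
  rw [h.dif_eq _ hxy]
  have := congrArg (fun t => sgn x.1 • t) key
  simp only [smul_add, smul_neg, sgn_smul_sgn_smul] at this
  have e1 : sgn (x.1 + (x.1 + 1)) = -1 := by
    rw [← sgn_one]
    apply sgn_congr
    push_cast
    grind
  have e2 : sgn (x.1 + x.1) = 1 := sgn_of_even ⟨_, rfl⟩
  have e3 : sgn (x.1 + (x.1 - 1 + x.1)) = -sgn x.1 := by
    rw [neg_sgn]
    apply sgn_congr
    push_cast
    grind
  have e4 : sgn (x.1 + (x.1 - 1 + (y.1 - 1 + 0) + x.1)) = -sgn (x.1 + y.1 - 1) := by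
    rw [neg_sgn]
    apply sgn_congr
    push_cast
    grind
  rw [e1, e2, e3, e4, show (2 : ℤ) + (x.1 - 1 + (y.1 - 1 + 0)) = x.1 + y.1 by ring] at this
  simp only [neg_smul, one_smul, neg_neg] at this
  rw [← sub_eq_zero] at this ⊢
  rw [← this]
  abel

theorem dif_dif (x : ℤ × M) (hx : x.2 ∈ gr x.1) : dif (x.1 + 1, dif x) = 0 := by
  have hx' : IsHomogeneousList gr [x] := by simpa using hx
  have hm : IsHomogeneousList gr [((2 : ℤ), m)] := by simpa using h.mem
  have key := h.insertM_self_br hx'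
  have e0 : br (brElt br x [(2, m)]) [(2, m)] = 0 := by
    rw [h.br_br _ _ _ hx hm hm, jacobiSum_cons_singleton h.br_nil, brElt, h.br_self]
    have := (h.br_multiadditive x hx).apply_zero (l := []) (l' := []) ((2, m).1 + sdeg [((2 : ℤ), m)])
      (by simp) (by simp)
    rw [List.nil_append] at this
    rw [this]
    simp [sgn_one, sgn_zero]
  simp only [insertM, sdeg_cons, sdeg_nil] at key
  rw [h.dif_eq _ (h.dif_mem x hx), key, h.dif_eq x hx, h.br_sub_left, h.br_zsmul_left]
  rw [brElt] at e0
  simp only [sdeg_cons, sdeg_nil, brElt] at e0 ⊢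
  rw [show x.1 + 1 = x.1 + (2 - 1 + 0) by ring, e0,
    show (2 : ℤ) + (x.1 - 1 + 0) = x.1 + (2 - 1 + 0) by ring,
    show x.1 + (2 - 1 + 0) - 1 = x.1 by ring, add_zero, neg_sgn_smul]
  simp

end InducedByMul
end InducedByMul
end BInfinityData

namespace Leavitt

open BInfinityData

variable {k : Type*} [Field k] {V : Type*} [Quiver V] [Fintype V] [Fintype (Quiver.Total V)]

/-! ### Multilinear cochains and their braces -/

section Multilinear

theorem isLinearMap_splitSum {X W N : Type*} [AddCommGroup W] [Module k W] [AddCommGroup N]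
    [Module k N] {f : W → List X → List X → N} (h : ∀ a b, IsLinearMap k fun x => f x a b)
    (l : List X) : IsLinearMap k fun x => splitSum (f x) l := by
  refine ⟨fun x y => ?_, fun c x => ?_⟩
  · rw [← splitSum_add]
    exact splitSum_congr fun a b _ => (h a b).map_add x y
  · rw [smul_splitSum]
    exact splitSum_congr fun a b _ => (h a b).map_smul c x

theorem isLinearMap_add {W N : Type*} [AddCommGroup W] [Module k W] [AddCommGroup N]
    [Module k N] {f g : W → N} (hf : IsLinearMap k f) (hg : IsLinearMap k g) :
    IsLinearMap k fun x => f x + g x :=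
  ⟨fun x y => by rw [hf.map_add, hg.map_add]; abel, fun c x => by
    rw [hf.map_smul, hg.map_smul, smul_add]⟩

theorem isLinearMap_comp {W W' N : Type*} [AddCommGroup W] [Module k W] [AddCommGroup W']
    [Module k W'] [AddCommGroup N] [Module k N] {f : W' → N} (hf : IsLinearMap k f)
    {g : W → W'} (hg : IsLinearMap k g) : IsLinearMap k fun x => f (g x) :=
  ⟨fun x y => by rw [hg.map_add, hf.map_add], fun c x => by rw [hg.map_smul, hf.map_smul]⟩

theorem isLinearMap_twist (n : ℤ) : IsLinearMap k (twist k V n) := (twist k V n).isLinear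

/-- The cochain is linear in each argument. -/
def IsMultilinear (φ : Cochain k V) : Prop :=
  ∀ l l', IsLinearMap k fun x => φ (l ++ x :: l')

namespace IsMultilinear

variable {φ : Cochain k V} (h : IsMultilinear φ)
include h

theorem map_zero (l l' : List (Alg k V)) : φ (l ++ 0 :: l') = 0 := (h l l').map_zero

theorem map_neg (l l' : List (Alg k V)) (x : Alg k V) : φ (l ++ -x :: l') = -φ (l ++ x :: l') :=
  (h l l').map_neg x

theorem map_zsmul (l l' : List (Alg k V)) (n : ℤ) (x : Alg k V) :
    φ (l ++ (n • x) :: l') = n • φ (l ++ x :: l') :=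
  _root_.map_zsmul ((h l l').mk' _) n x

theorem map_zsmul_cons (l : List (Alg k V)) (n : ℤ) (x : Alg k V) :
    φ ((n • x) :: l) = n • φ (x :: l) :=
  h.map_zsmul [] l n x

theorem append_left (l : List (Alg k V)) : IsMultilinear fun l' => φ (l ++ l') := by
  intro m m'
  simpa using h (l ++ m) m'

theorem cons (x : Alg k V) : IsMultilinear fun l' => φ (x :: l') := h.append_left [x]

/-- Twisting homogeneous arguments gives a sign. -/
theorem map_twist (n : ℤ) {l : List (ℤ × Alg k V)} (hl : IsHomogeneousList (gr k V) l)
    (l' : List (Alg k V)) :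
    φ ((l.map Prod.snd).map (twist k V n) ++ l') = sgn (n * sdeg l) • φ (l.map Prod.snd ++ l') := by
  induction l generalizing φ with
  | nil => simp [sgn_zero]
  | cons x l ih =>
    rw [isHomogeneousList_cons] at hl
    simp only [List.map_cons, List.cons_append]
    rw [twist_of_mem n hl.1, h.map_zsmul_cons, ih (h.cons _) hl.2,
      sgn_smul_sgn_smul, sdeg_cons, ← mul_add]

/-- Multilinear maps are determined by their values on homogeneous elements. -/
theorem ext {ψ : Cochain k V} (h' : IsMultilinear ψ)
    (H : ∀ l : List (ℤ × Alg k V), IsHomogeneousList (gr k V) l →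
      φ (l.map Prod.snd) = ψ (l.map Prod.snd)) : φ = ψ := by
  have key : ∀ (l : List (Alg k V)) (m : List (ℤ × Alg k V)), IsHomogeneousList (gr k V) m →
      φ (m.map Prod.snd ++ l) = ψ (m.map Prod.snd ++ l) := by
    intro l
    induction l with
    | nil =>
      intro m hm
      simpa using H m hm
    | cons a l ih =>
      intro m hm
      refine induction_homogeneous (P := fun a => φ (m.map Prod.snd ++ a :: l) =
        ψ (m.map Prod.snd ++ a :: l)) ?_ ?_ a
      · intro n z hz
        have := ih (m ++ [(n, z)]) (by simpa using ⟨hm, hz⟩)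
        simpa using this
      · intro y z hy hz
        rw [(h _ _).map_add, (h' _ _).map_add, hy, hz]
  funext l
  exact key l [] (by simp)

end IsMultilinear

theorem hochInsert_nil (φ : Cochain k V) (pre l : List (Alg k V)) :
    hochInsert φ pre [] l = φ (pre ++ l) := by
  rw [hochInsert]

theorem hochInsert_cons (φ : Cochain k V) (pre : List (Alg k V)) (ψ : ℤ × Cochain k V)
    (ψs : List (ℤ × Cochain k V)) (l : List (Alg k V)) :
    hochInsert φ pre (ψ :: ψs) l = splitSum (fun l₀ l' => splitSum (fun l₁ l₂ =>
      hochInsert φ (pre ++ l₀.map (twist k V (sdeg (ψ :: ψs))) ++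
        [ψ.2 (l₁.map (twist k V (sdeg ψs)))]) ψs l₂) l') l := by
  rw [hochInsert]
  simp only [splitSum_eq_sum, List.length_drop, List.drop_drop, sdeg_cons]
  rfl

theorem isMultilinear_hochInsert_pre {φ : Cochain k V} (hφ : IsMultilinear φ)
    (ψs : List (ℤ × Cochain k V)) (l : List (Alg k V)) :
    IsMultilinear fun pre => hochInsert φ pre ψs l := by
  induction ψs generalizing l with
  | nil =>
    intro m m'
    simpa [hochInsert_nil] using hφ m (m' ++ l)
  | cons ψ ψs ih =>
    intro m m'
    simp only [hochInsert_cons]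
    refine isLinearMap_splitSum (fun l₀ l' => isLinearMap_splitSum (fun l₁ l₂ => ?_) _) _
    simpa using ih l₂ m (m' ++ l₀.map (twist k V (sdeg (ψ :: ψs))) ++
      [ψ.2 (l₁.map (twist k V (sdeg ψs)))])

theorem isMultilinear_hochInsert {φ : Cochain k V} (hφ : IsMultilinear φ)
    {ψs : List (ℤ × Cochain k V)} (hψ : ∀ ψ ∈ ψs, IsMultilinear ψ.2) (pre : List (Alg k V)) :
    IsMultilinear fun l => hochInsert φ pre ψs l := by
  induction ψs generalizing pre with
  | nil =>
    intro m m'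
    simpa [hochInsert_nil] using hφ (pre ++ m) m'
  | cons ψ ψs ih =>
    intro m m'
    simp only [hochInsert_cons, splitSum_append_cons]
    have ih' := fun pre => ih (fun ψ hψs => hψ ψ (by simp [hψs])) pre
    refine isLinearMap_add (isLinearMap_splitSum (fun l₀ l' => isLinearMap_add
      (isLinearMap_splitSum (fun l₁ l₂ => ?_) _) (isLinearMap_splitSum (fun l₁ l₂ => ?_) _)) _)
      (isLinearMap_splitSum (fun l₀ l' => isLinearMap_splitSum (fun l₁ l₂ => ?_) _) _)
    · exact ih' _ _ _
    · simp only [List.map_append, List.map_cons]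
      have h1 := isMultilinear_hochInsert_pre hφ ψs l₂
        (pre ++ l₀.map (twist k V (sdeg (ψ :: ψs)))) []
      exact isLinearMap_comp h1 (isLinearMap_comp (hψ ψ (by simp) _ _) (isLinearMap_twist _))
    · simp only [List.map_append, List.map_cons]
      have h1 := isMultilinear_hochInsert_pre hφ ψs l₂
        (pre ++ m.map (twist k V (sdeg (ψ :: ψs)))) (l₀.map (twist k V (sdeg (ψ :: ψs))) ++
          [ψ.2 (l₁.map (twist k V (sdeg ψs)))])
      have h2 := isLinearMap_comp h1 (isLinearMap_twist (sdeg (ψ :: ψs)))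
      simpa using h2

/-- The value of a cochain on a simple tensor of homogeneous elements. -/
def evalCochain (ψ : ℤ × Cochain k V) (l : List (ℤ × Alg k V)) : Alg k V := ψ.2 (l.map Prod.snd)

/-- On homogeneous elements, the sum of all insertions is a sum with Koszul signs. -/
theorem hochInsert_eq_jacobiSum {φ : Cochain k V} (hφ : IsMultilinear φ)
    {ψs : List (ℤ × Cochain k V)} (hψ : ∀ ψ ∈ ψs, IsMultilinear ψ.2) (pre : List (Alg k V))
    {l : List (ℤ × Alg k V)} (hl : IsHomogeneousList (gr k V) l) :
    hochInsert φ pre ψs (l.map Prod.snd) =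
      BInfinityData.jacobiSum evalCochain ψs (fun m => φ (pre ++ m.map Prod.snd)) l := by
  induction ψs generalizing pre l with
  | nil => rw [hochInsert_nil, BInfinityData.jacobiSum_nil]
  | cons ψ ψs ih =>
    rw [hochInsert_cons, splitSum_map, BInfinityData.jacobiSum]
    refine splitSum_congr fun l₀ l' e => ?_
    rw [splitSum_map, smul_splitSum]
    refine splitSum_congr fun l₁ l₂ e' => ?_
    subst e' e
    simp only [isHomogeneousList_append] at hl
    have h1 := (isMultilinear_hochInsert_pre hφ ψs (l₂.map Prod.snd)).append_left pre
    have h2 := h1.map_twist (sdeg (ψ :: ψs)) hl.1 [ψ.2 ((l₁.map Prod.snd).map (twist k V (sdeg ψs)))]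
    have h3 := (hψ ψ (by simp)).map_twist (sdeg ψs) hl.2.1 []
    rw [List.append_nil, List.append_nil] at h3
    have h4 := (h1.append_left (l₀.map Prod.snd)).map_zsmul_cons [] (sgn (sdeg ψs * sdeg l₁))
      (ψ.2 (l₁.map Prod.snd))
    rw [List.append_assoc, h2, h3, h4]
    have h5 := ih (fun ψ hψs => hψ ψ (by simp [hψs]))
      (pre ++ (l₀.map Prod.snd ++ [ψ.2 (l₁.map Prod.snd)])) hl.2.2
    rw [h5, mul_comm (sdeg (ψ :: ψs)), mul_comm (sdeg ψs)]
    simp [brElt, evalCochain]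

end Multilinear

end Leavitt

namespace BInfinityData

theorem jacobiSum_mem {k M M' N : Type*} [Field k] [AddCommGroup M] [Module k M] [AddCommGroup M']
    [Module k M'] [AddCommGroup N] [Module k N] {br : ℤ × M' → List (ℤ × M) → M}
    {gr' : ℤ → Submodule k M'} {gr : ℤ → Submodule k M} (hbr : ∀ x c, x.2 ∈ gr' x.1 →
      IsHomogeneousList gr c → br x c ∈ gr (x.1 + sdeg c)) {F : List (ℤ × M) → N}
    {b : List (ℤ × M')} {c : List (ℤ × M)} (hb : IsHomogeneousList gr' b)
    (hc : IsHomogeneousList gr c) (S : Submodule k N)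
    (h : ∀ l, IsHomogeneousList gr l → b.length ≤ l.length → sdeg l = sdeg b + sdeg c → F l ∈ S) :
    jacobiSum br b F c ∈ S := by
  have e : jacobiSum br b (fun l => S.mkQ (F l)) c = jacobiSum br b (fun _ => (0 : N ⧸ S)) c :=
    jacobiSum_congr hbr hb hc fun l hl h1 h2 => (Submodule.Quotient.mk_eq_zero S).2 (h l hl h1 h2)
  rw [← map_jacobiSum, jacobiSum_eq_zero (F := fun _ => (0 : N ⧸ S)) fun _ _ => rfl] at e
  exact (Submodule.Quotient.mk_eq_zero S).1 e

end BInfinityData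

namespace Leavitt

open BInfinityData

variable {k : Type*} [Field k] {V : Type*} [Quiver V] [Fintype V] [Fintype (Quiver.Total V)]

section PreCochains

variable (k V) in
/-- The multilinear cochains which are homogeneous of degree `d`: the Hochschild cochains of `L`,
relative to `k` and not normalized. -/
def preCochains (d : ℤ) : Submodule k (Cochain k V) where
  carrier := {φ | IsMultilinear φ ∧ ∀ l : List (ℤ × Alg k V), IsHomogeneousList (gr k V) l →
    φ (l.map Prod.snd) ∈ gr k V (d + sdeg l)}
  add_mem' := by
    rintro φ ψ ⟨h1, h2⟩ ⟨g1, g2⟩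
    exact ⟨fun l l' => isLinearMap_add (h1 l l') (g1 l l'),
      fun l hl => add_mem (h2 l hl) (g2 l hl)⟩
  zero_mem' := ⟨fun l l' => ⟨fun _ _ => (add_zero 0).symm, fun _ _ => (smul_zero _).symm⟩,
    fun l hl => zero_mem _⟩
  smul_mem' := by
    rintro c φ ⟨h1, h2⟩
    refine ⟨fun l l' => ⟨fun x y => ?_, fun b x => ?_⟩, fun l hl => Submodule.smul_mem _ c (h2 l hl)⟩
    · simp only [Pi.smul_apply, (h1 l l').map_add, smul_add]
    · simp only [Pi.smul_apply, (h1 l l').map_smul, smul_comm c b]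

theorem evalCochain_mem (x : ℤ × Cochain k V) (l : List (ℤ × Alg k V))
    (hx : x.2 ∈ preCochains k V x.1) (hl : IsHomogeneousList (gr k V) l) :
    evalCochain x l ∈ gr k V (x.1 + sdeg l) := hx.2 l hl

theorem isMultilinear_of_homogeneous {c : List (ℤ × Cochain k V)}
    (hc : IsHomogeneousList (preCochains k V) c) : ∀ ψ ∈ c, IsMultilinear ψ.2 :=
  fun ψ hψ => (hc ψ hψ).1

theorem hochBrace_eq_jacobiSum (x : ℤ × Cochain k V) {c : List (ℤ × Cochain k V)}
    {l : List (ℤ × Alg k V)} (hx : x.2 ∈ preCochains k V x.1)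
    (hc : IsHomogeneousList (preCochains k V) c) (hl : IsHomogeneousList (gr k V) l) :
    evalCochain (brElt hochBrace x c) l =
      BInfinityData.jacobiSum evalCochain c (evalCochain x) l :=
  hochInsert_eq_jacobiSum hx.1 (isMultilinear_of_homogeneous hc) [] hl

theorem hochBrace_mem_preCochains (x : ℤ × Cochain k V) (c : List (ℤ × Cochain k V))
    (hx : x.2 ∈ preCochains k V x.1) (hc : IsHomogeneousList (preCochains k V) c) :
    hochBrace x c ∈ preCochains k V (x.1 + sdeg c) := by
  refine ⟨isMultilinear_hochInsert hx.1 (isMultilinear_of_homogeneous hc) [], fun l hl => ?_⟩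
  have := hochBrace_eq_jacobiSum x hx hc hl
  simp only [evalCochain, brElt] at this
  rw [this]
  refine jacobiSum_mem evalCochain_mem hc hl _ fun m hm _ hs => ?_
  exact mem_gr_congr (hx.2 m hm) (by rw [hs]; ring)

theorem hochBrace_hochBrace (x : ℤ × Cochain k V) (b c : List (ℤ × Cochain k V))
    (hx : x.2 ∈ preCochains k V x.1) (hb : IsHomogeneousList (preCochains k V) b)
    (hc : IsHomogeneousList (preCochains k V) c) :
    hochBrace (brElt hochBrace x b) c = BInfinityData.jacobiSum hochBrace b (hochBrace x) c := by
  have hxb := hochBrace_mem_preCochains x b hx hb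
  have h1 := hochBrace_mem_preCochains (brElt hochBrace x b) c hxb hc
  have h2 : BInfinityData.jacobiSum hochBrace b (hochBrace x) c ∈
      preCochains k V (x.1 + sdeg b + sdeg c) := by
    refine jacobiSum_mem hochBrace_mem_preCochains hb hc _ fun l hl _ hs => ?_
    rw [add_assoc, ← hs]
    exact hochBrace_mem_preCochains x l hx hl
  refine h1.1.ext h2.1 fun l hl => ?_
  refine (hochBrace_eq_jacobiSum (brElt hochBrace x b) hxb hc hl).trans ?_
  have e1 : BInfinityData.jacobiSum evalCochain c (evalCochain (brElt hochBrace x b)) l =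
      BInfinityData.jacobiSum evalCochain c
        (BInfinityData.jacobiSum evalCochain b (evalCochain x)) l :=
    jacobiSum_congr evalCochain_mem hc hl fun m hm _ _ => hochBrace_eq_jacobiSum x hx hb hm
  have e2 := map_jacobiSum (Pi.evalAddMonoidHom (fun _ => Alg k V) (l.map Prod.snd))
    (br := hochBrace) b (hochBrace x) c
  refine e1.trans (Eq.trans ?_ e2.symm)
  rw [jacobiSum_jacobiSum evalCochain_mem hochBrace_mem_preCochains
    (fun x c l hx hc hl => hochBrace_eq_jacobiSum x hx hc hl) (fun l l' d y z => ?_) hb hc hl]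
  · refine jacobiSum_congr hochBrace_mem_preCochains hb hc fun c' hc' _ _ => ?_
    exact (hochBrace_eq_jacobiSum x hx hc' hl).symm
  · simpa [evalCochain] using (hx.1 (l.map Prod.snd) (l'.map Prod.snd)).map_add y z

end PreCochains

end Leavitt

namespace Leavitt

open BInfinityData

variable {k : Type*} [Field k] {V : Type*} [Quiver V] [Fintype V] [Fintype (Quiver.Total V)]

/-! ### The multiplication as a Hochschild cochain -/

section MulCochain

variable (k V) in
/-- The multiplication of `L` as a cochain: `sa ⊗ sb ↦ (-1)^{|a|} ab`. -/
def mulCochain : Cochain k V := fun l =>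
  match l with
  | [a, b] => -(twist k V 1 a * b)
  | _ => 0

@[simp] theorem mulCochain_pair (a b : Alg k V) :
    mulCochain k V [a, b] = -(twist k V 1 a * b) := rfl

theorem mulCochain_of_length {l : List (Alg k V)} (h : l.length ≠ 2) : mulCochain k V l = 0 := by
  rcases l with _ | ⟨a, _ | ⟨b, _ | ⟨c, l⟩⟩⟩
  · rfl
  · rfl
  · simp at h
  · rfl

theorem isMultilinear_of_length {φ : Cochain k V} {n : ℕ} (h0 : ∀ l, l.length ≠ n → φ l = 0)
    (h : ∀ l l', l.length + 1 + l'.length = n → IsLinearMap k fun x => φ (l ++ x :: l')) :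
    IsMultilinear φ := by
  intro l l'
  by_cases e : l.length + 1 + l'.length = n
  · exact h l l' e
  · have e' : ∀ x, φ (l ++ x :: l') = 0 := fun x => h0 _ (by simp; omega)
    exact ⟨fun x y => by rw [e', e', e', add_zero], fun c x => by rw [e', e', smul_zero]⟩

theorem mulCochain_mem : mulCochain k V ∈ preCochains k V 2 := by
  refine ⟨isMultilinear_of_length (n := 2) (fun l => mulCochain_of_length) ?_, ?_⟩
  · rintro (_ | ⟨a, l⟩) (_ | ⟨a', l'⟩) h <;> simp only [List.length_cons, List.length_nil] at h
    · omega
    · obtain rfl : l' = [] := List.length_eq_zero_iff.1 (by omega)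
      exact ⟨fun x y => by simp [add_mul]; abel, fun c x => by simp⟩
    · obtain rfl : l = [] := List.length_eq_zero_iff.1 (by omega)
      exact ⟨fun x y => by simp [mul_add]; abel, fun c x => by simp⟩
    · omega
  · rintro (_ | ⟨a, _ | ⟨b, _ | ⟨c, l⟩⟩⟩) hl
    · exact zero_mem _
    · exact zero_mem _
    · simp only [isHomogeneousList_cons] at hl
      exact neg_mem (mem_gr_congr (mul_mem_gr (twist_mem 1 hl.1) hl.2.1) (by simp; ring))
    · exact zero_mem _

theorem twist_apply (n : ℤ) {d : ℤ} {φ : Cochain k V} (hφ : φ ∈ preCochains k V d)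
    (l : List (Alg k V)) :
    twist k V n (φ l) = sgn (n * (d - 1)) • φ (l.map (twist k V n)) := by
  have h1 : IsMultilinear fun l => twist k V n (φ l) := fun l l' =>
    isLinearMap_comp (isLinearMap_twist n) (hφ.1 l l')
  have h2 : IsMultilinear fun l => sgn (n * (d - 1)) • φ (l.map (twist k V n)) := fun l l' => by
    have := isLinearMap_comp (hφ.1 (l.map (twist k V n)) (l'.map (twist k V n)))
      (isLinearMap_twist n)
    refine ⟨fun x y => ?_, fun c x => ?_⟩
    · simp only [List.map_append, List.map_cons, this.map_add, smul_add]
    · simp only [List.map_append, List.map_cons, this.map_smul, smul_comm c]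
  refine congrFun (h1.ext h2 fun l hl => ?_) l
  have h3 := hφ.1.map_twist n hl []
  rw [List.append_nil, List.append_nil] at h3
  rw [h3, twist_of_mem n (hφ.2 l hl), sgn_smul_sgn_smul]
  congr 2
  ring

theorem hochInsert_singleton (φ : Cochain k V) (pre : List (Alg k V)) (ψ : ℤ × Cochain k V)
    (l : List (Alg k V)) :
    hochInsert φ pre [ψ] l = splitSum (fun l₀ l' => splitSum (fun l₁ l₂ =>
      φ (pre ++ l₀.map (twist k V (ψ.1 - 1)) ++ ψ.2 l₁ :: l₂)) l') l := by
  rw [hochInsert_cons]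
  refine splitSum_congr fun l₀ l' _ => splitSum_congr fun l₁ l₂ _ => ?_
  have e : l₁.map (twist k V (sdeg ([] : List (ℤ × Cochain k V)))) = l₁ := by
    rw [sdeg_nil, List.map_congr_left fun x _ => twist_zero x, List.map_id']
  rw [hochInsert_nil, e]
  simp

/-- The sum over all products of neighbouring arguments. -/
def contractSum (f : Cochain k V) : Cochain k V
  | [] => 0
  | [_] => 0
  | a :: b :: l => f ((twist k V 1 a * b) :: l) +
      contractSum (fun m => f (twist k V 1 a :: m)) (b :: l)

theorem contractSum_eq_sum (f : Cochain k V) (a : Alg k V) (l : List (Alg k V)) :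
    ∑ i ∈ Finset.range l.length, f (((a :: l).take i).map (twist k V 1) ++
      (twist k V 1 ((a :: l).getD i 0) * (a :: l).getD (i + 1) 0) :: (a :: l).drop (i + 2)) =
      contractSum f (a :: l) := by
  induction l generalizing f a with
  | nil => simp [contractSum]
  | cons b l ih =>
    rw [List.length_cons, Finset.sum_range_succ', contractSum, ← ih, add_comm]
    simp

theorem splitSum_mulCochain {f : Cochain k V} (hf : IsMultilinear f) (l : List (Alg k V)) :
    splitSum (fun l₀ l' => splitSum (fun l₁ l₂ =>
      f (l₀.map (twist k V 1) ++ mulCochain k V l₁ :: l₂)) l') l = -contractSum f l := by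
  have key : ∀ {f : Cochain k V}, IsMultilinear f → ∀ l,
      splitSum (fun l₁ l₂ => f (mulCochain k V l₁ :: l₂)) l = match l with
    | a :: b :: l => -f ((twist k V 1 a * b) :: l)
    | _ => 0 := by
    intro f hf
    have h0 : ∀ m, f (0 :: m) = 0 := fun m => hf.map_zero [] m
    rintro (_ | ⟨a, _ | ⟨b, l⟩⟩)
    · exact h0 _
    · simp [splitSum_cons, mulCochain, h0]
    · rw [splitSum_cons, splitSum_cons, splitSum_eq_left]
      · rw [mulCochain_of_length (by simp), mulCochain_of_length (by simp), h0, h0,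
          mulCochain_pair]
        simpa using hf.map_neg [] l (twist k V 1 a * b)
      · intro c u v _
        rw [mulCochain_of_length (by simp), h0]
  induction l generalizing f with
  | nil => simpa [contractSum] using key hf []
  | cons a l ih =>
    rw [splitSum_cons]
    simp only [List.map_nil, List.nil_append, List.map_cons, List.cons_append]
    rw [ih (hf.cons _), key hf]
    rcases l with _ | ⟨b, l⟩
    · simp [contractSum]
    · simp only [contractSum, neg_add]

theorem hochDiff_cons (φ : ℤ × Cochain k V) (a : Alg k V) (l : List (Alg k V)) :
    hochDiff φ (a :: l) = -(twist k V φ.1 a * φ.2 l) +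
      sgn φ.1 • (φ.2 (((a :: l).dropLast).map (twist k V 1)) * (a :: l).getLast (by simp)) -
      sgn φ.1 • contractSum φ.2 (a :: l) := by
  rw [hochDiff, contractSum_eq_sum]

theorem hochCup_apply (φ ψ : ℤ × Cochain k V) (l : List (Alg k V)) :
    hochCup φ ψ l = splitSum (fun u v => φ.2 (u.map (twist k V ψ.1)) * ψ.2 v) l := by
  rw [hochCup, splitSum_eq_sum]

theorem sgn_sub_one (n : ℤ) : sgn (n - 1) = -sgn n := by
  rw [neg_sgn]
  apply sgn_congr
  push_cast
  grind

theorem twist_twist_map (m n : ℤ) (l : List (Alg k V)) :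
    (l.map (twist k V m)).map (twist k V n) = l.map (twist k V (n + m)) := by
  rw [List.map_map]
  exact List.map_congr_left fun x _ => (twist_add n m x).symm

theorem mulCochain_brace_singleton {φ : ℤ × Cochain k V} (hφ : φ.2 ∈ preCochains k V φ.1)
    (a : Alg k V) (l : List (Alg k V)) :
    hochBrace (2, mulCochain k V) [φ] (a :: l) = -(twist k V φ.1 a * φ.2 l) +
      sgn φ.1 • (φ.2 (((a :: l).dropLast).map (twist k V 1)) *
        (a :: l).getLast (by simp)) := by
  rw [hochBrace, hochInsert_singleton, splitSum_cons, add_comm]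
  congr 1
  · rw [splitSum_eq_left, splitSum_eq_right]
    · simp [← twist_add]
    · intro b u v _
      dsimp only
      rw [mulCochain_of_length]
      simp
    · intro b u v _
      exact splitSum_eq_zero fun x y _ => mulCochain_of_length (by simp)
  · obtain ⟨i, z, e⟩ := exists_append_singleton (c := a :: l) (by simp)
    simp only [e]
    rw [splitSum_of_length, lastTerm_append_singleton, mulCochain_of_length (by simp), zero_add]
    · have := twist_apply 1 hφ i
      simp [this, sgn_sub_one, mul_assoc]
    · intro u v hv
      exact mulCochain_of_length (by simp; omega)

theorem hochDiff_eq {φ : ℤ × Cochain k V} (hφ : φ.2 ∈ preCochains k V φ.1) :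
    hochDiff φ = hochBrace (2, mulCochain k V) [φ] -
      sgn (φ.1 - 1) • hochBrace φ [(2, mulCochain k V)] := by
  funext l
  have h : hochBrace φ [(2, mulCochain k V)] l = -contractSum φ.2 l := by
    rw [hochBrace, hochInsert_singleton]
    exact splitSum_mulCochain hφ.1 l
  rw [Pi.sub_apply, Pi.smul_apply, h]
  rcases l with _ | ⟨a, l⟩
  · rw [hochBrace, hochInsert_singleton]
    simp [hochDiff, mulCochain, contractSum]
  · rw [mulCochain_brace_singleton hφ, hochDiff_cons, sgn_sub_one]
    simp

theorem hochCup_eq {φ : ℤ × Cochain k V} (hφ : φ.2 ∈ preCochains k V φ.1) (ψ : ℤ × Cochain k V) :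
    sgn φ.1 • hochCup φ ψ = hochBrace (2, mulCochain k V) [φ, ψ] := by
  funext l
  rw [hochBrace, hochInsert_cons, splitSum_eq_left, Pi.smul_apply, hochCup_apply, smul_splitSum]
  · refine splitSum_congr fun u v _ => ?_
    rw [hochInsert_singleton, splitSum_eq_left, splitSum_eq_right]
    · have := twist_apply 1 hφ (u.map (twist k V (ψ.1 - 1)))
      rw [twist_twist_map] at this
      simp [this, sgn_sub_one, mul_assoc]
    · intro b x y _
      dsimp only
      rw [mulCochain_of_length]
      simp
    · intro b x y _
      exact splitSum_eq_zero fun x y _ => mulCochain_of_length (by simp)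
  · intro b x y _
    refine splitSum_eq_zero fun x y _ => ?_
    rw [hochInsert_singleton]
    exact splitSum_eq_zero fun x y _ => splitSum_eq_zero fun x y _ =>
      mulCochain_of_length (by simp; omega)

theorem mulCochain_brace_of_three_le {c : List (ℤ × Cochain k V)} (h : 3 ≤ c.length) :
    hochBrace (2, mulCochain k V) c = 0 := by
  have key : ∀ (c : List (ℤ × Cochain k V)) (pre l : List (Alg k V)),
      3 ≤ pre.length + c.length → hochInsert (mulCochain k V) pre c l = 0 := by
    intro c
    induction c with
    | nil =>
      intro pre l h
      rw [hochInsert_nil]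
      exact mulCochain_of_length (by simp at h ⊢; omega)
    | cons ψ c ih =>
      intro pre l h
      rw [hochInsert_cons]
      refine splitSum_eq_zero fun x y _ => splitSum_eq_zero fun u v _ => ih _ _ ?_
      simp at h ⊢
      omega
  funext l
  exact key c [] l (by simpa using h)

theorem mulCochain_brace_self : hochBrace (2, mulCochain k V) [(2, mulCochain k V)] = 0 := by
  funext l
  have h : hochBrace (2, mulCochain k V) [(2, mulCochain k V)] l =
      -contractSum (mulCochain k V) l := by
    rw [hochBrace, hochInsert_singleton]
    exact splitSum_mulCochain mulCochain_mem.1 l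
  rw [h]
  rcases l with _ | ⟨a, _ | ⟨b, _ | ⟨c, _ | ⟨d, l⟩⟩⟩⟩
  · simp [contractSum]
  · simp [contractSum]
  · simp [contractSum, mulCochain]
  · simp [contractSum, mulCochain, twist_eq, sgn_one, mul_assoc]
  · have key : ∀ (l pre : List (Alg k V)), 4 ≤ pre.length + l.length →
        contractSum (fun m => mulCochain k V (pre ++ m)) l = 0 := by
      intro l
      induction l with
      | nil => intro pre _; rfl
      | cons a l ih =>
        rcases l with _ | ⟨b, l⟩
        · intro pre _; rfl
        · intro pre h
          rw [contractSum, mulCochain_of_length (by simp at h ⊢; omega)]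
          have := ih (pre ++ [twist k V 1 a]) (by simp at h ⊢; omega)
          simpa using this
    have := key (a :: b :: c :: d :: l) [] (by simp)
    simpa using this

theorem hochInsert_add_left (φ φ' : Cochain k V) (pre : List (Alg k V))
    (ψs : List (ℤ × Cochain k V)) (l : List (Alg k V)) :
    hochInsert (φ + φ') pre ψs l = hochInsert φ pre ψs l + hochInsert φ' pre ψs l := by
  induction ψs generalizing pre l with
  | nil => simp only [hochInsert_nil, Pi.add_apply]
  | cons ψ ψs ih => simp only [hochInsert_cons, ih, splitSum_add]

theorem hochInsert_smul_left (c : k) (φ : Cochain k V) (pre : List (Alg k V))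
    (ψs : List (ℤ × Cochain k V)) (l : List (Alg k V)) :
    hochInsert (c • φ) pre ψs l = c • hochInsert φ pre ψs l := by
  induction ψs generalizing pre l with
  | nil => simp only [hochInsert_nil, Pi.smul_apply]
  | cons ψ ψs ih => simp only [hochInsert_cons, ih, smul_splitSum]

/-- The brace operation is linear in each of the inserted cochains. -/
theorem isLinearMap_hochInsert_right {φ : Cochain k V} (hφ : IsMultilinear φ)
    (b : List (ℤ × Cochain k V)) (d : ℤ) (b' : List (ℤ × Cochain k V)) (pre l : List (Alg k V)) :
    IsLinearMap k fun ψ => hochInsert φ pre (b ++ (d, ψ) :: b') l := by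
  induction b generalizing pre l with
  | nil =>
    simp only [List.nil_append, hochInsert_cons]
    refine isLinearMap_splitSum (fun l₀ l' => isLinearMap_splitSum (fun l₁ l₂ => ?_) _) _
    have h1 := isMultilinear_hochInsert_pre hφ b' l₂
      (pre ++ l₀.map (twist k V (sdeg ((d, (0 : Cochain k V)) :: b')))) []
    simp only [sdeg_cons] at h1 ⊢
    exact isLinearMap_comp h1 (g := fun ψ : Cochain k V => ψ (l₁.map (twist k V (sdeg b'))))
      ⟨fun _ _ => rfl, fun _ _ => rfl⟩
  | cons ψ' b ih =>
    simp only [List.cons_append, hochInsert_cons, sdeg_cons, sdeg_append]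
    exact isLinearMap_splitSum (fun l₀ l' => isLinearMap_splitSum (fun l₁ l₂ => ih _ _) _) _

theorem inducedByMul_hochBrace : InducedByMul (preCochains k V) hochDiff hochCup hochBrace
    (mulCochain k V) where
  mem := mulCochain_mem
  br_mem := hochBrace_mem_preCochains
  br_add_left _ c x y := funext fun l => hochInsert_add_left x y [] c l
  br_smul_left _ c a x := funext fun l => hochInsert_smul_left a x [] c l
  br_smul_right _ l l' d a y hx :=
    funext fun m => (isLinearMap_hochInsert_right hx.1 l d l' [] m).map_smul a y
  br_multiadditive _ hx := fun l l' d y z _ _ _ _ =>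
    funext fun m => (isLinearMap_hochInsert_right hx.1 l d l' [] m).map_add y z
  br_nil _ := funext fun _ => hochInsert_nil _ _ _
  br_br := hochBrace_hochBrace
  br_of_three_le _ _ h := mulCochain_brace_of_three_le h
  br_self := mulCochain_brace_self
  dif_eq _ hx := hochDiff_eq hx
  mul_eq _ y hx _ := hochCup_eq hx y

end MulCochain

end Leavitt

namespace BInfinityData

section InducedByMul

variable {k : Type*} [Field k] {M N : Type*} [AddCommGroup M] [Module k M] [AddCommGroup N]
  {gr nrm : ℤ → Submodule k M} {dif : ℤ × M → M} {mul : ℤ × M → ℤ × M → M}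
  {br : ℤ × M → List (ℤ × M) → M} {m : M}

theorem insertM_mem [Module k N]
    (hm : ∀ x y, x.2 ∈ nrm x.1 → y.2 ∈ nrm y.1 → mul x y ∈ nrm (x.1 + y.1))
    {F : List (ℤ × M) → N} {b : List (ℤ × M)} (hb : IsHomogeneousList nrm b)
    (hd : ∀ x ∈ b, dif x ∈ nrm (x.1 + 1)) (S : Submodule k N)
    (h : ∀ l, IsHomogeneousList nrm l → sdeg l = sdeg b + 1 → F l ∈ S) :
    insertM dif mul F b ∈ S := by
  fun_induction insertM dif mul F b with
  | case1 => exact zero_mem _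
  | case2 F y => exact h _ (by simpa using hd y (by simp)) (by simp)
  | case3 F y z b ih =>
    have hd' : ∀ x ∈ z :: b, dif x ∈ nrm (x.1 + 1) := fun x hx => hd x (by simp_all)
    simp only [isHomogeneousList_cons] at hb
    refine add_mem (add_mem (h _ ?_ ?_) (zsmul_mem (h _ ?_ ?_) _)) (zsmul_mem ?_ _)
    · simp only [isHomogeneousList_cons]
      exact ⟨hd y (by simp), hb.2⟩
    · simp; ring
    · simp only [isHomogeneousList_cons]
      exact ⟨hm y z hb.1 hb.2.1, hb.2.2⟩
    · simp; ring
    · refine ih (by simpa only [isHomogeneousList_cons] using hb.2) hd' fun l hl hs => h _ ?_ ?_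
      · simp only [isHomogeneousList_cons]
        exact ⟨hb.1, hl⟩
      · simp only [sdeg_cons] at hs ⊢
        rw [hs]
        ring

/-- A graded subspace that is closed under the products and braces need not be closed under the
differential; but those of its elements whose differential lies in it form a brace algebra. -/
theorem InducedByMul.isBraceAlgebra (h : InducedByMul gr dif mul br m)
    {sub : ℤ → Submodule k M} (hsub : ∀ d x, x ∈ sub d ↔ x ∈ nrm d ∧ dif (d, x) ∈ nrm (d + 1))
    (hle : ∀ d, nrm d ≤ gr d)
    (hm : ∀ x y, x.2 ∈ nrm x.1 → y.2 ∈ nrm y.1 → mul x y ∈ nrm (x.1 + y.1))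
    (hbr : ∀ x c, x.2 ∈ nrm x.1 → IsHomogeneousList nrm c → br x c ∈ nrm (x.1 + sdeg c)) :
    IsBraceAlgebra sub dif mul br := by
  have hs : ∀ {d x}, x ∈ sub d → x ∈ gr d := fun {d x} hx => hle d ((hsub d x).1 hx).1
  have hn : ∀ {c}, IsHomogeneousList sub c → IsHomogeneousList nrm c :=
    fun {c} hc x hx => ((hsub _ _).1 (hc x hx)).1
  have hg : ∀ {c}, IsHomogeneousList sub c → IsHomogeneousList gr c :=
    fun {c} hc x hx => hs (hc x hx)
  have mul_eq := fun (x y : ℤ × M) (hx : x.2 ∈ sub x.1) (hy : y.2 ∈ sub y.1) =>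
    h.mul_eq' x y (hs hx) (hs hy)
  constructor
  · intro d x hx
    refine (hsub _ _).2 ⟨((hsub d x).1 hx).2, ?_⟩
    rw [h.dif_dif (d, x) (hs hx)]
    exact zero_mem _
  · intro d x hx y hy
    have := h.br_multiadditive (2, m) h.mem [] [] d x y (by simp) (by simp) (hs hx) (hs hy)
    rw [h.dif_eq (d, x) (hs hx), h.dif_eq (d, y) (hs hy), h.dif_eq (d, x + y)
      (hs (add_mem hx hy)), h.br_add_left]
    simp only [List.nil_append] at this
    rw [this, smul_add]
    abel
  · intro d a x hx
    have := h.br_smul_right (2, m) [] [] d a x h.mem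
    rw [h.dif_eq (d, x) (hs hx), h.dif_eq (d, a • x) (hs (Submodule.smul_mem _ a hx)),
      h.br_smul_left]
    simp only [List.nil_append] at this
    rw [this, smul_sub, smul_comm a]
  · intro d e x hx y hy
    have hx' := (hsub _ _).1 hx
    have hy' := (hsub _ _).1 hy
    refine (hsub _ _).2 ⟨hm (d, x) (e, y) hx'.1 hy'.1, ?_⟩
    rw [h.dif_mul (d, x) (e, y) (hs hx) (hs hy)]
    refine add_mem ?_ (zsmul_mem ?_ _)
    · have := hm (d + 1, dif (d, x)) (e, y) hx'.2 hy'.1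
      rwa [show d + e + 1 = d + 1 + e by ring]
    · have := hm (d, x) (e + 1, dif (e, y)) hx'.1 hy'.2
      rwa [show d + e + 1 = d + (e + 1) by ring]
  · intro d e x hx x' hx' y hy
    have := h.br_multiadditive (2, m) h.mem [] [(e, y)] d x x' (by simp) (by simpa using hs hy)
      (hs hx) (hs hx')
    rw [mul_eq (d, x + x') (e, y) (add_mem hx hx') hy, mul_eq (d, x) (e, y) hx hy,
      mul_eq (d, x') (e, y) hx' hy, ← smul_add]
    exact congrArg _ this
  · intro d e x hx y hy y' hy'
    have := h.br_multiadditive (2, m) h.mem [(d, x)] [] e y y' (by simpa using hs hx) (by simp)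
      (hs hy) (hs hy')
    rw [mul_eq (d, x) (e, y + y') hx (add_mem hy hy'), mul_eq (d, x) (e, y) hx hy,
      mul_eq (d, x) (e, y') hx hy', ← smul_add]
    exact congrArg _ this
  · intro d e a x hx y hy
    have := h.br_smul_right (2, m) [] [(e, y)] d a x h.mem
    rw [mul_eq (d, a • x) (e, y) (Submodule.smul_mem _ a hx) hy, mul_eq (d, x) (e, y) hx hy,
      smul_comm a]
    exact congrArg _ this
  · intro d e a x hx y hy
    have := h.br_smul_right (2, m) [(d, x)] [] e a y h.mem
    rw [mul_eq (d, x) (e, a • y) hx (Submodule.smul_mem _ a hy), mul_eq (d, x) (e, y) hx hy,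
      smul_comm a]
    exact congrArg _ this
  · intro x c hx hc
    have hx' := (hsub _ _).1 hx
    refine (hsub _ _).2 ⟨hbr x c hx'.1 (hn hc), ?_⟩
    have hb := h.br_dif x c (hs hx) (hg hc)
    have e1 : jacobiSum br [x] (shiftedM dif mul) c =
        jacobiSum br [x] (fun l => if l.length = 1 then shiftedM dif mul l else 0) c +
        jacobiSum br [x] (fun l => if l.length = 1 then 0 else shiftedM dif mul l) c := by
      rw [← jacobiSum_add]
      congr 1
      funext l
      split_ifs <;> simp
    rw [jacobiSum_singleton_of_length (F := fun l => if l.length = 1 then shiftedM dif mul l else 0)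
      fun l hl => if_neg (by omega)] at e1
    rw [e1] at hb
    have e2 : dif (x.1 + sdeg c, br x c) = br (x.1 + 1, dif x) c +
        sgn (x.1 - 1) • insertM dif mul (br x) c -
        jacobiSum br [x] (fun l => if l.length = 1 then 0 else shiftedM dif mul l) c :=
      eq_sub_of_add_eq hb
    rw [e2]
    refine sub_mem (add_mem ?_ (zsmul_mem ?_ _)) ?_
    · have := hbr (x.1 + 1, dif x) c hx'.2 (hn hc)
      rwa [show x.1 + sdeg c + 1 = x.1 + 1 + sdeg c by ring]
    · refine insertM_mem hm (hn hc) (fun y hy => ((hsub _ _).1 (hc y hy)).2) _ fun l hl hl' => ?_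
      have := hbr x l hx'.1 hl
      rwa [hl', ← add_assoc] at this
    · refine jacobiSum_mem hbr (b := [x]) (by simpa using hx'.1) (hn hc) _ ?_
      rintro (_ | ⟨y, _ | ⟨z, _ | ⟨w, l⟩⟩⟩) hl h1 h2
      · simp at h1
      · simp
      · simp only [isHomogeneousList_cons] at hl
        have := hm y z hl.1 hl.2.1
        simp only [sdeg_cons, sdeg_nil] at h2
        rw [show x.1 + sdeg c + 1 = y.1 + z.1 by linarith]
        simpa [shiftedM] using zsmul_mem this (sgn y.1)
      · simp [shiftedM]
  · intro d c x _ y _ _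
    exact h.br_add_left d c x y
  · intro d c a x _ _
    exact h.br_smul_left d c a x
  · intro x l l' d y z hx hl hl' hy hz
    exact h.br_multiadditive x (hs hx) l l' d y z (hg hl) (hg hl') (hs hy) (hs hz)
  · intro x l l' d a y hx _ _ _
    exact h.br_smul_right x l l' d a y (hs hx)
  · intro x _
    exact h.br_nil x
  · intro d x hx
    exact h.dif_dif (d, x) (hs hx)
  · intro d e x hx y hy
    exact h.dif_mul (d, x) (e, y) (hs hx) (hs hy)
  · intro d e f x hx y hy z hz
    exact h.mul_assoc (d, x) (e, y) (f, z) (hs hx) (hs hy) (hs hz)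
  · intro x b c hx hb hc
    exact h.br_br x b c (hs hx) (hg hb) (hg hc)
  · intro x c hx hc
    exact h.br_dif x c (hs hx) (hg hc)
  · intro x y c hx hy hc
    exact h.br_mul x y c (hs hx) (hs hy) (hg hc)

end InducedByMul

end BInfinityData

namespace Leavitt

open BInfinityData

variable {k : Type*} [Field k] {V : Type*} [Quiver V] [Fintype V] [Fintype (Quiver.Total V)]

/-! ### Normalized and relative cochains -/

section Normalized

variable (k V) in
/-- The multilinear cochains which are homogeneous of degree `d` and vanish if some argument
is one of the idempotents `e_i`. -/
def normalizedCochains (d : ℤ) : Submodule k (Cochain k V) where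
  carrier := {φ | φ ∈ preCochains k V d ∧ ∀ i l l', φ (l ++ e k i :: l') = 0}
  add_mem' := by
    rintro φ ψ ⟨h1, h2⟩ ⟨g1, g2⟩
    exact ⟨add_mem h1 g1, fun i l l' => by rw [Pi.add_apply, h2, g2, add_zero]⟩
  zero_mem' := ⟨zero_mem _, fun _ _ _ => rfl⟩
  smul_mem' := by
    rintro c φ ⟨h1, h2⟩
    exact ⟨Submodule.smul_mem _ c h1, fun i l l' => by rw [Pi.smul_apply, h2, smul_zero]⟩

theorem twist_e (n : ℤ) (i : V) : twist k V n (e k i) = sgn n • e k i := by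
  rw [twist_eq, sg_e]

theorem apply_twist_e {φ : Cochain k V} (hφ : IsMultilinear φ)
    (h0 : ∀ i l l', φ (l ++ e k i :: l') = 0) (n : ℤ) (i : V) (l l' : List (Alg k V)) :
    φ (l ++ twist k V n (e k i) :: l') = 0 := by
  rw [twist_e, hφ.map_zsmul, h0, smul_zero]

theorem hochCup_mem_preCochains (φ ψ : ℤ × Cochain k V) (hφ : φ.2 ∈ preCochains k V φ.1)
    (hψ : ψ.2 ∈ preCochains k V ψ.1) : hochCup φ ψ ∈ preCochains k V (φ.1 + ψ.1) :=
  inducedByMul_hochBrace.mul_mem φ ψ hφ hψ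

theorem hochCup_mem_normalized (φ ψ : ℤ × Cochain k V) (hφ : φ.2 ∈ normalizedCochains k V φ.1)
    (hψ : ψ.2 ∈ normalizedCochains k V ψ.1) :
    hochCup φ ψ ∈ normalizedCochains k V (φ.1 + ψ.1) := by
  refine ⟨hochCup_mem_preCochains φ ψ hφ.1 hψ.1, fun i l l' => ?_⟩
  rw [hochCup_apply, splitSum_append_cons, splitSum_eq_zero, splitSum_eq_zero, add_zero]
  · intro x y _
    rw [List.map_append, List.map_cons, apply_twist_e hφ.1.1 hφ.2, zero_mul]
  · intro x y _
    rw [hψ.2, mul_zero]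

theorem hochInsert_e_pre {φ : Cochain k V}
    (h0 : ∀ i l l', φ (l ++ e k i :: l') = 0) (ψs : List (ℤ × Cochain k V)) (i : V)
    (p p' l : List (Alg k V)) : hochInsert φ (p ++ e k i :: p') ψs l = 0 := by
  induction ψs generalizing p' l with
  | nil => rw [hochInsert_nil, List.append_assoc, List.cons_append, h0]
  | cons ψ ψs ih =>
    rw [hochInsert_cons]
    refine splitSum_eq_zero fun x y _ => splitSum_eq_zero fun u v _ => ?_
    simpa using ih (p' ++ x.map (twist k V (sdeg (ψ :: ψs))) ++
      [ψ.2 (u.map (twist k V (sdeg ψs)))]) v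

theorem hochInsert_e {φ : Cochain k V} (hφ : IsMultilinear φ)
    (h0 : ∀ i l l', φ (l ++ e k i :: l') = 0) {ψs : List (ℤ × Cochain k V)}
    (hψ : IsHomogeneousList (normalizedCochains k V) ψs) (i : V) (p l l' : List (Alg k V)) :
    hochInsert φ p ψs (l ++ e k i :: l') = 0 := by
  induction ψs generalizing p l l' with
  | nil => rw [hochInsert_nil, ← List.append_assoc, h0]
  | cons ψ ψs ih =>
    rw [isHomogeneousList_cons] at hψ
    have hpre := fun l => isMultilinear_hochInsert_pre hφ ψs l
    rw [hochInsert_cons, splitSum_append_cons, splitSum_eq_zero, splitSum_eq_zero, add_zero]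
    · intro x y _
      refine splitSum_eq_zero fun u v _ => ?_
      have h1 := fun p' => apply_twist_e (hpre v)
        (fun i m m' => hochInsert_e_pre h0 ψs i m m' v) (sdeg (ψ :: ψs)) i
        (p ++ l.map (twist k V (sdeg (ψ :: ψs)))) p'
      have h2 := h1 (x.map (twist k V (sdeg (ψ :: ψs))) ++ [ψ.2 (u.map (twist k V (sdeg ψs)))])
      simpa using h2
    · intro x y _
      rw [splitSum_append_cons, splitSum_eq_zero, splitSum_eq_zero, add_zero]
      · intro u v _
        rw [List.map_append, List.map_cons, apply_twist_e hψ.1.1.1 hψ.1.2]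
        exact (hpre v).map_zero _ []
      · intro u v _
        exact ih hψ.2 _ _ _

theorem hochBrace_mem_normalized (x : ℤ × Cochain k V) (c : List (ℤ × Cochain k V))
    (hx : x.2 ∈ normalizedCochains k V x.1) (hc : IsHomogeneousList (normalizedCochains k V) c) :
    hochBrace x c ∈ normalizedCochains k V (x.1 + sdeg c) :=
  ⟨hochBrace_mem_preCochains x c hx.1 fun y hy => (hc y hy).1,
    fun i l l' => hochInsert_e hx.1.1 hx.2 hc i [] l l'⟩

end Normalized

end Leavitt

namespace Leavitt

open BInfinityData

variable {k : Type*} [Field k] {V : Type*} [Quiver V] [Fintype V] [Fintype (Quiver.Total V)]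

section Relative

theorem contractSum_of_eq_zero {f : Cochain k V} (h : ∀ l, f l = 0) (l : List (Alg k V)) :
    contractSum f l = 0 := by
  induction l generalizing f with
  | nil => rfl
  | cons a l ih =>
    rcases l with _ | ⟨b, l⟩
    · rfl
    · rw [contractSum, h, ih fun l => h _, add_zero]

theorem twist_twist (n : ℤ) (x : Alg k V) : twist k V n (twist k V n x) = x := by
  rw [← twist_add, twist_congr (n := 0) (by push_cast; grind), twist_zero]

theorem map_twist_map_twist (n : ℤ) (l : List (Alg k V)) :
    (l.map (twist k V n)).map (twist k V n) = l := by
  rw [List.map_map]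
  conv_rhs => rw [← List.map_id l]
  exact List.map_congr_left fun x _ => twist_twist n x

section

variable {φ : Cochain k V} (hφ : IsMultilinear φ) (h0 : ∀ i l l', φ (l ++ e k i :: l') = 0)
include hφ h0

theorem contractSum_e_cons (i : V) (y : Alg k V) (l : List (Alg k V)) :
    contractSum φ (e k i :: y :: l) = -φ ((e k i * y) :: l) := by
  have h1 : ∀ m, φ (twist k V 1 (e k i) :: m) = 0 := fun m => apply_twist_e hφ h0 1 i [] m
  rw [contractSum, contractSum_of_eq_zero h1, twist_e, sgn_one, neg_one_smul, neg_mul, add_zero]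
  exact hφ.map_neg [] l _

omit hφ in
theorem contractSum_append_e (i : V) (u : List (Alg k V)) (x : Alg k V) (l : List (Alg k V)) :
    contractSum φ (u ++ x :: e k i :: l) =
      φ (u.map (twist k V 1) ++ (twist k V 1 x * e k i) :: l) +
      contractSum (fun m => φ (u.map (twist k V 1) ++ twist k V 1 x :: m)) (e k i :: l) := by
  induction u generalizing φ with
  | nil => rfl
  | cons a u ih =>
    have e1 : contractSum φ ((a :: u) ++ x :: e k i :: l) =
        contractSum (fun m => φ (twist k V 1 a :: m)) (u ++ x :: e k i :: l) := by
      rcases u with _ | ⟨b, u⟩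
      · rw [List.cons_append, List.nil_append, contractSum]
        exact add_eq_right.2 (h0 i [_] l)
      · rw [List.cons_append, List.cons_append, contractSum]
        refine add_eq_right.2 ?_
        have := h0 i ((twist k V 1 a * b) :: (u ++ [x])) l
        simpa using this
    rw [e1, ih fun i m m' => h0 i (twist k V 1 a :: m) m']
    rfl

omit hφ h0 in
/-- The differential of a normalized cochain, if exactly one argument is an idempotent: the four
terms measure the failure of `E`-linearity. -/
theorem hochDiff_singleton_e (d : ℤ) (i : V) :
    hochDiff (d, φ) [e k i] = sgn d • (φ [] * e k i - e k i * φ []) := by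
  rw [hochDiff_cons]
  simp [contractSum, twist_e, smul_sub, mul_assoc]
  abel

theorem hochDiff_e_cons (d : ℤ) (i : V) (y : Alg k V) (l : List (Alg k V)) :
    hochDiff (d, φ) (e k i :: y :: l) =
      sgn d • (φ ((e k i * y) :: l) - e k i * φ (y :: l)) := by
  rw [hochDiff_cons, contractSum_e_cons hφ h0]
  have h1 : φ ((e k i :: y :: l).dropLast.map (twist k V 1)) = 0 := by
    rw [List.dropLast_cons_cons, List.map_cons]
    exact apply_twist_e hφ h0 1 i [] _
  simp only [h1, zero_mul, smul_zero, add_zero, twist_e, smul_mul_assoc, smul_neg, smul_sub]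
  abel

omit hφ in
theorem hochDiff_append_e (d : ℤ) (i : V) (u : List (Alg k V)) (x : Alg k V) :
    hochDiff (d, φ) (u ++ [x, e k i]) =
      sgn d • (φ (u.map (twist k V 1) ++ [twist k V 1 x]) * e k i -
        φ (u.map (twist k V 1) ++ [twist k V 1 x * e k i])) := by
  obtain ⟨a, t, ht, ht'⟩ : ∃ a t, u ++ [x, e k i] = a :: t ∧ φ t = 0 := by
    rcases u with _ | ⟨a, u⟩
    · exact ⟨x, [e k i], rfl, h0 i [] []⟩
    · refine ⟨a, u ++ [x, e k i], rfl, ?_⟩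
      simpa using h0 i (u ++ [x]) []
  have hc := contractSum_append_e h0 i u x []
  simp only [contractSum, add_zero] at hc
  have hd : (a :: t).dropLast = u ++ [x] := by
    rw [← ht, show u ++ [x, e k i] = (u ++ [x]) ++ [e k i] by simp, List.dropLast_concat]
  have hg : (a :: t).getLast (by simp) = e k i := by
    simp only [← ht]
    simp
  rw [ht, hochDiff_cons, hd, hg, ← ht, hc]
  simp [ht', smul_sub]

theorem hochDiff_append_e_cons (d : ℤ) (i : V) (u : List (Alg k V)) (x y : Alg k V)
    (l : List (Alg k V)) :
    hochDiff (d, φ) (u ++ x :: e k i :: y :: l) =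
      sgn d • (φ (u.map (twist k V 1) ++ twist k V 1 x :: (e k i * y) :: l) -
        φ (u.map (twist k V 1) ++ (twist k V 1 x * e k i) :: y :: l)) := by
  obtain ⟨a, t, ht, ht'⟩ : ∃ a t, u ++ x :: e k i :: y :: l = a :: t ∧ φ t = 0 := by
    rcases u with _ | ⟨a, u⟩
    · exact ⟨x, e k i :: y :: l, rfl, h0 i [] _⟩
    · refine ⟨a, u ++ x :: e k i :: y :: l, rfl, ?_⟩
      simpa using h0 i (u ++ [x]) (y :: l)
  have hc := contractSum_append_e h0 i u x (y :: l)
  rw [contractSum_e_cons (fun m m' => by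
      simpa using hφ (u.map (twist k V 1) ++ twist k V 1 x :: m) m') (fun j m m' => by
      simpa using h0 j (u.map (twist k V 1) ++ twist k V 1 x :: m) m')] at hc
  have hd : (a :: t).dropLast = u ++ x :: e k i :: (y :: l).dropLast := by
    rw [← ht, List.dropLast_append_of_ne_nil (by simp)]
    simp
  have h1 := apply_twist_e hφ h0 1 i (u.map (twist k V 1) ++ [twist k V 1 x])
    (((y :: l).dropLast).map (twist k V 1))
  simp only [List.append_assoc, List.cons_append, List.nil_append] at h1
  rw [ht] at hc
  rw [ht, hochDiff_cons, hd, hc]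
  simp only [List.map_append, List.map_cons, h1, ht', smul_sub]
  simp
  abel

end

theorem sum_map_sub_one {M : Type*} (l : List (ℤ × M)) : (l.map fun x => x.1 - 1).sum = sdeg l := by
  induction l with
  | nil => rfl
  | cons x l ih => simp [ih]

/-- A normalized cochain is `E`-linear and `E`-balanced if and only if its differential is
normalized. -/
theorem mem_cochains_iff (d : ℤ) (φ : Cochain k V) : φ ∈ cochains k V d ↔
    φ ∈ normalizedCochains k V d ∧ hochDiff (d, φ) ∈ normalizedCochains k V (d + 1) := by
  constructor
  · rintro ⟨h1, h2, h3, h4, h5, h6, h7, h8⟩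
    have hm : IsMultilinear φ := fun l l' => ⟨h1 l l', h2 l l'⟩
    have hp : φ ∈ preCochains k V d := ⟨hm, fun l hl => by
      rw [← sum_map_sub_one]
      exact h8 l hl⟩
    refine ⟨⟨hp, h7⟩, inducedByMul_hochBrace.dif_mem (d, φ) hp, fun i l l' => ?_⟩
    rcases List.eq_nil_or_concat' l with rfl | ⟨u, x, rfl⟩
    · rcases l' with _ | ⟨y, l'⟩
      · rw [List.nil_append, hochDiff_singleton_e, h3, sub_self, smul_zero]
      · rw [List.nil_append, hochDiff_e_cons hm h7, h4, sub_self, smul_zero]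
    · rcases l' with _ | ⟨y, l'⟩
      · rw [List.append_assoc, List.singleton_append, hochDiff_append_e h7, h5, sub_self,
          smul_zero]
      · rw [List.append_assoc, List.singleton_append, hochDiff_append_e_cons hm h7, h6, sub_self,
          smul_zero]
  · rintro ⟨⟨⟨hm, h8⟩, h7⟩, -, h⟩
    have key : ∀ x : Alg k V, sgn d • x = 0 → x = 0 := fun x hx => by
      rw [← sgn_smul_smul_self d x, hx, smul_zero]
    refine ⟨fun l l' => (hm l l').map_add, fun l l' => (hm l l').map_smul, fun i => ?_,
      fun i y l => ?_, fun i x l => ?_, fun i x y u l => ?_, h7, fun l hl => ?_⟩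
    · have := h i [] []
      rw [List.nil_append, hochDiff_singleton_e] at this
      exact (sub_eq_zero.1 (key _ this)).symm
    · have := h i [] (y :: l)
      rw [List.nil_append, hochDiff_e_cons hm h7] at this
      exact sub_eq_zero.1 (key _ this)
    · have := h i (l.map (twist k V 1) ++ [twist k V 1 x]) []
      rw [List.append_assoc, List.singleton_append, hochDiff_append_e h7, map_twist_map_twist,
        twist_twist] at this
      exact (sub_eq_zero.1 (key _ this)).symm
    · have := h i (u.map (twist k V 1) ++ [twist k V 1 x]) (y :: l)
      rw [List.append_assoc, List.singleton_append, hochDiff_append_e_cons hm h7,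
        map_twist_map_twist, twist_twist] at this
      exact (sub_eq_zero.1 (key _ this)).symm
    · rw [sum_map_sub_one]
      exact h8 l hl

theorem isBraceAlgebra_hochschild :
    IsBraceAlgebra (cochains k V) hochDiff hochCup hochBrace :=
  inducedByMul_hochBrace.isBraceAlgebra mem_cochains_iff (fun _ _ h => h.1)
    hochCup_mem_normalized hochBrace_mem_normalized

end Relative

end Leavitt

namespace Leavitt

open BInfinityData

variable {k : Type*} [Field k] {V : Type*} [Quiver V] [Fintype V] [Fintype (Quiver.Total V)]

/-! ### The insertion cochains -/

section InsertionCochain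

/-- The component of `Φ_n` in tensor length `0`. -/
def unitPart : List (ℤ × (Alg k V × Alg k V)) → Alg k V
  | [x] => x.2.1
  | _ => 0

@[simp] theorem unitPart_nil : unitPart ([] : List (ℤ × (Alg k V × Alg k V))) = 0 := rfl

@[simp] theorem unitPart_singleton (x : ℤ × (Alg k V × Alg k V)) : unitPart [x] = x.2.1 := rfl

@[simp] theorem unitPart_cons_cons (x y : ℤ × (Alg k V × Alg k V)) (l) :
    unitPart (x :: y :: l) = 0 := rfl

/-- The cochain of degree `sdeg l + 1` which inserts the elements of `l` into its argument.  For
`l = []` this is the identity map of `L`, and for `l ≠ []` it is `Φ_n(l)` up to sign. -/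
def insCochain (l : List (ℤ × (Alg k V × Alg k V))) : Cochain k V
  | [] => unitPart l
  | [v] => act (shiftPart l) (twist k V (sdeg l) v)
  | _ => 0

@[simp] theorem insCochain_nil (l : List (ℤ × (Alg k V × Alg k V))) :
    insCochain l [] = unitPart l := rfl

@[simp] theorem insCochain_singleton (l : List (ℤ × (Alg k V × Alg k V))) (v : Alg k V) :
    insCochain l [v] = act (shiftPart l) (twist k V (sdeg l) v) := rfl

@[simp] theorem insCochain_cons_cons (l : List (ℤ × (Alg k V × Alg k V))) (v w : Alg k V) (m) :
    insCochain l (v :: w :: m) = 0 := rfl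

theorem insCochain_of_length {m : List (Alg k V)} (l : List (ℤ × (Alg k V × Alg k V)))
    (h : 2 ≤ m.length) : insCochain l m = 0 := by
  rcases m with _ | ⟨v, _ | ⟨w, m⟩⟩ <;> simp at h ⊢

/-- In `insertM`, the function is only applied to lists whose degree is one more than that of the
given list. -/
theorem insertM_congr_sdeg {N : Type*} [AddCommGroup N] {F G : List (ℤ × (Alg k V × Alg k V)) → N}
    {b : List (ℤ × (Alg k V × Alg k V))} (h : ∀ l, sdeg l = sdeg b + 1 → F l = G l) :
    insertM leavittDiff leavittCup F b = insertM leavittDiff leavittCup G b := by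
  induction b generalizing F G with
  | nil => rfl
  | cons y b ih =>
    rcases b with _ | ⟨z, b⟩
    · exact h _ (by simp)
    · simp only [insertM]
      rw [h _ (by simp; ring), h _ (by simp; ring), ih fun l hl => h _ (by simp at hl ⊢; linarith)]

theorem contractSum_of_length {f : Cochain k V} (h : ∀ m, 2 ≤ m.length → f m = 0)
    {m : List (Alg k V)} (hm : 3 ≤ m.length) : contractSum f m = 0 := by
  obtain ⟨v, w, t, m, rfl⟩ : ∃ v w t m', m = v :: w :: t :: m' := by
    rcases m with _ | ⟨v, _ | ⟨w, _ | ⟨t, m⟩⟩⟩ <;> simp at hm ⊢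
  have key : ∀ n : List (Alg k V), ∀ f : Cochain k V, (∀ m, n.length ≤ m.length + 1 → f m = 0) →
      contractSum f n = 0 := by
    intro n
    induction n with
    | nil => exact fun _ _ => rfl
    | cons a n ih =>
      intro f hf
      rcases n with _ | ⟨b, n⟩
      · rfl
      · rw [contractSum, hf _ (by simp), ih _ fun m h => hf _ (by simpa using h), add_zero]
  exact key _ f fun n hn => h n (by simp at hn; omega)

/-- The insertion cochains satisfy the equations of a twisting morphism: the differential and
the products of the arguments are turned into products of cochains. -/
theorem insertM_insCochain {l : List (ℤ × (Alg k V × Alg k V))}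
    (hl : IsHomogeneousList (leavittGr k V) l) (h0 : l ≠ []) (m : List (Alg k V)) :
    insertM leavittDiff leavittCup (fun l => insCochain l m) l =
      splitSum (fun a b => sgn (sdeg a + 1) •
        hochCup (sdeg a + 1, insCochain a) (sdeg b + 1, insCochain b) m) l -
      sgn (sdeg l + 1) • contractSum (insCochain l) m := by
  obtain ⟨y, c, rfl⟩ := List.exists_cons_of_ne_nil h0
  rcases m with _ | ⟨v, _ | ⟨w, m⟩⟩
  · have h : ∀ a b, a ++ b = y :: c → b.length ≠ 1 ∨ a.length ≠ 1 →
        sgn (sdeg a + 1) • (unitPart a * unitPart b) = 0 := by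
      rintro (_ | ⟨p, _ | ⟨q, a⟩⟩) (_ | ⟨p', _ | ⟨q', b⟩⟩) - h <;> simp at h ⊢
    simp only [hochCup_apply, splitSum_nil, List.map_nil, insCochain_nil, contractSum, smul_zero,
      sub_zero]
    rcases c with _ | ⟨z, _ | ⟨t, c⟩⟩
    · simp [insertM, leavittDiff, splitSum_cons]
    · simp [insertM, leavittCup, splitSum_cons]
    · rw [insertM_eq_zero, splitSum_eq_zero]
      · intro a b e
        refine h a b e ?_
        by_contra! hc
        have := congrArg List.length e
        simp [hc] at this
      · rintro (_ | ⟨p, _ | ⟨q, a⟩⟩) h <;> simp at h ⊢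
  · have e1 := insertM_act (twist k V (sdeg (y :: c) + 1) v) y c hl
    simp only [insCochain_singleton]
    rw [insertM_congr_sdeg (G := fun l => act (shiftPart l) (twist k V (sdeg (y :: c) + 1) v))
      fun l h => by rw [h], e1]
    simp only [hochCup_apply, splitSum_cons _ v, splitSum_nil, List.map_nil, List.map_cons,
      insCochain_nil, insCochain_singleton, contractSum, smul_zero, sub_zero, smul_add,
      splitSum_add]
    rw [sub_eq_add_neg]
    congr 1
    · rw [splitSum_cons, splitSum_eq_left]
      · have e2 : sg k V y.1 (twist k V (sdeg (y :: c) + 1) v) =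
            sgn y.1 • twist k V (sdeg c) v := by
          rw [twist_eq, twist_eq, map_zsmul, ← sg_add, smul_smul, ← sgn_add, sgn_congr
            (show ((y.1 + sdeg c : ℤ) : ZMod 2) = ((sdeg (y :: c) + 1 : ℤ)) by simp; ring_nf)]
          congr 1
          exact sg_congr (by simp; grind) v
        rw [e2, map_zsmul, mul_smul_comm]
        simp
      · rintro p a b -
        simp
    · rw [splitSum_of_length]
      · simp only [unitPart_nil, mul_zero, smul_zero, zero_add, unitPart_singleton]
        obtain ⟨l, t, e⟩ := exists_append_singleton (List.cons_ne_nil y c)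
        rw [e, lastTerm_append_singleton, lastTerm_append_singleton, ← neg_one_zsmul, smul_smul,
          ← smul_mul_assoc, ← smul_mul_assoc, ← map_zsmul, ← map_zsmul]
        congr 2
        simp only [twist_eq, map_zsmul, smul_smul, ← sg_add]
        rw [← sgn_one]
        simp only [← sgn_add]
        congr 1
        · apply sgn_congr; simp; grind
        · congr 1
          apply sg_congr; simp; ring
      · rintro a (_ | ⟨p, _ | ⟨q, b⟩⟩) h <;> simp at h ⊢
  · rw [insertM_eq_zero fun _ _ => by rfl]
    rcases m with _ | ⟨t, m⟩
    · simp only [hochCup_apply, splitSum_cons _ v, splitSum_cons _ w, splitSum_nil, List.map_nil,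
        List.map_cons,
        insCochain_nil, insCochain_singleton, insCochain_cons_cons, contractSum, mul_zero, zero_mul,
        zero_add, add_zero]
      rw [eq_comm, sub_eq_zero, twist_eq (sdeg (y :: c)) (_ * _), map_mul, map_zsmul, act_mul,
        splitSum_shiftPart, smul_splitSum, smul_splitSum]
      refine splitSum_congr fun a b e => ?_
      rw [← e]
      simp only [twist_eq, map_zsmul, smul_mul_assoc, mul_smul_comm, smul_smul, ← sg_add, ← sgn_add,
        totalDeg_shiftPart]
      congr 1
      · apply sgn_congr; simp; grind
      · congr 2
        · apply sg_congr; simp; grind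
        · apply sg_congr; simp; grind
    · rw [contractSum_of_length fun m hm => insCochain_of_length _ hm, splitSum_eq_zero]
      · simp
      · intro a b _
        rw [hochCup_apply, splitSum_eq_zero, smul_zero]
        intro x z e
        dsimp only
        rcases le_or_gt 2 x.length with hx | hx
        · rw [insCochain_of_length _ (by simpa using hx), zero_mul]
        · have := congrArg List.length e
          rw [insCochain_of_length b (m := z) (by simp at this; omega), mul_zero]
      · simp

/-! ### The maps `Φ_n` in terms of the insertion operators -/

theorem asLinear_coe (g : Alg k V →ₗ[k] Alg k V) : asLinear (fun x => g x) = g := by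
  rw [asLinear, dif_pos g.isLinear]
  rfl

/-- The homotopy in tensor length `n + 1`, if the functions to which the canonical derivation is
applied are known to be linear. -/
theorem homotopy_append_singleton (d : ℤ) (φ : Cochain k V) (l : List (Alg k V)) (a : Alg k V)
    {g : Alg k V →ₗ[k] Alg k V} (hg : ∀ x, ∑ α : Quiver.Total V,
      φ (l.map (twist k V 1) ++ [x * gho k α, arr k α]) = g x) :
    homotopy d φ (l ++ [a]) = sgn d • dpair g a := by
  unfold homotopy
  simp only [List.reverse_append, List.reverse_cons, List.reverse_nil, List.nil_append,
    List.singleton_append, List.reverse_reverse, hg, asLinear_coe]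
  rw [smul_neg, neg_sgn_smul, sgn_congr (show ((1 + d + 1 : ℤ) : ZMod 2) = d by push_cast; grind)]
  rfl

@[simp] theorem homotopy_nil (d : ℤ) (φ : Cochain k V) : homotopy d φ [] = 0 := rfl

theorem phi_singleton (x : ℤ × (Alg k V × Alg k V)) : phi [x] = phiOne x.1 x.2 := rfl

@[simp] theorem phi_nil : phi ([] : List (ℤ × (Alg k V × Alg k V))) = 0 := rfl

theorem phi_append_singleton {l : List (ℤ × (Alg k V × Alg k V))} (hl : l ≠ [])
    (x : ℤ × (Alg k V × Alg k V)) :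
    phi (l ++ [x]) = sgn l.length • homotopy (sdeg l + 1 + x.1)
      (hochCup (sdeg l + 1, phi l) (x.1, phiOne x.1 x.2)) := by
  obtain ⟨m, y, rfl⟩ := exists_append_singleton hl
  have h1 : totalDeg (y :: m.reverse) = totalDeg (m ++ [y]) := by
    simp [totalDeg, add_comm]
  have h2 : totalDeg (y :: m.reverse) - m.reverse.length = sdeg (m ++ [y]) + 1 := by
    rw [h1, sdeg]; simp; ring
  have h3 : ((m.reverse.length + 1 : ℤ)) = ((m ++ [y]).length : ℤ) := by simp
  simp only [phi, List.reverse_append, List.reverse_cons, List.reverse_nil, List.nil_append,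
    List.singleton_append, phiRev]
  rw [h2, h3]

@[simp] theorem phiOne_nil (d : ℤ) (w : Alg k V × Alg k V) : phiOne d w [] = w.1 := rfl

theorem phiOne_singleton (d : ℤ) (w : Alg k V × Alg k V) (a : Alg k V) :
    phiOne d w [a] = dpair ((LinearMap.mulRight k w.2).comp (twist k V d)) a := rfl

@[simp] theorem phiOne_cons_cons (d : ℤ) (w : Alg k V × Alg k V) (a b : Alg k V)
    (l : List (Alg k V)) : phiOne d w (a :: b :: l) = 0 := rfl

theorem twist_arr (n : ℤ) (α : Quiver.Total V) : twist k V n (arr k α) = arr k α := by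
  rw [twist_of_mem n (arr_mem_gr α)]
  simp [sgn_zero]

theorem phiOne_arr (d : ℤ) {w : Alg k V × Alg k V} (hw : w.2 ∈ diag k V) (α : Quiver.Total V) :
    phiOne d w [arr k α] = -(arr k α * w.2) := by
  rw [phiOne_singleton, dpair_arr, LinearMap.comp_apply, twist_arr, LinearMap.mulRight_apply,
    mul_assoc, ← mem_diag.1 hw, ← mul_assoc, arr_mul_e_self]

theorem phiOne_eq (x : ℤ × (Alg k V × Alg k V)) : phiOne x.1 x.2 = insCochain [x] := by
  funext m
  rcases m with _ | ⟨v, _ | ⟨w, m⟩⟩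
  · rfl
  · have : (LinearMap.mulRight k x.2.2).comp (twist k V x.1) =
        sgn x.1 • lamInner (x.1 - 1) x.2.2 LinearMap.id := by
      ext z
      simp only [LinearMap.comp_apply, LinearMap.mulRight_apply, LinearMap.smul_apply,
        lamInner_apply, LinearMap.id_apply, twist_eq, sub_add_cancel, smul_mul_assoc, mul_assoc]
      rw [← Finset.mul_sum, sum_gho_mul_arr_mul]
    rw [phiOne_singleton, this, dpair_zsmul, insCochain_singleton, act_apply]
    have e : lam (shiftPart [x]) = -dpair (lamInner (x.1 - 1) x.2.2 LinearMap.id) :=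
      lam_append_singleton [] _
    rw [e, twist_eq, map_zsmul, ← sg_add, totalDeg_shiftPart, sg_congr (n := 0), map_zsmul]
    · simp [sgn_sub_one]
    · push_cast; grind
  · rfl

theorem insCochain_smul_append_singleton {l : List (ℤ × (Alg k V × Alg k V))} (hl : l ≠ [])
    {x : ℤ × (Alg k V × Alg k V)} (hx : x.2.2 ∈ diag k V) (c : ℤ) :
    homotopy (sdeg l + 1 + x.1)
      (hochCup (sdeg l + 1, c • insCochain l) (x.1, phiOne x.1 x.2)) =
    (sgn (sdeg l) * c) • insCochain (l ++ [x]) := by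
  funext m
  rcases eq_or_ne m [] with rfl | hm
  · obtain ⟨y, l, rfl⟩ := List.exists_cons_of_ne_nil hl
    rcases l with _ | ⟨z, l⟩ <;> simp
  obtain ⟨m, a, rfl⟩ := exists_append_singleton hm
  rcases m with _ | ⟨b, m⟩
  · rw [homotopy_append_singleton (g := (-c * sgn (sdeg l)) • lamInner (x.1 - 1) x.2.2
      (lam (shiftPart l)))]
    · rw [dpair_zsmul, Pi.smul_apply, List.nil_append, insCochain_singleton, shiftPart_append,
        shiftPart_cons, shiftPart_nil, act_apply, lam_append_singleton_apply, twist_eq, map_zsmul,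
        map_zsmul, ← sg_add, sg_congr (n := 0), smul_neg, smul_smul, smul_smul]
      · simp only [neg_mul, mul_neg, neg_smul, sg_zero]
        congr 2
        rw [← mul_assoc, mul_comm, ← mul_assoc, ← sgn_add, mul_assoc, mul_comm c, ← mul_assoc, ← sgn_add]
        congr 1
        apply sgn_congr
        simp
        grind
      · simp; grind
    · intro z
      rw [LinearMap.smul_apply, lamInner_apply, Finset.smul_sum]
      refine Finset.sum_congr rfl fun α _ => ?_
      simp only [List.map_nil, List.nil_append, hochCup_apply, splitSum_cons _ (_ * _),
        splitSum_cons _ (arr k α),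
        splitSum_nil, phiOne_cons_cons, phiOne_arr _ hx, List.map_cons,
        Pi.smul_apply, insCochain_singleton, insCochain_cons_cons, act_apply,
        totalDeg_shiftPart, smul_zero, mul_zero, zero_mul, zero_add, add_zero, sub_add_cancel,
        twist_eq, map_zsmul, ← sg_add, map_mul, sg_of_mem _ (gho_mem_gr α), mul_smul_comm,
        smul_mul_assoc,
        smul_smul, mul_neg, neg_mul, neg_smul]
      rw [sg_congr (n := x.1) (by push_cast; grind), smul_neg, smul_smul, ← sgn_add, ← sgn_add,
        ← sgn_add, ← sgn_add]
      congr 3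
      apply sgn_congr
      push_cast
      grind
  · rw [homotopy_append_singleton (g := 0)]
    · rw [Pi.smul_apply, insCochain_of_length _ (by simp)]
      simp
    · intro z
      refine Finset.sum_eq_zero fun α _ => ?_
      rw [hochCup_apply, splitSum_eq_zero]
      intro u v e
      dsimp only
      rw [phiOne_eq, Pi.smul_apply]
      rcases le_or_gt 2 u.length with hu | hu
      · rw [insCochain_of_length _ (by simpa using hu), smul_zero, zero_mul]
      · have := congrArg List.length e
        rw [insCochain_of_length _ (m := v) (by simp at this; omega), mul_zero]

/-- `Φ_n` inserts its arguments. -/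
theorem phi_eq {l : List (ℤ × (Alg k V × Alg k V))} (hl : ∀ x ∈ l, x.2.2 ∈ diag k V)
    (h0 : l ≠ []) : phi l = sgn (shiftExp l) • insCochain l := by
  induction l using List.reverseRecOn with
  | nil => exact absurd rfl h0
  | append_singleton l x ih =>
    rcases eq_or_ne l [] with rfl | hl'
    · rw [List.nil_append, phi_singleton, phiOne_eq]
      simp [sgn_zero]
    · rw [phi_append_singleton hl', ih (fun y hy => hl y (by simp [hy])) hl',
        insCochain_smul_append_singleton hl' (hl x (by simp)), smul_smul, ← sgn_add, ← sgn_add]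
      congr 1
      apply sgn_congr
      simp [sdeg]
      grind

end InsertionCochain

end Leavitt

namespace Leavitt

open BInfinityData

variable {k : Type*} [Field k] {V : Type*} [Quiver V] [Fintype V] [Fintype (Quiver.Total V)]

/-! ### The twisting morphism -/

section Twisting

theorem insCochain_mem_normalized {l : List (ℤ × (Alg k V × Alg k V))}
    (hl : IsHomogeneousList (leavittGr k V) l) (h0 : l ≠ []) :
    insCochain l ∈ normalizedCochains k V (sdeg l + 1) := by
  have hs := isHomogeneousList_shiftPart hl
  refine ⟨⟨?_, ?_⟩, ?_⟩
  · rintro (_ | ⟨a, l₁⟩) (_ | ⟨b, l₂⟩)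
    · exact ((act (shiftPart l)).comp (twist k V (sdeg l))).isLinear
    · exact (0 : Alg k V →ₗ[k] Alg k V).isLinear
    · have h : ∀ x, insCochain l (a :: l₁ ++ [x]) = 0 := fun x =>
        insCochain_of_length l (by simp)
      refine ⟨fun x y => ?_, fun c x => ?_⟩ <;> simp only [h, add_zero, smul_zero]
    · have h : ∀ x, insCochain l (a :: l₁ ++ x :: b :: l₂) = 0 := fun x =>
        insCochain_of_length l (by simp; omega)
      refine ⟨fun x y => ?_, fun c x => ?_⟩ <;> simp only [h, add_zero, smul_zero]
  · rintro (_ | ⟨v, _ | ⟨w, m⟩⟩) hm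
    · rcases l with _ | ⟨x, _ | ⟨y, l⟩⟩
      · exact absurd rfl h0
      · have := ((mem_leavittGr.1 (hl x (by simp))).1).1
        simpa using this
      · simp
    · have hv := twist_mem (sdeg l) (hm v (by simp))
      refine mem_gr_congr (act_mem_gr (fun x hx => (hs x hx).1) hv) ?_
      rw [totalDeg_shiftPart]
      simp
      ring_nf
    · simp
  · rintro i (_ | ⟨a, l₁⟩) (_ | ⟨b, l₂⟩)
    · simp only [List.nil_append, insCochain_singleton, twist_e, map_zsmul]
      rw [act_e (by simpa [shiftPart] using h0), smul_zero]
    all_goals exact insCochain_of_length _ (by simp; try omega)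

/-- The differential is the graded commutator with the identity of `L`, which is the insertion
cochain of the empty list, up to the products of neighbouring arguments. -/
theorem hochDiff_eq_hochCup (d : ℤ) (φ : Cochain k V) (m : List (Alg k V)) :
    hochDiff (d, φ) m = -hochCup (1, insCochain []) (d, φ) m +
      sgn d • hochCup (d, φ) (1, insCochain []) m - sgn d • contractSum φ m := by
  rcases m with _ | ⟨a, m⟩
  · simp [hochDiff, hochCup_apply, contractSum]
  have h1 : hochCup (1, insCochain []) (d, φ) (a :: m) = twist k V d a * φ m := by
    rw [hochCup_apply, splitSum_cons, splitSum_eq_left]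
    · simp
    · intro b x y _
      simp
  have h2 : ∀ n (hn : n ≠ []), hochCup (d, φ) (1, insCochain []) n =
      φ (n.dropLast.map (twist k V 1)) * n.getLast hn := by
    intro n hn
    obtain ⟨u, z, rfl⟩ := exists_append_singleton hn
    rw [hochCup_apply, splitSum_of_length, lastTerm_append_singleton]
    · simp
    · intro x y hy
      dsimp only
      rw [insCochain_of_length _ hy, mul_zero]
  rw [hochDiff_cons, h1, h2]

/-- The maps `Φ_n`, viewed as maps on the bar construction. -/
def shiftedPhi (l : List (ℤ × (Alg k V × Alg k V))) : Cochain k V := sgn (shiftExp l) • phi l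

@[simp] theorem shiftedPhi_nil : shiftedPhi ([] : List (ℤ × (Alg k V × Alg k V))) = 0 := by
  simp [shiftedPhi]

theorem phi_eq_shiftedPhi (l : List (ℤ × (Alg k V × Alg k V))) :
    phi l = sgn (shiftExp l) • shiftedPhi l := (sgn_smul_smul_self _ _).symm

theorem shiftedPhi_eq {l : List (ℤ × (Alg k V × Alg k V))}
    (hl : IsHomogeneousList (leavittGr k V) l) (h0 : l ≠ []) : shiftedPhi l = insCochain l := by
  rw [shiftedPhi, phi_eq (fun x hx => (mem_leavittGr.1 (hl x hx)).2.2) h0, sgn_smul_smul_self]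

/-- Separating the two trivial splittings. -/
theorem splitSum_proper {X N : Type*} [AddCommGroup N] {f g : List X → List X → N} {l : List X}
    (hl : l ≠ []) (hfg : ∀ a b, a ++ b = l → a ≠ [] → b ≠ [] → f a b = g a b)
    (h1 : ∀ b, g [] b = 0) (h2 : ∀ a, g a [] = 0) :
    splitSum f l = f [] l + f l [] + splitSum g l := by
  obtain ⟨y, c, rfl⟩ := List.exists_cons_of_ne_nil hl
  obtain ⟨u, z, e⟩ := exists_append_singleton hl
  have key : splitSum (fun a b => f a b - g a b) (y :: c) = f [] (y :: c) + f (y :: c) [] := by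
    rw [splitSum_cons, h1, sub_zero, splitSum_eq_right, h2, sub_zero]
    intro a x y' e'
    rw [hfg _ _ (by simp [e']) (by simp) (by simp), sub_self]
  rw [← key, splitSum_sub, sub_add_cancel]

/-- The maps `Φ_n` form a twisting morphism: they satisfy the equations of an `A_∞`-morphism.  The
terms with an empty list in `insertM_insCochain` make up the Hochschild differential. -/
theorem insertM_shiftedPhi {l : List (ℤ × (Alg k V × Alg k V))}
    (hl : IsHomogeneousList (leavittGr k V) l) (h0 : l ≠ []) :
    insertM leavittDiff leavittCup shiftedPhi l = hochDiff (sdeg l + 1, shiftedPhi l) +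
      splitSum (fun a b => sgn (sdeg a + 1) •
        hochCup (sdeg a + 1, shiftedPhi a) (sdeg b + 1, shiftedPhi b)) l := by
  rw [insertM_congr leavittDiff_mem leavittCup_mem hl
    fun m hm hm' => shiftedPhi_eq hm' hm]
  funext m
  have e1 := map_insertM (dif := leavittDiff) (mul := leavittCup)
    (Pi.evalAddMonoidHom (fun _ : List (Alg k V) => Alg k V) m) insCochain l
  have e2 := map_splitSum (Pi.evalAddMonoidHom (fun _ : List (Alg k V) => Alg k V) m)
    (fun a b => sgn (sdeg a + 1) •
        hochCup (sdeg a + 1, shiftedPhi a) (sdeg b + 1, shiftedPhi b)) l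
  simp only [Pi.evalAddMonoidHom_apply, Pi.smul_apply] at e1 e2
  rw [e1, Pi.add_apply, e2, insertM_insCochain hl h0, shiftedPhi_eq hl h0, hochDiff_eq_hochCup,
    splitSum_proper h0 (g := fun a b => sgn (sdeg a + 1) •
        hochCup (sdeg a + 1, shiftedPhi a) (sdeg b + 1, shiftedPhi b) m)]
  · simp [sgn_one]
    abel
  · intro a b e ha hb
    rw [← e, isHomogeneousList_append] at hl
    rw [shiftedPhi_eq hl.1 ha, shiftedPhi_eq hl.2 hb]
  · intro b
    rw [shiftedPhi_nil, hochCup_apply, splitSum_eq_zero, smul_zero]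
    intros; simp
  · intro b
    rw [shiftedPhi_nil, hochCup_apply, splitSum_eq_zero, smul_zero]
    intros; simp

theorem hochCup_eq_zero_left (d : ℤ) (ψ : ℤ × Cochain k V) : hochCup (d, 0) ψ = 0 := by
  funext m
  rw [hochCup_apply, splitSum_eq_zero, Pi.zero_apply]
  intros; simp

theorem splitSum_mem {X N : Type*} [AddCommGroup N] [Module k N] (S : Submodule k N)
    {f : List X → List X → N} {l : List X} (h : ∀ a b, a ++ b = l → f a b ∈ S) :
    splitSum f l ∈ S := by
  rw [splitSum_eq_sum]
  exact sum_mem fun i _ => h _ _ (List.take_append_drop i l)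

theorem shiftedPhi_mem_normalized {l : List (ℤ × (Alg k V × Alg k V))}
    (hl : IsHomogeneousList (leavittGr k V) l) :
    shiftedPhi l ∈ normalizedCochains k V (sdeg l + 1) := by
  rcases eq_or_ne l [] with rfl | h0
  · simp
  · rw [shiftedPhi_eq hl h0]
    exact insCochain_mem_normalized hl h0

/-- The differential of `Φ_n(l)` is expressed by values on lists of other lengths, which are
normalized; hence `Φ_n(l)` is `E`-linear and `E`-balanced. -/
theorem shiftedPhi_mem {l : List (ℤ × (Alg k V × Alg k V))}
    (hl : IsHomogeneousList (leavittGr k V) l) : shiftedPhi l ∈ cochains k V (sdeg l + 1) := by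
  rcases eq_or_ne l [] with rfl | h0
  · simp
  refine (mem_cochains_iff _ _).2 ⟨shiftedPhi_mem_normalized hl, ?_⟩
  rw [eq_sub_iff_add_eq.2 (insertM_shiftedPhi hl h0).symm]
  refine sub_mem ?_ (splitSum_mem _ fun a b e => ?_)
  · refine insertM_mem (nrm := leavittGr k V) leavittCup_mem hl
      (fun x hx => leavittDiff_mem x (hl x hx)) _ fun m hm h => ?_
    rw [show sdeg l + 1 + 1 = sdeg m + 1 by rw [h]]
    exact shiftedPhi_mem_normalized hm
  · rw [← e, isHomogeneousList_append] at hl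
    refine zsmul_mem ?_ _
    have := hochCup_mem_normalized (sdeg a + 1, shiftedPhi a) (sdeg b + 1, shiftedPhi b)
      (shiftedPhi_mem_normalized hl.1) (shiftedPhi_mem_normalized hl.2)
    rw [← e, sdeg_append]
    convert this using 1
    ring_nf

theorem phi_mem {l : List (ℤ × (Alg k V × Alg k V))}
    (hl : IsHomogeneousList (leavittGr k V) l) : phi l ∈ cochains k V (sdeg l + 1) := by
  rw [phi_eq_shiftedPhi]
  exact zsmul_mem (shiftedPhi_mem hl) _

end Twisting

end Leavitt

namespace Leavitt

open BInfinityData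

variable {k : Type*} [Field k] {V : Type*} [Quiver V] [Fintype V] [Fintype (Quiver.Total V)]

/-! ### The homotopy -/

section Homotopy

/-- The map `x ↦ g(σ(x)) - ∑_α g(σ(x) α^*) α`, which vanishes if `g` is right linear over `L`. -/
def rightDefect (g : Alg k V →ₗ[k] Alg k V) : Alg k V →ₗ[k] Alg k V :=
  g.comp (sigma k V).toLinearMap - ∑ α : Quiver.Total V, (LinearMap.mulRight k (arr k α)).comp
    (g.comp ((LinearMap.mulRight k (gho k α)).comp (sigma k V).toLinearMap))

theorem rightDefect_apply (g : Alg k V →ₗ[k] Alg k V) (x : Alg k V) : rightDefect g x =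
    g (sigma k V x) - ∑ α : Quiver.Total V, g (sigma k V x * gho k α) * arr k α := by
  simp [rightDefect]

theorem rightDefect_comp_mulLeft (g : Alg k V →ₗ[k] Alg k V) (x : Alg k V) :
    (rightDefect g).comp (LinearMap.mulLeft k (sigma k V x)) =
      rightDefect (g.comp (LinearMap.mulLeft k x)) := by
  ext z
  simp [rightDefect_apply, sigma_sigma, mul_assoc]

/-- A right `E`-linear map is recovered, up to its value at `1`, from its failure to be right
linear over `L`: both sides define derivations in a suitable sense, and they agree on the
generators. -/
theorem dpair_rightDefect (a : Alg k V) {g : Alg k V →ₗ[k] Alg k V}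
    (hg : ∀ x i, g (x * e k i) = g x * e k i) : dpair (rightDefect g) a = g a - g 1 * a := by
  have he : ∀ (g : Alg k V →ₗ[k] Alg k V) (i : V), (∀ x i, g (x * e k i) = g x * e k i) →
      g (e k i) = g 1 * e k i := fun g i hg => by rw [← hg, one_mul]
  have mul : ∀ x z : Alg k V, (∀ g : Alg k V →ₗ[k] Alg k V, (∀ x i, g (x * e k i) = g x * e k i) →
      dpair (rightDefect g) x = g x - g 1 * x) → (∀ g : Alg k V →ₗ[k] Alg k V,
      (∀ x i, g (x * e k i) = g x * e k i) → dpair (rightDefect g) z = g z - g 1 * z) →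
      ∀ g : Alg k V →ₗ[k] Alg k V, (∀ x i, g (x * e k i) = g x * e k i) →
      dpair (rightDefect g) (x * z) = g (x * z) - g 1 * (x * z) := by
    intro x z hx hz g hg
    rw [dpair_mul, rightDefect_comp_mulLeft, hx g hg, hz]
    · simp only [LinearMap.comp_apply, LinearMap.mulLeft_apply, mul_one]
      noncomm_ring
    · intro y i
      simp only [LinearMap.comp_apply, LinearMap.mulLeft_apply, ← mul_assoc, hg]
  have key : ∀ g : Alg k V →ₗ[k] Alg k V, (∀ x i, g (x * e k i) = g x * e k i) →
      dpair (rightDefect g) a = g a - g 1 * a := by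
    induction a using induction_arr_gho with
    | one => intro g _; simp
    | arr α z ih =>
      refine mul _ _ (fun g hg => ?_) ih
      rw [dpair_arr, rightDefect_apply, ← sg_one, sg_arr, sgn_one]
      simp only [neg_smul, one_smul, neg_mul, map_neg]
      rw [Finset.sum_eq_single α]
      · have h3 : g (arr k α) * e k α.left = g (arr k α) := by rw [← hg, arr_mul_e_self]
        rw [arr_mul_gho_self, he g _ hg, mul_assoc, e_mul_arr_self, sub_mul, neg_mul, neg_mul, h3,
          mul_assoc, arr_mul_e_self]
        abel
      · intro β _ h
        rw [arr_mul_gho_ne h.symm]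
        simp
      · simp
    | gho α z ih =>
      refine mul _ _ (fun g hg => ?_) ih
      rw [dpair_gho, rightDefect_apply, ← sg_one, sg_e, he g _ hg, sub_mul, Finset.sum_mul,
        Finset.sum_eq_single α]
      · rw [e_mul_gho_self, mul_assoc, e_mul_gho_self, mul_assoc (g (gho k α)), arr_mul_gho_self,
          ← hg, gho_mul_e_self]
        abel
      · intro β _ h
        rw [mul_assoc, arr_mul_gho_ne h, mul_zero]
      · simp
    | add y z hy hz => intro g hg; rw [map_add, map_add, hy g hg, hz g hg, mul_add]; abel
    | smul c z hz =>
      intro g hg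
      rw [map_smul, map_smul, hz g hg, mul_smul_comm, smul_sub]
  exact key g hg

/-- The map `x ↦ ∑_α φ(u, x α^*, α)`. -/
def diagonalMap {φ : Cochain k V} (hφ : IsMultilinear φ) (u : List (Alg k V)) :
    Alg k V →ₗ[k] Alg k V :=
  ∑ α : Quiver.Total V, ((hφ u [arr k α]).mk' _).comp (LinearMap.mulRight k (gho k α))

theorem diagonalMap_apply {φ : Cochain k V} (hφ : IsMultilinear φ) (u : List (Alg k V))
    (x : Alg k V) :
    diagonalMap hφ u x = ∑ α : Quiver.Total V, φ (u ++ [x * gho k α, arr k α]) := by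
  simp [diagonalMap]

theorem homotopy_eq_dpair {φ : Cochain k V} (hφ : IsMultilinear φ) (d : ℤ) (l : List (Alg k V))
    (a : Alg k V) :
    homotopy d φ (l ++ [a]) = sgn d • dpair (diagonalMap hφ (l.map (twist k V 1))) a :=
  homotopy_append_singleton d φ l a fun x => (diagonalMap_apply hφ _ x).symm

theorem homotopy_mem_normalized {d : ℤ} {φ : Cochain k V} (hφ : φ ∈ normalizedCochains k V d) :
    homotopy d φ ∈ normalizedCochains k V (d - 1) := by
  obtain ⟨⟨hm, hd⟩, h0⟩ := hφ
  refine ⟨⟨?_, ?_⟩, ?_⟩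
  · intro l l'
    rcases List.eq_nil_or_concat l' with rfl | ⟨m, a, rfl⟩
    · simp only [homotopy_eq_dpair hm]
      exact (sgn d • dpair (diagonalMap hm (l.map (twist k V 1)))).isLinear
    · simp only [← List.cons_append, List.concat_eq_append, ← List.append_assoc,
        homotopy_eq_dpair hm, List.map_append, List.map_cons]
      refine ⟨fun x y => ?_, fun c x => ?_⟩
      · rw [← smul_add, ← dpair_add]
        congr 3
        ext z
        simp only [diagonalMap_apply, LinearMap.add_apply, List.append_assoc, List.cons_append,
          map_add, (hm _ _).map_add, Finset.sum_add_distrib]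
      · rw [smul_comm, ← dpair_smul]
        congr 3
        ext z
        simp only [diagonalMap_apply, LinearMap.smul_apply, List.append_assoc, List.cons_append,
          map_smul, (hm _ _).map_smul, Finset.smul_sum]
  · intro l hl
    rcases eq_or_ne l [] with rfl | hl'
    · exact zero_mem _
    · obtain ⟨m, a, rfl⟩ := exists_append_singleton hl'
      rw [isHomogeneousList_append] at hl
      rw [List.map_append, List.map_singleton, homotopy_eq_dpair hm]
      refine zsmul_mem_gr _ (mem_gr_congr (dpair_mem_gr (δ := d + sdeg m - 2) (fun c x hx => ?_)
        (hl.2 a (by simp))) (by simp; ring))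
      rw [diagonalMap_apply]
      refine sum_mem fun α _ => ?_
      rw [hm.map_twist 1 hl.1]
      refine zsmul_mem_gr _ ?_
      have := hd (m ++ [(c + -1, x * gho k α), (1, arr k α)]) (by
        rw [isHomogeneousList_append]
        refine ⟨hl.1, ?_⟩
        simp [mul_mem_gr hx (gho_mem_gr α), arr_mem_gr])
      rw [List.map_append] at this
      refine mem_gr_congr this ?_
      simp
      ring
  · intro i l l'
    rcases List.eq_nil_or_concat l' with rfl | ⟨m, a, rfl⟩
    · rw [homotopy_eq_dpair hm, dpair_e, smul_zero]
    · rw [List.concat_eq_append, ← List.cons_append, ← List.append_assoc, homotopy_eq_dpair hm,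
        show diagonalMap hm _ = 0 from ?_, dpair_zero, smul_zero]
      ext x
      rw [diagonalMap_apply]
      simp [apply_twist_e hm h0]

theorem contractSum_append_pair (f : Cochain k V) (u : List (Alg k V)) (x y : Alg k V) :
    contractSum f (u ++ [x, y]) = contractSum (fun m => f (m ++ [y])) (u ++ [x]) +
      f (u.map (twist k V 1) ++ [twist k V 1 x * y]) := by
  induction u generalizing f with
  | nil => simp [contractSum]
  | cons b u ih =>
    rcases u with _ | ⟨c, u⟩
    · simp [contractSum]
    · have := ih (fun m => f (twist k V 1 b :: m))
      simp only [List.cons_append, contractSum, List.map_cons] at this ⊢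
      rw [this]
      simp only [List.append_assoc, List.cons_append, List.nil_append]
      abel

theorem twist_one (x : Alg k V) : twist k V 1 x = -sigma k V x := by
  rw [twist_eq, sgn_one, sg_one, neg_one_smul]

theorem contractSum_map_twist {f : Cochain k V} (hf : IsMultilinear f) (u : List (Alg k V)) :
    contractSum (fun m => f (m.map (twist k V 1))) u = -contractSum f (u.map (twist k V 1)) := by
  induction u generalizing f with
  | nil => simp [contractSum]
  | cons b u ih =>
    rcases u with _ | ⟨c, u⟩
    · simp [contractSum]
    · have := ih (hf.cons (twist k V 1 (twist k V 1 b)))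
      simp only [contractSum, List.map_cons] at this ⊢
      rw [this, neg_add]
      congr 1
      rw [show twist k V 1 (twist k V 1 b * c) = -(twist k V 1 (twist k V 1 b) * twist k V 1 c) by
        simp [twist_one]]
      exact hf.map_neg [] _ _

theorem contractSum_sum {ι : Type*} (s : Finset ι) (f : ι → Cochain k V) (u : List (Alg k V)) :
    contractSum (fun m => ∑ i ∈ s, f i m) u = ∑ i ∈ s, contractSum (f i) u := by
  induction u generalizing f with
  | nil => simp [contractSum]
  | cons b u ih =>
    rcases u with _ | ⟨c, u⟩
    · simp [contractSum]
    · simp only [contractSum, Finset.sum_add_distrib, ih fun i m => f i (twist k V 1 b :: m)]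

theorem contractSum_zsmul (c : ℤ) (f : Cochain k V) (u : List (Alg k V)) :
    contractSum (fun m => c • f m) u = c • contractSum f u := by
  induction u generalizing f with
  | nil => simp [contractSum]
  | cons b u ih =>
    rcases u with _ | ⟨c, u⟩
    · simp [contractSum]
    · simp only [contractSum, smul_add, ih fun m => f (twist k V 1 b :: m)]

theorem exists_contractSum (F : List (Alg k V) → Alg k V →ₗ[k] Alg k V) (u : List (Alg k V)) :
    ∃ K : Alg k V →ₗ[k] Alg k V, (∀ z, K z = contractSum (fun w => F w z) u) ∧
      ∀ a, dpair K a = contractSum (fun w => dpair (F w) a) u := by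
  induction u generalizing F with
  | nil => exact ⟨0, by simp [contractSum]⟩
  | cons b u ih =>
    rcases u with _ | ⟨c, u⟩
    · exact ⟨0, by simp [contractSum]⟩
    · obtain ⟨K, h1, h2⟩ := ih fun m => F (twist k V 1 b :: m)
      refine ⟨F ((twist k V 1 b * c) :: u) + K, fun z => ?_, fun a => ?_⟩
      · rw [LinearMap.add_apply, h1, contractSum]
      · rw [dpair_add, h2, contractSum]

theorem twist_mul_gho (n : ℤ) (z : Alg k V) (α : Quiver.Total V) :
    twist k V n (z * gho k α) = sg k V n z * gho k α := by
  rw [twist_eq, map_mul, sg_gho, mul_smul_comm, sgn_smul_smul_self]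

theorem hochDiff_append_singleton (φ : ℤ × Cochain k V) (b q : Alg k V) (n : List (Alg k V)) :
    hochDiff φ (b :: (n ++ [q])) = -(twist k V φ.1 b * φ.2 (n ++ [q])) +
      sgn φ.1 • (φ.2 ((b :: n).map (twist k V 1)) * q) -
      sgn φ.1 • contractSum φ.2 ((b :: n) ++ [q]) := by
  rw [hochDiff_cons]
  simp only [← List.cons_append, List.dropLast_concat, List.getLast_concat]

theorem dpair_sub (g h : Alg k V →ₗ[k] Alg k V) (a : Alg k V) :
    dpair (g - h) a = dpair g a - dpair h a := by
  rw [sub_eq_add_neg, dpair_add, dpair_neg, ← sub_eq_add_neg]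

/-- The homotopy identity `1 = ΦΨ + δH + Hδ`. -/
theorem homotopy_identity {d : ℤ} {φ : Cochain k V} (hφ : φ ∈ cochains k V d) :
    φ = phiOne d (psi d φ) + hochDiff (d - 1, homotopy d φ) +
      homotopy (d + 1) (hochDiff (d, φ)) := by
  have hn := (mem_cochains_iff d φ).1 hφ
  have hm := hn.1.1.1
  have hm' := hn.2.1.1
  have hr := hφ.2.2.2.2.1
  -- `φ` is determined by its failure to be right linear in the last argument
  have key : ∀ u a, φ (u ++ [a]) = -dpair (-rightDefect ((hm u []).mk' _)) a := by
    intro u a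
    rw [dpair_neg, neg_neg, dpair_rightDefect]
    · have h1 : φ (u ++ [1]) = 0 := by
        have := map_sum ((hm u []).mk' _) (fun i => e k i) Finset.univ
        simp only [IsLinearMap.mk'_apply] at this
        rw [← sum_e, this]
        exact Finset.sum_eq_zero fun i _ => hn.1.2 i u []
      simp [h1]
    · intro x i
      exact hr i x u
  have hs : sgn (d + 1) * sgn d = -1 := by
    rw [← neg_sgn, neg_mul, sgn_mul_self]
  have hsum : ∀ u z, ∑ α : Quiver.Total V, φ (u ++ [z * gho k α * arr k α]) = φ (u ++ [z]) := by
    intro u z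
    have := map_sum ((hm u []).mk' _) (fun α => z * gho k α * arr k α) Finset.univ
    simp only [IsLinearMap.mk'_apply, mul_assoc, ← Finset.mul_sum, sum_gho_mul_arr, mul_one] at this
    simp only [mul_assoc, this]
  funext l
  rcases List.eq_nil_or_concat l with rfl | ⟨u, a, rfl⟩
  · simp [psi, hochDiff]
  rw [List.concat_eq_append, Pi.add_apply, Pi.add_apply, homotopy_eq_dpair hm']
  rcases u with _ | ⟨b, m⟩
  -- tensor length `1`: only `ΦΨ` and `Hδ` contribute
  · have h1 : diagonalMap hm' ([].map (twist k V 1)) =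
        sgn d • ((LinearMap.mulRight k (psi d φ).2).comp (twist k V d)) +
        sgn d • -rightDefect ((hm [] []).mk' _) := by
      ext z
      simp only [diagonalMap_apply, LinearMap.add_apply, LinearMap.smul_apply, LinearMap.neg_apply,
        LinearMap.comp_apply, LinearMap.mulRight_apply, rightDefect_apply, IsLinearMap.mk'_apply,
        List.map_nil, List.nil_append, hochDiff_cons, contractSum, psi, List.dropLast_cons_cons,
        List.dropLast_singleton, List.map_cons, List.getLast_cons_cons, List.getLast_singleton,
        twist_mul_gho, sg_one, add_zero, Finset.sum_sub_distrib, Finset.sum_add_distrib,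
        Finset.sum_neg_distrib, ← Finset.smul_sum]
      have h2 := hsum [] (sigma k V z)
      rw [List.nil_append] at h2
      rw [← h2]
      simp only [twist_eq d z, mul_neg, smul_mul_assoc, smul_neg, sgn_smul_smul_self,
        ← Finset.mul_sum,
        mul_assoc, List.nil_append, smul_sub]
      abel
    have h3 : hochDiff (d - 1, homotopy d φ) [a] = 0 := by simp [hochDiff_cons, contractSum]
    rw [h1, dpair_add, dpair_zsmul, dpair_zsmul, key, ← smul_add, smul_smul, hs, List.nil_append,
      h3, phiOne_singleton]
    abel
  -- tensor length at least `2`: all terms of `δ` cancel between `δH` and `Hδ`, except for those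
  -- which make up the failure of right linearity
  · obtain ⟨u, t, e⟩ := exists_append_singleton (List.cons_ne_nil b m)
    obtain ⟨K, hK, hK'⟩ := exists_contractSum (fun w => diagonalMap hm (w.map (twist k V 1)))
      (b :: m)
    have h1 : diagonalMap hm' ((b :: m).map (twist k V 1)) =
        -(LinearMap.mulLeft k (twist k V (d + 1) b)).comp (diagonalMap hm (m.map (twist k V 1))) +
        sgn d • -rightDefect ((hm (b :: m) []).mk' _) + sgn d • K -
        sgn d • (diagonalMap hm u).comp (LinearMap.mulLeft k t) := by
      ext z
      simp only [diagonalMap_apply, LinearMap.add_apply, LinearMap.smul_apply, LinearMap.neg_apply,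
        LinearMap.sub_apply, LinearMap.mulLeft_apply, hK,
        LinearMap.comp_apply, rightDefect_apply, IsLinearMap.mk'_apply]
      have h2 : ∀ α : Quiver.Total V,
          hochDiff (d, φ) ((b :: m).map (twist k V 1) ++ [z * gho k α, arr k α]) =
          -(twist k V (d + 1) b * φ (m.map (twist k V 1) ++ [z * gho k α, arr k α])) +
          sgn d • (φ ((b :: m) ++ [sigma k V z * gho k α]) * arr k α) -
          sgn d •
            (-contractSum (fun w => φ (w.map (twist k V 1) ++ [z * gho k α, arr k α])) (b :: m) +
              φ (u ++ [t * z * gho k α, arr k α]) +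
              φ ((b :: m) ++ [sigma k V z * gho k α * arr k α])) := by
        intro α
        have hm2 : IsMultilinear fun w => φ (w ++ [z * gho k α, arr k α]) := fun l l' => by
          simpa using hm l (l' ++ [z * gho k α, arr k α])
        have c1 : contractSum (fun w => φ (w ++ [arr k α]))
            ((b :: m).map (twist k V 1) ++ [z * gho k α]) =
            -contractSum (fun w => φ (w.map (twist k V 1) ++ [z * gho k α, arr k α])) (b :: m) +
              φ (u ++ [t * z * gho k α, arr k α]) := by
          rw [contractSum_map_twist hm2, neg_neg, e, List.map_append, List.map_singleton,
            List.append_assoc, List.singleton_append, contractSum_append_pair, map_twist_map_twist,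
            twist_twist]
          simp only [List.append_assoc, List.singleton_append, mul_assoc]
        have c2 : (b :: m).map (twist k V 1) ++ [z * gho k α, arr k α] =
            twist k V 1 b :: ((m.map (twist k V 1) ++ [z * gho k α]) ++ [arr k α]) := by simp
        have c3 : (twist k V 1 b :: (m.map (twist k V 1) ++ [z * gho k α])) ++ [arr k α] =
            (b :: m).map (twist k V 1) ++ [z * gho k α, arr k α] := by simp
        have c4 : (twist k V 1 b :: (m.map (twist k V 1) ++ [z * gho k α])).map (twist k V 1) =
            (b :: m) ++ [sigma k V z * gho k α] := by
          simp only [List.map_cons, List.map_append, List.map_nil, map_twist_map_twist, twist_twist,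
            twist_mul_gho, sg_one, List.cons_append]
        rw [c2, hochDiff_append_singleton, c3, c4, contractSum_append_pair, c1, map_twist_map_twist,
          twist_mul_gho, sg_one, twist_add]
        simp only [List.append_assoc, List.singleton_append]
      simp only [h2, Finset.sum_sub_distrib, Finset.sum_add_distrib,
        Finset.sum_neg_distrib, ← Finset.smul_sum, hsum, contractSum_sum, Finset.mul_sum]
      simp only [smul_add, smul_sub, smul_neg, neg_sub]
      abel
    have h3 : hochDiff (d - 1, homotopy d φ) (b :: (m ++ [a])) =
        -sgn d • (twist k V (d - 1) b * dpair (diagonalMap hm (m.map (twist k V 1))) a) +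
        dpair K a - dpair ((diagonalMap hm u).comp (LinearMap.mulLeft k t)) a := by
      have c1 : contractSum (fun w => homotopy d φ (w ++ [a])) (b :: m) = sgn d • dpair K a := by
        simp only [homotopy_eq_dpair hm, hK', contractSum_zsmul]
      have c2 : homotopy d φ (u.map (twist k V 1) ++ [twist k V 1 t * a]) =
          homotopy d φ ((b :: m).map (twist k V 1)) * a -
            sgn d • dpair ((diagonalMap hm u).comp (LinearMap.mulLeft k t)) a := by
        rw [e, List.map_append, List.map_singleton, homotopy_eq_dpair hm, homotopy_eq_dpair hm,
          dpair_mul, map_twist_map_twist, smul_mul_assoc, smul_add, sub_eq_add_neg, ← smul_neg,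
          ← dpair_neg]
        congr 4
        ext z
        simp [twist_one, sigma_sigma]
      rw [hochDiff_append_singleton, e, List.append_assoc, List.singleton_append,
        contractSum_append_pair, ← e, c1]
      dsimp only
      rw [c2, homotopy_eq_dpair hm, sgn_sub_one]
      simp only [neg_smul, mul_smul_comm, smul_add, smul_sub, sgn_smul_smul_self]
      abel
    rw [h1, dpair_sub, dpair_add, dpair_add, dpair_zsmul, dpair_zsmul, dpair_zsmul, key,
      dpair_neg ((LinearMap.mulLeft k _).comp _), dpair_mulLeft_comp, List.cons_append, h3]
    have h4 : phiOne d (psi d φ) (b :: (m ++ [a])) = 0 := by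
      rcases m with _ | ⟨c, m⟩ <;> rfl
    have h5 : twist k V (d + 1) b = twist k V (d - 1) b := twist_congr (by push_cast; grind) b
    rw [h4, h5, neg_smul, smul_sub, smul_add, smul_add, smul_smul, smul_smul, smul_smul, hs,
      smul_neg, ← neg_smul, neg_sgn]
    abel

end Homotopy

end Leavitt

namespace Leavitt

open BInfinityData

variable {k : Type*} [Field k] {V : Type*} [Quiver V] [Fintype V] [Fintype (Quiver.Total V)]

/-! ### The homotopy transfer -/

section Retract

theorem phiOne_eq_shiftedPhi {d : ℤ} {w : Alg k V × Alg k V} (hw : w ∈ leavittGr k V d) :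
    phiOne d w = shiftedPhi [(d, w)] := by
  rw [shiftedPhi_eq (by simpa) (by simp), ← phiOne_eq]

theorem phiOne_mem {d : ℤ} {w : Alg k V × Alg k V} (hw : w ∈ leavittGr k V d) :
    phiOne d w ∈ cochains k V d := by
  have := shiftedPhi_mem (l := [(d, w)]) (by simpa)
  rwa [← phiOne_eq_shiftedPhi hw, show sdeg [(d, w)] + 1 = d by simp] at this

theorem hochDiff_phiOne {d : ℤ} {w : Alg k V × Alg k V} (hw : w ∈ leavittGr k V d) :
    hochDiff (d, phiOne d w) = phiOne (d + 1) (leavittDiff (d, w)) := by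
  have := insertM_shiftedPhi (l := [(d, w)]) (by simpa) (by simp)
  rw [phiOne_eq_shiftedPhi hw, phiOne_eq_shiftedPhi (leavittDiff_mem (d, w) hw)]
  simp only [splitSum_cons, splitSum_nil, shiftedPhi_nil, hochCup_eq_zero_left, smul_zero, zero_add,
    insertM] at this
  rw [this]
  have h0 : ∀ (d : ℤ) (ψ : ℤ × Cochain k V), hochCup ψ (d, 0) = 0 := by
    intro d ψ
    funext m
    rw [hochCup_apply, splitSum_eq_zero, Pi.zero_apply]
    intros; simp
  simp [h0]

theorem psi_mem {d : ℤ} {φ : Cochain k V} (hφ : φ ∈ cochains k V d) :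
    psi d φ ∈ leavittGr k V d := by
  have h3 := hφ.2.2.1
  have h5 := hφ.2.2.2.2.1
  have h8 := hφ.2.2.2.2.2.2.2
  refine mem_leavittGr.2 ⟨⟨?_, mem_diag.2 h3⟩, neg_mem (sum_mem fun α _ => ?_),
    neg_mem (mem_diag.2 fun i => ?_)⟩
  · simpa [psi] using h8 [] (by simp)
  · have := h8 [(1, arr k α)] (by simpa using arr_mem_gr α)
    exact mem_gr_congr (mul_mem_gr (gho_mem_gr α) this) (by simp; ring)
  · rw [Finset.mul_sum, Finset.sum_mul]
    refine Finset.sum_congr rfl fun α _ => ?_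
    have := h5 i (arr k α) []
    rw [List.nil_append, List.nil_append] at this
    rw [mul_assoc, ← this, ← mul_assoc, e_mul_gho, arr_mul_e]
    split
    · rfl
    · have h0 : φ [0] = 0 := ((mem_cochains_iff d φ).1 hφ).1.1.1.map_zero [] []
      rw [zero_mul, h0, mul_zero]

theorem isLinear_psi_add (d : ℤ) (φ ψ : Cochain k V) : psi d (φ + ψ) = psi d φ + psi d ψ := by
  simp [psi, mul_add, Finset.sum_add_distrib, add_comm]

theorem psi_smul (d : ℤ) (c : k) (φ : Cochain k V) : psi d (c • φ) = c • psi d φ := by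
  simp [psi, Finset.smul_sum]

theorem psi_hochDiff {d : ℤ} {φ : Cochain k V} :
    leavittDiff (d, psi d φ) = psi (d + 1) (hochDiff (d, φ)) := by
  simp only [leavittDiff, psi, hochDiff_cons, contractSum, twist_arr]
  refine Prod.ext rfl ?_
  have h := sum_gho_mul_arr_mul (k := k) (V := V) (φ [])
  simp only [List.dropLast_singleton, List.map_nil, List.getLast_singleton, smul_zero, sub_zero,
    mul_add, mul_neg, Finset.sum_add_distrib, Finset.sum_neg_distrib, mul_smul_comm,
    ← Finset.smul_sum, ← mul_assoc]
  simp only [mul_assoc, h]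
  abel

theorem psi_phiOne {d : ℤ} {w : Alg k V × Alg k V} (hw : w ∈ leavittGr k V d) :
    psi d (phiOne d w) = w := by
  have hw' := (mem_leavittGr.1 hw).2.2
  refine Prod.ext rfl ?_
  simp only [psi, phiOne_arr d hw', mul_neg, Finset.sum_neg_distrib, neg_neg, sum_gho_mul_arr_mul]

theorem homotopy_mem {d : ℤ} {φ : Cochain k V} (hφ : φ ∈ cochains k V d) :
    homotopy d φ ∈ cochains k V (d - 1) := by
  have hn := (mem_cochains_iff d φ).1 hφ
  refine (mem_cochains_iff _ _).2 ⟨homotopy_mem_normalized hn.1, ?_⟩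
  have h1 : hochDiff (d - 1, homotopy d φ) =
      φ - phiOne d (psi d φ) - homotopy (d + 1) (hochDiff (d, φ)) := by
    conv_rhs => enter [1, 1]; rw [homotopy_identity hφ]
    abel
  rw [h1, sub_add_cancel]
  have h2 := homotopy_mem_normalized hn.2
  rw [add_sub_cancel_right] at h2
  exact sub_mem (sub_mem hn.1 ((mem_cochains_iff d _).1 (phiOne_mem (psi_mem hφ))).1) h2

theorem homotopy_add {d : ℤ} {φ ψ : Cochain k V} (hφ : φ ∈ cochains k V d)
    (hψ : ψ ∈ cochains k V d) : homotopy d (φ + ψ) = homotopy d φ + homotopy d ψ := by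
  have h1 := ((mem_cochains_iff d φ).1 hφ).1.1.1
  have h2 := ((mem_cochains_iff d ψ).1 hψ).1.1.1
  have h3 := ((mem_cochains_iff d _).1 (add_mem hφ hψ)).1.1.1
  funext l
  rcases List.eq_nil_or_concat l with rfl | ⟨u, a, rfl⟩
  · simp
  rw [List.concat_eq_append, Pi.add_apply, homotopy_eq_dpair h1, homotopy_eq_dpair h2,
    homotopy_eq_dpair h3, ← smul_add, ← dpair_add]
  congr 3
  ext z
  simp [diagonalMap_apply, Finset.sum_add_distrib]

theorem homotopy_smul {d : ℤ} {φ : Cochain k V} (c : k) (hφ : φ ∈ cochains k V d) :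
    homotopy d (c • φ) = c • homotopy d φ := by
  have h1 := ((mem_cochains_iff d φ).1 hφ).1.1.1
  have h3 := ((mem_cochains_iff d _).1 (Submodule.smul_mem _ c hφ)).1.1.1
  funext l
  rcases List.eq_nil_or_concat l with rfl | ⟨u, a, rfl⟩
  · simp
  rw [List.concat_eq_append, Pi.smul_apply, homotopy_eq_dpair h1, homotopy_eq_dpair h3,
    smul_comm c, ← dpair_smul]
  congr 3
  ext z
  simp [diagonalMap_apply, Finset.smul_sum]

variable (k V) in
theorem isHomotopyDeformationRetract :
    IsHomotopyDeformationRetract (leavitt k V) (hochschild k V) phiOne psi homotopy where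
  ι_graded := by
    refine ⟨fun d w hw => by rw [add_zero]; exact phiOne_mem hw, fun d w hw w' hw' => ?_,
      fun d c w hw => ?_⟩
    · funext l
      rcases l with _ | ⟨a, _ | ⟨b, l⟩⟩
      · rfl
      · rw [Pi.add_apply, phiOne_singleton, phiOne_singleton, phiOne_singleton, ← dpair_add]
        congr 2
        ext z
        simp [mul_add]
      · exact (add_zero 0).symm
    · funext l
      rcases l with _ | ⟨a, _ | ⟨b, l⟩⟩
      · rfl
      · rw [Pi.smul_apply, phiOne_singleton, phiOne_singleton, ← dpair_smul]
        congr 2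
        ext z
        simp
      · exact (smul_zero c).symm
  π_graded := ⟨fun d φ hφ => by rw [add_zero]; exact psi_mem hφ,
    fun d φ _ ψ _ => isLinear_psi_add d φ ψ, fun d c φ _ => psi_smul d c φ⟩
  h_graded := ⟨fun d φ hφ => homotopy_mem hφ, fun d φ hφ ψ hψ => homotopy_add hφ hψ,
    fun d c φ hφ => homotopy_smul c hφ⟩
  ι_comm := fun d w hw => hochDiff_phiOne hw
  π_comm := fun d φ _ => psi_hochDiff
  π_ι := fun d w hw => psi_phiOne hw
  homotopy := fun d φ hφ => homotopy_identity hφ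

/-- The homotopy takes values in the cochains which vanish if the last argument is an arrow: this
follows from the first Cuntz-Krieger relation, since the cochains are normalized. -/
theorem homotopy_append_arr {d : ℤ} {φ : Cochain k V} (hφ : φ ∈ normalizedCochains k V d)
    (l : List (Alg k V)) (α : Quiver.Total V) : homotopy d φ (l ++ [arr k α]) = 0 := by
  rw [homotopy_eq_dpair hφ.1.1, dpair_arr, diagonalMap_apply, Finset.sum_eq_zero]
  · simp
  · intro β _
    rw [arr_mul_gho]
    split
    · exact hφ.2 _ _ _
    · exact hφ.1.1.map_zero _ _

/-- The cochains which vanish in tensor length `0` and if the last argument is an arrow form a left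
ideal. -/
theorem hochCup_append_arr {ψ : ℤ × Cochain k V} (h0 : ψ.2 [] = 0)
    (h : ∀ l α, ψ.2 (l ++ [arr k α]) = 0) (φ : ℤ × Cochain k V) (l : List (Alg k V))
    (α : Quiver.Total V) : hochCup φ ψ (l ++ [arr k α]) = 0 := by
  rw [hochCup_apply, splitSum_append_singleton, splitSum_eq_zero, h0, mul_zero, zero_add]
  intro x y _
  rw [h, mul_zero]

theorem homotopy_eq_zero {d : ℤ} {φ : Cochain k V} (h : ∀ l α, φ (l ++ [arr k α]) = 0) :
    homotopy d φ = 0 := by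
  funext l
  rcases List.eq_nil_or_concat l with rfl | ⟨u, a, rfl⟩
  · simp
  · rw [List.concat_eq_append, homotopy_append_singleton (g := 0)]
    · simp
    · intro x
      refine Finset.sum_eq_zero fun α _ => ?_
      rw [show [x * gho k α, arr k α] = [x * gho k α] ++ [arr k α] from rfl, ← List.append_assoc, h]

theorem psi_eq_zero {d : ℤ} {φ : Cochain k V} (h0 : φ [] = 0) (h : ∀ α, φ [arr k α] = 0) :
    psi d φ = 0 := by
  simp [psi, h0, h]

theorem hochCup_nil (φ ψ : ℤ × Cochain k V) : hochCup φ ψ [] = φ.2 [] * ψ.2 [] := by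
  simp [hochCup_apply]

theorem hochCup_arr (φ ψ : ℤ × Cochain k V) (α : Quiver.Total V) :
    hochCup φ ψ [arr k α] = φ.2 [] * ψ.2 [arr k α] + φ.2 [arr k α] * ψ.2 [] := by
  simp [hochCup_apply, splitSum_cons, twist_arr]

variable (k V) in
theorem isHomotopyTransfer :
    IsHomotopyTransfer (leavitt k V) (hochschild k V) phiOne psi homotopy phi where
  retract := isHomotopyDeformationRetract k V
  h_mul_h := fun d e φ hφ ψ hψ => homotopy_eq_zero fun l α =>
    hochCup_append_arr rfl (homotopy_append_arr ((mem_cochains_iff e ψ).1 hψ).1) _ l α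
  π_mul_h := fun d e φ hφ ψ hψ => psi_eq_zero ((hochCup_nil _ _).trans (mul_zero _)) fun α =>
    hochCup_append_arr rfl (homotopy_append_arr ((mem_cochains_iff e ψ).1 hψ).1) _ [] α
  f_one := fun d w hw => rfl
  f_succ := fun l d w hl _ _ => by
    rw [phi_append_singleton hl, show totalDeg l + 1 - l.length = sdeg l + 1 by rw [sdeg]; ring]
    rfl
  m_succ := fun l d w h0 hl hw => by
    have e1 : ∀ φ ψ : ℤ × Cochain k V, (hochschild k V).m [φ, ψ] = hochCup φ ψ := fun _ _ => rfl
    rcases l with _ | ⟨x, _ | ⟨y, l⟩⟩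
    · exact absurd rfl h0
    · have hx := (mem_leavittGr.1 (hl x (by simp))).2.2
      rw [e1, show (leavitt k V).m ([x] ++ [(d, w)]) = leavittCup x (d, w) from rfl, phi_singleton]
      simp only [psi, hochCup_nil, hochCup_arr, phiOne_nil, phiOne_arr _ hx,
        phiOne_arr d (mem_leavittGr.1 hw).2.2, leavittCup, List.length_singleton, Nat.sub_self,
        mul_zero, Nat.zero_div, Nat.cast_zero, sgn_zero, one_smul]
      refine Prod.ext rfl ?_
      simp only [mul_add, mul_neg, neg_mul, Finset.sum_add_distrib, Finset.sum_neg_distrib,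
        mul_assoc,
        sum_gho_mul_arr_mul]
      abel
    · have h1 : ∀ α : Quiver.Total V, phi (x :: y :: l) [arr k α] = 0 := fun α => by
        rw [phi_eq (fun z hz => (mem_leavittGr.1 (hl z hz)).2.2) h0, Pi.smul_apply,
          insCochain_singleton, twist_arr, shiftPart_cons, shiftPart_cons, act_arr_cons_cons,
          smul_zero]
      have h2 : phi (x :: y :: l) [] = 0 := by
        rw [phi_eq (fun z hz => (mem_leavittGr.1 (hl z hz)).2.2) h0, Pi.smul_apply,
          insCochain_nil, unitPart_cons_cons, smul_zero]
      rw [e1, psi_eq_zero]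
      · rw [smul_zero, List.cons_append, List.cons_append]
        rcases l with _ | ⟨z, l⟩ <;> exact ofBrace_m_cons_cons_cons ..
      · rw [hochCup_nil]
        dsimp only
        rw [h2, zero_mul]
      · intro α
        rw [hochCup_arr]
        dsimp only
        rw [h1, h2, zero_mul, zero_mul, add_zero]

end Retract

end Leavitt

/-! ### Sums over compositions with few parts -/

section FewParts

variable {N : Type*} [AddCommMonoid N]

theorem comps_one {n : ℕ} (h : n ≠ 0) : comps 1 n = {![n]} := by
  rw [comps, weakComps, Finset.Nat.antidiagonalTuple_one, Finset.filter_singleton, if_pos]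
  simpa using Nat.one_le_iff_ne_zero.2 h

theorem comps_eq_empty {r n : ℕ} (h : n < r) : comps r n = ∅ := by
  refine Finset.filter_eq_empty_iff.2 fun {c} hc hc' => ?_
  have h1 := sum_of_mem_weakComps hc
  have h2 : ∑ _ : Fin r, 1 ≤ ∑ i, c i := Finset.sum_le_sum fun i _ => hc' i
  simp at h2
  omega

theorem sum_comps_of_le_one {n : ℕ} (G : ∀ r, (Fin r → ℕ) → N)
    (h : ∀ r c, 2 ≤ r → G r c = 0) :
    ∑ r ∈ Finset.range (n + 1), ∑ c ∈ comps r n, G r c =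
      if n = 0 then G 0 ![] else G 1 ![n] := by
  split_ifs with hn
  · subst hn
    simp [comps, weakComps]
  · rw [Finset.sum_eq_single 1, comps_one hn, Finset.sum_singleton]
    · intro r _ hr
      rcases r with _ | _ | r
      · obtain ⟨m, rfl⟩ := Nat.exists_eq_succ_of_ne_zero hn
        simp [comps, weakComps]
      · exact absurd rfl hr
      · exact Finset.sum_eq_zero fun c _ => h _ c (by omega)
    · simp [hn]

theorem sum_comps_comps {n m : ℕ} (G : ∀ r s, (Fin r → ℕ) → (Fin s → ℕ) → N)
    (h : ∀ r s c d, 2 ≤ r ∨ 2 ≤ s → G r s c d = 0) :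
    ∑ r ∈ Finset.range (n + 1), ∑ s ∈ Finset.range (m + 1),
      ∑ c ∈ comps r n, ∑ d ∈ comps s m, G r s c d =
    if n = 0 then (if m = 0 then G 0 0 ![] ![] else G 0 1 ![] ![m])
    else (if m = 0 then G 1 0 ![n] ![] else G 1 1 ![n] ![m]) := by
  have e : ∀ r, ∑ s ∈ Finset.range (m + 1), ∑ c ∈ comps r n, ∑ d ∈ comps s m, G r s c d =
      ∑ c ∈ comps r n, if m = 0 then G r 0 c ![] else G r 1 c ![m] := by
    intro r
    rw [Finset.sum_comm]
    exact Finset.sum_congr rfl fun c _ =>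
      sum_comps_of_le_one (fun s d => G r s c d) fun s d hs => h _ _ _ _ (Or.inr hs)
  simp only [e]
  refine sum_comps_of_le_one (fun r c => if m = 0 then G r 0 c ![] else G r 1 c ![m])
    fun r c hr => ?_
  split_ifs <;> exact h _ _ _ _ (Or.inl hr)

theorem sum_comps_two {n : ℕ} (G : (Fin 2 → ℕ) → N) (h : ∀ i, G ![0, i] = 0)
    (h' : ∀ i, G ![i, 0] = 0) :
    ∑ c ∈ comps 2 n, G c = ∑ i ∈ Finset.range (n + 1), G ![i, n - i] := by
  rw [comps, Finset.sum_filter_of_ne, weakComps, Finset.Nat.antidiagonalTuple_two, Finset.sum_map,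
    Finset.Nat.sum_antidiagonal_eq_sum_range_succ_mk]
  · rfl
  · intro c _ hc
    have hc2 : c = ![c 0, c 1] := by ext i; fin_cases i <;> rfl
    intro i
    rw [Nat.one_le_iff_ne_zero]
    intro hi
    refine hc ?_
    fin_cases i
    · rw [hc2, show c 0 = 0 from hi, h]
    · rw [hc2, show c 1 = 0 from hi, h']

theorem sum_comps_of_le_two {n : ℕ} (hn : n ≠ 0) (G : ∀ r, (Fin r → ℕ) → N)
    (h : ∀ r c, 3 ≤ r → G r c = 0) :
    ∑ r ∈ Finset.Icc 1 n, ∑ c ∈ comps r n, G r c = G 1 ![n] + ∑ c ∈ comps 2 n, G 2 c := by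
  have h1 : ∑ r ∈ Finset.Icc 1 n, ∑ c ∈ comps r n, G r c =
      ∑ r ∈ Finset.Icc 1 (n + 1), ∑ c ∈ comps r n, G r c := by
    refine Finset.sum_subset (Finset.Icc_subset_Icc_right (by omega)) fun r hr hr' => ?_
    rw [comps_eq_empty, Finset.sum_empty]
    simp at hr hr'
    omega
  have h2 : ∑ r ∈ ({1, 2} : Finset ℕ), ∑ c ∈ comps r n, G r c =
      ∑ r ∈ Finset.Icc 1 (n + 1), ∑ c ∈ comps r n, G r c := by
    refine Finset.sum_subset (fun r hr => ?_) fun r hr hr' => ?_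
    · simp at hr ⊢
      omega
    · refine Finset.sum_eq_zero fun c _ => h r c ?_
      simp at hr hr'
      omega
  rw [h1, ← h2, Finset.sum_pair (by simp), comps_one hn, Finset.sum_singleton]

end FewParts

namespace Leavitt

open BInfinityData

variable {k : Type*} [Field k] {V : Type*} [Quiver V] [Fintype V] [Fintype (Quiver.Total V)]

/-! ### The `A_∞`-morphism -/

section AInfinityMorphism

theorem unitPart_add (l l' : List (ℤ × (Alg k V × Alg k V))) (d : ℤ) (x y : Alg k V × Alg k V) :
    unitPart (l ++ (d, x + y) :: l') =
      unitPart (l ++ (d, x) :: l') + unitPart (l ++ (d, y) :: l') := by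
  rcases l with _ | ⟨a, _ | ⟨b, l⟩⟩ <;> rcases l' with _ | ⟨c, l'⟩ <;> simp

theorem unitPart_smul (l l' : List (ℤ × (Alg k V × Alg k V))) (d : ℤ) (c : k)
    (x : Alg k V × Alg k V) :
    unitPart (l ++ (d, c • x) :: l') = c • unitPart (l ++ (d, x) :: l') := by
  rcases l with _ | ⟨a, _ | ⟨b, l⟩⟩ <;> rcases l' with _ | ⟨c, l'⟩ <;> simp

theorem insCochain_add (l l' : List (ℤ × (Alg k V × Alg k V))) (d : ℤ) (x y : Alg k V × Alg k V) :
    insCochain (l ++ (d, x + y) :: l') =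
      insCochain (l ++ (d, x) :: l') + insCochain (l ++ (d, y) :: l') := by
  funext m
  rcases m with _ | ⟨v, _ | ⟨w, m⟩⟩
  · exact unitPart_add ..
  · simp [act_add]
  · exact (add_zero 0).symm

theorem insCochain_smul (l l' : List (ℤ × (Alg k V × Alg k V))) (d : ℤ) (c : k)
    (x : Alg k V × Alg k V) :
    insCochain (l ++ (d, c • x) :: l') = c • insCochain (l ++ (d, x) :: l') := by
  funext m
  rcases m with _ | ⟨v, _ | ⟨w, m⟩⟩
  · exact unitPart_smul ..
  · simp [act_smul]
  · exact (smul_zero c).symm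

theorem phi_isGradedMultilinear (n : ℕ) :
    IsGradedMultilinear (leavittGr k V) (cochains k V) n (1 - n) phi := by
  have h : ∀ (l l' : List (ℤ × (Alg k V × Alg k V))) (d : ℤ) (x : Alg k V × Alg k V),
      IsHomogeneousList (leavittGr k V) l → IsHomogeneousList (leavittGr k V) l' →
      x ∈ leavittGr k V d → phi (l ++ (d, x) :: l') =
        sgn (shiftExp (l ++ (d, (0 : Alg k V × Alg k V)) :: l')) • insCochain (l ++ (d, x) :: l') := by
    intro l l' d x hl hl' hx
    rw [phi_eq _ (by simp)]
    · simp
    · have : IsHomogeneousList (leavittGr k V) (l ++ (d, x) :: l') := by simp [hl, hl', hx]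
      exact fun y hy => (mem_leavittGr.1 (this y hy)).2.2
  refine ⟨fun l hn hl => ?_, fun l l' d x y _ hl hl' hx hy => ?_, fun l l' d c x _ hl hl' hx => ?_⟩
  · have := phi_mem hl
    rwa [sdeg, hn, sub_add_eq_add_sub, add_sub_assoc] at this
  · rw [h _ _ _ _ hl hl' hx, h _ _ _ _ hl hl' hy, h _ _ _ _ hl hl' (add_mem hx hy), insCochain_add,
      smul_add]
  · rw [h _ _ _ _ hl hl' hx, h _ _ _ _ hl hl' (Submodule.smul_mem _ c hx), insCochain_smul,
      smul_comm]

theorem isMultiadditive_phi : IsMultiadditive (leavittGr k V) (phi (k := k) (V := V)) :=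
  fun l l' d x y hl hl' hx hy => (phi_isGradedMultilinear _).add l l' d x y rfl hl hl' hx hy

theorem isMultiadditive_shiftedPhi :
    IsMultiadditive (leavittGr k V) (shiftedPhi (k := k) (V := V)) := by
  have := isMultiadditive_phi.shiftExp_smul (k := k) (N := Cochain k V) [] []
  simp only [List.nil_append, List.append_nil] at this
  exact this

theorem hochCup_zsmul (d e a b : ℤ) (φ ψ : Cochain k V) :
    hochCup (d, a • φ) (e, b • ψ) = (a * b) • hochCup (d, φ) (e, ψ) := by
  funext m
  rw [Pi.smul_apply, hochCup_apply, hochCup_apply, smul_splitSum]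
  refine splitSum_congr fun u v _ => ?_
  simp only [Pi.smul_apply, smul_mul_assoc, mul_smul_comm, smul_smul, mul_comm b]

theorem hochDiff_zsmul (d a : ℤ) (φ : Cochain k V) :
    hochDiff (d, a • φ) = a • hochDiff (d, φ) := by
  funext m
  have h1 := hochCup_zsmul 1 d 1 a (insCochain []) φ
  have h2 := hochCup_zsmul d 1 a 1 φ (insCochain [])
  rw [one_smul, one_mul] at h1
  rw [one_smul, mul_one] at h2
  rw [Pi.smul_apply, hochDiff_eq_hochCup, hochDiff_eq_hochCup, h1, h2]
  have h3 := contractSum_zsmul a φ m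
  rw [show (fun m => a • φ m) = a • φ from rfl] at h3
  rw [h3, smul_sub, smul_add, smul_neg, smul_comm a, smul_comm a]
  rfl

theorem block_one {X : Type*} (l : List X) : block ![l.length] l 0 = l := by simp [block]

theorem block_two_zero {X : Type*} (a b : List X) :
    block ![a.length, b.length] (a ++ b) 0 = a := by
  have : Finset.Iio (0 : Fin 2) = ∅ := rfl
  simp [block, this]

theorem block_two_one {X : Type*} (a b : List X) :
    block ![a.length, b.length] (a ++ b) 1 = b := by
  have : Finset.Iio (1 : Fin 2) = {0} := rfl
  simp [block, this]

theorem morTensor_one {f : List (ℤ × (Alg k V × Alg k V)) → Cochain k V}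
    (l : List (ℤ × (Alg k V × Alg k V))) :
    morTensor f l ![l.length] = [(sdeg l + 1, f l)] := by
  simp [morTensor, block_one, sdeg]
  ring

theorem morTensor_two {f : List (ℤ × (Alg k V × Alg k V)) → Cochain k V}
    (a b : List (ℤ × (Alg k V × Alg k V))) :
    morTensor f (a ++ b) ![a.length, b.length] = [(sdeg a + 1, f a), (sdeg b + 1, f b)] := by
  simp [morTensor, List.ofFn_succ, block_two_zero, block_two_one, sdeg]
  constructor <;> ring

theorem koszul_one (δ x : Fin 1 → ℤ) : koszul δ x = 0 := by
  rw [koszul_succ]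
  simp [koszul]

theorem hochCup_nil_phi (d e : ℤ) (φ : Cochain k V) :
    hochCup (d, phi []) (e, φ) = 0 ∧ hochCup (d, φ) (e, phi []) = 0 := by
  constructor <;> funext m <;> rw [hochCup_apply] <;>
    exact splitSum_eq_zero fun x y _ => by simp [phi_nil]

theorem m_morTensor_two_eq_zero (l : List (ℤ × (Alg k V × Alg k V))) (c : Fin 2 → ℕ)
    (h : c 0 = 0 ∨ c 1 = 0) : (hochschild k V).m (morTensor phi l c) = 0 := by
  have h' : ∀ i, c i = 0 → block c l i = [] := fun i hi => by simp [block, hi]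
  change hochCup (_, phi (block c l 0)) (_, phi (block c l 1)) = 0
  rcases h with h | h
  · rw [h' _ h]
    exact (hochCup_nil_phi ..).1
  · rw [h' _ h]
    exact (hochCup_nil_phi ..).2

/-- The contribution of a composition with two parts to the equation of an `A_∞`-morphism. -/
theorem sgn_smul_m_morTensor_two (a b : List (ℤ × (Alg k V × Alg k V))) :
    sgn ((∑ i : Fin 2, (((2 : ℕ) : ℤ) - 1 - (i : ℕ)) * ((![a.length, b.length] i : ℤ) - 1)) +
        koszul (fun j => 1 - (![a.length, b.length] j : ℤ))
          (fun i => totalDeg (block ![a.length, b.length] (a ++ b) i))) •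
      (hochschild k V).m (morTensor phi (a ++ b) ![a.length, b.length]) =
    sgn (shiftExp (a ++ b)) • sgn (sdeg a + 1) •
      hochCup (sdeg a + 1, shiftedPhi a) (sdeg b + 1, shiftedPhi b) := by
  rw [morTensor_two, shiftedPhi, shiftedPhi, hochCup_zsmul, koszul_succ, ← sgn_add,
    sgn_smul_sgn_smul, sgn_smul_sgn_smul]
  congr 1
  apply sgn_congr
  have : koszul (fun i : Fin 1 => 1 - (![a.length, b.length] i.succ : ℤ))
      (fun i => totalDeg (block ![a.length, b.length] (a ++ b) i.succ)) = 0 := by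
    rw [koszul_one]
  rw [this, block_two_zero, Fin.sum_univ_two]
  simp [sdeg]
  grind

theorem isAInfinityMorphism_phi :
    IsAInfinityMorphism (leavitt k V) (hochschild k V) phi where
  graded := fun n _ => phi_isGradedMultilinear n
  rel := fun l h0 hl => by
    have e1 := sum_insert_eq (dif := leavittDiff) (mul := leavittCup) (br := leavittBrace) phi
      isMultiadditive_phi hl
    refine e1.trans ?_
    rw [show (fun l => sgn (shiftExp l) • phi l) = shiftedPhi (k := k) (V := V) from rfl,
      insertM_shiftedPhi hl h0, sum_comps_of_le_two (by simpa using h0), sum_comps_two]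
    · rw [smul_add, smul_splitSum, splitSum_eq_sum]
      congr 1
      · rw [morTensor_one, shiftedPhi, hochDiff_zsmul, sgn_smul_smul_self]
        simp only [koszul_one]
        rw [show (∑ i : Fin 1, (((1 : ℕ) : ℤ) - 1 - (i : ℕ)) * ((![l.length] i : ℤ) - 1)) + 0 = 0
          by simp, sgn_zero, one_smul]
        rfl
      · refine Finset.sum_congr rfl fun i hi => ?_
        have := sgn_smul_m_morTensor_two (l.take i) (l.drop i)
        rw [List.take_append_drop, List.length_take, List.length_drop,
          min_eq_left (by simpa [Nat.lt_succ_iff] using hi)] at this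
        exact this.symm
    · intro i
      rw [m_morTensor_two_eq_zero l _ (Or.inl rfl), smul_zero]
    · intro i
      rw [m_morTensor_two_eq_zero l _ (Or.inr rfl), smul_zero]
    · intro r c hr
      obtain ⟨r, rfl⟩ := Nat.exists_eq_add_of_le' hr
      rw [morTensor, List.ofFn_succ, List.ofFn_succ, List.ofFn_succ]
      exact smul_zero _

end AInfinityMorphism

end Leavitt

namespace Leavitt

open BInfinityData

variable {k : Type*} [Field k] {V : Type*} [Quiver V] [Fintype V] [Fintype (Quiver.Total V)]

/-! ### The `B_∞`-morphism -/

section BInfinityMorphism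

theorem hochInsert_of_length {φ : Cochain k V} (h : ∀ m, 2 ≤ m.length → φ m = 0)
    (ψs : List (ℤ × Cochain k V)) (pre l : List (Alg k V)) (hl : 2 ≤ pre.length + ψs.length) :
    hochInsert φ pre ψs l = 0 := by
  induction ψs generalizing pre l with
  | nil => exact h _ (by simp at hl ⊢; omega)
  | cons ψ ψs ih =>
    rw [hochInsert_cons]
    exact splitSum_eq_zero fun _ _ _ => splitSum_eq_zero fun _ _ _ =>
      ih _ _ (by simp at hl ⊢; omega)

theorem jacobiSum_apply {M M' : Type*} [AddCommGroup M] {br : ℤ × M' → List (ℤ × M) → M}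
    (b : List (ℤ × M')) (F : List (ℤ × M) → Cochain k V) (c : List (ℤ × M)) (m : List (Alg k V)) :
    BInfinityData.jacobiSum br b F c m = BInfinityData.jacobiSum br b (fun l => F l m) c :=
  map_jacobiSum (Pi.evalAddMonoidHom (fun _ : List (Alg k V) => Alg k V) m) b F c

/-- The brace of two insertion cochains: inserting first the elements of `a`, and then those of
`b`, is the same as inserting `b` and elements of `a` into which parts of `b` are inserted. -/
theorem hochBrace_insCochain {a b : List (ℤ × (Alg k V × Alg k V))}
    (ha : IsHomogeneousList (leavittGr k V) a) (hb : IsHomogeneousList (leavittGr k V) b)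
    (ha0 : a ≠ []) :
    hochBrace (sdeg b + 1, insCochain b) [(sdeg a + 1, insCochain a)] =
      sgn (sdeg a * sdeg b) • BInfinityData.jacobiSum insBrace a insCochain b := by
  have hb' := isHomogeneousList_shiftPart hb
  funext m
  rw [Pi.smul_apply, jacobiSum_apply, hochBrace, hochInsert_singleton]
  rcases m with _ | ⟨v, _ | ⟨w, m⟩⟩
  · simp only [splitSum_nil, List.map_nil, List.nil_append, insCochain_singleton, insCochain_nil]
    rcases a with _ | ⟨x, _ | ⟨y, a⟩⟩
    · exact absurd rfl ha0
    · rw [jacobiSum_singleton_of_length, unitPart_singleton,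
        twist_of_mem _ (ha x (by simp)).1.1, map_zsmul]
      · simp [brElt, insBrace, mul_comm]
      · rintro (_ | ⟨p, _ | ⟨q, l⟩⟩) h <;> simp at h ⊢
    · rw [BInfinityData.jacobiSum_eq_zero]
      · simp
      · rintro (_ | ⟨p, _ | ⟨q, l⟩⟩) h <;> simp at h ⊢
  · simp only [splitSum_cons, splitSum_nil, List.map_nil, List.nil_append, insCochain_singleton,
      List.map_cons, List.cons_append, insCochain_cons_cons, zero_add, add_zero]
    rw [BInfinityData.jacobiSum_congr insBrace_mem (G := fun l =>
      sgn (sdeg a + sdeg b) • act (shiftPart l) (sg k V (sdeg a + sdeg b) v)) ha hb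
      fun l _ _ hl => by rw [hl, twist_eq, map_zsmul],
      jacobiSum_zsmul, ← act_act _ _ _ ha hb, twist_eq, twist_eq,
      map_zsmul, map_zsmul, map_zsmul,
      sg_act (fun x hx => (isHomogeneousList_shiftPart ha x hx).1), map_zsmul, map_zsmul,
      ← sg_add, totalDeg_shiftPart, sgn_smul_sgn_smul, sgn_smul_sgn_smul, sgn_smul_sgn_smul,
      add_comm (sdeg b) (sdeg a)]
    congr 1
    apply sgn_congr
    push_cast
    ring
  · rw [BInfinityData.jacobiSum_eq_zero fun l _ => by rfl, smul_zero]
    refine splitSum_eq_zero fun l₀ l' e => splitSum_eq_zero fun l₁ l₂ e' => ?_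
    subst e'
    rcases l₀ with _ | ⟨p, l₀⟩
    · rcases l₂ with _ | ⟨p, l₂⟩
      · simp at e
        subst e
        simp
      · simp
    · exact insCochain_of_length _ (by simp; omega)

theorem shiftedPhi_of_length {b : List (ℤ × (Alg k V × Alg k V))}
    (hb : IsHomogeneousList (leavittGr k V) b) (m : List (Alg k V)) (hm : 2 ≤ m.length) :
    shiftedPhi b m = 0 := by
  rcases eq_or_ne b [] with rfl | h0
  · simp
  · rw [shiftedPhi_eq hb h0, insCochain_of_length _ hm]

theorem hochBrace_zsmul (d e x y : ℤ) (φ ψ : Cochain k V) (hφ : IsMultilinear φ) :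
    hochBrace (d, x • φ) [(e, y • ψ)] = (x * y) • hochBrace (d, φ) [(e, ψ)] := by
  funext m
  rw [Pi.smul_apply, hochBrace, hochBrace, hochInsert_singleton, hochInsert_singleton]
  simp only [smul_splitSum]
  refine splitSum_congr fun l₀ l' _ => splitSum_congr fun l₁ l₂ _ => ?_
  rw [Pi.smul_apply, Pi.smul_apply, hφ.map_zsmul, smul_smul]

theorem hochschild_mu_singleton (x : ℤ × Cochain k V) (b : List (ℤ × Cochain k V)) :
    (hochschild k V).mu [x] b = sgn (shiftExp (x :: b)) • hochBrace x b := by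
  rw [hochschild, ofBrace_mu_singleton]

theorem opp_mu_singleton_singleton (x y : ℤ × Cochain k V) :
    (hochschild k V).opp.mu [x] [y] = sgn (1 + y.1 * x.1 + y.1) • hochBrace y [x] := by
  change sgn _ • (hochschild k V).mu [y] [x] = _
  rw [hochschild_mu_singleton, sgn_smul_sgn_smul]
  simp

theorem opp_mu_singleton_nil (x : ℤ × Cochain k V) : (hochschild k V).opp.mu [x] [] = x.2 := by
  change sgn _ • (hochschild k V).mu [] [x] = _
  rw [hochschild, ofBrace_mu_nil_singleton]
  simp [sgn_zero]

theorem opp_mu_nil_singleton (x : ℤ × Cochain k V) : (hochschild k V).opp.mu [] [x] = x.2 := by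
  change sgn _ • (hochschild k V).mu [x] [] = _
  rw [hochschild_mu_singleton]
  have : hochBrace x [] = x.2 := by
    funext m
    rw [hochBrace, hochInsert_nil, List.nil_append]
  simp [sgn_zero, this]

theorem opp_mu_nil_nil : (hochschild k V).opp.mu [] [] = 0 := by
  change sgn _ • (hochschild k V).mu [] [] = _
  rw [hochschild, ofBrace_mu_nil_nil, smul_zero]

/-- The products of the target vanish on most pairs of lists, since the cochains `Φ_n` live in
tensor lengths `0` and `1`. -/
theorem opp_mu_eq_zero {a b : List (ℤ × Cochain k V)}
    (hb : ∀ x ∈ b, ∀ m, 2 ≤ m.length → x.2 m = 0) (h : 2 ≤ a.length ∨ 2 ≤ b.length) :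
    (hochschild k V).opp.mu a b = 0 := by
  change sgn _ • (hochschild k V).mu b a = 0
  suffices (hochschild k V).mu b a = 0 by rw [this, smul_zero]
  rcases b with _ | ⟨x, _ | ⟨y, b⟩⟩
  · rcases a with _ | ⟨p, _ | ⟨q, a⟩⟩ <;> simp at h
    exact ofBrace_mu_nil_cons_cons ..
  · refine (hochschild_mu_singleton x a).trans ?_
    have : hochBrace x a = 0 := by
      funext m
      exact hochInsert_of_length (hb x (by simp)) a [] m (by simpa using h)
    rw [this, smul_zero]
  · exact ofBrace_mu_cons_cons ..

theorem isHomogeneousList_block {M : Type*} [AddCommGroup M] [Module k M]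
    {gr : ℤ → Submodule k M} {l : List (ℤ × M)} (hl : IsHomogeneousList gr l) {r : ℕ}
    (c : Fin r → ℕ) (i : Fin r) : IsHomogeneousList gr (block c l i) :=
  fun x hx => hl x (List.mem_of_mem_drop (List.mem_of_mem_take hx))

theorem opp_mu_morTensor_eq_zero (a : List (ℤ × (Alg k V × Alg k V)))
    {b : List (ℤ × (Alg k V × Alg k V))} (hb : IsHomogeneousList (leavittGr k V) b) {r s : ℕ}
    (i : Fin r → ℕ) (j : Fin s → ℕ) (h : 2 ≤ r ∨ 2 ≤ s) :
    (hochschild k V).opp.mu (morTensor phi a i) (morTensor phi b j) = 0 := by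
  refine opp_mu_eq_zero (fun x hx m hm => ?_) (by simpa [morTensor] using h)
  obtain ⟨t, rfl⟩ := (List.mem_ofFn' _ _).1 hx
  change phi (block j b t) m = 0
  rw [phi_eq_shiftedPhi, Pi.smul_apply, shiftedPhi_of_length (isHomogeneousList_block hb _ _) m hm,
    smul_zero]

theorem sum_phi_muTensor {a b : List (ℤ × (Alg k V × Alg k V))}
    (ha : IsHomogeneousList (leavittGr k V) a) (hb : IsHomogeneousList (leavittGr k V) b) :
    ∑ t ∈ Finset.Icc 1 (a.length + b.length),
      ∑ p ∈ weakComps t a.length, ∑ q ∈ weakComps t b.length,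
        sgn (shiftSign p q + muTensorSign a b p q) • phi ((leavitt k V).muTensor a b p q) =
    sgn (shiftExp (a ++ b)) • BInfinityData.jacobiSum insBrace a shiftedPhi b := by
  simp only [sum_muTensor]
  rw [← Finset.smul_sum, ← jacobiSum_congr_br (br := leavittBrace) ha hb
    fun x c _ hc => leavittBrace_eq x hc,
    ← sum_tensorSum_ofBrace (isBraceAlgebra_leavitt k V) _ isMultiadditive_shiftedPhi ha hb le_rfl]
  congr 1
  refine Finset.sum_subset (fun t ht => ?_) fun t ht ht' => ?_
  · simp at ht ⊢
    omega
  · obtain rfl : t = 0 := by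
      simp at ht ht'
      omega
    simp [tensorSum]

theorem isBInfinityMorphism_phi :
    IsBInfinityMorphism (leavitt k V) (hochschild k V).opp phi where
  aInfinity := ⟨isAInfinityMorphism_phi.graded, isAInfinityMorphism_phi.rel⟩
  rel := fun a b ha hb => by
    refine Eq.trans ?_ (sum_phi_muTensor ha hb).symm
    refine (sum_comps_comps _ fun r s i j h => ?_).trans ?_
    · rw [opp_mu_morTensor_eq_zero a hb i j h, smul_zero]
    split_ifs with h1 h2 h2
    · obtain rfl := List.length_eq_zero_iff.1 h1
      obtain rfl := List.length_eq_zero_iff.1 h2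
      rw [show morTensor phi ([] : List (ℤ × (Alg k V × Alg k V))) ![] = [] from rfl,
        opp_mu_nil_nil]
      simp
    · obtain rfl := List.length_eq_zero_iff.1 h1
      rw [show morTensor phi ([] : List (ℤ × (Alg k V × Alg k V))) ![] = [] from rfl,
        morTensor_one, opp_mu_nil_singleton, koszul_one, List.nil_append, jacobiSum_nil,
        ← phi_eq_shiftedPhi]
      simp [koszul, sgn_zero]
    · obtain rfl := List.length_eq_zero_iff.1 h2
      rw [show morTensor phi ([] : List (ℤ × (Alg k V × Alg k V))) ![] = [] from rfl,
        morTensor_one, opp_mu_singleton_nil, koszul_one, List.append_nil,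
        jacobiSum_nil_right insBrace_nil, ← phi_eq_shiftedPhi]
      simp [koszul, sgn_zero]
    · have ha0 : a ≠ [] := fun h => h1 (by simp [h])
      have hb0 : b ≠ [] := fun h => h2 (by simp [h])
      rw [BInfinityData.jacobiSum_congr insBrace_mem (G := insCochain) ha hb fun l hl hl' _ =>
        shiftedPhi_eq hl fun h => h1 (by simpa [h] using hl'),
        morTensor_one, morTensor_one, opp_mu_singleton_singleton, koszul_one, koszul_one,
        phi_eq_shiftedPhi a, phi_eq_shiftedPhi b, hochBrace_zsmul,
        shiftedPhi_eq ha ha0, shiftedPhi_eq hb hb0, hochBrace_insCochain ha hb ha0, ← sgn_add,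
        sgn_smul_sgn_smul, sgn_smul_sgn_smul, sgn_smul_sgn_smul]
      · congr 1
        apply sgn_congr
        simp [sdeg]
        grind
      · exact (shiftedPhi_mem_normalized hb).1.1

end BInfinityMorphism

/-! ### The quasi-isomorphism -/

section QuasiIso

theorem _root_.BInfinityData.IsHomotopyDeformationRetract.isQuasiIso
    {M N : Type*} [AddCommGroup M] [Module k M] [AddCommGroup N] [Module k N]
    {A : BInfinityData k M} {B : BInfinityData k N} {ι : ℤ → M → N} {π : ℤ → N → M}
    {h : ℤ → N → N} (H : IsHomotopyDeformationRetract A B ι π h) {f : List (ℤ × M) → N}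
    (hf : ∀ d, ∀ x ∈ A.gr d, f [(d, x)] = ι d x) : IsQuasiIso A B f where
  injective := fun d x hx _ => by
    rintro ⟨y, hy, e⟩
    refine ⟨π (d - 1) y, by simpa using H.π_graded.mem _ y hy, ?_⟩
    rw [H.π_comm _ y hy, ← e, hf d x hx, sub_add_cancel, H.π_ι d x hx]
  surjective := fun d y hy h0 => by
    have hπ : π d y ∈ A.gr d := by simpa using H.π_graded.mem d y hy
    have hz : ∀ d, h d 0 = 0 := fun d => by
      simpa using H.h_graded.smul d (0 : k) 0 (zero_mem _)
    have hπz : ∀ d, π d 0 = 0 := fun d => by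
      simpa using H.π_graded.smul d (0 : k) 0 (zero_mem _)
    refine ⟨π d y, hπ, by rw [H.π_comm d y hy, h0, hπz], h d y,
      by simpa [sub_eq_add_neg] using H.h_graded.mem d y hy, ?_⟩
    have := H.homotopy d y hy
    rwa [h0, hz, add_zero, ← hf d _ hπ] at this

theorem isBInfinityQuasiIso_phi :
    IsBInfinityQuasiIso (leavitt k V) (hochschild k V).opp phi where
  source := (isBraceAlgebra_leavitt k V).isBInfinityAlgebra
  target := isBraceAlgebra_hochschild.isBInfinityAlgebra.opp
  morphism := isBInfinityMorphism_phi
  quasiIso := by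
    have h : IsQuasiIso (leavitt k V) (hochschild k V) phi :=
      (isHomotopyDeformationRetract k V).isQuasiIso (isHomotopyTransfer k V).f_one
    exact ⟨h.injective, h.surjective⟩

end QuasiIso

/-! ### The morphism in terms of the brace operation -/

section BraceFormula

variable {n : ℕ} (d : Fin n → ℤ) (u : Fin n → Alg k V)

theorem shiftPart_ofFn : shiftPart (List.ofFn fun i => (d i + 1, ((0 : Alg k V), u i))) =
    List.ofFn fun i => (d i, u i) := by
  simp [shiftPart, List.map_ofFn, Function.comp_def]

theorem sdeg_ofFn {M : Type*} (f : Fin n → ℤ × M) :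
    sdeg (List.ofFn f) = ∑ i, ((f i).1 - 1) := by
  simp [sdeg, totalDeg, List.map_ofFn, Function.comp_def, List.sum_ofFn]

theorem shiftExp_ofFn {M : Type*} {n : ℕ} (f : Fin n → ℤ × M) :
    shiftExp (List.ofFn f) = ∑ i : Fin n, ((n : ℤ) - 1 - (i : ℕ)) * (f i).1 := by
  induction n with
  | zero => simp
  | succ n ih =>
    rw [List.ofFn_succ, shiftExp_cons, ih, Fin.sum_univ_succ]
    simp
    refine Finset.sum_congr rfl fun i _ => ?_
    ring

theorem phi_ofFn_singleton (hn : 1 ≤ n) (hu : ∀ i, u i ∈ gr k V (d i) ⊓ diag k V) (c : ℤ)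
    (v : Alg k V) (hv : v ∈ gr k V c) :
    phi (List.ofFn fun i => (d i + 1, ((0 : Alg k V), u i))) [v] =
      sgn ((c - 1) * ∑ i, d i + ∑ i : Fin n, (d i - 1) * ((n : ℤ) - 1 - (i : ℕ))) •
        brace (List.ofFn fun i => (d i, u i)) v := by
  rw [phi_eq, Pi.smul_apply, insCochain_singleton, shiftPart_ofFn, brace_eq_act, twist_of_mem _ hv,
    map_zsmul, sgn_smul_sgn_smul, sdeg_ofFn, shiftExp_ofFn]
  · congr 1
    apply sgn_congr
    have e : ∑ i : Fin n, ((n : ℤ) - 1 - (i : ℕ)) * (d i + 1) =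
        ∑ i : Fin n, (d i - 1) * ((n : ℤ) - 1 - (i : ℕ)) +
          2 * ∑ i : Fin n, ((n : ℤ) - 1 - (i : ℕ)) := by
      rw [Finset.mul_sum, ← Finset.sum_add_distrib]
      exact Finset.sum_congr rfl fun i _ => by ring
    simp only [e, add_sub_cancel_right]
    push_cast
    rw [show (2 : ZMod 2) = 0 from rfl]
    ring
  · simpa [IsHomogeneousList, List.forall_mem_ofFn_iff] using hu
  · simpa [List.forall_mem_ofFn_iff] using fun i => (hu i).2
  · simp [List.ofFn_eq_nil_iff]
    omega

theorem phi_ofFn_of_length (hn : 1 ≤ n) (hu : ∀ i, u i ∈ gr k V (d i) ⊓ diag k V)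
    (l : List (Alg k V)) (hl : l.length ≠ 1) :
    phi (List.ofFn fun i => (d i + 1, ((0 : Alg k V), u i))) l = 0 := by
  rw [phi_eq, Pi.smul_apply]
  · rcases l with _ | ⟨v, _ | ⟨w, l⟩⟩
    · rcases n with _ | _ | n
      · simp
      · simp
      · simp [List.ofFn_succ]
    · simp at hl
    · simp
  · simpa [List.forall_mem_ofFn_iff] using fun i => (hu i).2
  · simp [List.ofFn_eq_nil_iff]
    omega

theorem act_eq_zero (l l' : List (ℤ × Alg k V)) (d : ℤ) : act (l ++ (d, 0) :: l') = 0 := by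
  simpa using act_smul l l' d (0 : k) 0

theorem phi_unit (d : ℤ) (u : Alg k V) :
    phi [(d, (u, 0))] [] = u ∧ ∀ l : List (Alg k V), l ≠ [] → phi [(d, (u, 0))] l = 0 := by
  rw [phi_eq (by simp) (by simp)]
  refine ⟨by simp [sgn_zero], ?_⟩
  rintro (_ | ⟨v, _ | ⟨w, l⟩⟩) hl
  · exact absurd rfl hl
  · rw [Pi.smul_apply, insCochain_singleton, shiftPart_cons, shiftPart_nil,
      show act [(d - 1, (0 : Alg k V))] = 0 from act_eq_zero [] [] _, LinearMap.zero_apply,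
      smul_zero]
  · simp

theorem phi_eq_zero {l : List (ℤ × (Alg k V × Alg k V))} (h2 : 2 ≤ l.length)
    (hl : IsHomogeneousList (leavittGr k V) l) (h : ∃ x ∈ l, x.2.2 = 0) : phi l = 0 := by
  rw [phi_eq (fun x hx => (mem_leavittGr.1 (hl x hx)).2.2) (by rintro rfl; simp at h2)]
  obtain ⟨⟨d, u, y⟩, hx, rfl⟩ := h
  funext m
  rw [Pi.smul_apply]
  rcases m with _ | ⟨v, _ | ⟨w, m⟩⟩
  · rcases l with _ | ⟨p, _ | ⟨q, l⟩⟩ <;> simp at h2 ⊢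
  · obtain ⟨l₁, l₂, rfl⟩ := List.append_of_mem hx
    simp only [insCochain_singleton, shiftPart_append, shiftPart_cons, act_eq_zero,
      LinearMap.zero_apply, smul_zero, Pi.zero_apply]
  · simp

end BraceFormula

end Leavitt

end

/-- For the Leavitt path algebra `L` of a finite quiver without sinks: the canonical derivation and
the brace operation of `Ĉ^*(L, L)` are well defined; the maps `Φ_n` are obtained by homotopy
transfer along `(Φ_1, Ψ, H)`; they form a `B_∞`-quasi-isomorphism from the `B_∞`-algebra
`Ĉ^*(L, L)` to the opposite of the `B_∞`-algebra `C̄_E^*(L, L)`; and they are given by the brace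
operation. -/
theorem theorem13 (k : Type*) [Field k] (V : Type*) [Quiver V] [Fintype V]
    [Fintype (Quiver.Total V)] (no_sinks : ∀ i : V, ∃ j : V, Nonempty (i ⟶ j)) :
    (∃! D, Leavitt.IsCanonicalDerivation k V D) ∧
    (∀ us : List (ℤ × Leavitt.Alg k V),
      (∀ u ∈ us, u.2 ∈ Leavitt.gr k V u.1 ⊓ Leavitt.diag k V) →
      (∃! T, Leavitt.IsBrace us T) ∧ (∃! T, Leavitt.IsShiftedBrace us T)) ∧
    (Leavitt.hochschild k V).IsBInfinityAlgebra ∧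
    BInfinityData.IsHomotopyTransfer (Leavitt.leavitt k V) (Leavitt.hochschild k V)
      Leavitt.phiOne Leavitt.psi Leavitt.homotopy Leavitt.phi ∧
    BInfinityData.IsBInfinityQuasiIso (Leavitt.leavitt k V) (Leavitt.hochschild k V).opp
      Leavitt.phi ∧
    (∀ (n : ℕ) (d : Fin n → ℤ) (u : Fin n → Leavitt.Alg k V), 1 ≤ n →
      (∀ i, u i ∈ Leavitt.gr k V (d i) ⊓ Leavitt.diag k V) →
      (∀ c : ℤ, ∀ v ∈ Leavitt.gr k V c,
        Leavitt.phi (List.ofFn fun i => (d i + 1, ((0 : Leavitt.Alg k V), u i))) [v] =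
          sgn ((c - 1) * ∑ i, d i + ∑ i : Fin n, (d i - 1) * ((n : ℤ) - 1 - (i : ℕ))) •
            Leavitt.brace (List.ofFn fun i => (d i, u i)) v) ∧
      (∀ l : List (Leavitt.Alg k V), l.length ≠ 1 →
        Leavitt.phi (List.ofFn fun i => (d i + 1, ((0 : Leavitt.Alg k V), u i))) l = 0)) ∧
    (∀ (d : ℤ), ∀ u ∈ Leavitt.gr k V d ⊓ Leavitt.diag k V,
      Leavitt.phi [(d, (u, 0))] [] = u ∧
      ∀ l : List (Leavitt.Alg k V), l ≠ [] → Leavitt.phi [(d, (u, 0))] l = 0) ∧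
    (∀ l : List (ℤ × (Leavitt.Alg k V × Leavitt.Alg k V)), 2 ≤ l.length →
      IsHomogeneousList (Leavitt.leavittGr k V) l → (∃ x ∈ l, x.2.2 = 0) →
      Leavitt.phi l = 0) := by
  refine ⟨Leavitt.existsUnique_isCanonicalDerivation, fun us hus => ⟨?_, ?_⟩,
    Leavitt.isBraceAlgebra_hochschild.isBInfinityAlgebra, Leavitt.isHomotopyTransfer k V,
    Leavitt.isBInfinityQuasiIso_phi, fun n d u hn hu => ⟨?_, ?_⟩, ?_, ?_⟩
  · exact ⟨_, Leavitt.isBrace_act hus, fun T hT => hT.unique (Leavitt.isBrace_act hus)⟩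
  · exact ⟨_, Leavitt.isShiftedBrace_shAct hus,
      fun T hT => hT.unique (Leavitt.isShiftedBrace_shAct hus)⟩
  · exact Leavitt.phi_ofFn_singleton d u hn hu
  · exact Leavitt.phi_ofFn_of_length d u hn hu
  · exact fun d u _ => Leavitt.phi_unit d u
  · exact fun l h2 hl h => Leavitt.phi_eq_zero h2 hl h
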